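/- Let $a>0$, $b<1$ and $f(x)=ax+\frac bx$. For $x,t,x_0>0$ put $\gamma=2a(1-b)$, $k=ax_0$, $z=\dfrac{x}{\sqrt{4\sinh^2(at)}}$ and $$p(x,t|x_0)=a\,x_0^{1/2}\Big(\frac{x}{x_0}\Big)^{-b/2}z^{1/2}I_{-(\frac12+\frac b2)}(kz)\,\frac{e^{\gamma t/4}}{(4\sinh^2(at))^{1/4}}\exp\Big(-\frac a4\coth(at)\,x^2-\frac{a x^2}{4}+\frac{a x_0^2}{2(1-e^{2at})}\Big),$$ where $I_\alpha(z)=\sum_{m\ge0}\frac{(z/2)^{2m+\alpha}}{m!\,\Gamma(m+\alpha+1)}$. For $0<\beta<1$ and $s,t>0$ let $$g_\beta(s;t)=t^{-\beta}\,W_{-\beta,1-\beta}(-s\,t^{-\beta}),\qquad W_{\mu,\nu}(z)=\sum_{m\ge0}\frac{z^m}{m!\,\Gamma(\mu m+\nu)}\quad(\text{with }1/\Gamma=0\text{ at the poles of }\Gamma),$$ and, for a function $h$ on $(0,\infty)$, let $h_\beta(t)=\int_0^\infty h(s)\,g_\beta(s;t)\,ds$; put $h_1=h$. Let ${}_CD_t^\beta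 h(t)=\frac1{\Gamma(1-\beta)}\int_0^t(t-\tau)^{-\beta}h'(\tau)\,d\tau$ for $0<\beta<1$ and ${}_CD_t^1h=h'$. (1) $p$ is the transition probability density on $(0,\infty)$ of the Fokker–Planck equation with $f$. That is, for every $x_0>0$: for all $t>0$, $p(\cdot,t|x_0)\ge0$ and $\int_0^\infty p(x,t|x_0)\,dx=1$; the equation $\partial_tp=\partial_x^2p+\partial_x[f(x)p]$ holds for all $x,t>0$; $p(x,t|x_0)\,dx\to\delta_{x_0}$ weakly (against bounded continuous functions) as $t\to0^+$; and $\int_0^\infty p(x,t|y)\,p(y,s|x_0)\,dy=p(x,s+t|x_0)$ for all $x,s,t>0$. (2) Let $0<\beta<1$, $x_0>0$ and $p_\beta(x,t|x_0)=\int_0^\infty p(x,s|x_0)\,g_\beta(s;t)\,ds$. This integral converges absolutely for all $x,t>0$; for every $t>0$, $p_\beta(\cdot,t|x_0)$ is a probability density on $(0,\infty)$; $p_\beta(x,t|x_0)\,dx\to\delta_{x_0}$ weakly as $t\to0^+$; and $p_\beta$ solves the fractional Fokker–Planck equation ${}_CD_t^\beta p_\beta=\partial_x^2p_\beta+\partial_x[f(x)p_\beta]$,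 in the classical sense at all $x,t>0$ with $x\ne x_0$, and on all of $(0,\infty)$ in the weak sense: for every $\psi\in C^2$ with compact support in $(0,\infty)$ and every $t>0$, $${}_CD_t^\beta\int_0^\infty\psi\,p_\beta\,dx=\int_0^\infty(\psi''-f\psi')\,p_\beta\,dx .$$ (3) Let $0<\beta\le1$, and let $\varphi$ be integrable on $(0,\infty)$ and locally Hölder continuous there. With $$u(x,t)=\int_0^\infty p(x,t|y)\,\varphi(y)\,dy,\qquad u_\beta(x,t)=\int_0^\infty u(x,s)\,g_\beta(s;t)\,ds\quad(u_1=u),$$ where these integrals converge absolutely, the function $u_\beta$ satisfies, in the classical sense, ${}_CD_t^\beta u_\beta=\partial_x^2u_\beta+\partial_x[f(x)u_\beta]$ for all $x,t>0$, and $u_\beta(x,t)\to\varphi(x)$ as $t\to0^+$ for every $x>0$. -/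

import Mathlib

open Set Filter Topology MeasureTheory

noncomputable section

/-- The modified Bessel function of the first kind, `I_α(z) = ∑ (z/2)^(2m+α) / (m! Γ(m+α+1))`,
for real order `α` and real `z > 0`. -/
def besselI (α z : ℝ) : ℝ :=
  ∑' m : ℕ, (z / 2) ^ (2 * (m : ℝ) + α) / ((m.factorial : ℝ) * Real.Gamma ((m : ℝ) + α + 1))

/-- The Wright function `W_{β,α}(z) = ∑ z^k / (k! Γ(βk+α))`. At the poles of `Γ` the factor `1/Γ`
is `0`, which is also the value that `Real.Gamma` and division give. -/
def wrightW (β α z : ℝ) : ℝ :=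
  ∑' k : ℕ, z ^ k / ((k.factorial : ℝ) * Real.Gamma (β * (k : ℝ) + α))

/-- The Wright type function `g_β(s;t) = t^(-β) W_{-β,1-β}(-s/t^β)`, for `0 < β < 1`. -/
def wrightG (β s t : ℝ) : ℝ :=
  1 / t ^ β * wrightW (-β) (1 - β) (-(s / t ^ β))

/-- The Wright type transformation `h_β(t) = ∫₀^∞ h(s) g_β(s;t) ds` for `0 < β < 1`. For `β = 1` the
kernel is the Dirac mass at `t`, so that `h_1 = h`. -/
def wrightTransform (β : ℝ) (h : ℝ → ℝ) (t : ℝ) : ℝ :=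
  if β = 1 then h t else ∫ s in Ioi (0 : ℝ), h s * wrightG β s t

/-- `h` has the Caputo derivative `v` of order `β ∈ (0, 1]` at time `t > 0`:
for `β < 1`, `h` is differentiable on `(0, t]`, the integral below converges absolutely, and
`v = (1/Γ(1-β)) ∫₀ᵗ (t-τ)^(-β) h'(τ) dτ`; for `β = 1` this is the ordinary derivative. -/
def HasCaputoDerivAt (β : ℝ) (h : ℝ → ℝ) (v t : ℝ) : Prop :=
  if β = 1 then HasDerivAt h v t
  else
    (∀ τ ∈ Ioc 0 t, DifferentiableAt ℝ h τ) ∧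
      IntegrableOn (fun τ => (t - τ) ^ (-β) * deriv h τ) (Ioo 0 t) ∧
      v = 1 / Real.Gamma (1 - β) * ∫ τ in Ioo 0 t, (t - τ) ^ (-β) * deriv h τ

/-- `u(x,t)` satisfies `D_C^β u = u_xx + (f u)_x` at the point `(x,t)`, in the classical sense. -/
def SolvesFokkerPlanckAt (β : ℝ) (f : ℝ → ℝ) (u : ℝ → ℝ → ℝ) (x t : ℝ) : Prop :=
  ContDiffAt ℝ 2 (fun y => u y t) x ∧
    DifferentiableAt ℝ (fun y => f y * u y t) x ∧
    HasCaputoDerivAt β (fun τ => u x τ)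
      (deriv (deriv (fun y => u y t)) x + deriv (fun y => f y * u y t) x) t

/-- `u(x,t)` satisfies `D_C^β u = u_xx + (f u)_x` on `(0,∞)` at time `t` in the weak sense:
for every `C²` function `ψ` with compact support in `(0,∞)`,
`D_C^β ∫ ψ u dx = ∫ (ψ'' - f ψ') u dx`. -/
def SolvesFokkerPlanckWeaklyAt (β : ℝ) (f : ℝ → ℝ) (u : ℝ → ℝ → ℝ) (t : ℝ) : Prop :=
  ∀ ψ : ℝ → ℝ, ContDiff ℝ 2 ψ → HasCompactSupport ψ → tsupport ψ ⊆ Ioi 0 →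
    HasCaputoDerivAt β (fun τ => ∫ x in Ioi (0 : ℝ), ψ x * u x τ)
      (∫ x in Ioi (0 : ℝ), (deriv (deriv ψ) x - f x * deriv ψ x) * u x t) t

/-- `q(x,t)` is, for every time `t > 0`, a probability density on `(0,∞)`, and it tends weakly to
the Dirac mass at `x₀` as `t → 0+`. -/
def IsDensityFrom (q : ℝ → ℝ → ℝ) (x₀ : ℝ) : Prop :=
  (∀ t > 0, (∀ x > 0, 0 ≤ q x t) ∧ IntegrableOn (fun x => q x t) (Ioi 0) ∧
      ∫ x in Ioi (0 : ℝ), q x t = 1) ∧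
    ∀ ψ : BoundedContinuousFunction ℝ ℝ,
      Tendsto (fun t => ∫ x in Ioi (0 : ℝ), ψ x * q x t) (𝓝[>] 0) (𝓝 (ψ x₀))

/-- `φ` is locally Hölder continuous on `(0,∞)` (the exponent may depend on the place). -/
def IsLocallyHolder (φ : ℝ → ℝ) : Prop :=
  ∀ x > 0, ∃ U ∈ 𝓝 x, ∃ C r : NNReal, 0 < r ∧ HolderOnWith C r φ U

/-- The force `f(x) = a x + b / x`. -/
def force (a b x : ℝ) : ℝ := a * x + b / x

/-- The transition density `p(x,t|x₀)`, with `γ = 2a(1-b)`, `k = a x₀`, `z = x / (4 sinh²(at))^(1/2)`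
and `coth = cosh / sinh`. -/
def transitionDensity (a b x t x₀ : ℝ) : ℝ :=
  let γ := 2 * a * (1 - b)
  let k := a * x₀
  let z := x / √(4 * Real.sinh (a * t) ^ 2)
  a * x₀ ^ (1 / 2 : ℝ) * (x / x₀) ^ (-b / 2) * z ^ (1 / 2 : ℝ) * besselI (-(1 / 2 + b / 2)) (k * z) *
    (Real.exp (γ * t / 4) / (4 * Real.sinh (a * t) ^ 2) ^ (1 / 4 : ℝ)) *
    Real.exp (-(a / 4 * (Real.cosh (a * t) / Real.sinh (a * t)) * x ^ 2) - a * x ^ 2 / 4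
      + a * x₀ ^ 2 / (2 * (1 - Real.exp (2 * a * t))))

/-- `p_β(x,t|x₀)`: the Wright type transformation in time of the transition density. -/
def fracDensity (β a b x t x₀ : ℝ) : ℝ :=
  wrightTransform β (fun s => transitionDensity a b x s x₀) t

/-- `u(x,t) = ∫₀^∞ p(x,t|y) φ(y) dy`. -/
def greenSolution (a b : ℝ) (φ : ℝ → ℝ) (x t : ℝ) : ℝ :=
  ∫ y in Ioi (0 : ℝ), transitionDensity a b x t y * φ y

/-- `u_β(x,t)`: the Wright type transformation in time of `u(x,t)`. -/
def fracSolution (β a b : ℝ) (φ : ℝ → ℝ) (x t : ℝ) : ℝ :=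
  wrightTransform β (fun s => greenSolution a b φ x s) t

end

noncomputable section

/-! ### The Gamma integral in exponential coordinates -/

/-! Kernels. `wrightJ β ν s t` is the Hankel integral of exp(λt - sλ^β) λ^(-ν), written in the
coordinate λ = e^z. The integrand takes conjugate values at conjugate points, so the upper half of
the contour suffices, and the kernel is its imaginary part divided by π; the kernel g_β is the case
ν = 1 - β. Under the integral sign ∂_s multiplies by -λ^β, ∂_t by λ, and fractional integration of
order μ in time by λ^(-μ), so each only shifts ν (`hasDerivAt_wrightJ_left`,
`hasDerivAt_wrightJ_right`, `integral_rpow_mul_wrightJ`). The angle π/2 gives decay in s for every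
real t and yields these rules; the angle π, available for t > 0, yields the Wright series
(`hasSum_wrightJ`) and self-similarity. The mass of g_β is the boundary value of the kernel of index
1 at s = 0+, which is 1 by the mean value property of exp. Its positivity comes from the path of
constant phase (`wrightJ_one_nonneg`).

Time. Let h(s) - h₀ = O(s^ε + s). Then the time derivative of h_β is the integral of h - h₀ against
index -β, and fractional integration of order 1 - β turns this into index 1 - 2β
(`hasCaputoDerivAt_wrightTransform`). That index is also -∂_s of g_β, so integration by parts in s
gives the transform of h' whenever that makes sense (`integral_deriv_mul_wrightJ`).

Space. For a solution u no bound on u_t near s = 0 is available. The equation is therefore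
integrated twice in x, which leaves only u, its integrals and the flux at one end point; the latter
is eliminated by a second such identity. The transformed identity exhibits u_β as a C² function and
gives the equation (`IsFluxSolution.solvesFokkerPlanckAt_wrightTransform`). Only a locally uniform
Hölder rate of u at time 0 is needed.

The density. With c = `targetRate`, A = `sourceRate` and α = `besselOrder`, p(x,t|y) = 2 c^(1+α)
x^(-b) exp(-c x² - A y²) F_α(cA x² y²), where F_α is the entire part of the Bessel function. From c'
= A' = -4cA, F_α' = F_{α+1} and the three-term recurrence, every superposition of such densities
solves the equation (`exists_isFluxSolution_fpSolution`). Weber's integral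
`integral_besselF_mul_besselF` gives the Chapman-Kolmogorov equation and the moments of x², hence
total mass 1 and a second moment of x² - y² of size O(t).

Initial values. The second moment gives weak convergence to the Dirac mass. For a locally Hölder φ,
detailed balance exchanges source and target near the diagonal, while away from it p = O(s)
(`exists_transitionDensity_le_mul`); together they give the rate required above
(`exists_abs_greenSolution_sub_le`). For p itself the initial value off the diagonal is 0 with rate
s. On the diagonal p is merely integrable in time (`integrableOn_transitionDensity_diag`), so there
the equation is obtained weakly, from H(s) = ∫ ψ p dx, which is Lipschitz. -/

lemma integrable_exp_neg_mul_exp_add {K w : ℝ} (hK : 0 < K) (hw : 0 < w) :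
    Integrable (fun x : ℝ => Real.exp (-K * Real.exp x + w * x)) := by
  have h1 : IntegrableOn (fun u : ℝ => u ^ (w - 1) * Real.exp (-K * u)) (Ioi 0) :=
    (integrableOn_rpow_mul_exp_neg_mul_rpow (s := w - 1) (p := 1) (by linarith) one_pos
      hK).congr_fun (fun x _ => by simp) measurableSet_Ioi
  have h2 := integrableOn_image_iff_integrableOn_abs_deriv_smul (s := univ) (f := Real.exp)
    (f' := Real.exp) MeasurableSet.univ (fun x _ => (Real.hasDerivAt_exp x).hasDerivWithinAt)
    Real.exp_injective.injOn (fun u : ℝ => u ^ (w - 1) * Real.exp (-K * u))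
  rw [image_univ, Real.range_exp] at h2
  have h3 := h2.1 h1
  rw [integrableOn_univ] at h3
  refine h3.congr (Eventually.of_forall fun x => ?_)
  simp only [abs_of_pos (Real.exp_pos x), smul_eq_mul]
  rw [← Real.exp_mul, ← Real.exp_add, ← Real.exp_add]
  congr 1; ring

lemma integral_exp_neg_mul_exp_add {K w : ℝ} (hK : 0 < K) (hw : 0 < w) :
    ∫ x : ℝ, Real.exp (-K * Real.exp x + w * x) = K ^ (-w) * Real.Gamma w := by
  have h2 := integral_image_eq_integral_abs_deriv_smul (s := univ) (f := Real.exp)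
    (f' := Real.exp) MeasurableSet.univ (fun x _ => (Real.hasDerivAt_exp x).hasDerivWithinAt)
    Real.exp_injective.injOn (fun u : ℝ => u ^ (w - 1) * Real.exp (-(K * u)))
  rw [image_univ, Real.range_exp, Real.integral_rpow_mul_exp_neg_mul_Ioi hw hK,
    Measure.restrict_univ] at h2
  rw [Real.rpow_neg hK.le, ← Real.inv_rpow hK.le, ← one_div, h2]
  refine integral_congr_ae (Eventually.of_forall fun x => ?_)
  simp only [abs_of_pos (Real.exp_pos x), smul_eq_mul]
  rw [← Real.exp_mul, ← Real.exp_add, ← Real.exp_add]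
  congr 1; ring

lemma integrable_exp_neg_mul_exp_mul_add {K p w : ℝ} (hK : 0 < K) (hp : 0 < p) (hw : 0 < w) :
    Integrable (fun x : ℝ => Real.exp (-K * Real.exp (p * x) + w * x)) := by
  have h := (integrable_exp_neg_mul_exp_add hK (div_pos hw hp)).comp_mul_left' hp.ne'
  refine h.congr (Eventually.of_forall fun x => ?_)
  simp only
  congr 2
  field_simp

/-- Young's inequality in exponential coordinates. -/
lemma exists_exp_mul_le {β : ℝ} (hβ : β < 1) (hβ0 : 0 < β) (r : ℝ) {η : ℝ} (hη : 0 < η) :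
    ∃ C, ∀ x : ℝ, r * Real.exp (β * x) ≤ η * Real.exp x + C := by
  obtain ⟨X, hX⟩ : ∃ X, |r| * Real.exp (-((1 - β) * X)) ≤ η := by
    have : Tendsto (fun X : ℝ => |r| * Real.exp (-((1 - β) * X))) atTop (𝓝 (|r| * 0)) := by
      refine Tendsto.const_mul _ (Real.tendsto_exp_neg_atTop_nhds_zero.comp ?_)
      exact tendsto_id.const_mul_atTop (by linarith)
    rw [mul_zero] at this
    exact ((this.eventually (gt_mem_nhds hη)).exists).imp fun _ h => h.le
  refine ⟨|r| * Real.exp (β * X), fun x => ?_⟩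
  have h0 : r * Real.exp (β * x) ≤ |r| * Real.exp (β * x) :=
    mul_le_mul_of_nonneg_right (le_abs_self r) (Real.exp_pos _).le
  rcases le_total x X with h | h
  · have : |r| * Real.exp (β * x) ≤ |r| * Real.exp (β * X) := by gcongr
    nlinarith [mul_pos hη (Real.exp_pos x)]
  · have h1 : |r| * Real.exp (β * x) = |r| * Real.exp (-((1 - β) * x)) * Real.exp x := by
      rw [mul_assoc, ← Real.exp_add]; congr 2; ring
    have h2 : |r| * Real.exp (-((1 - β) * x)) ≤ |r| * Real.exp (-((1 - β) * X)) := by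
      have : 0 ≤ 1 - β := by linarith
      gcongr
    have h3 : |r| * Real.exp (-((1 - β) * x)) * Real.exp x ≤ η * Real.exp x := by
      gcongr; exact h2.trans hX
    have : 0 ≤ |r| * Real.exp (β * X) := by positivity
    linarith

/-- Since β < 1, Young's inequality absorbs the term in exp(βx) into half of K exp(x). This is the
majorant for the Wright integrand at height π, where the s-term may grow. -/
lemma integrable_exp_neg_exp_add_exp {β K r w : ℝ} (hβ0 : 0 < β) (hβ : β < 1) (hK : 0 < K)
    (hw : 0 < w) :
    Integrable (fun x : ℝ => Real.exp (-K * Real.exp x + r * Real.exp (β * x) + w * x)) := by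
  obtain ⟨C, hC⟩ := exists_exp_mul_le hβ hβ0 r (half_pos hK)
  refine ((integrable_exp_neg_mul_exp_add (half_pos hK) hw).const_mul (Real.exp C)).mono'
    (by fun_prop) (Eventually.of_forall fun x => ?_)
  rw [Real.norm_eq_abs, abs_of_pos (Real.exp_pos _), ← Real.exp_add]
  have := hC x
  exact Real.exp_le_exp.2 (by nlinarith)

/-! ### Rotation of half-lines -/

/-- Rotating a horizontal half-line in the plane of an entire function. -/
lemma integral_horizontal_sub {f f' : ℂ → ℂ} (hf : ∀ z, HasDerivAt f (f' z) z)
    (hf' : Continuous f') {S : Set ℝ} {b : ℝ → ℝ} (hb : IntegrableOn b S)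
    {θ₁ θ₂ : ℝ} (hθ : θ₁ ≤ θ₂) (hS : MeasurableSet S)
    (hbound : ∀ y ∈ Icc θ₁ θ₂, ∀ x ∈ S, ‖f' (x + y * Complex.I)‖ ≤ b x)
    (e : ℝ → ℂ) (he : ∀ y ∈ Icc θ₁ θ₂, ∫ x in S, f' (x + y * Complex.I) = e y)
    (h1 : IntegrableOn (fun x : ℝ => f (x + θ₁ * Complex.I)) S)
    (h2 : IntegrableOn (fun x : ℝ => f (x + θ₂ * Complex.I)) S) :
    (∫ x in S, f (x + θ₂ * Complex.I)) - ∫ x in S, f (x + θ₁ * Complex.I)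
      = Complex.I * ∫ y in θ₁..θ₂, e y := by
  rw [← integral_sub h2 h1]
  -- The difference between the two heights is a vertical integral of `f'`. After Fubini the inner
  -- horizontal integral of `f'` is the boundary term `e y`, so Cauchy's theorem on the infinite
  -- strip needs no limit of rectangles.
  have hd : ∀ x : ℝ, f (x + θ₂ * Complex.I) - f (x + θ₁ * Complex.I)
      = ∫ y in θ₁..θ₂, Complex.I * f' (x + y * Complex.I) := by
    intro x
    refine (intervalIntegral.integral_eq_sub_of_hasDerivAt
      (f := fun y : ℝ => f (x + y * Complex.I)) (fun y _ => ?_) ?_).symm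
    · have h3 : HasDerivAt (fun y : ℝ => (x : ℂ) + y * Complex.I) Complex.I y := by
        simpa using ((Complex.ofRealCLM.hasDerivAt (x := y)).mul_const Complex.I).const_add (x : ℂ)
      have := (hf (x + y * Complex.I)).comp y h3
      rwa [mul_comm] at this
    · exact Continuous.intervalIntegrable (by fun_prop) _ _
  simp_rw [hd, intervalIntegral.integral_of_le hθ]
  rw [integral_integral_swap]
  · rw [← integral_const_mul]
    refine setIntegral_congr_fun measurableSet_Ioc fun y hy => ?_
    rw [integral_const_mul, he y (Ioc_subset_Icc_self hy)]
  · have hcont : Continuous (Function.uncurry fun (x y : ℝ) => Complex.I * f' (x + y * Complex.I)) := by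
      fun_prop
    have hb' : Integrable (fun p : ℝ × ℝ => b p.1 * 1)
        ((volume.restrict S).prod (volume.restrict (Ioc θ₁ θ₂))) :=
      hb.mul_prod (integrable_const (1 : ℝ))
    refine hb'.mono' hcont.aestronglyMeasurable ?_
    rw [Measure.prod_restrict]
    refine (ae_restrict_iff' (hS.prod measurableSet_Ioc)).2 (Eventually.of_forall ?_)
    rintro ⟨x, y⟩ ⟨hx, hy⟩
    have := hbound y (Ioc_subset_Icc_self hy) x hx
    change ‖Complex.I * f' (x + y * Complex.I)‖ ≤ b x * 1
    rwa [norm_mul, Complex.norm_I, one_mul, mul_one]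

/-! ### The Wright kernels as contour integrals -/

/-- The integrand of the contour integral of the Wright kernels, in logarithmic coordinates. -/
def wrightIntegrand (β ν s t : ℝ) (z : ℂ) : ℂ :=
  Complex.exp (t * Complex.exp z - s * Complex.exp (β * z) + (1 - ν) * z)

lemma continuous_wrightIntegrand (β ν s t : ℝ) : Continuous (wrightIntegrand β ν s t) := by
  unfold wrightIntegrand; fun_prop

/-- Multiplication by λ = e^z, or by λ^β below, only shifts the index. All differential relations
between the kernels come from these two identities. -/
lemma wrightIntegrand_mul_exp (β ν s t : ℝ) (z : ℂ) :
    wrightIntegrand β ν s t z * Complex.exp z = wrightIntegrand β (ν - 1) s t z := by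
  unfold wrightIntegrand
  rw [← Complex.exp_add]; congr 1; push_cast; ring

lemma wrightIntegrand_mul_exp_mul (β ν s t : ℝ) (z : ℂ) :
    wrightIntegrand β ν s t z * Complex.exp (β * z) = wrightIntegrand β (ν - β) s t z := by
  unfold wrightIntegrand
  rw [← Complex.exp_add]; congr 1; push_cast; ring

lemma hasDerivAt_wrightIntegrand (β ν s t : ℝ) (z : ℂ) :
    HasDerivAt (wrightIntegrand β ν s t)
      (t * wrightIntegrand β (ν - 1) s t z - s * β * wrightIntegrand β (ν - β) s t z
        + (1 - ν) * wrightIntegrand β ν s t z) z := by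
  have h1 : HasDerivAt (fun z : ℂ => Complex.exp (β * z)) (Complex.exp (β * z) * β) z := by
    have := ((hasDerivAt_id z).const_mul (β : ℂ)).cexp
    simpa using this
  have h := ((((Complex.hasDerivAt_exp z).const_mul (t : ℂ)).sub (h1.const_mul (s : ℂ))).add
    ((hasDerivAt_id z).const_mul ((1 : ℂ) - ν))).cexp
  refine h.congr_deriv ?_
  rw [← wrightIntegrand_mul_exp, ← wrightIntegrand_mul_exp_mul]
  simp only [wrightIntegrand, Pi.sub_apply, Pi.add_apply, id]
  ring

lemma norm_wrightIntegrand (β ν s t : ℝ) (z : ℂ) :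
    ‖wrightIntegrand β ν s t z‖ = Real.exp (t * (Real.exp z.re * Real.cos z.im)
      - s * (Real.exp (β * z.re) * Real.cos (β * z.im)) + (1 - ν) * z.re) := by
  have h1 : (Complex.exp (β * z)).re = Real.exp (β * z.re) * Real.cos (β * z.im) := by
    rw [Complex.exp_re]; simp
  unfold wrightIntegrand
  rw [Complex.norm_exp]
  congr 1
  simp only [Complex.add_re, Complex.sub_re, Complex.re_ofReal_mul, Complex.exp_re z, h1]
  have : ((1 - (ν : ℂ)) * z).re = (1 - ν) * z.re := by
    rw [show (1 - (ν : ℂ)) = ((1 - ν : ℝ) : ℂ) by push_cast; rfl, Complex.re_ofReal_mul]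
  rw [this]

/-- The integral over the broken line from `0` up to `iθ` and then horizontally to `∞`. -/
def wrightContour (β ν s t θ : ℝ) : ℂ :=
  (∫ x in Ioi (0 : ℝ), wrightIntegrand β ν s t (x + θ * Complex.I))
    + Complex.I * ∫ y in (0 : ℝ)..θ, wrightIntegrand β ν s t (y * Complex.I)

/-- The kernels `t^(ν-1) W_{-β,ν}(-s t^(-β))`, as contour integrals. -/
def wrightJ (β ν s t : ℝ) : ℝ := (wrightContour β ν s t (Real.pi / 2)).im / Real.pi

lemma integrableOn_wrightIntegrand_deriv {β ν s t : ℝ} {S : Set ℝ} {y : ℝ}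
    (h : ∀ w ∈ ({ν, ν - 1, ν - β} : Set ℝ),
      IntegrableOn (fun x : ℝ => wrightIntegrand β w s t (x + y * Complex.I)) S) :
    IntegrableOn (fun x : ℝ =>
      (t * wrightIntegrand β (ν - 1) s t (x + y * Complex.I)
        - s * β * wrightIntegrand β (ν - β) s t (x + y * Complex.I)
        + (1 - ν) * wrightIntegrand β ν s t (x + y * Complex.I))) S :=
  (((h (ν - 1) (by simp)).const_mul _).sub ((h (ν - β) (by simp)).const_mul _)).add
    ((h ν (by simp)).const_mul _)

lemma hasDerivAt_add_mul_I {f f' : ℂ → ℂ} (hf : ∀ z, HasDerivAt f (f' z) z) (y x : ℝ) :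
    HasDerivAt (fun x : ℝ => f (x + y * Complex.I)) (f' (x + y * Complex.I)) x := by
  have h3 : HasDerivAt (fun x : ℝ => (x : ℂ) + y * Complex.I) 1 x := by
    simpa using (Complex.ofRealCLM.hasDerivAt (x := x)).add_const (y * Complex.I)
  have := (hf (x + y * Complex.I)).comp x h3
  rwa [mul_one] at this

/-- The derivative in z is a combination of the integrands of index ν - 1, ν - β and ν, so majorants
for these three dominate it. -/
lemma exists_wrightIntegrand_deriv_bound {β ν s t : ℝ} {S : Set ℝ} {T : Set ℝ}
    (h : ∀ w ∈ ({ν, ν - 1, ν - β} : Set ℝ), ∃ b : ℝ → ℝ, IntegrableOn b S ∧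
      ∀ y ∈ T, ∀ x ∈ S, ‖wrightIntegrand β w s t (x + y * Complex.I)‖ ≤ b x) :
    ∃ b : ℝ → ℝ, IntegrableOn b S ∧ ∀ y ∈ T, ∀ x ∈ S,
      ‖(t * wrightIntegrand β (ν - 1) s t (x + y * Complex.I)
        - s * β * wrightIntegrand β (ν - β) s t (x + y * Complex.I)
        + (1 - ν) * wrightIntegrand β ν s t (x + y * Complex.I))‖ ≤ b x := by
  obtain ⟨b₁, hb₁, h₁⟩ := h (ν - 1) (by simp)
  obtain ⟨b₂, hb₂, h₂⟩ := h (ν - β) (by simp)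
  obtain ⟨b₃, hb₃, h₃⟩ := h ν (by simp)
  refine ⟨fun x => |t| * b₁ x + |s * β| * b₂ x + |1 - ν| * b₃ x,
    ((hb₁.const_mul _).add (hb₂.const_mul _)).add (hb₃.const_mul _), fun y hy x hx => ?_⟩
  refine (norm_add_le _ _).trans (add_le_add ((norm_sub_le _ _).trans (add_le_add ?_ ?_)) ?_)
  · rw [norm_mul, Complex.norm_real, Real.norm_eq_abs]
    exact mul_le_mul_of_nonneg_left (h₁ y hy x hx) (abs_nonneg _)
  · rw [norm_mul, ← Complex.ofReal_mul, Complex.norm_real, Real.norm_eq_abs]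
    exact mul_le_mul_of_nonneg_left (h₂ y hy x hx) (abs_nonneg _)
  · rw [norm_mul, show (1 - (ν : ℂ)) = ((1 - ν : ℝ) : ℂ) by push_cast; rfl, Complex.norm_real,
      Real.norm_eq_abs]
    exact mul_le_mul_of_nonneg_left (h₃ y hy x hx) (abs_nonneg _)

/-- The contour integral does not depend on the angle, as long as the integrand is dominated. -/
lemma wrightContour_eq_of_bound {β ν s t θ₁ θ₂ : ℝ} (hθ : θ₁ ≤ θ₂)
    (h : ∀ w : ℝ, ∃ b : ℝ → ℝ, IntegrableOn b (Ioi 0) ∧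
      ∀ y ∈ Icc θ₁ θ₂, ∀ x ∈ Ioi (0 : ℝ), ‖wrightIntegrand β w s t (x + y * Complex.I)‖ ≤ b x) :
    wrightContour β ν s t θ₁ = wrightContour β ν s t θ₂ := by
  have hint : ∀ y ∈ Icc θ₁ θ₂, ∀ w : ℝ, IntegrableOn
      (fun x : ℝ => wrightIntegrand β w s t (x + y * Complex.I)) (Ioi 0) := by
    intro y hy w
    obtain ⟨b, hb, hb'⟩ := h w
    refine Integrable.mono' hb ?_ ((ae_restrict_iff' measurableSet_Ioi).2
      (Eventually.of_forall fun x hx => hb' y hy x hx))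
    exact ((continuous_wrightIntegrand β w s t).comp (by fun_prop)).aestronglyMeasurable
  obtain ⟨b, hb, hb'⟩ := exists_wrightIntegrand_deriv_bound (ν := ν) (fun w _ => h w)
  -- The derivative integrates over (0,∞) to minus the value at the corner; the change in the
  -- horizontal part thus cancels the change in the vertical segment.
  have key := integral_horizontal_sub (hasDerivAt_wrightIntegrand β ν s t)
    (by have := continuous_wrightIntegrand β; fun_prop) hb hθ measurableSet_Ioi hb'
    (fun y => - wrightIntegrand β ν s t (y * Complex.I)) (fun y hy => ?_)
    (hint _ (left_mem_Icc.2 hθ) ν) (hint _ (right_mem_Icc.2 hθ) ν)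
  · have hi : ∀ a b, IntervalIntegrable (fun y : ℝ => wrightIntegrand β ν s t (y * Complex.I))
        volume a b := fun a b => by
      have := continuous_wrightIntegrand β ν s t
      exact Continuous.intervalIntegrable (by fun_prop) _ _
    unfold wrightContour
    rw [← intervalIntegral.integral_add_adjacent_intervals (hi 0 θ₁) (hi θ₁ θ₂)]
    rw [intervalIntegral.integral_neg] at key
    linear_combination -key
  · have hd := hasDerivAt_add_mul_I (hasDerivAt_wrightIntegrand β ν s t) y
    have hi := integrableOn_wrightIntegrand_deriv (fun w _ => hint y hy w) (ν := ν)
    have := integral_Ioi_of_hasDerivAt_of_tendsto' (a := 0) (fun x _ => hd x) hi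
      (tendsto_zero_of_hasDerivAt_of_integrableOn_Ioi (fun x _ => hd x) hi (hint y hy ν))
    rw [this]; simp

/-- For `ν < 1` the contour integral along `[0, iθ] ∪ (iθ + [0, ∞))` has the same imaginary part
as the integral over the whole horizontal line at height `θ`. -/
lemma wrightContour_im_eq {β ν s t θ : ℝ} (hβ : 0 < β) (hν : ν < 1) (hθ : 0 ≤ θ)
    (hi : IntegrableOn (fun x : ℝ => wrightIntegrand β ν s t (x + θ * Complex.I)) (Ioi 0)) :
    Integrable (fun x : ℝ => wrightIntegrand β ν s t (x + θ * Complex.I)) ∧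
    (wrightContour β ν s t θ).im = (∫ x : ℝ, wrightIntegrand β ν s t (x + θ * Complex.I)).im := by
  have h : ∀ w ∈ ({ν, ν - 1, ν - β} : Set ℝ), ∃ b : ℝ → ℝ, IntegrableOn b (Iic 0) ∧
      ∀ y ∈ (univ : Set ℝ), ∀ x ∈ Iic (0 : ℝ),
        ‖wrightIntegrand β w s t (x + y * Complex.I)‖ ≤ b x := by
    intro w hw
    have hw1 : w < 1 := by
      rcases hw with rfl | rfl | rfl
      · exact hν
      · linarith
      · linarith
    -- To the left of 0 both exponentials are bounded by 1 and only exp((1-w)x) decays, which is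
    -- where ν < 1 enters.
    refine ⟨fun x => Real.exp (|t| + |s|) * Real.exp ((1 - w) * x), ?_, fun y _ x hx => ?_⟩
    · exact (integrableOn_exp_mul_Iic (by linarith) 0).const_mul _
    · rw [norm_wrightIntegrand]
      beta_reduce
      rw [← Real.exp_add]
      have hx' : x ≤ 0 := hx
      have e1 : |Real.exp x * Real.cos y| ≤ 1 := by
        rw [abs_mul, abs_of_pos (Real.exp_pos _)]
        exact mul_le_one₀ (Real.exp_le_one_iff.2 hx') (abs_nonneg _) (Real.abs_cos_le_one _)
      have e2 : |Real.exp (β * x) * Real.cos (β * y)| ≤ 1 := by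
        rw [abs_mul, abs_of_pos (Real.exp_pos _)]
        exact mul_le_one₀ (Real.exp_le_one_iff.2 (by nlinarith)) (abs_nonneg _)
          (Real.abs_cos_le_one _)
      have e3 : t * (Real.exp x * Real.cos y) ≤ |t| := by
        refine (le_abs_self _).trans ?_
        rw [abs_mul]; exact mul_le_of_le_one_right (abs_nonneg _) e1
      have e4 : -(s * (Real.exp (β * x) * Real.cos (β * y))) ≤ |s| := by
        refine (neg_le_abs _).trans ?_
        rw [abs_mul]; exact mul_le_of_le_one_right (abs_nonneg _) e2
      simp only [Complex.add_re, Complex.ofReal_re, Complex.mul_re, Complex.I_re, mul_zero,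
        Complex.ofReal_im, Complex.I_im, mul_one, sub_self, add_zero, Complex.add_im,
        Complex.mul_im, zero_add]
      exact Real.exp_le_exp.2 (by linarith)
  have hint : ∀ y : ℝ, ∀ w ∈ ({ν, ν - 1, ν - β} : Set ℝ), IntegrableOn
      (fun x : ℝ => wrightIntegrand β w s t (x + y * Complex.I)) (Iic 0) := by
    intro y w hw
    obtain ⟨b, hb, hb'⟩ := h w hw
    refine Integrable.mono' hb ?_ ((ae_restrict_iff' measurableSet_Iic).2
      (Eventually.of_forall fun x hx => hb' y (mem_univ _) x hx))
    exact ((continuous_wrightIntegrand β w s t).comp (by fun_prop)).aestronglyMeasurable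
  obtain ⟨b, hb, hb'⟩ := exists_wrightIntegrand_deriv_bound (ν := ν) h
  have key := integral_horizontal_sub (hasDerivAt_wrightIntegrand β ν s t)
    (by have := continuous_wrightIntegrand β; fun_prop) hb hθ measurableSet_Iic
    (fun y _ => hb' y (mem_univ _))
    (fun y => wrightIntegrand β ν s t (y * Complex.I)) (fun y hy => ?_)
    (hint 0 ν (by simp)) (hint θ ν (by simp))
  -- At height 0 the integrand is real, so prolonging the contour to -∞ does not change the
  -- imaginary part.
  · have hreal : (∫ x in Iic (0 : ℝ), wrightIntegrand β ν s t (x + (0 : ℝ) * Complex.I)).im = 0 := by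
      have : ∀ x : ℝ, wrightIntegrand β ν s t (x + (0 : ℝ) * Complex.I)
          = ((Real.exp (t * Real.exp x - s * Real.exp (β * x) + (1 - ν) * x) : ℝ) : ℂ) := by
        intro x; unfold wrightIntegrand; push_cast; simp
      simp_rw [this]
      rw [integral_complex_ofReal, Complex.ofReal_im]
    have hunion : Integrable (fun x : ℝ => wrightIntegrand β ν s t (x + θ * Complex.I)) := by
      rw [← integrableOn_univ, ← Iic_union_Ioi (a := (0 : ℝ))]
      exact (hint θ ν (by simp)).union hi
    refine ⟨hunion, ?_⟩
    rw [← intervalIntegral.integral_Iic_add_Ioi (hint θ ν (by simp)) hi]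
    unfold wrightContour
    rw [eq_add_of_sub_eq key]
    simp only [Complex.add_im, hreal]
    ring
  · have hd := hasDerivAt_add_mul_I (hasDerivAt_wrightIntegrand β ν s t) y
    have hi := integrableOn_wrightIntegrand_deriv (fun w hw => hint y w hw) (ν := ν)
    have := integral_Iic_of_hasDerivAt_of_tendsto' (a := 0) (fun x _ => hd x) hi
      (tendsto_zero_of_hasDerivAt_of_integrableOn_Iic (fun x _ => hd x) hi (hint y ν (by simp)))
    rw [this]; simp

lemma HasSum.of_eq {ι E : Type*} [AddCommMonoid E] [TopologicalSpace E] {f g : ι → E} {a b : E}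
    (h : HasSum f a) (hf : ∀ k, g k = f k) (hab : b = a) : HasSum g b := by
  rw [hab, show g = f from funext hf]; exact h

lemma norm_wrightIntegrand_add_mul_I (β ν s t x y : ℝ) :
    ‖wrightIntegrand β ν s t (x + y * Complex.I)‖ = Real.exp (t * (Real.exp x * Real.cos y)
      - s * (Real.exp (β * x) * Real.cos (β * y)) + (1 - ν) * x) := by
  rw [norm_wrightIntegrand]; simp

/-- For `t > 0` all angles in `[π/2, π]` give the same contour integral. -/
lemma exists_wrightIntegrand_bound_of_pos {β s t : ℝ} (hβ : 0 < β) (hβ1 : β < 1) (hs : 0 < s)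
    (ht : 0 < t) (w : ℝ) : ∃ b : ℝ → ℝ, IntegrableOn b (Ioi 0) ∧
      ∀ y ∈ Icc (Real.pi / 2) Real.pi, ∀ x ∈ Ioi (0 : ℝ),
        ‖wrightIntegrand β w s t (x + y * Complex.I)‖ ≤ b x := by
  have hpi := Real.pi_pos
  -- This angle exceeds π/2 while βθ stays below π/2. Up to θ, cos(βy) > 0 makes the s-term decay;
  -- beyond θ, cos y < 0 makes the t-term decay, and it dominates the s-term because β < 1.
  set θ := Real.pi / (1 + β) with hθ
  have hθ1 : Real.pi / 2 < θ := by
    rw [hθ]; exact div_lt_div_of_pos_left hpi (by linarith) (by linarith)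
  have hθ2 : θ < Real.pi := by
    rw [hθ, div_lt_iff₀ (by linarith)]; nlinarith
  have hθ3 : β * θ < Real.pi / 2 := by
    rw [hθ, ← mul_div_assoc, div_lt_div_iff₀ (by linarith) (by norm_num)]; nlinarith
  have hκ1 : 0 < Real.cos (β * θ) := Real.cos_pos_of_mem_Ioo ⟨by nlinarith, hθ3⟩
  have hκ2 : 0 < - Real.cos θ := by
    have := Real.cos_neg_of_pi_div_two_lt_of_lt hθ1 (by linarith)
    linarith
  refine ⟨fun x => Real.exp (-(s * Real.cos (β * θ)) * Real.exp (β * x) + (|w| + 2) * x)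
    + Real.exp (-(t * - Real.cos θ) * Real.exp x + s * Real.exp (β * x) + (|w| + 2) * x), ?_, ?_⟩
  · exact ((integrable_exp_neg_mul_exp_mul_add (by positivity) hβ (by positivity)).add
      (integrable_exp_neg_exp_add_exp hβ hβ1 (by positivity) (by positivity))).integrableOn
  · intro y hy x hx
    have hx0 : 0 < x := hx
    have hw : (1 - w) * x ≤ (|w| + 2) * x := by
      have := neg_abs_le w
      exact mul_le_mul_of_nonneg_right (by linarith) hx0.le
    rw [norm_wrightIntegrand_add_mul_I]
    have p1 := Real.exp_pos x
    have p2 := Real.exp_pos (β * x)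
    rcases le_total y θ with h | h
    · refine le_add_of_le_of_nonneg (Real.exp_le_exp.2 ?_) (Real.exp_pos _).le
      have c1 : Real.cos y ≤ 0 := Real.cos_nonpos_of_pi_div_two_le_of_le hy.1 (by linarith [hy.2])
      have c2 : Real.cos (β * θ) ≤ Real.cos (β * y) :=
        Real.cos_le_cos_of_nonneg_of_le_pi (by nlinarith [hy.1]) (by linarith) (by gcongr)
      have e1 : t * (Real.exp x * Real.cos y) ≤ 0 :=
        mul_nonpos_of_nonneg_of_nonpos ht.le (mul_nonpos_of_nonneg_of_nonpos p1.le c1)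
      have e2 : s * (Real.exp (β * x) * Real.cos (β * θ))
          ≤ s * (Real.exp (β * x) * Real.cos (β * y)) := by gcongr
      linarith
    · refine le_add_of_nonneg_of_le (Real.exp_pos _).le (Real.exp_le_exp.2 ?_)
      have c1 : Real.cos y ≤ Real.cos θ :=
        Real.cos_le_cos_of_nonneg_of_le_pi (by linarith) hy.2 h
      have e1 : t * (Real.exp x * Real.cos y) ≤ t * (Real.exp x * Real.cos θ) := by gcongr
      have e2 : -(s * (Real.exp (β * x) * Real.cos (β * y))) ≤ s * (Real.exp (β * x) * 1) := by
        rw [← mul_neg, ← mul_neg]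
        gcongr
        linarith [Real.neg_one_le_cos (β * y)]
      linarith

/-- For `t ≤ 0` all angles in `[0, π/2]` are admissible. -/
lemma exists_wrightIntegrand_bound_of_nonpos {β s t : ℝ} (hβ : 0 < β) (hβ1 : β < 1) (hs : 0 < s)
    (ht : t ≤ 0) (w : ℝ) : ∃ b : ℝ → ℝ, IntegrableOn b (Ioi 0) ∧
      ∀ y ∈ Icc 0 (Real.pi / 2), ∀ x ∈ Ioi (0 : ℝ),
        ‖wrightIntegrand β w s t (x + y * Complex.I)‖ ≤ b x := by
  have hpi := Real.pi_pos
  have hκ1 : 0 < Real.cos (β * (Real.pi / 2)) :=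
    Real.cos_pos_of_mem_Ioo ⟨by nlinarith, by nlinarith⟩
  refine ⟨fun x => Real.exp (-(s * Real.cos (β * (Real.pi / 2))) * Real.exp (β * x)
    + (|w| + 2) * x), (integrable_exp_neg_mul_exp_mul_add (by positivity) hβ
      (by positivity)).integrableOn, ?_⟩
  intro y hy x hx
  have hx0 : 0 < x := hx
  have hw : (1 - w) * x ≤ (|w| + 2) * x := by
    have := neg_abs_le w
    exact mul_le_mul_of_nonneg_right (by linarith) hx0.le
  rw [norm_wrightIntegrand_add_mul_I]
  have p1 := Real.exp_pos x
  have p2 := Real.exp_pos (β * x)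
  refine Real.exp_le_exp.2 ?_
  have c1 : 0 ≤ Real.cos y := Real.cos_nonneg_of_mem_Icc ⟨by linarith [hy.1], hy.2⟩
  have c2 : Real.cos (β * (Real.pi / 2)) ≤ Real.cos (β * y) :=
    Real.cos_le_cos_of_nonneg_of_le_pi (mul_nonneg hβ.le hy.1) (by nlinarith)
      (mul_le_mul_of_nonneg_left hy.2 hβ.le)
  have e1 : t * (Real.exp x * Real.cos y) ≤ 0 :=
    mul_nonpos_of_nonpos_of_nonneg ht (mul_nonneg p1.le c1)
  have e2 : s * (Real.exp (β * x) * Real.cos (β * (Real.pi / 2)))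
      ≤ s * (Real.exp (β * x) * Real.cos (β * y)) := by gcongr
  linarith

lemma wrightJ_eq_pi {β s t : ℝ} (hβ : 0 < β) (hβ1 : β < 1) (hs : 0 < s) (ht : 0 < t) (ν : ℝ) :
    wrightJ β ν s t = (wrightContour β ν s t Real.pi).im / Real.pi := by
  unfold wrightJ
  rw [wrightContour_eq_of_bound (by linarith [Real.pi_pos])
    (exists_wrightIntegrand_bound_of_pos hβ hβ1 hs ht)]

lemma wrightIntegrand_ofReal (β ν s t x : ℝ) : wrightIntegrand β ν s t x
    = ((Real.exp (t * Real.exp x - s * Real.exp (β * x) + (1 - ν) * x) : ℝ) : ℂ) := by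
  unfold wrightIntegrand; push_cast; simp

/-- For t ≤ 0 the contour turns down onto the positive real axis, where the integrand is real. This
causality later confines convolutions in time to (0,t). -/
lemma wrightJ_of_nonpos {β s t : ℝ} (hβ : 0 < β) (hβ1 : β < 1) (hs : 0 < s) (ht : t ≤ 0) (ν : ℝ) :
    wrightJ β ν s t = 0 := by
  unfold wrightJ
  rw [← wrightContour_eq_of_bound (by linarith [Real.pi_pos])
    (exists_wrightIntegrand_bound_of_nonpos hβ hβ1 hs ht)]
  unfold wrightContour
  simp only [Complex.ofReal_zero, zero_mul, add_zero, wrightIntegrand_ofReal,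
    intervalIntegral.integral_same, mul_zero]
  rw [integral_complex_ofReal, Complex.ofReal_im, zero_div]

lemma wrightIntegrand_pi (β ν s t x : ℝ) : wrightIntegrand β ν s t (x + Real.pi * Complex.I)
    = Complex.exp (-(t * Real.exp x : ℝ) + ((1 - ν) * x : ℝ) + ((1 - ν) * Real.pi : ℝ) * Complex.I)
      * Complex.exp (-(s * Real.exp (β * x) : ℝ) * Complex.exp ((β * Real.pi : ℝ) * Complex.I)) := by
  unfold wrightIntegrand
  rw [← Complex.exp_add, Complex.exp_add (x : ℂ), Complex.exp_pi_mul_I, mul_add (β : ℂ), Complex.exp_add (β * x : ℂ)]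
  congr 1
  rw [show (((β * Real.pi : ℝ) : ℂ) * Complex.I) = β * (Real.pi * Complex.I) by push_cast; ring]
  push_cast
  ring

lemma wrightJ_integrableOn_pi {β s t : ℝ} (hβ : 0 < β) (hβ1 : β < 1) (hs : 0 < s) (ht : 0 < t)
    (ν : ℝ) : IntegrableOn
      (fun x : ℝ => wrightIntegrand β ν s t (x + Real.pi * Complex.I)) (Ioi 0) := by
  obtain ⟨b, hb, hb'⟩ := exists_wrightIntegrand_bound_of_pos hβ hβ1 hs ht ν
  refine Integrable.mono' hb ?_ ((ae_restrict_iff' measurableSet_Ioi).2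
    (Eventually.of_forall fun x hx => hb' Real.pi ⟨by linarith [Real.pi_pos], le_rfl⟩ x hx))
  exact ((continuous_wrightIntegrand β ν s t).comp (by fun_prop)).aestronglyMeasurable

/-- Reflection formula in a form valid also at the poles of Γ(1 - w), where `Real.Gamma` and its
inverse are both 0. This matches the convention 1/Γ = 0 in `wrightW`. -/
lemma Gamma_mul_sin_eq (w : ℝ) (hw : 0 < w) :
    Real.Gamma w * Real.sin (Real.pi * w) = Real.pi * (Real.Gamma (1 - w))⁻¹ := by
  have h := Real.Gamma_mul_Gamma_one_sub w
  have hG := (Real.Gamma_pos_of_pos hw).ne'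
  by_cases hs : Real.sin (Real.pi * w) = 0
  · rw [hs, div_zero] at h
    have : Real.Gamma (1 - w) = 0 := by simpa [hG] using h
    rw [hs, this]; simp
  · have h1 : Real.Gamma (1 - w) ≠ 0 := by
      intro h0
      rw [h0, mul_zero] at h
      exact absurd h.symm (div_ne_zero Real.pi_ne_zero hs)
    rw [eq_div_iff hs] at h
    field_simp
    linarith

/-- The contour integral is the Wright function. -/
lemma hasSum_wrightJ {β ν s t : ℝ} (hβ : 0 < β) (hβ1 : β < 1) (hs : 0 < s) (ht : 0 < t)
    (hν : ν < 1) : HasSum (fun k : ℕ => t ^ (ν - 1) *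
      ((-(s / t ^ β)) ^ k / ((k.factorial : ℝ) * Real.Gamma (-β * k + ν)))) (wrightJ β ν s t) := by
  have hpi := Real.pi_pos
  obtain ⟨hint, him⟩ := wrightContour_im_eq hβ hν hpi.le (wrightJ_integrableOn_pi hβ hβ1 hs ht ν)
  rw [wrightJ_eq_pi hβ hβ1 hs ht, him]
  set c : ℂ := Complex.exp ((β * Real.pi : ℝ) * Complex.I) with hc
  set d : ℂ := Complex.exp (((1 - ν) * Real.pi : ℝ) * Complex.I) with hd
  have hc1 : ‖c‖ = 1 := Complex.norm_exp_ofReal_mul_I _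
  have hd1 : ‖d‖ = 1 := Complex.norm_exp_ofReal_mul_I _
  have hw : ∀ k : ℕ, 0 < β * k + (1 - ν) := fun k => by
    have : 0 ≤ β * (k : ℝ) := by positivity
    linarith
  have hpow : ∀ (k : ℕ) (x : ℝ), Real.exp (-t * Real.exp x + (β * k + (1 - ν)) * x)
      = Real.exp (-t * Real.exp x + (1 - ν) * x) * Real.exp (β * x) ^ k := by
    intro k x
    rw [← Real.exp_nat_mul, ← Real.exp_add]; congr 1; ring
  have hexp : ∀ y : ℝ, HasSum (fun k : ℕ => y ^ k / (k.factorial : ℝ)) (Real.exp y) := by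
    intro y
    rw [Real.exp_eq_exp_ℝ]; exact NormedSpace.expSeries_div_hasSum_exp y
  have hcexp : ∀ y : ℂ, HasSum (fun k : ℕ => y ^ k / (k.factorial : ℂ)) (Complex.exp y) := by
    intro y
    rw [Complex.exp_eq_exp_ℂ]; exact NormedSpace.expSeries_div_hasSum_exp y
  have hbsum : ∀ x : ℝ, HasSum (fun k : ℕ => s ^ k / (k.factorial : ℝ)
        * Real.exp (-t * Real.exp x + (β * k + (1 - ν)) * x))
      (Real.exp (-t * Real.exp x + s * Real.exp (β * x) + (1 - ν) * x)) := by
    intro x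
    have := (hexp (s * Real.exp (β * x))).mul_left (Real.exp (-t * Real.exp x + (1 - ν) * x))
    rw [← Real.exp_add] at this
    refine this.of_eq (fun k => ?_) ?_
    · rw [hpow, mul_pow]; ring
    · congr 1; ring
  -- On the line at height π the s-exponential is expanded in powers of s. The absolute values of
  -- the terms sum to the integrand with +s exp(βx), which is still integrable since β < 1.
  have key := hasSum_integral_of_dominated_convergence (μ := volume)
    (F := fun (k : ℕ) (x : ℝ) => (((-s) ^ k / (k.factorial : ℝ)
        * Real.exp (-t * Real.exp x + (β * k + (1 - ν)) * x) : ℝ) : ℂ) * (d * c ^ k))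
    (f := fun x : ℝ => wrightIntegrand β ν s t (x + Real.pi * Complex.I))
    (fun k x => s ^ k / (k.factorial : ℝ)
        * Real.exp (-t * Real.exp x + (β * k + (1 - ν)) * x))
    (fun k => by fun_prop)
    (fun k => Eventually.of_forall fun x => by
      rw [norm_mul, norm_mul, norm_pow, hc1, hd1, Complex.norm_real, Real.norm_eq_abs, abs_mul,
        abs_div, abs_pow, abs_neg, abs_of_pos hs, Nat.abs_cast, abs_of_pos (Real.exp_pos _)]
      simp)
    (Eventually.of_forall fun x => (hbsum x).summable)
    (by
      simp_rw [fun x => (hbsum x).tsum_eq]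
      exact integrable_exp_neg_exp_add_exp hβ hβ1 ht (by linarith))
    (Eventually.of_forall fun x => by
      have := (hcexp (-(s * Real.exp (β * x) : ℝ) * c)).mul_left
        (Complex.exp (-(t * Real.exp x : ℝ) + ((1 - ν) * x : ℝ)) * d)
      rw [wrightIntegrand_pi, Complex.exp_add _ (((1 - ν) * Real.pi : ℝ) * Complex.I)]
      refine this.of_eq (fun k => ?_) rfl
      rw [hpow, mul_pow]
      push_cast
      rw [show (-t * Complex.exp x + (1 - ν) * x : ℂ)
        = -(t * Complex.exp x) + (1 - ν) * x by ring]
      rw [neg_pow (s * Complex.exp (β * x) : ℂ), mul_pow, neg_pow (s : ℂ)]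
      ring)
  have him2 := (Complex.hasSum_im key).div_const Real.pi
  refine him2.of_eq (fun k => ?_) rfl
  rw [integral_mul_const, integral_complex_ofReal, integral_const_mul,
    integral_exp_neg_mul_exp_add ht (hw k), Complex.im_ofReal_mul]
  -- Each term is a real Gamma integral times a phase. Only the sine of the phase survives, and the
  -- reflection formula turns it into 1/Γ(ν - βk).
  have hdc : (d * c ^ k).im = Real.sin (Real.pi * (β * k + (1 - ν))) := by
    rw [hc, hd, ← Complex.exp_nat_mul, ← Complex.exp_add,
      show (((1 - ν) * Real.pi : ℝ) : ℂ) * Complex.I + k * (((β * Real.pi : ℝ) : ℂ) * Complex.I)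
        = ((Real.pi * (β * k + (1 - ν)) : ℝ) : ℂ) * Complex.I by push_cast; ring,
      Complex.exp_ofReal_mul_I_im]
  have hg := Gamma_mul_sin_eq _ (hw k)
  have htp : t ^ (-(β * k + (1 - ν))) = t ^ (ν - 1) * ((t ^ β) ^ k)⁻¹ := by
    rw [← Real.rpow_natCast, ← Real.rpow_mul ht.le, ← Real.rpow_neg ht.le, ← Real.rpow_add ht]
    congr 1; ring
  rw [hdc, htp, show -β * k + ν = 1 - (β * k + (1 - ν)) by ring, neg_pow (s / t ^ β), div_pow,
    neg_pow s]
  rw [show ∀ A B C D S : ℝ, A * (B * C * D) * S / Real.pi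
    = A * B * C * (D * S) / Real.pi by intros; ring, hg]
  field_simp

lemma wrightJ_eq_wrightW {β ν s t : ℝ} (hβ : 0 < β) (hβ1 : β < 1) (hs : 0 < s) (ht : 0 < t)
    (hν : ν < 1) : wrightJ β ν s t = t ^ (ν - 1) * wrightW (-β) ν (-(s / t ^ β)) := by
  have h := hasSum_wrightJ hβ hβ1 hs ht hν
  rw [wrightW, ← tsum_mul_left, h.tsum_eq]

lemma wrightG_eq_wrightJ {β s t : ℝ} (hβ : 0 < β) (hβ1 : β < 1) (hs : 0 < s) (ht : 0 < t) :
    wrightG β s t = wrightJ β (1 - β) s t := by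
  rw [wrightJ_eq_wrightW hβ hβ1 hs ht (by linarith), wrightG, one_div, ← Real.rpow_neg ht.le]
  congr 2; ring

/-- Self-similarity of the kernels. -/
lemma wrightJ_scaling {β ν s t : ℝ} (hβ : 0 < β) (hβ1 : β < 1) (hs : 0 < s) (ht : 0 < t)
    (hν : ν < 1) : wrightJ β ν s t = t ^ (ν - 1) * wrightJ β ν (s / t ^ β) 1 := by
  rw [wrightJ_eq_wrightW hβ hβ1 hs ht hν, wrightJ_eq_wrightW hβ hβ1 (by positivity) one_pos hν]
  simp

/-! ### The Gamma integral with a complex rate -/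

lemma integrableOn_rpow_mul_cexp {μ : ℝ} (hμ : 0 < μ) {r : ℂ} (hr : 0 < r.re) :
    IntegrableOn (fun v : ℝ => ((v ^ (μ - 1) : ℝ) : ℂ) * Complex.exp (-(r * v))) (Ioi 0) := by
  have h : IntegrableOn (fun v : ℝ => v ^ (μ - 1) * Real.exp (-r.re * v ^ (1 : ℝ))) (Ioi 0) :=
    integrableOn_rpow_mul_exp_neg_mul_rpow (by linarith) one_pos hr
  refine h.mono' (by fun_prop) ((ae_restrict_iff' measurableSet_Ioi).2
    (Eventually.of_forall fun v hv => ?_))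
  rw [norm_mul, Complex.norm_real, Complex.norm_exp, Real.norm_eq_abs,
    abs_of_nonneg (Real.rpow_nonneg (le_of_lt hv) _)]
  simp

/-- Both sides are analytic in r on the right half-plane and agree for positive real r; the identity
theorem is applied along the points 1 + 1/(n+1), which accumulate at 1. -/
lemma integral_rpow_mul_cexp {μ : ℝ} (hμ : 0 < μ) {r : ℂ} (hr : 0 < r.re) :
    ∫ v in Ioi (0 : ℝ), ((v ^ (μ - 1) : ℝ) : ℂ) * Complex.exp (-(r * v))
      = (1 / r) ^ (μ : ℂ) * Real.Gamma μ := by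
  set U : Set ℂ := {r | 0 < r.re} with hU
  have hUo : IsOpen U := isOpen_lt continuous_const Complex.continuous_re
  have hUc : IsPreconnected U := (convex_halfSpace_re_gt 0).isPreconnected
  have hd1 : DifferentiableOn ℂ
      (fun r : ℂ => ∫ v in Ioi (0 : ℝ), ((v ^ (μ - 1) : ℝ) : ℂ) * Complex.exp (-(r * v))) U := by
    intro r hr
    have hr' : 0 < r.re := hr
    have hε : 0 < r.re / 2 := by linarith
    have := hasDerivAt_integral_of_dominated_loc_of_deriv_le (𝕜 := ℂ)
      (μ := volume.restrict (Ioi (0 : ℝ))) (x₀ := r) (s := {z : ℂ | r.re / 2 < z.re})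
      (F := fun (r : ℂ) (v : ℝ) => ((v ^ (μ - 1) : ℝ) : ℂ) * Complex.exp (-(r * v)))
      (F' := fun (r : ℂ) (v : ℝ) => ((v ^ (μ - 1) : ℝ) : ℂ) * (Complex.exp (-(r * v)) * (-v)))
      (bound := fun v => v ^ μ * Real.exp (-(r.re / 2) * v ^ (1 : ℝ)))
      ((isOpen_lt continuous_const Complex.continuous_re).mem_nhds
        (show r.re / 2 < r.re by linarith))
      (Eventually.of_forall fun _ => by fun_prop) (integrableOn_rpow_mul_cexp hμ hr')
      (by fun_prop)
      ((ae_restrict_iff' measurableSet_Ioi).2 (Eventually.of_forall fun v hv z hz => ?_))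
      (integrableOn_rpow_mul_exp_neg_mul_rpow (by linarith) one_pos hε)
      (Eventually.of_forall fun v z _ => ?_)
    · exact this.2.differentiableAt.differentiableWithinAt
    · have hv' : 0 < v := hv
      have hz' : r.re / 2 < z.re := hz
      rw [norm_mul, norm_mul, Complex.norm_real, Complex.norm_exp, Real.norm_eq_abs, norm_neg,
        Complex.norm_real, Real.norm_eq_abs, abs_of_pos hv',
        abs_of_nonneg (Real.rpow_nonneg hv'.le _)]
      have e : v ^ μ = v ^ (μ - 1) * v := by
        rw [← Real.rpow_add_one hv'.ne']; congr 1; ring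
      rw [e, Real.rpow_one, mul_comm (Real.exp _) v, ← mul_assoc]
      refine mul_le_mul_of_nonneg_left (Real.exp_le_exp.2 ?_) (by positivity)
      simp only [Complex.neg_re, Complex.mul_re, Complex.ofReal_re, Complex.ofReal_im, mul_zero,
        sub_zero]
      nlinarith
    · have h1 : HasDerivAt (fun z : ℂ => -(z * (v : ℂ))) (-(v : ℂ)) z := by
        have := ((hasDerivAt_id z).mul_const (v : ℂ)).neg
        rwa [one_mul] at this
      exact (h1.cexp).const_mul _
  have hd2 : DifferentiableOn ℂ (fun r : ℂ => (1 / r) ^ (μ : ℂ) * Real.Gamma μ) U := by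
    intro r hr
    have hr' : 0 < r.re := hr
    have h0 : r ≠ 0 := fun h => by simp [h] at hr'
    refine (DifferentiableAt.mul_const (DifferentiableAt.cpow_const
      ((differentiableAt_const _).div differentiableAt_id h0) ?_) _).differentiableWithinAt
    left
    change 0 < ((1 : ℂ) / r).re
    rw [one_div, Complex.inv_re]
    exact div_pos hr' (Complex.normSq_pos.2 h0)
  refine (hd1.analyticOnNhd hUo).eqOn_of_preconnected_of_frequently_eq (hd2.analyticOnNhd hUo)
    hUc (z₀ := 1) (by simp [hU]) ?_ hr
  have hreal : ∀ x : ℝ, 0 < x →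
      ∫ v in Ioi (0 : ℝ), ((v ^ (μ - 1) : ℝ) : ℂ) * Complex.exp (-((x : ℂ) * v))
        = (1 / (x : ℂ)) ^ (μ : ℂ) * Real.Gamma μ := by
    intro x hx
    have h := Real.integral_rpow_mul_exp_neg_mul_Ioi hμ hx
    have h' := congrArg (fun y : ℝ => (y : ℂ)) h
    simp only [← integral_complex_ofReal] at h'
    push_cast [Complex.ofReal_cpow (one_div_pos.2 hx).le] at h'
    exact h'
  have ht : Tendsto (fun n : ℕ => ((1 + 1 / ((n : ℝ) + 1) : ℝ) : ℂ)) atTop (𝓝[≠] 1) := by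
    refine tendsto_nhdsWithin_iff.2 ⟨?_, Eventually.of_forall fun n => ?_⟩
    · have := tendsto_one_div_add_atTop_nhds_zero_nat (𝕜 := ℝ) |>.const_add 1
      rw [add_zero] at this
      exact_mod_cast (Complex.continuous_ofReal.tendsto 1).comp this
    · have : (0 : ℝ) < 1 / ((n : ℝ) + 1) := by positivity
      intro h
      have h' : (1 + 1 / ((n : ℝ) + 1) : ℝ) = 1 := Complex.ofReal_injective (by simpa using h)
      linarith
  exact ht.frequently (Frequently.of_forall fun n => hreal _ (by positivity))

/-! ### Parameter integrals of the Wright integrand -/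

/-- A path in the closed half strip `0 ≤ re`, `0 ≤ im ≤ π/2`, along which the Wright integrand
is integrable with all moments. -/
structure IsWrightPath (β : ℝ) (z : ℝ → ℂ) (m : Measure ℝ) : Prop where
  cont : Continuous z
  mem : ∀ᵐ x ∂m, 0 ≤ (z x).re ∧ 0 ≤ (z x).im ∧ (z x).im ≤ Real.pi / 2 ∧
    Real.exp (z x).re * Real.cos (z x).im ≤ 1
  int : ∀ K > 0, ∀ w : ℝ,
    Integrable (fun x => Real.exp (-K * Real.exp (β * (z x).re) + w * (z x).re)) m

lemma cos_half_pos {β : ℝ} (hβ : 0 < β) (hβ1 : β < 1) : 0 < Real.cos (β * (Real.pi / 2)) :=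
  Real.cos_pos_of_mem_Ioo ⟨by nlinarith [Real.pi_pos], by nlinarith [Real.pi_pos]⟩

lemma isWrightPath_ray {β : ℝ} (hβ : 0 < β) :
    IsWrightPath β (fun x => x + (Real.pi / 2 : ℝ) * Complex.I) (volume.restrict (Ioi 0)) where
  cont := by fun_prop
  mem := (ae_restrict_iff' measurableSet_Ioi).2 (Eventually.of_forall fun x hx => by
    have hx' : (0 : ℝ) < x := hx
    have hp := Real.pi_pos
    have : 0 ≤ Real.pi / 2 := by linarith
    simp [-Complex.ofReal_div, hx'.le, this])
  int := fun K hK w => by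
    have h := (integrable_exp_neg_mul_exp_mul_add hK hβ
      (show 0 < |w| + 1 by positivity)).integrableOn (s := Ioi 0)
    refine h.mono' (by fun_prop) ((ae_restrict_iff' measurableSet_Ioi).2
      (Eventually.of_forall fun x hx => ?_))
    have hx' : (0 : ℝ) < x := hx
    rw [Real.norm_eq_abs, abs_of_pos (Real.exp_pos _)]
    simp [-Complex.ofReal_div]
    nlinarith [le_abs_self w]

lemma isWrightPath_arc (β : ℝ) :
    IsWrightPath β (fun y => y * Complex.I) (volume.restrict (Ioc 0 (Real.pi / 2))) where
  cont := by fun_prop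
  mem := (ae_restrict_iff' measurableSet_Ioc).2 (Eventually.of_forall fun x hx => by
    simp [hx.1.le, hx.2, Real.cos_le_one])
  int := fun K hK w => by simp

section
variable {β : ℝ} {z : ℝ → ℂ} {m : Measure ℝ}

/-- On the path cos(β im z) ≥ cos(βπ/2) > 0, so the s-term decays. The t-term has 0 ≤ re e^z ≤ 1,
hence contributes at most exp(T), uniformly in t ≤ T and in particular for all negative t. -/
lemma IsWrightPath.norm_le (h : IsWrightPath β z m) (hβ : 0 < β) (hβ1 : β < 1) :
    ∀ᵐ x ∂m, ∀ s, 0 ≤ s → ∀ T, 0 ≤ T → ∀ t ≤ T, ∀ ν, ‖wrightIntegrand β ν s t (z x)‖ ≤ Real.exp T *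
      Real.exp (-(s * Real.cos (β * (Real.pi / 2))) * Real.exp (β * (z x).re)
        + (1 - ν) * (z x).re) := by
  filter_upwards [h.mem] with x ⟨h1, h2, h3, h4⟩ s hs T hT t ht ν
  rw [norm_wrightIntegrand, ← Real.exp_add]
  refine Real.exp_le_exp.2 ?_
  have c1 : 0 ≤ Real.cos (z x).im :=
    Real.cos_nonneg_of_mem_Icc ⟨by linarith [Real.pi_pos], h3⟩
  have c2 : Real.cos (β * (Real.pi / 2)) ≤ Real.cos (β * (z x).im) :=
    Real.cos_le_cos_of_nonneg_of_le_pi (mul_nonneg hβ.le h2) (by nlinarith [Real.pi_pos])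
      (mul_le_mul_of_nonneg_left h3 hβ.le)
  have c3 : 0 ≤ Real.exp (z x).re * Real.cos (z x).im := by positivity
  have e1 : t * (Real.exp (z x).re * Real.cos (z x).im) ≤ T := by nlinarith
  have e2 : s * (Real.exp (β * (z x).re) * Real.cos (β * (Real.pi / 2)))
      ≤ s * (Real.exp (β * (z x).re) * Real.cos (β * (z x).im)) := by gcongr
  linarith

lemma IsWrightPath.integrable (h : IsWrightPath β z m) (hβ : 0 < β) (hβ1 : β < 1) {s : ℝ}
    (hs : 0 < s) (ν t : ℝ) : Integrable (fun x => wrightIntegrand β ν s t (z x)) m := by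
  have hc := continuous_wrightIntegrand β ν s t
  refine ((h.int (s * Real.cos (β * (Real.pi / 2))) (mul_pos hs (cos_half_pos hβ hβ1))
    (1 - ν)).const_mul (Real.exp |t|)).mono' (hc.comp h.cont).aestronglyMeasurable ?_
  filter_upwards [h.norm_le hβ hβ1] with x hx
  exact hx s hs.le |t| (abs_nonneg t) t (le_abs_self t) ν

lemma IsWrightPath.hasDerivAt_left (h : IsWrightPath β z m) (hβ : 0 < β) (hβ1 : β < 1) {s : ℝ}
    (hs : 0 < s) (ν t : ℝ) : HasDerivAt (fun s => ∫ x, wrightIntegrand β ν s t (z x) ∂m)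
      (-∫ x, wrightIntegrand β (ν - β) s t (z x) ∂m) s := by
  have hc := continuous_wrightIntegrand β
  have hz := h.cont
  rw [← integral_neg]
  refine (hasDerivAt_integral_of_dominated_loc_of_deriv_le (s := Ioi (s / 2))
    (F' := fun s x => - wrightIntegrand β (ν - β) s t (z x))
    (bound := fun x => Real.exp |t| * Real.exp (-(s / 2 * Real.cos (β * (Real.pi / 2)))
      * Real.exp (β * (z x).re) + (1 - (ν - β)) * (z x).re))
    (Ioi_mem_nhds (by linarith)) (Eventually.of_forall fun s => ?_) (h.integrable hβ hβ1 hs ν t)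
    ?_ ?_ ((h.int _ (mul_pos (half_pos hs) (cos_half_pos hβ hβ1)) _).const_mul _) ?_).2
  · exact ((hc ν s t).comp hz).aestronglyMeasurable
  · exact ((hc (ν - β) s t).comp hz).neg.aestronglyMeasurable
  · filter_upwards [h.norm_le hβ hβ1] with x hx r hr
    have hr' : s / 2 < r := hr
    rw [norm_neg]
    refine (hx r (by linarith) |t| (abs_nonneg t) t (le_abs_self t) (ν - β)).trans ?_
    gcongr
    exact (cos_half_pos hβ hβ1).le
  · refine Eventually.of_forall fun x r _ => ?_
    have h1 : HasDerivAt (fun s : ℝ => (t * Complex.exp (z x) - s * Complex.exp (β * z x)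
        + (1 - ν) * z x : ℂ)) (-(1 * Complex.exp (β * z x))) r :=
      (((Complex.ofRealCLM.hasDerivAt (x := r)).mul_const _).const_sub _).add_const _
    have := h1.cexp
    rw [one_mul, mul_neg] at this
    rw [← wrightIntegrand_mul_exp_mul]
    exact this

lemma IsWrightPath.hasDerivAt_right (h : IsWrightPath β z m) (hβ : 0 < β) (hβ1 : β < 1) {s : ℝ}
    (hs : 0 < s) (ν t : ℝ) : HasDerivAt (fun t => ∫ x, wrightIntegrand β ν s t (z x) ∂m)
      (∫ x, wrightIntegrand β (ν - 1) s t (z x) ∂m) t := by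
  have hc := continuous_wrightIntegrand β
  have hz := h.cont
  refine (hasDerivAt_integral_of_dominated_loc_of_deriv_le (s := Iio (|t| + 1))
    (F' := fun t x => wrightIntegrand β (ν - 1) s t (z x))
    (bound := fun x => Real.exp (|t| + 1) * Real.exp (-(s * Real.cos (β * (Real.pi / 2)))
      * Real.exp (β * (z x).re) + (1 - (ν - 1)) * (z x).re))
    (Iio_mem_nhds (by linarith [le_abs_self t])) (Eventually.of_forall fun t => ?_)
    (h.integrable hβ hβ1 hs ν t)
    ?_ ?_ ((h.int _ (mul_pos hs (cos_half_pos hβ hβ1)) _).const_mul _) ?_).2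
  · exact ((hc ν s t).comp hz).aestronglyMeasurable
  · exact ((hc (ν - 1) s t).comp hz).aestronglyMeasurable
  · filter_upwards [h.norm_le hβ hβ1] with x hx r hr
    exact hx s hs.le (|t| + 1) (by positivity) r (le_of_lt hr) (ν - 1)
  · refine Eventually.of_forall fun x r _ => ?_
    have h1 : HasDerivAt (fun t : ℝ => (t * Complex.exp (z x) - s * Complex.exp (β * z x)
        + (1 - ν) * z x : ℂ)) (1 * Complex.exp (z x)) r :=
      (((Complex.ofRealCLM.hasDerivAt (x := r)).mul_const _).sub_const _).add_const _
    have := h1.cexp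
    rw [one_mul] at this
    rw [← wrightIntegrand_mul_exp]
    exact this

lemma IsWrightPath.exists_norm_integral_le (h : IsWrightPath β z m) (hβ : 0 < β) (hβ1 : β < 1)
    (ν : ℝ) {s₀ : ℝ} (hs₀ : 0 < s₀) (T : ℝ) : ∃ C, ∀ s ≥ s₀, ∀ t ≤ T,
      ‖∫ x, wrightIntegrand β ν s t (z x) ∂m‖
        ≤ C * Real.exp (-(Real.cos (β * (Real.pi / 2)) / 2) * s) := by
  have hκ := cos_half_pos hβ hβ1
  refine ⟨Real.exp |T| * ∫ x, Real.exp (-(s₀ / 2 * Real.cos (β * (Real.pi / 2)))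
    * Real.exp (β * (z x).re) + (1 - ν) * (z x).re) ∂m, fun s hs t ht => ?_⟩
  have hs' : s₀ ≤ s := hs
  rw [mul_right_comm, ← integral_const_mul]
  refine norm_integral_le_of_norm_le ((h.int _ (mul_pos (half_pos hs₀) hκ) _).const_mul _) ?_
  filter_upwards [h.norm_le hβ hβ1, h.mem] with x hx ⟨hx1, _⟩
  refine (hx s (by linarith) |T| (abs_nonneg T) t (ht.trans (le_abs_self T)) ν).trans ?_
  rw [mul_assoc]
  refine mul_le_mul_of_nonneg_left ?_ (Real.exp_pos _).le
  rw [← Real.exp_add]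
  refine Real.exp_le_exp.2 ?_
  have hE : 1 ≤ Real.exp (β * (z x).re) := Real.one_le_exp (by positivity)
  set κ := Real.cos (β * (Real.pi / 2))
  set E := Real.exp (β * (z x).re)
  have : s * κ * E ≥ s₀ / 2 * κ * E + κ / 2 * s := by
    have a1 : (s / 2) * κ * E ≥ s₀ / 2 * κ * E := by gcongr
    have a2 : (s / 2) * κ * E ≥ (s / 2) * κ * 1 := by
      have : 0 ≤ s / 2 * κ := mul_nonneg (by linarith) hκ.le
      gcongr
    linarith
  linarith

end

/-! ### Fractional integration of the kernels in time -/

lemma wrightIntegrand_sub (β ν s t v : ℝ) (z : ℂ) : wrightIntegrand β ν s (t - v) z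
    = wrightIntegrand β ν s t z * Complex.exp (-(v * Complex.exp z)) := by
  unfold wrightIntegrand
  rw [← Complex.exp_add]; congr 1; push_cast; ring

/-- On the ray at height π/2 the real part of e^z vanishes and the Gamma integral with rate e^z does
not converge absolutely. The damping σ moves the rate into the open right half-plane and makes
Fubini legitimate; it is removed in `IsWrightPath.tendsto_damped`. -/
lemma IsWrightPath.integral_damped {β : ℝ} {z : ℝ → ℂ} {m : Measure ℝ} [SFinite m]
    (h : IsWrightPath β z m) (hβ : 0 < β) (hβ1 : β < 1) {s σ μ : ℝ} (hs : 0 < s) (hσ : 0 < σ)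
    (hμ : 0 < μ) (ν t : ℝ) :
    IntegrableOn (fun v : ℝ => ((v ^ (μ - 1) * Real.exp (-(σ * v)) : ℝ) : ℂ)
      * ∫ x, wrightIntegrand β ν s (t - v) (z x) ∂m) (Ioi 0) ∧
    ∫ v in Ioi (0 : ℝ), ((v ^ (μ - 1) * Real.exp (-(σ * v)) : ℝ) : ℂ)
      * ∫ x, wrightIntegrand β ν s (t - v) (z x) ∂m
      = Real.Gamma μ * ∫ x, wrightIntegrand β ν s t (z x)
        * (1 / (σ + Complex.exp (z x))) ^ (μ : ℂ) ∂m := by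
  have hz := h.cont
  have hκ := cos_half_pos hβ hβ1
  have hmeas : AEStronglyMeasurable (fun p : ℝ × ℝ =>
      ((p.1 ^ (μ - 1) * Real.exp (-(σ * p.1)) : ℝ) : ℂ)
        * wrightIntegrand β ν s (t - p.1) (z p.2)) ((volume.restrict (Ioi 0)).prod m) := by
    refine AEStronglyMeasurable.mul ?_ ?_
    · exact (Measurable.aestronglyMeasurable (by fun_prop))
    · refine Continuous.aestronglyMeasurable ?_
      unfold wrightIntegrand
      fun_prop
  have hv : IntegrableOn (fun v : ℝ => v ^ (μ - 1) * Real.exp (-σ * v ^ (1 : ℝ))) (Ioi 0) :=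
    integrableOn_rpow_mul_exp_neg_mul_rpow (by linarith) one_pos hσ
  have hint : Integrable (fun p : ℝ × ℝ => ((p.1 ^ (μ - 1) * Real.exp (-(σ * p.1)) : ℝ) : ℂ)
      * wrightIntegrand β ν s (t - p.1) (z p.2)) ((volume.restrict (Ioi 0)).prod m) := by
    refine (hv.mul_prod ((h.int (s * Real.cos (β * (Real.pi / 2))) (mul_pos hs hκ)
      (1 - ν)).const_mul (Real.exp |t|))).mono' hmeas ?_
    have h1 : ∀ᵐ p : ℝ × ℝ ∂((volume.restrict (Ioi 0)).prod m), 0 < p.1 :=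
      Measure.quasiMeasurePreserving_fst.ae (ae_restrict_mem measurableSet_Ioi)
    have h2 := (Measure.quasiMeasurePreserving_snd (μ := volume.restrict (Ioi (0 : ℝ)))).ae
      (h.norm_le hβ hβ1)
    filter_upwards [h1, h2] with p hp1 hp2
    rw [norm_mul, Complex.norm_real, Real.norm_eq_abs,
      abs_of_nonneg (mul_nonneg (Real.rpow_nonneg hp1.le _) (Real.exp_pos _).le), Real.rpow_one,
      neg_mul]
    refine mul_le_mul_of_nonneg_left ?_ (mul_nonneg (Real.rpow_nonneg hp1.le _) (Real.exp_pos _).le)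
    exact hp2 s hs.le |t| (abs_nonneg t) (t - p.1) (by linarith [le_abs_self t]) ν
  refine ⟨?_, ?_⟩
  · have := hint.integral_prod_left
    simp only [integral_const_mul] at this
    exact this
  · simp_rw [← integral_const_mul]
    rw [integral_integral_swap hint]
    refine integral_congr_ae ?_
    filter_upwards [h.mem] with x ⟨h1, h2, h3, h4⟩
    have hre : 0 < (σ + Complex.exp (z x)).re := by
      rw [Complex.add_re, Complex.ofReal_re, Complex.exp_re]
      have : 0 ≤ Real.cos (z x).im :=
        Real.cos_nonneg_of_mem_Icc ⟨by linarith [Real.pi_pos], h3⟩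
      positivity
    have hG := integral_rpow_mul_cexp hμ hre
    rw [mul_left_comm, mul_comm (Real.Gamma μ : ℂ), ← hG, ← integral_const_mul]
    refine integral_congr_ae (Eventually.of_forall fun v => ?_)
    simp only
    rw [wrightIntegrand_sub, show -((σ + Complex.exp (z x)) * (v : ℂ))
      = ((-(σ * v) : ℝ) : ℂ) + -(v * Complex.exp (z x)) by push_cast; ring, Complex.exp_add]
    push_cast
    ring

/-- Since re e^z ≥ 0 and |e^z| ≥ 1, also |σ + e^z| ≥ 1, so the factor has norm at most 1 and
convergence is dominated. In the limit it is exp(-μz), which raises the index by μ. -/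
lemma IsWrightPath.tendsto_damped {β : ℝ} {z : ℝ → ℂ} {m : Measure ℝ}
    (h : IsWrightPath β z m) (hβ : 0 < β) (hβ1 : β < 1) {s μ : ℝ} (hs : 0 < s)
    (hμ : 0 < μ) (ν t : ℝ) :
    Tendsto (fun σ : ℝ => ∫ x, wrightIntegrand β ν s t (z x)
        * (1 / (σ + Complex.exp (z x))) ^ (μ : ℂ) ∂m) (𝓝[>] 0)
      (𝓝 (∫ x, wrightIntegrand β (ν + μ) s t (z x) ∂m)) := by
  have hz := h.cont
  have hc := continuous_wrightIntegrand β ν s t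
  refine tendsto_integral_filter_of_dominated_convergence
    (fun x => ‖wrightIntegrand β ν s t (z x)‖) ?_ ?_ (h.integrable hβ hβ1 hs ν t).norm ?_
  · refine Eventually.of_forall fun σ => AEStronglyMeasurable.mul
      (hc.comp hz).aestronglyMeasurable (Measurable.aestronglyMeasurable ?_)
    have := hz.measurable
    fun_prop
  · filter_upwards [self_mem_nhdsWithin] with σ hσ
    have hσ' : 0 < σ := hσ
    filter_upwards [h.mem] with x ⟨h1, h2, h3, h4⟩
    rw [norm_mul, Complex.norm_cpow_real]
    refine mul_le_of_le_one_right (norm_nonneg _) (Real.rpow_le_one (norm_nonneg _) ?_ hμ.le)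
    rw [norm_div, norm_one]
    refine div_le_one_of_le₀ ?_ (norm_nonneg _)
    have hcos : 0 ≤ Real.cos (z x).im :=
      Real.cos_nonneg_of_mem_Icc ⟨by linarith [Real.pi_pos], h3⟩
    have e1 : 1 ≤ ‖Complex.exp (z x)‖ := by
      rw [Complex.norm_exp]; exact Real.one_le_exp h1
    refine e1.trans ?_
    rw [← sq_le_sq₀ (norm_nonneg _) (norm_nonneg _), ← Complex.normSq_eq_norm_sq,
      ← Complex.normSq_eq_norm_sq, Complex.normSq_apply, Complex.normSq_apply]
    have e2 : 0 ≤ (Complex.exp (z x)).re := by rw [Complex.exp_re]; positivity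
    simp only [Complex.add_re, Complex.add_im, Complex.ofReal_re, Complex.ofReal_im, zero_add]
    nlinarith
  · filter_upwards [h.mem] with x ⟨h1, h2, h3, h4⟩
    have e : wrightIntegrand β (ν + μ) s t (z x) = wrightIntegrand β ν s t (z x)
        * (1 / ((0 : ℝ) + Complex.exp (z x))) ^ (μ : ℂ) := by
      -- The principal power of exp(-z) is exp(-μz) because |im z| ≤ π/2 < π.
      rw [Complex.ofReal_zero, zero_add, one_div, ← Complex.exp_neg,
        Complex.cpow_def_of_ne_zero (Complex.exp_ne_zero _), Complex.log_exp]
      · unfold wrightIntegrand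
        rw [← Complex.exp_add]; congr 1; push_cast; ring
      · simp only [Complex.neg_im]; linarith [Real.pi_pos]
      · simp only [Complex.neg_im]; linarith [Real.pi_pos]
    rw [e]
    refine Tendsto.const_mul _ ?_
    have hne : ((0 : ℝ) : ℂ) + Complex.exp (z x) ≠ 0 := by simp [Complex.exp_ne_zero]
    have hcont : ContinuousAt
        (fun σ : ℝ => (1 / ((σ : ℂ) + Complex.exp (z x))) ^ (μ : ℂ)) 0 := by
      refine ContinuousAt.cpow (ContinuousAt.div continuousAt_const (by fun_prop) hne)
        continuousAt_const ?_
      rw [Complex.ofReal_zero, zero_add, one_div, ← Complex.exp_neg, Complex.mem_slitPlane_iff]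
      rcases h3.lt_or_eq with h3 | h3
      · left
        rw [Complex.exp_re]
        exact mul_pos (Real.exp_pos _) (Real.cos_pos_of_mem_Ioo
          ⟨by simp only [Complex.neg_im]; linarith,
            by simp only [Complex.neg_im]; linarith [Real.pi_pos]⟩)
      · right
        rw [Complex.exp_im, Complex.neg_im, h3, Real.sin_neg, Real.sin_pi_div_two]
        exact mul_ne_zero (Real.exp_ne_zero _) (by norm_num)
    exact hcont.tendsto.mono_left nhdsWithin_le_nhds

lemma wrightContour_half (β ν s t : ℝ) : wrightContour β ν s t (Real.pi / 2)
    = (∫ x in Ioi (0 : ℝ), wrightIntegrand β ν s t (x + (Real.pi / 2 : ℝ) * Complex.I))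
      + Complex.I * ∫ y in Ioc 0 (Real.pi / 2), wrightIntegrand β ν s t (y * Complex.I) := by
  rw [wrightContour, intervalIntegral.integral_of_le (by linarith [Real.pi_pos])]

section
variable {β : ℝ}

/-! ### Derivatives, decay and fractional integrals of the kernels -/

lemma hasDerivAt_wrightContour_left (hβ : 0 < β) (hβ1 : β < 1) {s : ℝ} (hs : 0 < s) (ν t : ℝ) :
    HasDerivAt (fun s => wrightContour β ν s t (Real.pi / 2))
      (-wrightContour β (ν - β) s t (Real.pi / 2)) s := by
  simp only [wrightContour_half]
  have h := ((isWrightPath_ray hβ).hasDerivAt_left hβ hβ1 hs ν t).add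
    (((isWrightPath_arc β).hasDerivAt_left hβ hβ1 hs ν t).const_mul Complex.I)
  exact h.congr_deriv (by ring)

lemma hasDerivAt_wrightContour_right (hβ : 0 < β) (hβ1 : β < 1) {s : ℝ} (hs : 0 < s) (ν t : ℝ) :
    HasDerivAt (fun t => wrightContour β ν s t (Real.pi / 2))
      (wrightContour β (ν - 1) s t (Real.pi / 2)) t := by
  simp only [wrightContour_half]
  exact ((isWrightPath_ray hβ).hasDerivAt_right hβ hβ1 hs ν t).add
    (((isWrightPath_arc β).hasDerivAt_right hβ hβ1 hs ν t).const_mul Complex.I)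

lemma hasDerivAt_im_div_pi {f : ℝ → ℂ} {f' : ℂ} {x : ℝ} (h : HasDerivAt f f' x) :
    HasDerivAt (fun x => (f x).im / Real.pi) (f'.im / Real.pi) x :=
  ((Complex.imCLM.hasFDerivAt.comp_hasDerivAt x h)).div_const _

lemma hasDerivAt_wrightJ_left (hβ : 0 < β) (hβ1 : β < 1) {s : ℝ} (hs : 0 < s) (ν t : ℝ) :
    HasDerivAt (fun s => wrightJ β ν s t) (-wrightJ β (ν - β) s t) s := by
  have := hasDerivAt_im_div_pi (hasDerivAt_wrightContour_left hβ hβ1 hs ν t)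
  rw [Complex.neg_im, neg_div] at this
  exact this

lemma hasDerivAt_wrightJ_right (hβ : 0 < β) (hβ1 : β < 1) {s : ℝ} (hs : 0 < s) (ν t : ℝ) :
    HasDerivAt (fun t => wrightJ β ν s t) (wrightJ β (ν - 1) s t) t :=
  hasDerivAt_im_div_pi (hasDerivAt_wrightContour_right hβ hβ1 hs ν t)

lemma exists_abs_wrightJ_le (hβ : 0 < β) (hβ1 : β < 1) (ν : ℝ) {s₀ : ℝ} (hs₀ : 0 < s₀) (T : ℝ) :
    ∃ C, ∀ s ≥ s₀, ∀ t ≤ T, |wrightJ β ν s t|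
      ≤ C * Real.exp (-(Real.cos (β * (Real.pi / 2)) / 2) * s) := by
  obtain ⟨C₁, h₁⟩ := (isWrightPath_ray hβ).exists_norm_integral_le hβ hβ1 ν hs₀ T
  obtain ⟨C₂, h₂⟩ := (isWrightPath_arc β).exists_norm_integral_le hβ hβ1 ν hs₀ T
  refine ⟨(C₁ + C₂) / Real.pi, fun s hs t ht => ?_⟩
  unfold wrightJ
  rw [abs_div, abs_of_pos Real.pi_pos, div_mul_eq_mul_div]
  refine div_le_div_of_nonneg_right ?_ Real.pi_pos.le
  refine (Complex.abs_im_le_norm _).trans ?_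
  rw [wrightContour_half]
  refine (norm_add_le _ _).trans ?_
  rw [norm_mul, Complex.norm_I, one_mul, add_mul]
  exact add_le_add (h₁ s hs t ht) (h₂ s hs t ht)

/-- Fractional integration of order `μ` in time raises the index by `μ`. -/
lemma integral_rpow_mul_wrightJ (hβ : 0 < β) (hβ1 : β < 1) {s μ t : ℝ} (hs : 0 < s) (hμ : 0 < μ)
    (ht : 0 < t) (ν : ℝ) : ∫ τ in Ioo 0 t, (t - τ) ^ (μ - 1) * wrightJ β ν s τ
      = Real.Gamma μ * wrightJ β (ν + μ) s t := by
  have hcomb : ∀ σ > 0, ∫ v in Ioi (0 : ℝ), v ^ (μ - 1) * Real.exp (-(σ * v))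
      * wrightJ β ν s (t - v) = (Real.Gamma μ * ((∫ x in Ioi (0 : ℝ),
        wrightIntegrand β ν s t (x + (Real.pi / 2 : ℝ) * Complex.I)
          * (1 / (σ + Complex.exp (x + (Real.pi / 2 : ℝ) * Complex.I))) ^ (μ : ℂ))
        + Complex.I * ∫ y in Ioc 0 (Real.pi / 2), wrightIntegrand β ν s t (y * Complex.I)
          * (1 / (σ + Complex.exp (y * Complex.I))) ^ (μ : ℂ))).im / Real.pi := by
    intro σ hσ
    obtain ⟨i1, e1⟩ := (isWrightPath_ray hβ).integral_damped hβ hβ1 hs hσ hμ ν t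
    obtain ⟨i2, e2⟩ := (isWrightPath_arc β).integral_damped hβ hβ1 hs hσ hμ ν t
    rw [mul_add, ← e1, mul_left_comm, ← e2, ← integral_const_mul, ← integral_add i1
      (i2.const_mul _)]
    have hci : IntegrableOn (fun v : ℝ => ((v ^ (μ - 1) * Real.exp (-(σ * v)) : ℝ) : ℂ)
        * (∫ x in Ioi (0 : ℝ), wrightIntegrand β ν s (t - v) (x + (Real.pi / 2 : ℝ) * Complex.I))
        + Complex.I * (((v ^ (μ - 1) * Real.exp (-(σ * v)) : ℝ) : ℂ)
        * ∫ y in Ioc 0 (Real.pi / 2), wrightIntegrand β ν s (t - v) (y * Complex.I))) (Ioi 0) :=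
      i1.add (i2.const_mul _)
    rw [← Complex.imCLM_apply, ← ContinuousLinearMap.integral_comp_comm _ hci, ← integral_div]
    refine integral_congr_ae (Eventually.of_forall fun v => ?_)
    simp only [wrightJ, wrightContour_half, Complex.imCLM_apply]
    rw [mul_left_comm, ← mul_add, Complex.im_ofReal_mul, mul_div_assoc]
  have hlim : Tendsto (fun σ : ℝ => ∫ v in Ioi (0 : ℝ), v ^ (μ - 1) * Real.exp (-(σ * v))
      * wrightJ β ν s (t - v)) (𝓝[>] 0) (𝓝 (Real.Gamma μ * wrightJ β (ν + μ) s t)) := by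
    have h1 := (isWrightPath_ray hβ).tendsto_damped hβ hβ1 hs hμ ν t
    have h2 := (isWrightPath_arc β).tendsto_damped hβ hβ1 hs hμ ν t
    have h3 := (h1.add (h2.const_mul Complex.I)).const_mul (Real.Gamma μ : ℂ)
    rw [← wrightContour_half] at h3
    have h4 := ((Complex.continuous_im.tendsto _).comp h3).div_const Real.pi
    rw [Complex.im_ofReal_mul, mul_div_assoc] at h4
    refine h4.congr' ?_
    filter_upwards [self_mem_nhdsWithin] with σ hσ
    exact (hcomb σ hσ).symm
  obtain ⟨C, hC⟩ := exists_abs_wrightJ_le hβ hβ1 ν hs t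
  have hJc : Continuous (fun v => wrightJ β ν s (t - v)) := by
    refine Continuous.comp (g := fun t => wrightJ β ν s t) ?_ (by fun_prop)
    exact continuous_iff_continuousAt.2 fun τ =>
      (hasDerivAt_wrightJ_right hβ hβ1 hs ν τ).continuousAt
  set D := C * Real.exp (-(Real.cos (β * (Real.pi / 2)) / 2) * s) with hD
  -- By causality the integrand vanishes for v > t, so on (0,t] an integrable power dominates it and
  -- the damping can be dropped on this side too.
  have hlim2 : Tendsto (fun σ : ℝ => ∫ v in Ioi (0 : ℝ), v ^ (μ - 1) * Real.exp (-(σ * v))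
      * wrightJ β ν s (t - v)) (𝓝[>] 0)
      (𝓝 (∫ v in Ioi (0 : ℝ), v ^ (μ - 1) * wrightJ β ν s (t - v))) := by
    refine tendsto_integral_filter_of_dominated_convergence
      (fun v => (Ioc 0 t).indicator (fun v => v ^ (μ - 1) * D) v) ?_ ?_ ?_ ?_
    · exact Eventually.of_forall fun σ =>
        (Measurable.aestronglyMeasurable (by fun_prop)).mul hJc.aestronglyMeasurable
    · filter_upwards [self_mem_nhdsWithin] with σ hσ
      have hσ' : 0 < σ := hσ
      refine (ae_restrict_iff' measurableSet_Ioi).2 (Eventually.of_forall fun v hv => ?_)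
      have hv' : 0 < v := hv
      rcases le_or_gt v t with hvt | hvt
      · rw [indicator_of_mem (show v ∈ Ioc 0 t from ⟨hv', hvt⟩), norm_mul, norm_mul,
          Real.norm_eq_abs, Real.norm_eq_abs, Real.norm_eq_abs, abs_of_pos (Real.exp_pos _),
          abs_of_nonneg (Real.rpow_nonneg hv'.le _), mul_assoc]
        refine mul_le_mul_of_nonneg_left ?_ (Real.rpow_nonneg hv'.le _)
        refine (mul_le_of_le_one_left (abs_nonneg _) (Real.exp_le_one_iff.2 ?_)).trans
          (hC s le_rfl _ (by linarith))
        nlinarith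
      · rw [wrightJ_of_nonpos hβ hβ1 hs (by linarith), mul_zero, norm_zero,
          indicator_of_notMem (fun h => absurd h.2 (not_le.2 hvt))]
    · refine IntegrableOn.integrable ?_
      rw [IntegrableOn, integrable_indicator_iff measurableSet_Ioc, IntegrableOn,
        Measure.restrict_restrict measurableSet_Ioc,
        inter_eq_self_of_subset_left Ioc_subset_Ioi_self]
      refine Integrable.mul_const ?_ _
      exact (intervalIntegrable_iff_integrableOn_Ioc_of_le ht.le).1
        (intervalIntegral.intervalIntegrable_rpow' (by linarith))
    · refine Eventually.of_forall fun v => ?_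
      refine Tendsto.mul_const _ ?_
      have : ContinuousAt (fun σ : ℝ => v ^ (μ - 1) * Real.exp (-(σ * v))) 0 := by fun_prop
      have := this.tendsto.mono_left (nhdsWithin_le_nhds (s := Ioi 0))
      simpa using this
  rw [← tendsto_nhds_unique hlim2 hlim]
  have e1 : ∫ v in Ioi (0 : ℝ), v ^ (μ - 1) * wrightJ β ν s (t - v)
      = ∫ v in (0 : ℝ)..t, v ^ (μ - 1) * wrightJ β ν s (t - v) := by
    rw [intervalIntegral.integral_of_le ht.le]
    refine setIntegral_eq_of_subset_of_forall_sdiff_eq_zero measurableSet_Ioi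
      Ioc_subset_Ioi_self fun v hv => ?_
    have : t < v := by
      by_contra h
      exact hv.2 ⟨hv.1, not_lt.1 h⟩
    rw [wrightJ_of_nonpos hβ hβ1 hs (by linarith), mul_zero]
  have e2 := intervalIntegral.integral_comp_sub_left (a := 0) (b := t)
    (fun τ => (t - τ) ^ (μ - 1) * wrightJ β ν s τ) t
  simp only [sub_sub_cancel, sub_self, sub_zero] at e2
  rw [e1, e2, ← integral_Ioc_eq_integral_Ioo, ← intervalIntegral.integral_of_le ht.le]

end

/-! ### Bounds for the kernels -/

/-- The bound from the angle π/2 requires s to stay away from 0. For s ≤ 1 the line at height π is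
used instead, where ν < 1 gives a majorant independent of s. -/
lemma exists_abs_wrightJ_one_le {β : ℝ} (hβ : 0 < β) (hβ1 : β < 1) {ν : ℝ} (hν : ν < 1) :
    ∃ C, 0 < C ∧ ∀ s > 0, |wrightJ β ν s 1|
      ≤ C * Real.exp (-(Real.cos (β * (Real.pi / 2)) / 2) * s) := by
  set κ := Real.cos (β * (Real.pi / 2)) / 2 with hκ
  have hκ0 : 0 < κ := half_pos (cos_half_pos hβ hβ1)
  obtain ⟨C₁, h₁⟩ := exists_abs_wrightJ_le hβ hβ1 ν one_pos 1
  set C₂ := (∫ x : ℝ, Real.exp (-1 * Real.exp x + 1 * Real.exp (β * x) + (1 - ν) * x)) / Real.pi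
  have h₂ : ∀ s > 0, s ≤ 1 → |wrightJ β ν s 1| ≤ C₂ := by
    intro s hs hs1
    obtain ⟨hint, him⟩ := wrightContour_im_eq hβ hν Real.pi_pos.le
      (wrightJ_integrableOn_pi hβ hβ1 hs one_pos ν)
    rw [wrightJ_eq_pi hβ hβ1 hs one_pos, him, abs_div, abs_of_pos Real.pi_pos]
    refine div_le_div_of_nonneg_right ((Complex.abs_im_le_norm _).trans ?_) Real.pi_pos.le
    refine norm_integral_le_of_norm_le
      (integrable_exp_neg_exp_add_exp hβ hβ1 one_pos (by linarith)) (Eventually.of_forall fun x => ?_)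
    rw [norm_wrightIntegrand_add_mul_I, Real.cos_pi]
    refine Real.exp_le_exp.2 ?_
    have e1 := Real.neg_one_le_cos (β * Real.pi)
    have e2 : -(s * (Real.exp (β * x) * Real.cos (β * Real.pi))) ≤ 1 * (Real.exp (β * x) * 1) := by
      rw [← mul_neg, ← mul_neg]
      have := Real.cos_le_one (β * Real.pi)
      have p := Real.exp_pos (β * x)
      rcases le_total (-Real.cos (β * Real.pi)) 0 with h | h
      · have : s * (Real.exp (β * x) * -Real.cos (β * Real.pi)) ≤ 0 :=
          mul_nonpos_of_nonneg_of_nonpos hs.le (mul_nonpos_of_nonneg_of_nonpos p.le h)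
        linarith
      · have : Real.exp (β * x) * -Real.cos (β * Real.pi) ≤ Real.exp (β * x) * 1 := by
          gcongr; linarith
        have h0 : 0 ≤ Real.exp (β * x) * -Real.cos (β * Real.pi) := by positivity
        nlinarith
    linarith
  refine ⟨max (max C₁ (C₂ * Real.exp κ)) 1, by positivity, fun s hs => ?_⟩
  rcases le_total 1 s with h | h
  · refine (h₁ s h 1 le_rfl).trans ?_
    gcongr
    exact (le_max_left _ _).trans (le_max_left _ _)
  · have h0 := h₂ s hs h
    have hC2 : 0 ≤ C₂ := (abs_nonneg _).trans h0
    calc |wrightJ β ν s 1| ≤ C₂ * (Real.exp κ * Real.exp (-κ * s)) := by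
          rw [← Real.exp_add]
          refine h0.trans (le_mul_of_one_le_right hC2 (Real.one_le_exp ?_))
          nlinarith
      _ = C₂ * Real.exp κ * Real.exp (-κ * s) := by ring
      _ ≤ _ := by
          gcongr
          exact (le_max_right _ _).trans (le_max_left _ _)

lemma exists_abs_wrightJ_le_rpow_mul_exp {β : ℝ} (hβ : 0 < β) (hβ1 : β < 1) {ν : ℝ} (hν : ν < 1) :
    ∃ C, 0 < C ∧ ∀ s > 0, ∀ t > 0, |wrightJ β ν s t| ≤ C * t ^ (ν - 1) *
      Real.exp (-(Real.cos (β * (Real.pi / 2)) / 2) * (s / t ^ β)) := by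
  obtain ⟨C, hC, h⟩ := exists_abs_wrightJ_one_le hβ hβ1 hν
  refine ⟨C, hC, fun s hs t ht => ?_⟩
  rw [wrightJ_scaling hβ hβ1 hs ht hν, abs_mul, abs_of_pos (Real.rpow_pos_of_pos ht _),
    mul_comm C, mul_assoc]
  have := h (s / t ^ β) (by positivity)
  gcongr

/-! ### Total mass -/

/-- Mean value property of exp on the unit circle, halved by conjugation symmetry. It evaluates the
arc for ν = 1, s = 0, t = 1. -/
lemma integral_re_exp_exp_mul_I :
    (∫ y in (0 : ℝ)..Real.pi, Complex.exp (Complex.exp (y * Complex.I))).re = Real.pi := by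
  have hcont : Continuous fun y : ℝ => Complex.exp (Complex.exp (y * Complex.I)) := by fun_prop
  have h1 : ∫ y in (0 : ℝ)..2 * Real.pi, Complex.exp (Complex.exp (y * Complex.I))
      = 2 * Real.pi := by
    have := (Complex.differentiable_exp.diffContOnCl (s := Metric.ball 0 |1|)).circleAverage
    rw [Real.circleAverage_def] at this
    simp only [circleMap, Complex.ofReal_one, one_mul, zero_add, Complex.exp_zero] at this
    rw [Complex.real_smul] at this
    have h2 : ((2 * Real.pi : ℝ) : ℂ) ≠ 0 := by
      exact_mod_cast (by positivity : (2 * Real.pi : ℝ) ≠ 0)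
    rw [Complex.ofReal_inv, inv_mul_eq_one₀ h2] at this
    rw [← this]; push_cast; ring
  have h2 : (∫ y in Real.pi..2 * Real.pi, Complex.exp (Complex.exp (y * Complex.I))).re
      = (∫ y in (0 : ℝ)..Real.pi, Complex.exp (Complex.exp (y * Complex.I))).re := by
    have e := intervalIntegral.integral_comp_sub_left (a := 0) (b := Real.pi)
      (fun y : ℝ => Complex.exp (Complex.exp (y * Complex.I))) (2 * Real.pi)
    rw [sub_zero, show 2 * Real.pi - Real.pi = Real.pi by ring] at e
    rw [← e]
    simp only [← Complex.reCLM_apply]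
    rw [← ContinuousLinearMap.intervalIntegral_comp_comm _ (Continuous.intervalIntegrable
      (by fun_prop) _ _), ← ContinuousLinearMap.intervalIntegral_comp_comm _
      (hcont.intervalIntegrable _ _)]
    refine intervalIntegral.integral_congr fun y _ => ?_
    simp only [Complex.reCLM_apply]
    rw [Complex.exp_re (Complex.exp _), Complex.exp_re (Complex.exp _),
      Complex.exp_ofReal_mul_I_re, Complex.exp_ofReal_mul_I_im, Complex.exp_ofReal_mul_I_re, Complex.exp_ofReal_mul_I_im, Real.cos_two_pi_sub,
      Real.sin_two_pi_sub, Real.cos_neg]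
  have h3 := intervalIntegral.integral_add_adjacent_intervals
    (hcont.intervalIntegrable (μ := volume) 0 Real.pi)
    (hcont.intervalIntegrable (μ := volume) Real.pi (2 * Real.pi))
  rw [h1] at h3
  have h4 := congrArg Complex.re h3
  rw [Complex.add_re, h2] at h4
  simp at h4
  linarith

/-- Because ∂_s of the kernel of index 1 is minus the kernel of index 1 - β, this limit is the total
mass of the latter. The index 1 excludes the full horizontal line, so the bent contour is kept: at s
= 0 its ray is real and its arc gives π. -/
lemma tendsto_wrightJ_one_zero {β : ℝ} (hβ : 0 < β) (hβ1 : β < 1) :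
    Tendsto (fun s => wrightJ β 1 s 1) (𝓝[>] 0) (𝓝 1) := by
  have h1 : Tendsto (fun s : ℝ => ∫ x in Ioi (0 : ℝ),
      wrightIntegrand β 1 s 1 (x + Real.pi * Complex.I)) (𝓝[>] 0)
      (𝓝 (∫ x in Ioi (0 : ℝ), wrightIntegrand β 1 0 1 (x + Real.pi * Complex.I))) := by
    refine tendsto_integral_filter_of_dominated_convergence
      (fun x => Real.exp (-1 * Real.exp x + 1 * Real.exp (β * x) + 1 * x)) ?_ ?_
      (integrable_exp_neg_exp_add_exp hβ hβ1 one_pos one_pos).integrableOn ?_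
    · exact Eventually.of_forall fun s =>
        ((continuous_wrightIntegrand β 1 s 1).comp (by fun_prop)).aestronglyMeasurable
    · filter_upwards [Ioo_mem_nhdsGT (zero_lt_one' ℝ)] with s hs
      refine (ae_restrict_iff' measurableSet_Ioi).2 (Eventually.of_forall fun x hx => ?_)
      have hx' : 0 < x := hx
      rw [norm_wrightIntegrand_add_mul_I, Real.cos_pi]
      refine Real.exp_le_exp.2 ?_
      have e2 : -(s * (Real.exp (β * x) * Real.cos (β * Real.pi))) ≤ s * (Real.exp (β * x) * 1) := by
        rw [← mul_neg, ← mul_neg]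
        have := hs.1
        gcongr
        linarith [Real.neg_one_le_cos (β * Real.pi)]
      have := Real.exp_pos (β * x)
      nlinarith [hs.1, hs.2]
    · refine Eventually.of_forall fun x => ?_
      have : Continuous fun s : ℝ => wrightIntegrand β 1 s 1 (x + Real.pi * Complex.I) := by
        unfold wrightIntegrand; fun_prop
      exact (this.tendsto 0).mono_left nhdsWithin_le_nhds
  have h2 : Tendsto (fun s : ℝ => ∫ y in (0 : ℝ)..Real.pi,
      wrightIntegrand β 1 s 1 (y * Complex.I)) (𝓝[>] 0)
      (𝓝 (∫ y in (0 : ℝ)..Real.pi, wrightIntegrand β 1 0 1 (y * Complex.I))) := by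
    have : Continuous (Function.uncurry fun (s y : ℝ) => wrightIntegrand β 1 s 1 (y * Complex.I)) := by
      unfold wrightIntegrand Function.uncurry; fun_prop
    exact ((intervalIntegral.continuous_parametric_intervalIntegral_of_continuous' this 0
      Real.pi).tendsto 0).mono_left nhdsWithin_le_nhds
  have h3 := h1.add (h2.const_mul Complex.I)
  have h4 := ((Complex.continuous_im.tendsto _).comp h3).div_const Real.pi
  have e : ((∫ x in Ioi (0 : ℝ), wrightIntegrand β 1 0 1 (x + Real.pi * Complex.I))
      + Complex.I * ∫ y in (0 : ℝ)..Real.pi, wrightIntegrand β 1 0 1 (y * Complex.I)).im / Real.pi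
      = 1 := by
    have e1 : ∀ x : ℝ, wrightIntegrand β 1 0 1 (x + Real.pi * Complex.I)
        = ((Real.exp (-Real.exp x) : ℝ) : ℂ) := by
      intro x
      unfold wrightIntegrand
      rw [Complex.exp_add (x : ℂ), Complex.exp_pi_mul_I]
      push_cast
      congr 1; ring
    have e2 : ∀ y : ℝ, wrightIntegrand β 1 0 1 (y * Complex.I)
        = Complex.exp (Complex.exp (y * Complex.I)) := by
      intro y; unfold wrightIntegrand; simp
    simp_rw [e1, e2]
    rw [integral_complex_ofReal, Complex.add_im, Complex.ofReal_im, zero_add, Complex.I_mul_im,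
      integral_re_exp_exp_mul_I, div_self Real.pi_ne_zero]
  rw [e] at h4
  refine h4.congr' ?_
  filter_upwards [self_mem_nhdsWithin] with s hs
  rw [wrightJ_eq_pi hβ hβ1 hs one_pos]
  rfl

lemma tendsto_wrightJ_one_atTop {β : ℝ} (hβ : 0 < β) (hβ1 : β < 1) :
    Tendsto (fun s => wrightJ β 1 s 1) atTop (𝓝 0) := by
  obtain ⟨C, hC⟩ := exists_abs_wrightJ_le hβ hβ1 1 one_pos 1
  have hκ0 := half_pos (cos_half_pos hβ hβ1)
  refine squeeze_zero_norm' (a := fun s => C * Real.exp (-(Real.cos (β * (Real.pi / 2)) / 2) * s))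
    ?_ ?_
  · filter_upwards [eventually_ge_atTop 1] with s hs
    exact hC s hs 1 le_rfl
  · have : Tendsto (fun s : ℝ => Real.exp (-((Real.cos (β * (Real.pi / 2)) / 2) * s))) atTop (𝓝 0) :=
      Real.tendsto_exp_neg_atTop_nhds_zero.comp (tendsto_id.const_mul_atTop hκ0)
    simpa using this.const_mul C

lemma continuousOn_wrightJ_left {β : ℝ} (hβ : 0 < β) (hβ1 : β < 1) (ν t : ℝ) :
    ContinuousOn (fun s => wrightJ β ν s t) (Ioi 0) := fun _ hs =>
  (hasDerivAt_wrightJ_left hβ hβ1 hs ν t).continuousAt.continuousWithinAt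

lemma integrableOn_wrightJ {β : ℝ} (hβ : 0 < β) (hβ1 : β < 1) {ν : ℝ} (hν : ν < 1) {t ε : ℝ}
    (ht : 0 < t) (hε : 0 ≤ ε) : IntegrableOn (fun s => s ^ ε * |wrightJ β ν s t|) (Ioi 0) := by
  obtain ⟨C, hC, h⟩ := exists_abs_wrightJ_le_rpow_mul_exp hβ hβ1 hν
  have hκ : 0 < Real.cos (β * (Real.pi / 2)) / 2 / t ^ β :=
    div_pos (half_pos (cos_half_pos hβ hβ1)) (by positivity)
  have h1 : IntegrableOn (fun s : ℝ => s ^ ε * Real.exp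
      (-(Real.cos (β * (Real.pi / 2)) / 2 / t ^ β) * s ^ (1 : ℝ))) (Ioi 0) :=
    integrableOn_rpow_mul_exp_neg_mul_rpow (by linarith) one_pos hκ
  refine (h1.const_mul (C * t ^ (ν - 1))).mono' ?_ ((ae_restrict_iff' measurableSet_Ioi).2
    (Eventually.of_forall fun s hs => ?_))
  · refine ContinuousOn.aestronglyMeasurable (fun s hs => ?_) measurableSet_Ioi
    exact ((Real.continuousAt_rpow_const _ _ (Or.inl (ne_of_gt hs))).continuousWithinAt).mul
      ((continuousOn_wrightJ_left hβ hβ1 ν t).abs s hs)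
  · have hs' : 0 < s := hs
    rw [norm_mul, Real.norm_of_nonneg (by positivity), Real.norm_eq_abs, abs_abs]
    refine (mul_le_mul_of_nonneg_left (h s hs t ht) (by positivity)).trans (le_of_eq ?_)
    rw [Real.rpow_one, show -(Real.cos (β * (Real.pi / 2)) / 2 / t ^ β) * s
      = -(Real.cos (β * (Real.pi / 2)) / 2) * (s / t ^ β) by ring]
    ring

lemma integral_wrightJ_one {β : ℝ} (hβ : 0 < β) (hβ1 : β < 1) :
    ∫ s in Ioi (0 : ℝ), wrightJ β (1 - β) s 1 = 1 := by
  have hint : IntegrableOn (fun s => wrightJ β (1 - β) s 1) (Ioi 0) := by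
    have := integrableOn_wrightJ hβ hβ1 (show 1 - β < 1 by linarith) one_pos le_rfl
    simp only [Real.rpow_zero, one_mul] at this
    exact (integrable_norm_iff ((continuousOn_wrightJ_left hβ hβ1 _ _).aestronglyMeasurable
      measurableSet_Ioi)).1 this
  -- The value of `wrightJ` at s = 0 plays no role; it is replaced by the limit 1 to make the
  -- primitive continuous at the end point.
  have h := integral_Ioi_of_hasDerivAt_of_tendsto (a := 0)
    (f := Function.update (fun s => wrightJ β 1 s 1) 0 1) (f' := fun s => -wrightJ β (1 - β) s 1)
    (m := 0) ?_ ?_ hint.neg ?_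
  · rw [Function.update_self, integral_neg] at h; linarith
  · rw [continuousWithinAt_update_same]
    simpa using tendsto_wrightJ_one_zero hβ hβ1
  · intro s hs
    refine (hasDerivAt_wrightJ_left hβ hβ1 hs 1 1).congr_of_eventuallyEq ?_
    filter_upwards [eventually_ne_nhds (ne_of_gt hs)] with y hy
    rw [Function.update_of_ne hy]
  · refine (tendsto_wrightJ_one_atTop hβ hβ1).congr' ?_
    filter_upwards [eventually_ne_atTop 0] with y hy
    rw [Function.update_of_ne hy]

lemma integral_wrightJ {β : ℝ} (hβ : 0 < β) (hβ1 : β < 1) {t : ℝ} (ht : 0 < t) :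
    ∫ s in Ioi (0 : ℝ), wrightJ β (1 - β) s t = 1 := by
  have h1 : ∫ s in Ioi (0 : ℝ), wrightJ β (1 - β) s t
      = ∫ s in Ioi (0 : ℝ), (t ^ β)⁻¹ * wrightJ β (1 - β) ((t ^ β)⁻¹ * s) 1 := by
    refine setIntegral_congr_fun measurableSet_Ioi fun s hs => ?_
    rw [wrightJ_scaling hβ hβ1 hs ht (by linarith), ← Real.rpow_neg ht.le,
      show 1 - β - 1 = -β by ring, Real.rpow_neg ht.le, div_eq_inv_mul]
  have hp : 0 < (t ^ β)⁻¹ := by positivity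
  rw [h1, integral_const_mul, integral_comp_mul_left_Ioi
    (fun s => wrightJ β (1 - β) s 1) 0 hp, mul_zero, integral_wrightJ_one hβ hβ1]
  rw [inv_inv, smul_eq_mul, mul_one, inv_mul_cancel₀ (by positivity)]

/-! ### Positivity, by the curve of steepest descent -/

/-- The curve on which the phase of the Wright integrand is constant. -/
def steepestCurve (β r y : ℝ) : ℝ := Real.log (r * Real.sin (β * y) / Real.sin y) / (1 - β)

lemma sin_mul_pos {β y : ℝ} (hβ : 0 < β) (hβ1 : β < 1) (h0 : 0 < y) (h1 : y < Real.pi) :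
    0 < Real.sin (β * y) :=
  Real.sin_pos_of_pos_of_lt_pi (by positivity) (by nlinarith)

lemma exp_steepestCurve {β r y : ℝ} (hβ : 0 < β) (hβ1 : β < 1) (hr : 0 < r) (h0 : 0 < y)
    (h1 : y < Real.pi) : Real.exp (steepestCurve β r y) * Real.sin y
      = r * (Real.exp (β * steepestCurve β r y) * Real.sin (β * y)) := by
  have s1 := sin_mul_pos hβ hβ1 h0 h1
  have s2 := Real.sin_pos_of_pos_of_lt_pi h0 h1
  have e : Real.exp ((1 - β) * steepestCurve β r y) = r * Real.sin (β * y) / Real.sin y := by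
    rw [steepestCurve, mul_div_cancel₀ _ (by linarith), Real.exp_log (by positivity)]
  rw [show steepestCurve β r y = (1 - β) * steepestCurve β r y + β * steepestCurve β r y by ring,
    Real.exp_add, e, show (1 - β) * steepestCurve β r y + β * steepestCurve β r y
      = steepestCurve β r y by ring]
  field_simp

lemma hasDerivAt_steepestCurve {β r y : ℝ} (hβ : 0 < β) (hβ1 : β < 1) (hr : 0 < r) (h0 : 0 < y)
    (h1 : y < Real.pi) : HasDerivAt (steepestCurve β r)
      ((β * (Real.cos (β * y) / Real.sin (β * y)) - Real.cos y / Real.sin y) / (1 - β)) y := by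
  have s1 := sin_mul_pos hβ hβ1 h0 h1
  have s2 := Real.sin_pos_of_pos_of_lt_pi h0 h1
  have d1 : HasDerivAt (fun y => Real.sin (β * y)) (Real.cos (β * y) * β) y := by
    have := ((hasDerivAt_id y).const_mul β).sin
    simpa using this
  have h := ((((d1.const_mul r).div (Real.hasDerivAt_sin y) s2.ne')).log
    (show r * Real.sin (β * y) / Real.sin y ≠ 0 by positivity)).div_const (1 - β)
  refine h.congr_deriv ?_
  have : 1 - β ≠ 0 := by linarith
  simp only [Pi.div_apply]
  field_simp

/-- On the curve e^z - r e^(βz) is real, so the phase of the integrand is exp(iβy). Multiplied by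
the tangent vector it has imaginary part proportional to sin((1-β)y) / ((1-β) sin y), which is
nonnegative. -/
lemma im_wrightIntegrand_mul_nonneg {β r y : ℝ} (hβ : 0 < β) (hβ1 : β < 1) (hr : 0 < r)
    (h0 : 0 < y) (h1 : y < Real.pi) :
    0 ≤ (wrightIntegrand β (1 - β) r 1 (steepestCurve β r y + y * Complex.I)
      * (((β * (Real.cos (β * y) / Real.sin (β * y)) - Real.cos y / Real.sin y) / (1 - β) : ℝ)
        + Complex.I)).im := by
  have s1 := sin_mul_pos hβ hβ1 h0 h1
  have s2 := Real.sin_pos_of_pos_of_lt_pi h0 h1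
  have hb : 0 < 1 - β := by linarith
  set x := steepestCurve β r y with hx
  set d := (β * (Real.cos (β * y) / Real.sin (β * y)) - Real.cos y / Real.sin y) / (1 - β) with hd
  have hz : ∀ c : ℝ, (Complex.exp (c * (x + y * Complex.I))).im
      = Real.exp (c * x) * Real.sin (c * y) := by
    intro c; rw [Complex.exp_im]; simp
  have hz1 : (Complex.exp (x + y * Complex.I)).im = Real.exp x * Real.sin y := by
    have := hz 1; simpa using this
  set E : ℂ := (1 : ℝ) * Complex.exp (x + y * Complex.I)
    - r * Complex.exp (β * (x + y * Complex.I)) with hE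
  have hEim : E.im = 0 := by
    rw [hE, Complex.sub_im, Complex.im_ofReal_mul, Complex.im_ofReal_mul, hz, hz1, one_mul,
      exp_steepestCurve hβ hβ1 hr h0 h1, sub_self]
  have hw : wrightIntegrand β (1 - β) r 1 (x + y * Complex.I)
      = ((Real.exp E.re * Real.exp (β * x) : ℝ) : ℂ)
        * Complex.exp ((β * y : ℝ) * Complex.I) := by
    have : E = (E.re : ℂ) := Complex.ext (by simp) (by simp [hEim])
    unfold wrightIntegrand
    rw [← hE, Complex.exp_add, this]
    push_cast
    rw [Complex.ofReal_re, ← Complex.exp_add, ← Complex.exp_add, ← Complex.exp_add]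
    congr 1; ring
  rw [hw, mul_assoc, Complex.im_ofReal_mul]
  refine mul_nonneg (by positivity) ?_
  rw [Complex.mul_im, Complex.exp_ofReal_mul_I_re, Complex.exp_ofReal_mul_I_im]
  simp only [Complex.add_im, Complex.add_re, Complex.ofReal_im, Complex.ofReal_re, Complex.I_im,
    Complex.I_re, zero_add, add_zero, mul_one]
  have key : Real.cos (β * y) + Real.sin (β * y) * d
      = Real.sin ((1 - β) * y) / ((1 - β) * Real.sin y) := by
    rw [show (1 - β) * y = y - β * y by ring, Real.sin_sub, hd]
    field_simp
    ring
  rw [key]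
  exact div_nonneg (Real.sin_nonneg_of_nonneg_of_le_pi (by positivity) (by nlinarith))
    (by positivity)

lemma im_primitive_real {β r : ℝ} {G : ℂ → ℂ} {R : ℝ}
    (hG : ∀ z ∈ Metric.ball (0 : ℂ) R, HasDerivAt G (wrightIntegrand β (1 - β) r 1 z) z)
    {x : ℝ} (hx : |x| < R) : (G x - G 0).im = 0 := by
  have hmem : ∀ y ∈ uIcc 0 x, ((y : ℝ) : ℂ) ∈ Metric.ball (0 : ℂ) R := by
    intro y hy
    rw [mem_ball_zero_iff, Complex.norm_real, Real.norm_eq_abs]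
    have h1 := abs_sub_left_of_mem_uIcc hy
    rw [sub_zero, sub_zero] at h1
    exact h1.trans_lt hx
  have h := intervalIntegral.integral_eq_sub_of_hasDerivAt (f := fun y : ℝ => G y) (a := 0) (b := x)
    (fun y hy => (hG _ (hmem y hy)).comp_ofReal)
    (Continuous.intervalIntegrable ((continuous_wrightIntegrand _ _ _ _).comp
      Complex.continuous_ofReal) _ _)
  rw [Complex.ofReal_zero] at h
  rw [← h]
  simp_rw [wrightIntegrand_ofReal]
  rw [intervalIntegral.integral_ofReal, Complex.ofReal_im]

lemma norm_add_mul_I_le (x y : ℝ) : ‖(x : ℂ) + y * Complex.I‖ ≤ |x| + |y| := by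
  refine (norm_add_le _ _).trans ?_
  simp

lemma im_primitive_vertical {β r : ℝ} {G : ℂ → ℂ} {R : ℝ}
    (hG : ∀ z ∈ Metric.ball (0 : ℂ) R, HasDerivAt G (wrightIntegrand β (1 - β) r 1 z) z)
    {x y₁ y₂ : ℝ} (hx : |x| + Real.pi < R) (h1 : 0 ≤ y₁) (h12 : y₁ ≤ y₂) (h2 : y₂ ≤ Real.pi) :
    G (x + y₂ * Complex.I) - G (x + y₁ * Complex.I)
      = ∫ y in y₁..y₂, wrightIntegrand β (1 - β) r 1 (x + y * Complex.I) * Complex.I := by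
  refine (intervalIntegral.integral_eq_sub_of_hasDerivAt
    (f := fun y : ℝ => G (x + y * Complex.I)) (fun y hy => ?_) ?_).symm
  · rw [uIcc_of_le h12] at hy
    have hmem : (x : ℂ) + y * Complex.I ∈ Metric.ball (0 : ℂ) R := by
      rw [mem_ball_zero_iff]
      refine (norm_add_mul_I_le x y).trans_lt ?_
      rw [abs_of_nonneg (h1.trans hy.1)]
      linarith [hy.2]
    have h3 : HasDerivAt (fun y : ℝ => (x : ℂ) + y * Complex.I) Complex.I y := by
      simpa using ((Complex.ofRealCLM.hasDerivAt (x := y)).mul_const Complex.I).const_add (x : ℂ)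
    exact (hG _ hmem).comp y h3
  · have := continuous_wrightIntegrand β (1 - β) r 1
    exact Continuous.intervalIntegrable (by fun_prop) _ _

lemma norm_wrightIntegrand_le_of_nonneg {β r x y : ℝ} (hr : 0 < r) (c : ℝ) (hc : Real.cos y ≤ c) :
    ‖wrightIntegrand β (1 - β) r 1 (x + y * Complex.I)‖
      ≤ Real.exp (c * Real.exp x + r * Real.exp (β * x) + β * x) := by
  rw [norm_wrightIntegrand_add_mul_I]
  refine Real.exp_le_exp.2 ?_
  have e2 : -(r * (Real.exp (β * x) * Real.cos (β * y))) ≤ r * (Real.exp (β * x) * 1) := by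
    rw [← mul_neg, ← mul_neg]
    gcongr
    linarith [Real.neg_one_le_cos (β * y)]
  have e1 : Real.exp x * Real.cos y ≤ Real.exp x * c := by gcongr
  linarith

/-- Keeps the integrand bounded on the short vertical segment that joins the real axis to the curve
as y tends to 0. -/
lemma steepestCurve_le {β r y : ℝ} (hβ : 0 < β) (hβ1 : β < 1) (hr : 0 < r) (h0 : 0 < y)
    (h1 : y ≤ Real.pi / 2) : steepestCurve β r y ≤ Real.log r / (1 - β) := by
  have hp := Real.pi_pos
  have s1 := sin_mul_pos hβ hβ1 h0 (by linarith)
  have s2 := Real.sin_pos_of_pos_of_lt_pi h0 (by linarith)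
  have s3 : Real.sin (β * y) ≤ Real.sin y :=
    Real.sin_le_sin_of_le_of_le_pi_div_two (by nlinarith) h1 (by nlinarith)
  refine div_le_div_of_nonneg_right (Real.log_le_log (by positivity) ?_) (by linarith)
  rw [div_le_iff₀ s2]
  gcongr

lemma tendsto_steepestCurve {β r : ℝ} (hβ : 0 < β) (hβ1 : β < 1) (hr : 0 < r) :
    Tendsto (steepestCurve β r) (𝓝[<] Real.pi) atTop := by
  have hp := Real.pi_pos
  have hs : 0 < r * Real.sin (β * Real.pi) :=
    mul_pos hr (Real.sin_pos_of_pos_of_lt_pi (by positivity) (by nlinarith))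
  have h1 : Tendsto (fun y => r * Real.sin (β * y)) (𝓝[<] Real.pi) (𝓝 (r * Real.sin (β * Real.pi))) :=
    ((by fun_prop : Continuous fun y => r * Real.sin (β * y)).tendsto _).mono_left
      nhdsWithin_le_nhds
  have h2 : Tendsto (fun y => Real.sin y) (𝓝[<] Real.pi) (𝓝[>] 0) := by
    refine tendsto_nhdsWithin_iff.2 ⟨?_, ?_⟩
    · have := (Real.continuous_sin.tendsto Real.pi).mono_left (nhdsWithin_le_nhds (s := Iio Real.pi))
      rwa [Real.sin_pi] at this
    · filter_upwards [Ioo_mem_nhdsLT hp] with y hy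
      exact Real.sin_pos_of_pos_of_lt_pi hy.1 hy.2
  have h3 := h1.pos_mul_atTop hs h2.inv_tendsto_nhdsGT_zero
  have h4 := (Real.tendsto_log_atTop.comp h3).atTop_div_const (show 0 < 1 - β by linarith)
  refine h4.congr fun y => ?_
  simp [steepestCurve, div_eq_mul_inv]

lemma primitive_steepest_mono {β r : ℝ} (hβ : 0 < β) (hβ1 : β < 1) (hr : 0 < r) {G : ℂ → ℂ} {R : ℝ}
    (hG : ∀ z ∈ Metric.ball (0 : ℂ) R, HasDerivAt G (wrightIntegrand β (1 - β) r 1 z) z)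
    {y₁ y₂ : ℝ} (h0 : 0 < y₁) (h12 : y₁ ≤ y₂) (h2 : y₂ < Real.pi)
    (hR : ∀ y ∈ Icc y₁ y₂, |steepestCurve β r y| + Real.pi < R) :
    (G (steepestCurve β r y₁ + y₁ * Complex.I)).im
      ≤ (G (steepestCurve β r y₂ + y₂ * Complex.I)).im := by
  have hd : ∀ y ∈ Icc y₁ y₂, HasDerivAt
      (fun y : ℝ => (G (steepestCurve β r y + y * Complex.I)).im)
      (wrightIntegrand β (1 - β) r 1 (steepestCurve β r y + y * Complex.I)
      * (((β * (Real.cos (β * y) / Real.sin (β * y)) - Real.cos y / Real.sin y) / (1 - β) : ℝ)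
        + Complex.I)).im y := by
    intro y hy
    have hy0 : 0 < y := h0.trans_le hy.1
    have hy1 : y < Real.pi := hy.2.trans_lt h2
    have hmem : (steepestCurve β r y : ℂ) + y * Complex.I ∈ Metric.ball (0 : ℂ) R := by
      rw [mem_ball_zero_iff]
      refine (norm_add_mul_I_le _ y).trans_lt ?_
      rw [abs_of_pos hy0]
      linarith [hR y hy]
    have h3 : HasDerivAt (fun y : ℝ => (steepestCurve β r y : ℂ) + y * Complex.I)
        (((β * (Real.cos (β * y) / Real.sin (β * y)) - Real.cos y / Real.sin y) / (1 - β) : ℝ)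
        + Complex.I) y := by
      have := (Complex.ofRealCLM.hasDerivAt (x := y)).mul_const Complex.I
      rw [Complex.ofRealCLM_apply, Complex.ofReal_one, one_mul] at this
      exact (hasDerivAt_steepestCurve hβ hβ1 hr hy0 hy1).ofReal_comp.add this
    exact Complex.imCLM.hasFDerivAt.comp_hasDerivAt y ((hG _ hmem).comp y h3)
  refine monotoneOn_of_deriv_nonneg (convex_Icc y₁ y₂)
    (fun y hy => (hd y hy).continuousAt.continuousWithinAt)
    (fun y hy => (hd y (interior_subset hy)).differentiableAt.differentiableWithinAt)
    (fun y hy => ?_) (left_mem_Icc.2 h12) (right_mem_Icc.2 h12) h12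
  rw [(hd y (interior_subset hy)).deriv]
  have hy' := interior_subset hy
  exact im_wrightIntegrand_mul_nonneg hβ hβ1 hr (h0.trans_le hy'.1) (hy'.2.trans_lt h2)

/-- The contour from 0 to iπ and out to x + iπ is compared with a path having the same end points:
along the real axis, up to the steepest curve at height y₁, along the curve to height y₂, and up to
height π. The real piece has no imaginary part and the curve contributes a nonnegative one. The
vertical pieces vanish in the limit, the lower by its length as y₁ → 0, the upper by the decay of
the integrand as y₂ → π. -/
lemma wrightJ_one_nonneg {β r : ℝ} (hβ : 0 < β) (hβ1 : β < 1) (hr : 0 < r) :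
    0 ≤ wrightJ β (1 - β) r 1 := by
  have hp := Real.pi_pos
  set f := wrightIntegrand β (1 - β) r 1 with hf
  have hfc : Continuous f := continuous_wrightIntegrand _ _ _ _
  set D : ℝ → ℂ := fun X => (∫ x in (0 : ℝ)..X, f (x + Real.pi * Complex.I))
    + Complex.I * ∫ y in (0 : ℝ)..Real.pi, f (y * Complex.I) with hD
  set e₁ : ℝ → ℝ := fun y => y * Real.exp (1 * Real.exp (Real.log r / (1 - β))
      + r * Real.exp (β * (Real.log r / (1 - β))) + β * (Real.log r / (1 - β))) with he₁
  set e₂ : ℝ → ℝ := fun x => Real.exp (-(1 / 2) * Real.exp x + r * Real.exp (β * x) + β * x)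
      * Real.pi with he₂
  -- `e₁` and `e₂` bound the lower and the upper vertical piece. Heights above 2π/3 have cosine at
  -- most -1/2, whence the constant in `e₂`.
  have main : ∀ y₁ ∈ Ioo 0 (Real.pi / 2), ∀ y₂ ∈ Ioo (2 * Real.pi / 3) Real.pi,
      -e₁ y₁ - e₂ (steepestCurve β r y₂) ≤ (D (steepestCurve β r y₂)).im := by
    intro y₁ hy₁ y₂ hy₂
    have h12 : y₁ ≤ y₂ := by linarith [hy₁.2, hy₂.1]
    have hcont : ContinuousOn (steepestCurve β r) (Icc y₁ y₂) := fun y hy =>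
      (hasDerivAt_steepestCurve hβ hβ1 hr (hy₁.1.trans_le hy.1)
        (hy.2.trans_lt hy₂.2)).continuousAt.continuousWithinAt
    obtain ⟨B, hB⟩ := isCompact_Icc.exists_bound_of_continuousOn hcont
    have hB' : ∀ y ∈ Icc y₁ y₂, |steepestCurve β r y| ≤ B := hB
    -- The disc contains all the pieces, so a single primitive `G` turns every contour integral into
    -- a difference of values.
    set R := B + 2 * Real.pi with hR
    obtain ⟨G, hG⟩ := (show DifferentiableOn ℂ f (Metric.ball 0 R) from fun z _ =>
      (hasDerivAt_wrightIntegrand _ _ _ _ z).differentiableAt.differentiableWithinAt).isExactOn_ball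
    have hRB : ∀ y ∈ Icc y₁ y₂, |steepestCurve β r y| + Real.pi < R := fun y hy => by
      linarith [hB' y hy]
    have hmono := primitive_steepest_mono hβ hβ1 hr hG hy₁.1 h12 hy₂.2 hRB
    set x₁ := steepestCurve β r y₁ with hx₁
    set x₂ := steepestCurve β r y₂ with hx₂
    have hR1 := hRB y₁ (left_mem_Icc.2 h12)
    have hR2 := hRB y₂ (right_mem_Icc.2 h12)
    rw [← hx₁] at hR1
    rw [← hx₂] at hR2
    have v1 := im_primitive_vertical hG hR1 le_rfl hy₁.1.le (by linarith [hy₁.2])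
    have v2 := im_primitive_vertical hG hR2 (by linarith [hy₂.1]) hy₂.2.le le_rfl
    have v0 := im_primitive_vertical hG (x := 0) (by rw [abs_zero, hR]; linarith [abs_nonneg x₁])
      le_rfl hp.le le_rfl
    have r1 := im_primitive_real hG (x := x₁) (by linarith)
    have hh : ∫ x in (0 : ℝ)..x₂, f (x + Real.pi * Complex.I)
        = G (x₂ + Real.pi * Complex.I) - G ((0 : ℝ) + Real.pi * Complex.I) := by
      refine intervalIntegral.integral_eq_sub_of_hasDerivAt
        (f := fun x : ℝ => G (x + Real.pi * Complex.I)) (fun x hx => ?_)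
        (Continuous.intervalIntegrable (by fun_prop) _ _)
      have hx' := abs_sub_left_of_mem_uIcc hx
      rw [sub_zero, sub_zero] at hx'
      have hmem : (x : ℂ) + Real.pi * Complex.I ∈ Metric.ball (0 : ℂ) R := by
        rw [mem_ball_zero_iff]
        refine (norm_add_mul_I_le x _).trans_lt ?_
        rw [abs_of_pos hp]; linarith
      have h3 : HasDerivAt (fun x : ℝ => (x : ℂ) + Real.pi * Complex.I) 1 x := by
        simpa using (Complex.ofRealCLM.hasDerivAt (x := x)).add_const (Real.pi * Complex.I)
      have := (hG _ hmem).comp x h3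
      rwa [mul_one] at this
    have n1 : ‖∫ y in (0 : ℝ)..y₁, f (x₁ + y * Complex.I) * Complex.I‖ ≤ e₁ y₁ := by
      have := intervalIntegral.norm_integral_le_of_norm_le_const (a := 0) (b := y₁)
        (f := fun y : ℝ => f (x₁ + y * Complex.I) * Complex.I)
        (C := Real.exp (1 * Real.exp (Real.log r / (1 - β))
          + r * Real.exp (β * (Real.log r / (1 - β))) + β * (Real.log r / (1 - β))))
        (fun y _ => ?_)
      · refine this.trans (le_of_eq ?_)
        rw [sub_zero, abs_of_pos hy₁.1, he₁]; ring
      · rw [norm_mul, Complex.norm_I, mul_one]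
        refine (norm_wrightIntegrand_le_of_nonneg hr 1 (Real.cos_le_one y)).trans ?_
        have := steepestCurve_le hβ hβ1 hr hy₁.1 hy₁.2.le
        gcongr
    have n2 : ‖∫ y in y₂..Real.pi, f (x₂ + y * Complex.I) * Complex.I‖ ≤ e₂ x₂ := by
      have := intervalIntegral.norm_integral_le_of_norm_le_const (a := y₂) (b := Real.pi)
        (f := fun y : ℝ => f (x₂ + y * Complex.I) * Complex.I)
        (C := Real.exp (-(1 / 2) * Real.exp x₂ + r * Real.exp (β * x₂) + β * x₂))
        (fun y hy => ?_)
      · refine this.trans ?_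
        rw [he₂]
        refine mul_le_mul_of_nonneg_left ?_ (Real.exp_pos _).le
        rw [abs_of_nonneg (by linarith [hy₂.2])]
        linarith [hy₂.1]
      · rw [norm_mul, Complex.norm_I, mul_one]
        refine norm_wrightIntegrand_le_of_nonneg hr _ ?_
        rw [uIoc_of_le hy₂.2.le] at hy
        have := Real.cos_le_cos_of_nonneg_of_le_pi (x := 2 * Real.pi / 3) (by positivity) hy.2
          (by linarith [hy₂.1, hy.1])
        refine this.trans (le_of_eq ?_)
        rw [show 2 * Real.pi / 3 = Real.pi - Real.pi / 3 by ring, Real.cos_pi_sub,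
          Real.cos_pi_div_three]
    have a1 := (abs_le.1 ((Complex.abs_im_le_norm _).trans n1)).1
    have a2 := (abs_le.1 ((Complex.abs_im_le_norm _).trans n2)).1
    rw [← v1] at a1
    rw [← v2] at a2
    have hD' : D x₂ = G (x₂ + Real.pi * Complex.I) - G 0 := by
      simp only [hD]
      rw [hh]
      have : Complex.I * ∫ y in (0 : ℝ)..Real.pi, f (y * Complex.I)
          = G ((0 : ℝ) + Real.pi * Complex.I) - G 0 := by
        rw [← intervalIntegral.integral_const_mul]
        simp only [Complex.ofReal_zero, zero_add, zero_mul] at v0 ⊢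
        rw [v0]
        simp_rw [mul_comm Complex.I]
        rfl
      rw [this]; ring
    rw [hD']
    simp only [Complex.sub_im, Complex.ofReal_zero, zero_mul, add_zero] at *
    linarith
  have hlimD : Tendsto D atTop (𝓝 (wrightContour β (1 - β) r 1 Real.pi)) := by
    refine Tendsto.add_const _ ?_
    exact intervalIntegral_tendsto_integral_Ioi 0
      (wrightJ_integrableOn_pi hβ hβ1 hr one_pos (1 - β)) tendsto_id
  have he2lim : Tendsto e₂ atTop (𝓝 0) := by
    obtain ⟨C, hC⟩ := exists_exp_mul_le hβ1 hβ r (show (0 : ℝ) < 1 / 4 by norm_num)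
    have h1 : Tendsto (fun x : ℝ => Real.exp C * (Real.exp x * Real.exp (-(1 / 4) * Real.exp x))
        * Real.pi) atTop (𝓝 (Real.exp C * 0 * Real.pi)) := by
      refine Tendsto.mul_const _ (Tendsto.const_mul _ ?_)
      have := (tendsto_rpow_mul_exp_neg_mul_atTop_nhds_zero 1 (1 / 4) (by norm_num)).comp
        Real.tendsto_exp_atTop
      simpa [Function.comp_def] using this
    rw [mul_zero, zero_mul] at h1
    refine squeeze_zero' (Eventually.of_forall fun x => by positivity) ?_ h1
    filter_upwards [eventually_ge_atTop 0] with x hx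
    rw [he₂]
    refine mul_le_mul_of_nonneg_right ?_ hp.le
    rw [← Real.exp_add, ← Real.exp_add]
    refine Real.exp_le_exp.2 ?_
    have := hC x
    nlinarith
  rw [wrightJ_eq_pi hβ hβ1 hr one_pos]
  refine div_nonneg ?_ hp.le
  have step : ∀ y₁ ∈ Ioo 0 (Real.pi / 2), -e₁ y₁ ≤ (wrightContour β (1 - β) r 1 Real.pi).im := by
    intro y₁ hy₁
    have hc := tendsto_steepestCurve hβ hβ1 hr
    have l1 := (he2lim.comp hc).const_sub (-e₁ y₁)
    have l2 := (Complex.continuous_im.tendsto _).comp (hlimD.comp hc)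
    rw [sub_zero] at l1
    refine le_of_tendsto_of_tendsto l1 l2 ?_
    filter_upwards [Ioo_mem_nhdsLT (show 2 * Real.pi / 3 < Real.pi by linarith)] with y₂ hy₂
    exact main y₁ hy₁ y₂ hy₂
  have l3 : Tendsto (fun y => -e₁ y) (𝓝[>] 0) (𝓝 (-e₁ 0)) :=
    ((by rw [he₁]; fun_prop : Continuous fun y => -e₁ y).tendsto 0).mono_left nhdsWithin_le_nhds
  rw [show -e₁ 0 = 0 by simp [he₁]] at l3
  refine le_of_tendsto l3 ?_
  filter_upwards [Ioo_mem_nhdsGT (show 0 < Real.pi / 2 by positivity)] with y hy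
  exact step y hy

lemma wrightJ_nonneg {β s t : ℝ} (hβ : 0 < β) (hβ1 : β < 1) (hs : 0 < s) (ht : 0 < t) :
    0 ≤ wrightJ β (1 - β) s t := by
  rw [wrightJ_scaling hβ hβ1 hs ht (by linarith)]
  exact mul_nonneg (by positivity) (wrightJ_one_nonneg hβ hβ1 (by positivity))

/-! ### The Wright transformation and the Caputo derivative -/

lemma wrightTransform_eq {β : ℝ} (hβ : 0 < β) (hβ1 : β < 1) (h : ℝ → ℝ) {t : ℝ} (ht : 0 < t) :
    wrightTransform β h t = ∫ s in Ioi (0 : ℝ), h s * wrightJ β (1 - β) s t := by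
  rw [wrightTransform, if_neg hβ1.ne]
  refine setIntegral_congr_fun measurableSet_Ioi fun s hs => ?_
  rw [wrightG_eq_wrightJ hβ hβ1 hs ht]

lemma integrableOn_wrightJ_self {β : ℝ} (hβ : 0 < β) (hβ1 : β < 1) {ν : ℝ} (hν : ν < 1) {t : ℝ}
    (ht : 0 < t) : IntegrableOn (fun s => wrightJ β ν s t) (Ioi 0) := by
  have := integrableOn_wrightJ hβ hβ1 hν ht le_rfl
  simp only [Real.rpow_zero, one_mul] at this
  exact (integrable_norm_iff ((continuousOn_wrightJ_left hβ hβ1 _ _).aestronglyMeasurable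
    measurableSet_Ioi)).1 this

lemma integral_rpow_mul_abs_wrightJ {β : ℝ} (hβ : 0 < β) (hβ1 : β < 1) {ν : ℝ} (hν : ν < 1)
    {t : ℝ} (ht : 0 < t) (ε : ℝ) : ∫ s in Ioi (0 : ℝ), s ^ ε * |wrightJ β ν s t|
      = t ^ (ν - 1 + β * (1 + ε)) * ∫ s in Ioi (0 : ℝ), s ^ ε * |wrightJ β ν s 1| := by
  have hp : 0 < (t ^ β)⁻¹ := by positivity
  have h1 : ∫ s in Ioi (0 : ℝ), s ^ ε * |wrightJ β ν s t|
      = ∫ s in Ioi (0 : ℝ), (t ^ (ν - 1) * (t ^ β) ^ ε) *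
        (((t ^ β)⁻¹ * s) ^ ε * |wrightJ β ν ((t ^ β)⁻¹ * s) 1|) := by
    refine setIntegral_congr_fun measurableSet_Ioi fun s hs => ?_
    have hs' : 0 < s := hs
    rw [wrightJ_scaling hβ hβ1 hs ht hν, abs_mul, abs_of_pos (Real.rpow_pos_of_pos ht _),
      Real.mul_rpow hp.le hs'.le, Real.inv_rpow (by positivity), div_eq_inv_mul]
    have : (t ^ β) ^ ε ≠ 0 := by positivity
    field_simp
  rw [h1, integral_const_mul, integral_comp_mul_left_Ioi
    (fun s => s ^ ε * |wrightJ β ν s 1|) 0 hp, mul_zero, inv_inv, smul_eq_mul, ← mul_assoc]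
  congr 1
  rw [← Real.rpow_mul ht.le, ← Real.rpow_add ht, ← Real.rpow_add ht]
  congr 1; ring

/-- The growth bound `|h s - h₀| ≤ C (s^ε + s)`. -/
lemma integrableOn_mul_wrightJ {β : ℝ} (hβ : 0 < β) (hβ1 : β < 1) {ν : ℝ} (hν : ν < 1) {t : ℝ}
    (ht : 0 < t) {k : ℝ → ℝ} (hk : ContinuousOn k (Ioi 0)) {C ε : ℝ} (hε : 0 < ε)
    (hkb : ∀ s > 0, |k s| ≤ C * (s ^ ε + s)) :
    IntegrableOn (fun s => k s * wrightJ β ν s t) (Ioi 0) ∧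
    ∫ s in Ioi (0 : ℝ), |k s * wrightJ β ν s t|
      ≤ C * (t ^ (ν - 1 + β * (1 + ε)) * (∫ s in Ioi (0 : ℝ), s ^ ε * |wrightJ β ν s 1|)
        + t ^ (ν - 1 + β * (1 + 1)) * ∫ s in Ioi (0 : ℝ), s ^ (1 : ℝ) * |wrightJ β ν s 1|) := by
  have hb : IntegrableOn (fun s => C * (s ^ ε * |wrightJ β ν s t| + s ^ (1 : ℝ) * |wrightJ β ν s t|))
      (Ioi 0) := ((integrableOn_wrightJ hβ hβ1 hν ht hε.le).add
        (integrableOn_wrightJ hβ hβ1 hν ht zero_le_one)).const_mul C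
  have hle : ∀ s ∈ Ioi (0 : ℝ), |k s * wrightJ β ν s t|
      ≤ C * (s ^ ε * |wrightJ β ν s t| + s ^ (1 : ℝ) * |wrightJ β ν s t|) := by
    intro s hs
    rw [abs_mul, Real.rpow_one, ← add_mul, ← mul_assoc]
    exact mul_le_mul_of_nonneg_right (hkb s hs) (abs_nonneg _)
  have hi : IntegrableOn (fun s => k s * wrightJ β ν s t) (Ioi 0) :=
    hb.mono' ((hk.mul (continuousOn_wrightJ_left hβ hβ1 ν t)).aestronglyMeasurable
      measurableSet_Ioi) ((ae_restrict_iff' measurableSet_Ioi).2 (Eventually.of_forall hle))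
  refine ⟨hi, ?_⟩
  rw [← integral_rpow_mul_abs_wrightJ hβ hβ1 hν ht, ← integral_rpow_mul_abs_wrightJ hβ hβ1 hν ht,
    ← integral_add (integrableOn_wrightJ hβ hβ1 hν ht hε.le)
      (integrableOn_wrightJ hβ hβ1 hν ht zero_le_one), ← integral_const_mul]
  exact setIntegral_mono_on hi.abs hb measurableSet_Ioi hle

lemma continuousOn_wrightJ_prod {β : ℝ} (hβ : 0 < β) (hβ1 : β < 1) {ν : ℝ} (hν : ν < 1) :
    ContinuousOn (fun p : ℝ × ℝ => wrightJ β ν p.1 p.2) (Ioi 0 ×ˢ Ioi 0) := by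
  have h1 : ContinuousOn (fun p : ℝ × ℝ => p.2 ^ (ν - 1) * wrightJ β ν (p.1 / p.2 ^ β) 1)
      (Ioi 0 ×ˢ Ioi 0) := by
    refine ContinuousOn.mul ?_ ?_
    · exact continuousOn_snd.rpow_const fun p hp => Or.inl (ne_of_gt hp.2)
    · refine (continuousOn_wrightJ_left hβ hβ1 ν 1).comp
        (continuousOn_fst.div (continuousOn_snd.rpow_const fun p hp => Or.inl (ne_of_gt hp.2))
          fun p hp => ?_) fun p hp => ?_
      · have : (0 : ℝ) < p.2 := hp.2
        positivity
      · have h1 : (0 : ℝ) < p.1 := hp.1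
        have h2 : (0 : ℝ) < p.2 := hp.2
        exact div_pos h1 (by positivity)
  exact h1.congr fun p hp => wrightJ_scaling hβ hβ1 hp.1 hp.2 hν

lemma integrableOn_sub_rpow_mul_rpow {t p q : ℝ} (hp : 0 < p) (hp1 : p ≤ 1) (hq : 0 < q)
    (hq1 : q ≤ 1) : IntegrableOn (fun τ => (t - τ) ^ (q - 1) * τ ^ (p - 1)) (Ioo 0 t) := by
  rcases le_or_gt t 0 with ht | ht
  · rw [Ioo_eq_empty (by linarith)]; exact integrableOn_empty
  have i1 : IntegrableOn (fun τ : ℝ => τ ^ (p - 1)) (Ioo 0 t) :=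
    ((intervalIntegrable_iff_integrableOn_Ioc_of_le ht.le).1
      (intervalIntegral.intervalIntegrable_rpow' (by linarith))).mono_set Ioo_subset_Ioc_self
  have i2 : IntegrableOn (fun τ : ℝ => (t - τ) ^ (q - 1)) (Ioo 0 t) := by
    have := (intervalIntegral.intervalIntegrable_rpow' (a := t) (b := 0)
      (r := q - 1) (by linarith)).comp_sub_left t
    rw [sub_self, sub_zero] at this
    exact ((intervalIntegrable_iff_integrableOn_Ioc_of_le ht.le).1 this).mono_set
      Ioo_subset_Ioc_self
  refine ((i1.const_mul ((t / 2) ^ (q - 1))).add (i2.const_mul ((t / 2) ^ (p - 1)))).mono'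
    (Measurable.aestronglyMeasurable (by fun_prop))
    ((ae_restrict_iff' measurableSet_Ioo).2 (Eventually.of_forall fun τ hτ => ?_))
  have a1 : 0 < τ := hτ.1
  have a2 : 0 < t - τ := by linarith [hτ.2]
  rw [Real.norm_eq_abs, abs_of_nonneg (by positivity)]
  simp only [Pi.add_apply]
  rcases le_total τ (t / 2) with h | h
  · have : (t - τ) ^ (q - 1) ≤ (t / 2) ^ (q - 1) :=
      Real.rpow_le_rpow_of_nonpos (by positivity) (by linarith) (by linarith)
    have h2 : 0 ≤ (t / 2) ^ (p - 1) * (t - τ) ^ (q - 1) := by positivity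
    have h3 : (t - τ) ^ (q - 1) * τ ^ (p - 1) ≤ (t / 2) ^ (q - 1) * τ ^ (p - 1) := by gcongr
    linarith
  · have : τ ^ (p - 1) ≤ (t / 2) ^ (p - 1) :=
      Real.rpow_le_rpow_of_nonpos (by positivity) h (by linarith)
    have h2 : 0 ≤ (t / 2) ^ (q - 1) * τ ^ (p - 1) := by positivity
    have h3 : (t - τ) ^ (q - 1) * τ ^ (p - 1) ≤ (t - τ) ^ (q - 1) * (t / 2) ^ (p - 1) := by gcongr
    linarith

section
variable {β : ℝ} {k : ℝ → ℝ} {C ε : ℝ}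

lemma hasDerivAt_integral_mul_wrightJ (hβ : 0 < β) (hβ1 : β < 1) (hk : ContinuousOn k (Ioi 0))
    (hε : 0 < ε) (hkb : ∀ s > 0, |k s| ≤ C * (s ^ ε + s)) {t : ℝ} (ht : 0 < t) :
    HasDerivAt (fun t => ∫ s in Ioi (0 : ℝ), k s * wrightJ β (1 - β) s t)
      (∫ s in Ioi (0 : ℝ), k s * wrightJ β (-β) s t) t := by
  obtain ⟨D, hD, hDb⟩ := exists_abs_wrightJ_le_rpow_mul_exp hβ hβ1 (show -β < 1 by linarith)
  set κ := Real.cos (β * (Real.pi / 2)) / 2 with hκ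
  have hκ0 : 0 < κ := half_pos (cos_half_pos hβ hβ1)
  have hcont : ∀ ν τ, ContinuousOn (fun s => k s * wrightJ β ν s τ) (Ioi 0) :=
    fun ν τ => hk.mul (continuousOn_wrightJ_left hβ hβ1 ν τ)
  -- For τ between t/2 and 2t the exponential decay is slowest at 2t and the power of τ is largest
  -- at t/2; the majorant uses these two values.
  set r := κ / (2 * t) ^ β with hr
  have hr0 : 0 < r := by positivity
  have ib : ∀ e : ℝ, 0 ≤ e → IntegrableOn (fun s : ℝ => s ^ e * Real.exp (-r * s ^ (1 : ℝ))) (Ioi 0) :=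
    fun e he => integrableOn_rpow_mul_exp_neg_mul_rpow (by linarith) one_pos hr0
  refine (hasDerivAt_integral_of_dominated_loc_of_deriv_le (μ := volume.restrict (Ioi 0))
    (s := Ioo (t / 2) (2 * t)) (x₀ := t) (F := fun τ s => k s * wrightJ β (1 - β) s τ) (F' := fun τ s => k s * wrightJ β (-β) s τ)
    (bound := fun s => C * (s ^ ε * Real.exp (-r * s ^ (1 : ℝ))
      + s ^ (1 : ℝ) * Real.exp (-r * s ^ (1 : ℝ))) * (D * (t / 2) ^ (-β - 1)))
    (Ioo_mem_nhds (by linarith) (by linarith)) ?_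
    (integrableOn_mul_wrightJ hβ hβ1 (show 1 - β < 1 by linarith) ht hk hε hkb).1 ?_ ?_ ?_ ?_).2
  · exact Eventually.of_forall fun τ => (hcont _ τ).aestronglyMeasurable measurableSet_Ioi
  · exact (hcont _ t).aestronglyMeasurable measurableSet_Ioi
  · refine (ae_restrict_iff' measurableSet_Ioi).2 (Eventually.of_forall fun s hs τ hτ => ?_)
    have hs' : 0 < s := hs
    have hτ0 : 0 < τ := by linarith [hτ.1]
    rw [norm_mul, Real.norm_eq_abs, Real.norm_eq_abs]
    have e1 := hDb s hs τ hτ0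
    have e2 : τ ^ (-β - 1) ≤ (t / 2) ^ (-β - 1) :=
      Real.rpow_le_rpow_of_nonpos (by positivity) hτ.1.le (by linarith)
    have e3 : -κ * (s / τ ^ β) ≤ -r * s := by
      have : τ ^ β ≤ (2 * t) ^ β := by gcongr; exact hτ.2.le
      have : s / (2 * t) ^ β ≤ s / τ ^ β := by gcongr
      rw [hr]
      calc -κ * (s / τ ^ β) ≤ -κ * (s / (2 * t) ^ β) := by nlinarith
        _ = _ := by ring
    have e4 : |wrightJ β (-β) s τ| ≤ D * (t / 2) ^ (-β - 1) * Real.exp (-r * s) := by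
      refine e1.trans ?_
      gcongr
    calc |k s| * |wrightJ β (-β) s τ|
        ≤ (C * (s ^ ε + s)) * (D * (t / 2) ^ (-β - 1) * Real.exp (-r * s)) := by
          refine mul_le_mul (hkb s hs) e4 (abs_nonneg _) ((abs_nonneg _).trans (hkb s hs))
      _ = _ := by rw [Real.rpow_one]; ring
  · exact (((ib ε hε.le).add (ib 1 zero_le_one)).const_mul C).mul_const _
  · refine (ae_restrict_iff' measurableSet_Ioi).2 (Eventually.of_forall fun s hs τ hτ => ?_)
    have := (hasDerivAt_wrightJ_right hβ hβ1 hs (1 - β) τ).const_mul (k s)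
    rwa [show 1 - β - 1 = -β by ring] at this

/-- Fubini, then fractional integration of order 1 - β, takes index -β to 1 - 2β. The growth bound
is essential: by self-similarity the integral of |k| against |J_{-β}(·,τ)| is at most of order
τ^(βε-1) + τ^(β-1), which is integrable at 0, whereas a bound without a rate would only give τ^(-1).
-/
lemma caputo_integral_mul_wrightJ (hβ : 0 < β) (hβ1 : β < 1) (hk : ContinuousOn k (Ioi 0))
    (hε : 0 < ε) (hε1 : ε ≤ 1) (hkb : ∀ s > 0, |k s| ≤ C * (s ^ ε + s)) {t : ℝ} (ht : 0 < t) :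
    IntegrableOn (fun τ => (t - τ) ^ (-β) * ∫ s in Ioi (0 : ℝ), k s * wrightJ β (-β) s τ)
      (Ioo 0 t) ∧
    ∫ τ in Ioo 0 t, (t - τ) ^ (-β) * ∫ s in Ioi (0 : ℝ), k s * wrightJ β (-β) s τ
      = Real.Gamma (1 - β) * ∫ s in Ioi (0 : ℝ), k s * wrightJ β (1 - 2 * β) s t := by
  have hν : -β < 1 := by linarith
  have hint : Integrable (fun p : ℝ × ℝ => (t - p.1) ^ (-β) * (k p.2 * wrightJ β (-β) p.2 p.1))
      ((volume.restrict (Ioo 0 t)).prod (volume.restrict (Ioi 0))) := by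
    have hmeas : AEStronglyMeasurable
        (fun p : ℝ × ℝ => (t - p.1) ^ (-β) * (k p.2 * wrightJ β (-β) p.2 p.1))
        ((volume.restrict (Ioo 0 t)).prod (volume.restrict (Ioi 0))) := by
      rw [Measure.prod_restrict]
      refine ContinuousOn.aestronglyMeasurable ?_ (measurableSet_Ioo.prod measurableSet_Ioi)
      have c1 : ContinuousOn (fun p : ℝ × ℝ => (t - p.1) ^ (-β)) (Ioo 0 t ×ˢ Ioi 0) := by
        refine ContinuousOn.rpow_const (by fun_prop) fun p hp => Or.inl ?_
        have := hp.1.2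
        exact (sub_pos.2 this).ne'
      have c2 : ContinuousOn (fun p : ℝ × ℝ => k p.2) (Ioo 0 t ×ˢ Ioi 0) :=
        hk.comp continuousOn_snd fun p hp => hp.2
      have c3 : ContinuousOn (fun p : ℝ × ℝ => wrightJ β (-β) p.2 p.1) (Ioo 0 t ×ˢ Ioi 0) :=
        (continuousOn_wrightJ_prod hβ hβ1 hν).comp (f := fun p : ℝ × ℝ => (p.2, p.1))
          (continuousOn_snd.prodMk continuousOn_fst) fun p hp => ⟨hp.2, hp.1.1⟩
      exact c1.mul (c2.mul c3)
    rw [integrable_prod_iff hmeas]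
    refine ⟨(ae_restrict_iff' measurableSet_Ioo).2 (Eventually.of_forall fun τ hτ =>
      (integrableOn_mul_wrightJ hβ hβ1 hν hτ.1 hk hε hkb).1.const_mul ((t - τ) ^ (-β))), ?_⟩
    have b1 := (integrableOn_sub_rpow_mul_rpow (t := t) (p := β * ε) (q := 1 - β) (by positivity)
      (by nlinarith) (by linarith) (by linarith)).mul_const
        (∫ s in Ioi (0 : ℝ), s ^ ε * |wrightJ β (-β) s 1|)
    have b2 := (integrableOn_sub_rpow_mul_rpow (t := t) (p := β) (q := 1 - β) (by positivity)
      (by nlinarith) (by linarith) (by linarith)).mul_const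
        (∫ s in Ioi (0 : ℝ), s ^ (1 : ℝ) * |wrightJ β (-β) s 1|)
    refine ((b1.add b2).const_mul C).mono' hmeas.norm.integral_prod_right'
      ((ae_restrict_iff' measurableSet_Ioo).2 (Eventually.of_forall fun τ hτ => ?_))
    have hτ0 : 0 < τ := hτ.1
    have hτ1 : 0 < t - τ := by linarith [hτ.2]
    have hb := (integrableOn_mul_wrightJ hβ hβ1 hν hτ0 hk hε hkb).2
    simp only [norm_mul, Real.norm_eq_abs (r := (t - τ) ^ (-β))]
    rw [integral_const_mul, Real.norm_eq_abs, abs_of_nonneg (by positivity),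
      abs_of_nonneg (by positivity : 0 ≤ (t - τ) ^ (-β))]
    simp only [Real.norm_eq_abs, ← abs_mul]
    refine (mul_le_mul_of_nonneg_left hb (by positivity)).trans (le_of_eq ?_)
    simp only [Pi.add_apply]
    rw [show -β - 1 + β * (1 + ε) = β * ε - 1 by ring, show -β - 1 + β * (1 + 1) = β - 1 by ring,
      show 1 - β - 1 = -β by ring]
    ring
  refine ⟨?_, ?_⟩
  · have := hint.integral_prod_left
    simp only [integral_const_mul] at this
    exact this
  · simp_rw [← integral_const_mul]
    rw [integral_integral_swap hint]
    refine setIntegral_congr_fun measurableSet_Ioi fun s hs => ?_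
    have := integral_rpow_mul_wrightJ hβ hβ1 hs (show 0 < 1 - β by linarith) ht (-β)
    rw [show -β + (1 - β) = 1 - 2 * β by ring, show 1 - β - 1 = -β by ring] at this
    rw [mul_left_comm, ← this, ← integral_const_mul]
    refine integral_congr_ae (Eventually.of_forall fun τ => ?_)
    simp only
    ring

lemma wrightTransform_eq_add (hβ : 0 < β) (hβ1 : β < 1) {h : ℝ → ℝ} {h₀ : ℝ}
    (hh : ContinuousOn h (Ioi 0)) (hε : 0 < ε) (hhb : ∀ s > 0, |h s - h₀| ≤ C * (s ^ ε + s))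
    {t : ℝ} (ht : 0 < t) :
    IntegrableOn (fun s => h s * wrightG β s t) (Ioi 0) ∧ wrightTransform β h t
      = h₀ + ∫ s in Ioi (0 : ℝ), (h s - h₀) * wrightJ β (1 - β) s t := by
  have hν : 1 - β < 1 := by linarith
  have i1 := (integrableOn_mul_wrightJ hβ hβ1 hν ht (k := fun s => h s - h₀)
    (hh.sub continuousOn_const) hε hhb).1
  have i2 := (integrableOn_wrightJ_self hβ hβ1 hν ht).const_mul h₀
  refine ⟨?_, ?_⟩
  · refine IntegrableOn.congr_fun (i1.add i2) (fun s hs => ?_) measurableSet_Ioi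
    simp only [Pi.add_apply]
    rw [wrightG_eq_wrightJ hβ hβ1 hs ht]; ring
  · rw [wrightTransform_eq hβ hβ1 h ht]
    have e : ∫ s in Ioi (0 : ℝ), h₀ * wrightJ β (1 - β) s t = h₀ := by
      rw [integral_const_mul, integral_wrightJ hβ hβ1 ht, mul_one]
    have e2 := integral_add i2 i1
    rw [e] at e2
    rw [← e2]
    refine integral_congr_ae (Eventually.of_forall fun s => ?_)
    simp only
    ring

/-- The Caputo derivative of a Wright transform. -/
theorem hasCaputoDerivAt_wrightTransform (hβ : 0 < β) (hβ1 : β < 1) {h : ℝ → ℝ} {h₀ : ℝ}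
    (hh : ContinuousOn h (Ioi 0)) (hε : 0 < ε) (hε1 : ε ≤ 1)
    (hhb : ∀ s > 0, |h s - h₀| ≤ C * (s ^ ε + s)) {t : ℝ} (ht : 0 < t) :
    HasCaputoDerivAt β (wrightTransform β h)
      (∫ s in Ioi (0 : ℝ), (h s - h₀) * wrightJ β (1 - 2 * β) s t) t := by
  rw [HasCaputoDerivAt, if_neg hβ1.ne]
  have hk : ContinuousOn (fun s => h s - h₀) (Ioi 0) := hh.sub continuousOn_const
  have hd : ∀ τ > 0, HasDerivAt (wrightTransform β h)
      (∫ s in Ioi (0 : ℝ), (h s - h₀) * wrightJ β (-β) s τ) τ := by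
    intro τ hτ
    refine ((hasDerivAt_integral_mul_wrightJ hβ hβ1 hk hε hhb hτ).const_add
      h₀).congr_of_eventuallyEq ?_
    filter_upwards [Ioi_mem_nhds hτ] with y hy
    exact (wrightTransform_eq_add hβ hβ1 hh hε hhb hy).2
  obtain ⟨c1, c2⟩ := caputo_integral_mul_wrightJ hβ hβ1 hk hε hε1 hhb ht
  refine ⟨fun τ hτ => (hd τ hτ.1).differentiableAt, ?_, ?_⟩
  · refine c1.congr_fun (fun τ hτ => ?_) measurableSet_Ioo
    simp only
    rw [(hd τ hτ.1).deriv]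
  · rw [setIntegral_congr_fun (g := fun τ => (t - τ) ^ (-β)
      * ∫ s in Ioi (0 : ℝ), (h s - h₀) * wrightJ β (-β) s τ) measurableSet_Ioo (fun τ hτ => by
        simp only
        rw [(hd τ hτ.1).deriv]), c2]
    have : Real.Gamma (1 - β) ≠ 0 := (Real.Gamma_pos_of_pos (by linarith)).ne'
    field_simp

lemma tendsto_wrightTransform_zero (hβ : 0 < β) (hβ1 : β < 1) {h : ℝ → ℝ} {h₀ : ℝ}
    (hh : ContinuousOn h (Ioi 0)) (hε : 0 < ε)
    (hhb : ∀ s > 0, |h s - h₀| ≤ C * (s ^ ε + s)) :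
    Tendsto (wrightTransform β h) (𝓝[>] 0) (𝓝 h₀) := by
  have hν : 1 - β < 1 := by linarith
  have hpow : ∀ e : ℝ, 0 < e → Tendsto (fun t : ℝ => t ^ e) (𝓝[>] 0) (𝓝 0) := fun e he => by
    have := (Real.continuousAt_rpow_const 0 e (Or.inr he.le)).tendsto.mono_left
      (nhdsWithin_le_nhds (s := Ioi 0))
    rwa [Real.zero_rpow he.ne'] at this
  have hb := (((hpow (β * ε) (by positivity)).mul_const
    (∫ s in Ioi (0 : ℝ), s ^ ε * |wrightJ β (1 - β) s 1|)).add ((hpow β hβ).mul_const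
    (∫ s in Ioi (0 : ℝ), s ^ (1 : ℝ) * |wrightJ β (1 - β) s 1|))).const_mul C
  rw [zero_mul, zero_mul, add_zero, mul_zero] at hb
  refine tendsto_iff_norm_sub_tendsto_zero.2 (squeeze_zero' (Eventually.of_forall fun _ =>
    norm_nonneg _) ?_ hb)
  filter_upwards [self_mem_nhdsWithin] with t ht
  have ht' : 0 < t := ht
  rw [(wrightTransform_eq_add hβ hβ1 hh hε hhb ht').2, add_sub_cancel_left]
  refine (norm_integral_le_integral_norm _).trans ?_
  have := (integrableOn_mul_wrightJ hβ hβ1 hν ht' (k := fun s => h s - h₀)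
    (hh.sub continuousOn_const) hε hhb).2
  rw [show 1 - β - 1 + β * (1 + ε) = β * ε by ring, show 1 - β - 1 + β * (1 + 1) = β by ring] at this
  exact this

end

/-- For a bounded function with a limit at `0+` no rate is needed. -/
lemma tendsto_wrightTransform_of_bounded {β : ℝ} (hβ : 0 < β) (hβ1 : β < 1) {h : ℝ → ℝ} {h₀ B : ℝ}
    (hh : ContinuousOn h (Ioi 0)) (hB : ∀ s > 0, |h s| ≤ B) (h0 : Tendsto h (𝓝[>] 0) (𝓝 h₀)) :
    Tendsto (wrightTransform β h) (𝓝[>] 0) (𝓝 h₀) := by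
  have hν : 1 - β < 1 := by linarith
  have hi := integrableOn_wrightJ_self hβ hβ1 hν one_pos
  -- The substitution s = t^β r fixes the kernel and leaves t only in the argument of h.
  have e : ∀ t > 0, wrightTransform β h t
      = ∫ r in Ioi (0 : ℝ), h (t ^ β * r) * wrightJ β (1 - β) r 1 := by
    intro t ht
    have hp : 0 < t ^ β := by positivity
    rw [wrightTransform_eq hβ hβ1 h ht]
    have := integral_comp_mul_left_Ioi (fun s => h s * wrightJ β (1 - β) s t) 0 hp
    rw [mul_zero, smul_eq_mul, eq_inv_mul_iff_mul_eq₀ hp.ne', ← integral_const_mul] at this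
    rw [← this]
    refine setIntegral_congr_fun measurableSet_Ioi fun r hr => ?_
    rw [wrightJ_scaling hβ hβ1 (mul_pos hp hr) ht hν, mul_div_cancel_left₀ _ hp.ne',
      show 1 - β - 1 = -β by ring, Real.rpow_neg ht.le]
    field_simp
  have key : Tendsto (fun t : ℝ => ∫ r in Ioi (0 : ℝ), h (t ^ β * r) * wrightJ β (1 - β) r 1)
      (𝓝[>] 0) (𝓝 (∫ r in Ioi (0 : ℝ), h₀ * wrightJ β (1 - β) r 1)) := by
    refine tendsto_integral_filter_of_dominated_convergence
      (fun r => B * |wrightJ β (1 - β) r 1|) ?_ ?_ (hi.abs.const_mul B) ?_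
    · filter_upwards [self_mem_nhdsWithin] with t ht
      have ht' : 0 < t := ht
      refine ContinuousOn.aestronglyMeasurable (ContinuousOn.mul ?_
        (continuousOn_wrightJ_left hβ hβ1 _ _)) measurableSet_Ioi
      exact hh.comp (by fun_prop) fun r hr => mul_pos (Real.rpow_pos_of_pos ht' _) hr
    · filter_upwards [self_mem_nhdsWithin] with t ht
      have ht' : 0 < t := ht
      refine (ae_restrict_iff' measurableSet_Ioi).2 (Eventually.of_forall fun r hr => ?_)
      rw [norm_mul, Real.norm_eq_abs, Real.norm_eq_abs]
      exact mul_le_mul_of_nonneg_right (hB _ (mul_pos (Real.rpow_pos_of_pos ht' _) hr))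
        (abs_nonneg _)
    · refine (ae_restrict_iff' measurableSet_Ioi).2 (Eventually.of_forall fun r hr => ?_)
      refine Tendsto.mul_const _ (h0.comp (tendsto_nhdsWithin_iff.2 ⟨?_, ?_⟩))
      · have := ((Real.continuousAt_rpow_const 0 β (Or.inr hβ.le)).tendsto.mono_left
          (nhdsWithin_le_nhds (s := Ioi 0))).mul_const r
        rwa [Real.zero_rpow hβ.ne', zero_mul] at this
      · filter_upwards [self_mem_nhdsWithin] with t ht
        exact mul_pos (Real.rpow_pos_of_pos ht _) hr
  rw [integral_const_mul, integral_wrightJ_one hβ hβ1, mul_one] at key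
  refine key.congr' ?_
  filter_upwards [self_mem_nhdsWithin] with t ht
  exact (e t ht).symm

/-! ### Classical solutions in flux form -/

lemma hasDerivAt_force (a b : ℝ) {x : ℝ} (hx : 0 < x) :
    HasDerivAt (force a b) (a - b / x ^ 2) x := by
  have h := ((hasDerivAt_id x).const_mul a).add ((hasDerivAt_inv hx.ne').const_mul b)
  refine h.congr_deriv ?_ |>.congr_of_eventuallyEq (Eventually.of_forall fun y => ?_)
  · field_simp; ring
  · simp [force, div_eq_mul_inv]

lemma continuousOn_force (a b : ℝ) : ContinuousOn (force a b) (Ioi 0) := fun _ hx =>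
  (hasDerivAt_force a b hx).continuousAt.continuousWithinAt

lemma contDiffOn_one_of_hasDerivAt {O : Set ℝ} (hO : IsOpen O) {F F' : ℝ → ℝ}
    (hF : ∀ y ∈ O, HasDerivAt F (F' y) y) (hF' : ContinuousOn F' O) : ContDiffOn ℝ 1 F O := by
  rw [show (1 : WithTop ℕ∞) = 0 + 1 by norm_num, contDiffOn_succ_iff_deriv_of_isOpen hO]
  refine ⟨fun y hy => (hF y hy).differentiableAt.differentiableWithinAt, by simp, ?_⟩
  rw [contDiffOn_zero]
  exact hF'.congr fun y hy => (hF y hy).deriv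

lemma contDiffOn_two_of_hasDerivAt {O : Set ℝ} (hO : IsOpen O) {F F' F'' : ℝ → ℝ}
    (hF : ∀ y ∈ O, HasDerivAt F (F' y) y) (hF' : ∀ y ∈ O, HasDerivAt F' (F'' y) y)
    (hF'' : ContinuousOn F'' O) : ContDiffOn ℝ 2 F O := by
  rw [show (2 : WithTop ℕ∞) = 1 + 1 by norm_num, contDiffOn_succ_iff_deriv_of_isOpen hO]
  exact ⟨fun y hy => (hF y hy).differentiableAt.differentiableWithinAt, by simp,
    (contDiffOn_one_of_hasDerivAt hO hF' hF'').congr fun y hy => (hF y hy).deriv⟩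

/-- A function with a differentiable flux `W = U' + f U` is `C²`. -/
lemma contDiffAt_two_of_flux {a b : ℝ} {O : Set ℝ} (hO : IsOpen O) (hO0 : O ⊆ Ioi 0)
    {U W R : ℝ → ℝ} (hU : ∀ y ∈ O, HasDerivAt U (W y - force a b y * U y) y)
    (hW : ∀ y ∈ O, HasDerivAt W (R y) y) (hR : ContinuousOn R O) {x : ℝ} (hx : x ∈ O) :
    ContDiffAt ℝ 2 U x ∧ DifferentiableAt ℝ (fun y => force a b y * U y) x ∧
      deriv (deriv U) x + deriv (fun y => force a b y * U y) x = R x := by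
  have hfU : ∀ y ∈ O, HasDerivAt (fun y => force a b y * U y)
      ((a - b / y ^ 2) * U y + force a b y * (W y - force a b y * U y)) y := fun y hy =>
    (hasDerivAt_force a b (hO0 hy)).mul (hU y hy)
  have hg : ∀ y ∈ O, HasDerivAt (fun y => W y - force a b y * U y)
      (R y - ((a - b / y ^ 2) * U y + force a b y * (W y - force a b y * U y))) y := fun y hy =>
    (hW y hy).sub (hfU y hy)
  have cU : ContinuousOn U O := fun y hy => (hU y hy).continuousAt.continuousWithinAt
  have cW : ContinuousOn W O := fun y hy => (hW y hy).continuousAt.continuousWithinAt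
  have cf : ContinuousOn (force a b) O := (continuousOn_force a b).mono hO0
  have cf' : ContinuousOn (fun y : ℝ => a - b / y ^ 2) O :=
    continuousOn_const.sub (continuousOn_const.div (by fun_prop) fun y hy =>
      pow_ne_zero 2 (ne_of_gt (hO0 hy)))
  have cg' := hR.sub ((cf'.mul cU).add (cf.mul (cW.sub (cf.mul cU))))
  refine ⟨(contDiffOn_two_of_hasDerivAt hO hU hg cg').contDiffAt (hO.mem_nhds hx),
    (hfU x hx).differentiableAt, ?_⟩
  have e : deriv U =ᶠ[𝓝 x] fun y => W y - force a b y * U y := by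
    filter_upwards [hO.mem_nhds hx] with y hy using (hU y hy).deriv
  rw [e.deriv_eq, (hg x hx).deriv, (hfU x hx).deriv]
  ring

/-- `u` solves the Fokker-Planck equation with force `f(x) = a x + b / x` on `(0,∞)²`, with flux
`w = u_x + f u` and time derivative `S = w_x`. -/
structure IsFluxSolution (a b : ℝ) (u w S : ℝ → ℝ → ℝ) : Prop where
  hasDerivAt_left : ∀ x > 0, ∀ s > 0,
    HasDerivAt (fun y => u y s) (w x s - force a b x * u x s) x
  hasDerivAt_flux : ∀ x > 0, ∀ s > 0, HasDerivAt (fun y => w y s) (S x s) x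
  hasDerivAt_right : ∀ x > 0, ∀ s > 0, HasDerivAt (u x) (S x s) s
  continuousOn : ContinuousOn (Function.uncurry u) (Ioi 0 ×ˢ Ioi 0)
  continuousOn_deriv : ContinuousOn (Function.uncurry S) (Ioi 0 ×ˢ Ioi 0)

lemma ContinuousOn.uncurry_left' {v : ℝ → ℝ → ℝ} {X Y : Set ℝ}
    (hv : ContinuousOn (Function.uncurry v) (X ×ˢ Y)) {s : ℝ} (hs : s ∈ Y) :
    ContinuousOn (fun y => v y s) X :=
  hv.comp (f := fun y => (y, s)) (by fun_prop) fun _ hy => ⟨hy, hs⟩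

lemma ContinuousOn.uncurry_right' {v : ℝ → ℝ → ℝ} {X Y : Set ℝ}
    (hv : ContinuousOn (Function.uncurry v) (X ×ˢ Y)) {x : ℝ} (hx : x ∈ X) :
    ContinuousOn (v x) Y :=
  hv.comp (f := fun s => (x, s)) (by fun_prop) fun _ hs => ⟨hx, hs⟩

lemma IsFluxSolution.solvesFokkerPlanckAt {a b : ℝ} {u w S : ℝ → ℝ → ℝ}
    (h : IsFluxSolution a b u w S) {x t : ℝ} (hx : 0 < x) (ht : 0 < t) :
    SolvesFokkerPlanckAt 1 (force a b) u x t := by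
  obtain ⟨h1, h2, h3⟩ := contDiffAt_two_of_flux isOpen_Ioi Subset.rfl
    (fun y hy => h.hasDerivAt_left y hy t ht) (fun y hy => h.hasDerivAt_flux y hy t ht)
    (h.continuousOn_deriv.uncurry_left' ht) hx
  refine ⟨h1, h2, ?_⟩
  rw [HasCaputoDerivAt, if_pos rfl, h3]
  exact h.hasDerivAt_right x hx t ht

/-- Twofold integration of the Fokker-Planck equation in space. -/
lemma IsFluxSolution.integral_sub_mul_deriv {a b : ℝ} {u w S : ℝ → ℝ → ℝ}
    (h : IsFluxSolution a b u w S) {p q s : ℝ} (hp : 0 < p) (hq : 0 < q) (hs : 0 < s) :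
    ∫ y in p..q, (q - y) * S y s
      = -((q - p) * w p s) + (u q s - u p s + ∫ y in p..q, force a b y * u y s) := by
  have h0 : uIcc p q ⊆ Ioi 0 := fun y hy => (lt_min hp hq).trans_le hy.1
  have cS := (h.continuousOn_deriv.uncurry_left' (s := s) hs).mono h0
  have cw : ContinuousOn (fun y => w y s) (uIcc p q) := fun y hy =>
    (h.hasDerivAt_flux y (h0 hy) s hs).continuousAt.continuousWithinAt
  have cfu : ContinuousOn (fun y => force a b y * u y s) (uIcc p q) :=
    ((continuousOn_force a b).mono h0).mul ((h.continuousOn.uncurry_left' (s := s) hs).mono h0)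
  have e1 := intervalIntegral.integral_mul_deriv_eq_deriv_mul (a := p) (b := q)
    (u := fun y => q - y) (u' := fun _ => -1) (v := fun y => w y s) (v' := fun y => S y s)
    (fun y _ => (hasDerivAt_id y).const_sub q) (fun y hy => h.hasDerivAt_flux y (h0 hy) s hs)
    (by simp) cS.intervalIntegrable
  have e2 := intervalIntegral.integral_eq_sub_of_hasDerivAt (a := p) (b := q)
    (f := fun y => u y s) (fun y hy => h.hasDerivAt_left y (h0 hy) s hs)
    (cw.sub cfu).intervalIntegrable
  rw [intervalIntegral.integral_sub cw.intervalIntegrable cfu.intervalIntegrable] at e2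
  rw [e1, ← e2, intervalIntegral.integral_const_mul]
  ring

/-! ### Integrals with parameters -/

lemma hasDerivAt_intervalIntegral_of_continuousOn {p q : ℝ} {k : ℝ → ℝ}
    (hk : ContinuousOn k (uIcc p q)) {v S : ℝ → ℝ → ℝ}
    (hv : ContinuousOn (Function.uncurry v) (uIcc p q ×ˢ Ioi 0))
    (hS : ContinuousOn (Function.uncurry S) (uIcc p q ×ˢ Ioi 0))
    (hd : ∀ y ∈ uIcc p q, ∀ s > 0, HasDerivAt (v y) (S y s) s) {s : ℝ} (hs : 0 < s) :
    HasDerivAt (fun s => ∫ y in p..q, k y * v y s) (∫ y in p..q, k y * S y s) s := by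
  have hK : IsCompact (uIcc p q ×ˢ Icc (s / 2) (2 * s)) := isCompact_uIcc.prod isCompact_Icc
  have hsub : uIcc p q ×ˢ Icc (s / 2) (2 * s) ⊆ uIcc p q ×ˢ Ioi 0 := by
    rintro ⟨y, r⟩ ⟨h1, h2⟩
    exact ⟨h1, (half_pos hs).trans_le h2.1⟩
  obtain ⟨B, hB⟩ := hK.exists_bound_of_continuousOn (hS.mono hsub)
  have c : ∀ r > 0, ContinuousOn (fun y => k y * v y r) (uIcc p q) := fun r hr =>
    hk.mul (hv.uncurry_left' hr)
  have c' : ContinuousOn (fun y => k y * S y s) (uIcc p q) := hk.mul (hS.uncurry_left' hs)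
  refine (intervalIntegral.hasDerivAt_integral_of_dominated_loc_of_deriv_le
    (s := Ioo (s / 2) (2 * s)) (F := fun s y => k y * v y s) (F' := fun s y => k y * S y s)
    (bound := fun y => |k y| * B) (Ioo_mem_nhds (by linarith) (by linarith)) ?_
    (c s hs).intervalIntegrable ?_ ?_ ?_ ?_).2
  · filter_upwards [Ioi_mem_nhds hs] with r hr
    exact ((c r hr).mono uIoc_subset_uIcc).aestronglyMeasurable measurableSet_uIoc
  · exact (c'.mono uIoc_subset_uIcc).aestronglyMeasurable measurableSet_uIoc
  · refine Eventually.of_forall fun y hy r hr => ?_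
    rw [norm_mul, Real.norm_eq_abs]
    exact mul_le_mul_of_nonneg_left (hB (y, r) ⟨uIoc_subset_uIcc hy, hr.1.le, hr.2.le⟩)
      (abs_nonneg _)
  · exact (hk.abs.mul continuousOn_const).intervalIntegrable
  · exact Eventually.of_forall fun y hy r hr =>
      (hd y (uIoc_subset_uIcc hy) r ((half_pos hs).trans hr.1)).const_mul (k y)

section
variable {p q : ℝ} {v : ℝ → ℝ → ℝ} {g B : ℝ → ℝ}

lemma continuousOn_integral_mul (hv : ContinuousOn (Function.uncurry v) (Icc p q ×ˢ Ioi 0))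
    (hg : ContinuousOn g (Ioi 0)) (hB : ∀ y ∈ Icc p q, ∀ s > 0, |v y s| ≤ B s)
    (hBi : IntegrableOn (fun s => B s * |g s|) (Ioi 0)) :
    ContinuousOn (fun y => ∫ s in Ioi (0 : ℝ), v y s * g s) (Icc p q) := by
  refine continuousOn_of_dominated (bound := fun s => B s * |g s|) (fun y hy => ?_)
    (fun y hy => ?_) hBi ?_
  · exact ((hv.uncurry_right' hy).mul hg).aestronglyMeasurable measurableSet_Ioi
  · refine (ae_restrict_iff' measurableSet_Ioi).2 (Eventually.of_forall fun s hs => ?_)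
    rw [norm_mul]
    exact mul_le_mul_of_nonneg_right (hB y hy s hs) (abs_nonneg _)
  · refine (ae_restrict_iff' measurableSet_Ioi).2 (Eventually.of_forall fun s hs => ?_)
    exact (hv.uncurry_left' hs).mul continuousOn_const

lemma intervalIntegral_mul_integral_swap (hpq : p ≤ q) {k : ℝ → ℝ} (hk : ContinuousOn k (Icc p q))
    (hv : ContinuousOn (Function.uncurry v) (Icc p q ×ˢ Ioi 0))
    (hg : ContinuousOn g (Ioi 0)) (hB : ∀ y ∈ Icc p q, ∀ s > 0, |v y s| ≤ B s)
    (hBi : IntegrableOn (fun s => B s * |g s|) (Ioi 0)) :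
    IntegrableOn (fun s => (∫ y in p..q, k y * v y s) * g s) (Ioi 0) ∧
    ∫ y in p..q, k y * ∫ s in Ioi (0 : ℝ), v y s * g s
      = ∫ s in Ioi (0 : ℝ), (∫ y in p..q, k y * v y s) * g s := by
  have hsub : Ioc p q ×ˢ Ioi (0 : ℝ) ⊆ Icc p q ×ˢ Ioi 0 := prod_mono Ioc_subset_Icc_self Subset.rfl
  have c1 : ContinuousOn (fun z : ℝ × ℝ => k z.1) (Icc p q ×ˢ Ioi 0) :=
    hk.comp continuousOn_fst fun z hz => hz.1
  have c2 : ContinuousOn (fun z : ℝ × ℝ => g z.2) (Icc p q ×ˢ Ioi 0) :=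
    hg.comp continuousOn_snd fun z hz => hz.2
  have hint : Integrable (fun z : ℝ × ℝ => k z.1 * (v z.1 z.2 * g z.2))
      ((volume.restrict (Ioc p q)).prod (volume.restrict (Ioi 0))) := by
    have hb := Integrable.mul_prod (((hk.abs).integrableOn_Icc (μ := volume)).mono_set
      Ioc_subset_Icc_self) hBi
    refine hb.mono' ?_ ?_
    · rw [Measure.prod_restrict]
      exact ((c1.mul (hv.mul c2)).mono hsub).aestronglyMeasurable
        (measurableSet_Ioc.prod measurableSet_Ioi)
    · rw [Measure.prod_restrict]
      refine (ae_restrict_iff' (measurableSet_Ioc.prod measurableSet_Ioi)).2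
        (Eventually.of_forall fun z hz => ?_)
      rw [norm_mul, norm_mul]
      exact mul_le_mul_of_nonneg_left (mul_le_mul_of_nonneg_right
        (hB z.1 (Ioc_subset_Icc_self hz.1) z.2 hz.2) (abs_nonneg _)) (abs_nonneg _)
  have e : ∀ s, ∫ y in Ioc p q, k y * (v y s * g s) = (∫ y in p..q, k y * v y s) * g s := by
    intro s
    rw [intervalIntegral.integral_of_le hpq, ← integral_mul_const]
    simp only [mul_assoc]
  refine ⟨?_, ?_⟩
  · have := hint.integral_prod_right
    exact this.congr (Eventually.of_forall e)
  · rw [intervalIntegral.integral_of_le hpq]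
    simp only [← integral_const_mul]
    rw [integral_integral_swap hint]
    exact integral_congr_ae (Eventually.of_forall e)

end

/-- Integration by parts in time against the Wright kernel. -/
lemma integral_deriv_mul_wrightJ {β : ℝ} (hβ : 0 < β) (hβ1 : β < 1) {H D : ℝ → ℝ} {H₀ C ε t : ℝ}
    (ht : 0 < t) (hε : 0 < ε) (hH : ∀ s > 0, HasDerivAt H (D s) s)
    (hHb : ∀ s > 0, |H s - H₀| ≤ C * (s ^ ε + s))
    (hD : IntegrableOn (fun s => D s * wrightJ β (1 - β) s t) (Ioi 0)) :
    ∫ s in Ioi (0 : ℝ), D s * wrightJ β (1 - β) s t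
      = ∫ s in Ioi (0 : ℝ), (H s - H₀) * wrightJ β (1 - 2 * β) s t := by
  have hc : ContinuousOn (fun s => H s - H₀) (Ioi 0) := fun s hs =>
    ((hH s hs).sub_const H₀).continuousAt.continuousWithinAt
  have i1 := (integrableOn_mul_wrightJ hβ hβ1 (show 1 - β < 1 by linarith) ht hc hε hHb).1
  have i2 := (integrableOn_mul_wrightJ hβ hβ1 (show 1 - 2 * β < 1 by linarith) ht hc hε hHb).1
  have hJ : ∀ s ∈ Ioi (0 : ℝ), HasDerivAt (fun s => wrightJ β (1 - β) s t)
      (-wrightJ β (1 - 2 * β) s t) s := fun s hs => by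
    have := hasDerivAt_wrightJ_left hβ hβ1 hs (1 - β) t
    rwa [show 1 - β - β = 1 - 2 * β by ring] at this
  have hH' : ∀ s ∈ Ioi (0 : ℝ), HasDerivAt (fun s => H s - H₀) (D s) s := fun s hs =>
    (hH s hs).sub_const H₀
  have i2' : IntegrableOn (fun s => (H s - H₀) * -wrightJ β (1 - 2 * β) s t) (Ioi 0) := by
    simp only [mul_neg]
    exact i2.neg
  obtain ⟨K, hK, hKb⟩ := exists_abs_wrightJ_le_rpow_mul_exp hβ hβ1 (show 1 - β < 1 by linarith)
  have hκ := cos_half_pos hβ hβ1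
  have h0 : Tendsto (fun s => (H s - H₀) * wrightJ β (1 - β) s t) (𝓝[>] 0) (𝓝 0) := by
    have hb : Tendsto (fun s : ℝ => C * (s ^ ε + s) * (K * t ^ (1 - β - 1))) (𝓝[>] 0) (𝓝 0) := by
      have : ContinuousAt (fun s : ℝ => C * (s ^ ε + s) * (K * t ^ (1 - β - 1))) 0 := by
        have := Real.continuousAt_rpow_const 0 ε (Or.inr hε.le)
        fun_prop
      have := this.tendsto.mono_left (nhdsWithin_le_nhds (s := Ioi 0))
      simpa [Real.zero_rpow hε.ne'] using this
    refine squeeze_zero_norm' ?_ hb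
    filter_upwards [self_mem_nhdsWithin] with s hs
    have hs' : 0 < s := hs
    rw [norm_mul]
    refine mul_le_mul (hHb s hs) ((hKb s hs t ht).trans ?_) (abs_nonneg _)
      ((abs_nonneg _).trans (hHb s hs))
    refine mul_le_of_le_one_right (by positivity) (Real.exp_le_one_iff.2 ?_)
    have : 0 ≤ s / t ^ β := by positivity
    nlinarith
  -- The product and its derivative are both integrable, which forces decay at infinity; no bound on
  -- `D` is needed.
  have hinf := tendsto_zero_of_hasDerivAt_of_integrableOn_Ioi
    (fun s hs => (hH' s hs).mul (hJ s hs)) (hD.add i2') i1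
  have := integral_Ioi_mul_deriv_eq_deriv_mul hH' hJ i2' hD h0 hinf
  simp only [mul_neg, integral_neg, sub_zero, zero_sub] at this
  linarith

/-! ### Transfer of the equation through the Wright transformation -/

lemma HasCaputoDerivAt.congr_of_eqOn {β : ℝ} {h k : ℝ → ℝ} {v t : ℝ} (hk : HasCaputoDerivAt β k v t)
    (ht : 0 < t) (e : EqOn h k (Ioi 0)) : HasCaputoDerivAt β h v t := by
  have hloc : ∀ τ > 0, h =ᶠ[𝓝 τ] k := fun τ hτ => by
    filter_upwards [Ioi_mem_nhds hτ] with y hy using e hy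
  unfold HasCaputoDerivAt at hk ⊢
  split_ifs at hk ⊢ with hβ
  · exact hk.congr_of_eventuallyEq (hloc t ht)
  · obtain ⟨h1, h2, h3⟩ := hk
    have e' : EqOn (fun τ => (t - τ) ^ (-β) * deriv k τ) (fun τ => (t - τ) ^ (-β) * deriv h τ)
        (Ioo 0 t) := fun τ hτ => by
      show _ * _ = _ * _
      rw [(hloc τ hτ.1).deriv_eq]
    refine ⟨fun τ hτ => (h1 τ hτ).congr_of_eventuallyEq (hloc τ hτ.1),
      h2.congr_fun e' measurableSet_Ioo, ?_⟩
    rw [h3, setIntegral_congr_fun measurableSet_Ioo e']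

lemma intervalIntegral_mul_sub_le {p x K : ℝ} (hpx : p ≤ x) {v : ℝ → ℝ}
    (hb : ∀ y ∈ Icc p x, |v y| ≤ K) : |∫ y in p..x, (x - y) * v y| ≤ (x - p) ^ 2 * K := by
  have := intervalIntegral.norm_integral_le_of_norm_le_const (a := p) (b := x)
    (f := fun y => (x - y) * v y) (C := (x - p) * K) fun y hy => by
      rw [uIoc_of_le hpx] at hy
      rw [norm_mul, Real.norm_eq_abs, Real.norm_eq_abs, abs_of_nonneg (by linarith [hy.2])]
      exact mul_le_mul (by linarith [hy.1]) (hb y (Ioc_subset_Icc_self hy)) (abs_nonneg _)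
        (by linarith)
  rw [Real.norm_eq_abs, abs_of_nonneg (by linarith : 0 ≤ x - p)] at this
  linarith [this]

/-- The time derivative of the twofold space integral of a solution, corrected by a multiple of the
same integral over `[p, q]` so that the flux at the end point `p` drops out. -/
lemma IsFluxSolution.hasDerivAt_integral_sub {a b : ℝ} {u w S : ℝ → ℝ → ℝ}
    (h : IsFluxSolution a b u w S) {p q x s : ℝ} (hp : 0 < p) (hpq : p < q) (hx : p ≤ x)
    (hs : 0 < s) :
    HasDerivAt (fun s => (∫ y in p..x, (x - y) * u y s)
        - (x - p) / (q - p) * ∫ y in p..q, (q - y) * u y s)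
      ((u x s - u p s + ∫ y in p..x, force a b y * u y s)
        - (x - p) / (q - p) * (u q s - u p s + ∫ y in p..q, force a b y * u y s)) s := by
  have key : ∀ z, p ≤ z → HasDerivAt (fun s => ∫ y in p..z, (z - y) * u y s)
      (-((z - p) * w p s) + (u z s - u p s + ∫ y in p..z, force a b y * u y s)) s := by
    intro z hz
    have h0 : uIcc p z ×ˢ Ioi (0 : ℝ) ⊆ Ioi 0 ×ˢ Ioi 0 := prod_mono (fun y hy => by
      rw [uIcc_of_le hz] at hy; exact hp.trans_le hy.1) Subset.rfl
    rw [← h.integral_sub_mul_deriv hp (hp.trans_le hz) hs]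
    exact hasDerivAt_intervalIntegral_of_continuousOn (by fun_prop) (h.continuousOn.mono h0)
      (h.continuousOn_deriv.mono h0) (fun y hy s hs => h.hasDerivAt_right y (h0 (⟨hy, hs⟩ :
        (y, s) ∈ uIcc p z ×ˢ Ioi (0 : ℝ))).1 s hs) hs
  refine ((key x hx).sub ((key q hpq.le).const_mul ((x - p) / (q - p)))).congr_deriv ?_
  have : q - p ≠ 0 := by linarith
  field_simp
  ring

/-- The Wright transform of a solution that is locally uniformly Hölder continuous in time at
`0` solves the fractional Fokker-Planck equation. -/
theorem IsFluxSolution.solvesFokkerPlanckAt_wrightTransform {a b β : ℝ} (hβ : 0 < β) (hβ1 : β < 1)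
    {u w S : ℝ → ℝ → ℝ} (h : IsFluxSolution a b u w S) {u₀ : ℝ → ℝ} {p q C ε : ℝ} (hp : 0 < p)
    (hpq : p < q) (hu₀ : ContinuousOn u₀ (Icc p q)) (hε : 0 < ε) (hε1 : ε ≤ 1)
    (hub : ∀ y ∈ Icc p q, ∀ s > 0, |u y s - u₀ y| ≤ C * (s ^ ε + s)) {x t : ℝ} (hx : x ∈ Ioo p q)
    (ht : 0 < t) :
    SolvesFokkerPlanckAt β (force a b) (fun y τ => wrightTransform β (u y) τ) x t := by
  have hν1 : 1 - β < 1 := by linarith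
  have hν2 : 1 - 2 * β < 1 := by linarith
  set g : ℝ → ℝ := fun s => wrightJ β (1 - β) s t with hg
  set g2 : ℝ → ℝ := fun s => wrightJ β (1 - 2 * β) s t with hg2
  have cg : ContinuousOn g (Ioi 0) := continuousOn_wrightJ_left hβ hβ1 _ _
  have cg2 : ContinuousOn g2 (Ioi 0) := continuousOn_wrightJ_left hβ hβ1 _ _
  have h0 : Icc p q ⊆ Ioi 0 := fun y hy => hp.trans_le hy.1
  have cu : ContinuousOn (Function.uncurry u) (Icc p q ×ˢ Ioi 0) :=
    h.continuousOn.mono (prod_mono h0 Subset.rfl)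
  have cu0 : ContinuousOn (Function.uncurry fun y s => u y s - u₀ y) (Icc p q ×ˢ Ioi 0) :=
    cu.sub (hu₀.comp continuousOn_fst fun z hz => hz.1)
  have cf : ContinuousOn (force a b) (Icc p q) := (continuousOn_force a b).mono h0
  obtain ⟨M, hM⟩ := isCompact_Icc.exists_bound_of_continuousOn hu₀
  set B1 : ℝ → ℝ := fun s => M + C * (s ^ ε + s) with hB1
  set B2 : ℝ → ℝ := fun s => C * (s ^ ε + s) with hB2
  have bu : ∀ y ∈ Icc p q, ∀ s > 0, |u y s| ≤ B1 s := fun y hy s hs => by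
    have h1 := hub y hy s hs
    have h2 := hM y hy
    rw [Real.norm_eq_abs] at h2
    calc |u y s| = |u₀ y + (u y s - u₀ y)| := by ring_nf
      _ ≤ _ := (abs_add_le _ _).trans (add_le_add h2 h1)
  have iB2 : ∀ ν < 1, IntegrableOn (fun s => B2 s * |wrightJ β ν s t|) (Ioi 0) := fun ν hν => by
    refine (((integrableOn_wrightJ hβ hβ1 hν ht hε.le).add
      (integrableOn_wrightJ hβ hβ1 hν ht zero_le_one)).const_mul C).congr
      (Eventually.of_forall fun s => ?_)
    simp only [Pi.add_apply, Real.rpow_one, hB2]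
    ring
  have iB1 : IntegrableOn (fun s => B1 s * |g s|) (Ioi 0) := by
    refine (((integrableOn_wrightJ_self hβ hβ1 hν1 ht).abs.const_mul M).add (iB2 _ hν1)).congr
      (Eventually.of_forall fun s => ?_)
    simp only [Pi.add_apply, hB1, hB2, hg]
    ring
  set U : ℝ → ℝ := fun y => ∫ s in Ioi (0 : ℝ), u y s * g s with hU
  -- `R` is the Caputo derivative of the transform. It depends continuously on the space variable
  -- because the rate of u at time 0 is uniform on [p,q].
  set R : ℝ → ℝ := fun y => ∫ s in Ioi (0 : ℝ), (u y s - u₀ y) * g2 s with hR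
  have cU : ContinuousOn U (Icc p q) := continuousOn_integral_mul cu cg bu iB1
  have cR : ContinuousOn R (Icc p q) := continuousOn_integral_mul cu0 cg2 hub (iB2 _ hν2)
  have iu : ∀ y ∈ Icc p q, IntegrableOn (fun s => u y s * g s) (Ioi 0) := fun y hy =>
    iB1.mono' (((cu.uncurry_right' hy).mul cg).aestronglyMeasurable measurableSet_Ioi)
      ((ae_restrict_iff' measurableSet_Ioi).2 (Eventually.of_forall fun s hs => by
        rw [norm_mul]
        exact mul_le_mul_of_nonneg_right (bu y hy s hs) (abs_nonneg _)))
  have sub : ∀ z ∈ Icc p q, Icc p z ⊆ Icc p q := fun z hz => Icc_subset_Icc_right hz.2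
  have sub' : ∀ z ∈ Icc p q, Icc p z ×ˢ Ioi (0 : ℝ) ⊆ Icc p q ×ˢ Ioi 0 := fun z hz =>
    prod_mono (sub z hz) Subset.rfl
  have pmem : p ∈ Icc p q := left_mem_Icc.2 hpq.le
  have qmem : q ∈ Icc p q := right_mem_Icc.2 hpq.le
  have eE : ∀ z ∈ Icc p q,
      IntegrableOn (fun s => (u z s - u p s + ∫ y in p..z, force a b y * u y s) * g s) (Ioi 0) ∧
      ∫ s in Ioi (0 : ℝ), (u z s - u p s + ∫ y in p..z, force a b y * u y s) * g s
        = U z - U p + ∫ y in p..z, force a b y * U y := by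
    intro z hz
    obtain ⟨i1, e1⟩ := intervalIntegral_mul_integral_swap hz.1 (cf.mono (sub z hz))
      (cu.mono (sub' z hz)) cg (fun y hy => bu y (sub z hz hy)) iB1
    have i2 := ((iu z hz).sub (iu p pmem)).add i1
    have e2 : (fun s => (u z s - u p s + ∫ y in p..z, force a b y * u y s) * g s)
        = fun s => u z s * g s - u p s * g s + (∫ y in p..z, force a b y * u y s) * g s := by
      funext s; ring
    rw [e2]
    refine ⟨i2, ?_⟩
    have i3 : IntegrableOn (fun s => u z s * g s - u p s * g s) (Ioi 0) :=
      (iu z hz).sub (iu p pmem)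
    rw [integral_add i3 i1, integral_sub (iu z hz) (iu p pmem), e1]
  have eG : ∀ z ∈ Icc p q,
      IntegrableOn (fun s => (∫ y in p..z, (z - y) * (u y s - u₀ y)) * g2 s) (Ioi 0) ∧
      ∫ s in Ioi (0 : ℝ), (∫ y in p..z, (z - y) * (u y s - u₀ y)) * g2 s
        = ∫ y in p..z, (z - y) * R y := by
    intro z hz
    obtain ⟨i1, e1⟩ := intervalIntegral_mul_integral_swap (k := fun y => z - y) hz.1 (by fun_prop)
      (cu0.mono (sub' z hz)) cg2 (fun y hy => hub y (sub z hz hy)) (iB2 _ hν2)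
    exact ⟨i1, e1.symm⟩
  have hsplit : ∀ z ∈ Icc p q, ∀ s > 0, ∫ y in p..z, (z - y) * (u y s - u₀ y)
      = (∫ y in p..z, (z - y) * u y s) - ∫ y in p..z, (z - y) * u₀ y := by
    intro z hz s hs
    rw [← intervalIntegral.integral_sub]
    · simp only [mul_sub]
    · refine ContinuousOn.intervalIntegrable ?_
      rw [uIcc_of_le hz.1]
      exact ContinuousOn.mul (by fun_prop) ((cu.uncurry_left' hs).mono (sub z hz))
    · refine ContinuousOn.intervalIntegrable ?_
      rw [uIcc_of_le hz.1]
      exact ContinuousOn.mul (by fun_prop) (hu₀.mono (sub z hz))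
  set K : ℝ := U q - U p + (∫ y in p..q, force a b y * U y) - ∫ y in p..q, (q - y) * R y with hK
  -- The time derivative of the corrected twofold space integral is integrated by parts against the
  -- kernel. Neither the flux nor the time derivative of u remains, so no control of them near s = 0
  -- is required.
  have main : ∀ z ∈ Icc p q, U z = U p + (z - p) / (q - p) * K
      - (∫ y in p..z, force a b y * U y) + ∫ y in p..z, (z - y) * R y := by
    intro z hz
    set θ := (z - p) / (q - p) with hθ
    have hθ0 : 0 ≤ θ := div_nonneg (by linarith [hz.1]) (by linarith)
    have hθ1 : θ ≤ 1 := (div_le_one (by linarith)).2 (by linarith [hz.2])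
    have parts := integral_deriv_mul_wrightJ hβ hβ1 (C := 2 * (q - p) ^ 2 * C)
      (H₀ := (∫ y in p..z, (z - y) * u₀ y) - θ * ∫ y in p..q, (q - y) * u₀ y) ht hε
      (fun s hs => h.hasDerivAt_integral_sub hp hpq hz.1 hs) ?_ ?_
    · have l1 : ∀ s, ((u z s - u p s + ∫ y in p..z, force a b y * u y s)
          - θ * (u q s - u p s + ∫ y in p..q, force a b y * u y s)) * wrightJ β (1 - β) s t
          = (u z s - u p s + ∫ y in p..z, force a b y * u y s) * g s
          - θ * ((u q s - u p s + ∫ y in p..q, force a b y * u y s) * g s) := fun s => by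
        simp only [hg]; ring
      have l2 : ∀ s ∈ Ioi (0 : ℝ), ((∫ y in p..z, (z - y) * u y s)
          - θ * (∫ y in p..q, (q - y) * u y s)
          - ((∫ y in p..z, (z - y) * u₀ y) - θ * ∫ y in p..q, (q - y) * u₀ y))
          * wrightJ β (1 - 2 * β) s t
          = (∫ y in p..z, (z - y) * (u y s - u₀ y)) * g2 s
          - θ * ((∫ y in p..q, (q - y) * (u y s - u₀ y)) * g2 s) := fun s hs => by
        rw [hsplit z hz s hs, hsplit q qmem s hs]
        simp only [hg2]; ring
      rw [integral_congr_ae (Eventually.of_forall l1), setIntegral_congr_fun measurableSet_Ioi l2,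
        integral_sub (eE z hz).1 ((eE q qmem).1.const_mul θ), integral_const_mul,
        integral_sub (eG z hz).1 ((eG q qmem).1.const_mul θ), integral_const_mul,
        (eE z hz).2, (eE q qmem).2, (eG z hz).2, (eG q qmem).2] at parts
      rw [hK]
      linear_combination parts
    · intro s hs
      have b0 : 0 ≤ C * (s ^ ε + s) := (abs_nonneg _).trans (hub p pmem s hs)
      have b1 := intervalIntegral_mul_sub_le hz.1 (v := fun y => u y s - u₀ y)
        fun y hy => hub y (sub z hz hy) s hs
      have b2 := intervalIntegral_mul_sub_le hpq.le (v := fun y => u y s - u₀ y)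
        fun y hy => hub y hy s hs
      rw [hsplit z hz s hs] at b1
      rw [hsplit q qmem s hs] at b2
      have b3 : (z - p) ^ 2 * (C * (s ^ ε + s)) ≤ (q - p) ^ 2 * (C * (s ^ ε + s)) := by
        refine mul_le_mul_of_nonneg_right ?_ b0
        have := hz.1
        have := hz.2
        gcongr
      rw [abs_le] at b1 b2 ⊢
      have c1 : θ * ((q - p) ^ 2 * (C * (s ^ ε + s))) ≤ (q - p) ^ 2 * (C * (s ^ ε + s)) :=
        mul_le_of_le_one_left (mul_nonneg (sq_nonneg _) b0) hθ1
      have c2 := mul_le_mul_of_nonneg_left b2.1 hθ0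
      have c3 := mul_le_mul_of_nonneg_left b2.2 hθ0
      constructor
      · linear_combination c3 + c1 + b1.1 + b3
      · linear_combination c2 + c1 + b1.2 + b3
    · refine ((eE z hz).1.sub ((eE q qmem).1.const_mul θ)).congr (Eventually.of_forall fun s => ?_)
      simp only [Pi.sub_apply, hg]
      ring
  -- `W` is the flux of `U`: differentiating `main` once gives U' = W - fU, and W' = R is then
  -- immediate.
  set W : ℝ → ℝ := fun z => K / (q - p) + ∫ y in p..z, R y with hW
  have ftc : ∀ {k : ℝ → ℝ}, ContinuousOn k (Icc p q) → ∀ z ∈ Ioo p q,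
      HasDerivAt (fun z => ∫ y in p..z, k y) (k z) z := by
    intro k hk z hz
    refine intervalIntegral.integral_hasDerivAt_right ?_ ?_ (hk.continuousAt (Icc_mem_nhds hz.1 hz.2))
    · refine ContinuousOn.intervalIntegrable (hk.mono ?_)
      rw [uIcc_of_le hz.1.le]
      exact Icc_subset_Icc_right hz.2.le
    · exact (hk.mono Ioo_subset_Icc_self).stronglyMeasurableAtFilter isOpen_Ioo z hz
  have hWd : ∀ z ∈ Ioo p q, HasDerivAt W (R z) z := fun z hz => (ftc cR z hz).const_add _
  have hUd : ∀ z ∈ Ioo p q, HasDerivAt U (W z - force a b z * U z) z := by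
    intro z hz
    have d1 := ((ftc cR z hz).fun_mul (hasDerivAt_id z)).sub
      (ftc (k := fun y => y * R y) (continuousOn_id.mul cR) z hz)
    have d2 := (((((hasDerivAt_id z).sub_const p).div_const (q - p)).mul_const K).const_add
      (U p)).sub (ftc (cf.mul cU) z hz)
    refine ((d2.add d1).congr_deriv ?_).congr_of_eventuallyEq ?_
    · simp only [hW, id_eq, Pi.mul_apply]
      ring
    · filter_upwards [isOpen_Ioo.mem_nhds hz] with z' hz'
      have hz'' := Ioo_subset_Icc_self hz'
      have iR : IntervalIntegrable R volume p z' := ContinuousOn.intervalIntegrable (by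
        rw [uIcc_of_le hz''.1]; exact cR.mono (sub z' hz''))
      have iyR : IntervalIntegrable (fun y => y * R y) volume p z' :=
        ContinuousOn.intervalIntegrable (by
          rw [uIcc_of_le hz''.1]; exact (continuousOn_id.mul cR).mono (sub z' hz''))
      rw [main z' hz'']
      have : ∫ y in p..z', (z' - y) * R y = z' * (∫ y in p..z', R y) - ∫ y in p..z', y * R y := by
        rw [← intervalIntegral.integral_const_mul, ← intervalIntegral.integral_sub
          (iR.const_mul z') iyR]
        simp only [sub_mul]
      rw [this]
      simp only [id, Pi.add_apply, Pi.sub_apply, Pi.mul_apply]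
      ring
  obtain ⟨r1, r2, r3⟩ := contDiffAt_two_of_flux isOpen_Ioo (Ioo_subset_Icc_self.trans h0) hUd hWd
    (cR.mono Ioo_subset_Icc_self) hx
  have eU : (fun y => wrightTransform β (u y) t) = U := by
    funext y
    exact wrightTransform_eq hβ hβ1 (u y) ht
  refine ⟨?_, ?_, ?_⟩
  · rw [eU]; exact r1
  · have : (fun y => force a b y * wrightTransform β (u y) t) = fun y => force a b y * U y := by
      rw [← eU]
    rw [this]; exact r2
  · have : (fun y => force a b y * wrightTransform β (u y) t) = fun y => force a b y * U y := by
      rw [← eU]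
    rw [eU, this, r3]
    have hx' := Ioo_subset_Icc_self hx
    exact hasCaputoDerivAt_wrightTransform hβ hβ1 (cu.uncurry_right' hx') hε hε1 (hub x hx') ht

/-! ### The entire part of the modified Bessel function -/

/-- The coefficients of `besselF`. -/
def besselCoeff (α : ℝ) (m : ℕ) : ℝ := 1 / ((m.factorial : ℝ) * Real.Gamma (m + α + 1))

/-- The entire function `F_α(w) = ∑ w^m / (m! Γ(m+α+1))`, so that
`I_α(z) = (z/2)^α F_α(z²/4)`. -/
def besselF (α w : ℝ) : ℝ := ∑' m : ℕ, besselCoeff α m * w ^ m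

section
variable {α : ℝ}

lemma Gamma_nat_add_pos (hα : -1 < α) (m : ℕ) : 0 < Real.Gamma (m + α + 1) :=
  Real.Gamma_pos_of_pos (by have : (0 : ℝ) ≤ m := m.cast_nonneg; linarith)

lemma besselCoeff_pos (hα : -1 < α) (m : ℕ) : 0 < besselCoeff α m := by
  have := Gamma_nat_add_pos hα m
  unfold besselCoeff
  positivity

lemma besselCoeff_succ (hα : -1 < α) (m : ℕ) :
    besselCoeff α (m + 1) * ((m + 1) * (m + α + 1)) = besselCoeff α m := by
  have h0 : (0 : ℝ) < m + α + 1 := by have : (0 : ℝ) ≤ m := m.cast_nonneg; linarith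
  have h1 := Gamma_nat_add_pos hα m
  have h2 : Real.Gamma (((m + 1 : ℕ) : ℝ) + α + 1) = (m + α + 1) * Real.Gamma (m + α + 1) := by
    rw [← Real.Gamma_add_one h0.ne']; congr 1; push_cast; ring
  have h3 : (0 : ℝ) < m.factorial := by positivity
  unfold besselCoeff
  rw [h2, Nat.factorial_succ]
  push_cast
  field_simp

lemma succ_mul_besselCoeff_succ (α : ℝ) (m : ℕ) :
    (m + 1) * besselCoeff α (m + 1) = besselCoeff (α + 1) m := by
  unfold besselCoeff
  rw [Nat.factorial_succ, show (m : ℝ) + (α + 1) + 1 = ((m + 1 : ℕ) : ℝ) + α + 1 by push_cast; ring]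
  push_cast
  have h3 : (0 : ℝ) < m.factorial := by positivity
  field_simp

lemma besselCoeff_eq (hα : -1 < α) (m : ℕ) :
    besselCoeff α m = (m + (α + 1)) * besselCoeff (α + 1) m := by
  rw [← succ_mul_besselCoeff_succ, ← besselCoeff_succ hα]; ring

/-- Comparison with the order -1/2, where the series is a multiple of cosh(2√w). The induction step
has the ratio (m+α+1)/(m+1/2), which is at least 1 exactly for α ≥ -1/2. -/
lemma besselCoeff_le (hα : -(1 / 2) ≤ α) (m : ℕ) :
    besselCoeff α m ≤ 1 / Real.Gamma (α + 1) * (4 ^ m / ((2 * m).factorial : ℝ)) := by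
  have hα' : -1 < α := by linarith
  induction m with
  | zero => simp [besselCoeff]
  | succ m ih =>
    have h0 : (0 : ℝ) < (m + 1) * (m + α + 1) := by
      have : (0 : ℝ) ≤ m := m.cast_nonneg
      have : (0 : ℝ) < m + α + 1 := by linarith
      positivity
    have hm : (0 : ℝ) ≤ m := m.cast_nonneg
    have hG : 0 < Real.Gamma (α + 1) := Real.Gamma_pos_of_pos (by linarith)
    rw [← besselCoeff_succ hα'] at ih
    refine le_of_mul_le_mul_right (ih.trans ?_) h0
    rw [show 2 * (m + 1) = 2 * m + 1 + 1 by ring, Nat.factorial_succ, Nat.factorial_succ]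
    push_cast
    have h3 : (0 : ℝ) < (2 * m).factorial := by positivity
    rw [pow_succ]
    have : 1 / Real.Gamma (α + 1) * (4 ^ m * 4 / ((2 * m + 1 + 1) * ((2 * m + 1) *
        ((2 * m).factorial : ℝ)))) * ((m + 1) * (m + α + 1))
        = 1 / Real.Gamma (α + 1) * (4 ^ m / ((2 * m).factorial : ℝ))
          * ((m + α + 1) / (m + 1 / 2)) := by
      have : (m : ℝ) + 1 / 2 ≠ 0 := by positivity
      field_simp
      ring
    rw [this]
    refine le_mul_of_one_le_right (by positivity) ?_
    rw [one_le_div (by positivity)]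
    linarith

lemma hasSum_four_pow_mul {w : ℝ} (hw : 0 ≤ w) :
    HasSum (fun m : ℕ => 4 ^ m / ((2 * m).factorial : ℝ) * w ^ m) (Real.cosh (2 * √w)) := by
  refine (Real.hasSum_cosh (2 * √w)).of_eq (fun m => ?_) rfl
  rw [pow_mul, mul_pow, Real.sq_sqrt hw, mul_pow]
  norm_num
  ring

lemma summable_besselCoeff_of_le (hα : -(1 / 2) ≤ α) {w : ℝ} (hw : 0 ≤ w) :
    Summable fun m => besselCoeff α m * w ^ m := by
  refine Summable.of_nonneg_of_le (fun m => mul_nonneg (besselCoeff_pos (by linarith) m).le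
    (by positivity)) (fun m => ?_)
    ((hasSum_four_pow_mul hw).summable.mul_left (1 / Real.Gamma (α + 1)))
  rw [← mul_assoc]
  exact mul_le_mul_of_nonneg_right (besselCoeff_le hα m) (by positivity)

lemma besselCoeff_mul_pow_succ (hα : -1 < α) (w : ℝ) (m : ℕ) :
    besselCoeff α (m + 1) * w ^ (m + 1) = w * (besselCoeff (α + 2) m * w ^ m)
      + (α + 1) * (besselCoeff (α + 1) (m + 1) * w ^ (m + 1)) := by
  rw [besselCoeff_eq hα (m + 1), show α + 2 = α + 1 + 1 by ring, ← succ_mul_besselCoeff_succ (α + 1) m]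
  push_cast
  ring

lemma summable_besselCoeff_nonneg (hα : -1 < α) {w : ℝ} (hw : 0 ≤ w) :
    Summable fun m => besselCoeff α m * w ^ m := by
  rw [← summable_nat_add_iff 1]
  simp only [besselCoeff_mul_pow_succ hα]
  exact ((summable_besselCoeff_of_le (by linarith) hw).mul_left w).add
    (((summable_nat_add_iff 1).2 (summable_besselCoeff_of_le (by linarith) hw)).mul_left _)

lemma summable_besselCoeff (hα : -1 < α) (w : ℝ) :
    Summable fun m => besselCoeff α m * w ^ m := by
  refine Summable.of_norm ?_
  refine (summable_besselCoeff_nonneg hα (abs_nonneg w)).congr fun m => ?_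
  rw [norm_mul, norm_pow, Real.norm_eq_abs, Real.norm_eq_abs, abs_of_pos (besselCoeff_pos hα m)]

/-- The three-term recurrence of Bessel functions. It closes the computation of the equation,
reduces moments to the zeroth one, and carries estimates from orders at least -1/2 to all orders
above -1. -/
lemma besselF_eq (hα : -1 < α) (w : ℝ) :
    besselF α w = w * besselF (α + 2) w + (α + 1) * besselF (α + 1) w := by
  have s1 := summable_besselCoeff hα w
  have s2 := summable_besselCoeff (α := α + 2) (by linarith) w
  have s3 := summable_besselCoeff (α := α + 1) (by linarith) w
  unfold besselF
  rw [s1.tsum_eq_zero_add, s3.tsum_eq_zero_add]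
  simp only [besselCoeff_mul_pow_succ hα]
  rw [(s2.mul_left w).tsum_add (((summable_nat_add_iff 1).2 s3).mul_left (α + 1)), tsum_mul_left,
    tsum_mul_left, besselCoeff_eq hα]
  push_cast
  ring

lemma besselF_nonneg (hα : -1 < α) {w : ℝ} (hw : 0 ≤ w) : 0 ≤ besselF α w :=
  tsum_nonneg fun m => mul_nonneg (besselCoeff_pos hα m).le (by positivity)

lemma hasDerivAt_besselF (hα : -1 < α) (w : ℝ) :
    HasDerivAt (besselF α) (besselF (α + 1) w) w := by
  set R := |w| + 1 with hR
  have hR0 : 0 < R := by positivity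
  have key := hasDerivAt_tsum_of_isPreconnected (𝕜 := ℝ) (t := Ioo (-R) R) (y₀ := 0) (y := w)
    (u := fun m : ℕ => besselCoeff α m * (m * R ^ (m - 1)))
    (g := fun m y => besselCoeff α m * y ^ m) (g' := fun m y => besselCoeff α m * (m * y ^ (m - 1)))
    ?_ isOpen_Ioo isPreconnected_Ioo ?_ ?_ ⟨by linarith, hR0⟩ (summable_besselCoeff hα 0)
    (by rw [hR]; constructor <;> cases abs_cases w <;> linarith)
  · refine key.congr_deriv ?_
    rw [Summable.tsum_eq_zero_add]
    · simp only [besselF, Nat.cast_zero, zero_mul, mul_zero, zero_add, add_tsub_cancel_right]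
      refine tsum_congr fun m => ?_
      rw [← succ_mul_besselCoeff_succ]
      push_cast
      ring
    · rw [← summable_nat_add_iff 1]
      refine (summable_besselCoeff (α := α + 1) (by linarith) w).congr fun m => ?_
      rw [← succ_mul_besselCoeff_succ, add_tsub_cancel_right]
      push_cast
      ring
  · rw [← summable_nat_add_iff 1]
    refine (summable_besselCoeff (α := α + 1) (by linarith) R).congr fun m => ?_
    rw [← succ_mul_besselCoeff_succ, add_tsub_cancel_right]
    push_cast
    ring
  · intro m y _
    exact (hasDerivAt_pow m y).const_mul _
  · intro m y hy
    rw [norm_mul, norm_mul, norm_pow, Real.norm_eq_abs, Real.norm_eq_abs, Real.norm_eq_abs,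
      abs_of_pos (besselCoeff_pos hα m), abs_of_nonneg (Nat.cast_nonneg m)]
    have := (besselCoeff_pos hα m).le
    have hy' : |y| ≤ R := abs_le.2 ⟨hy.1.le, hy.2.le⟩
    gcongr

lemma continuous_besselF (hα : -1 < α) : Continuous (besselF α) :=
  continuous_iff_continuousAt.2 fun w => (hasDerivAt_besselF hα w).continuousAt

/-! ### Growth of the entire part -/

lemma besselF_le_exp_sqrt (hα : -(1 / 2) ≤ α) {w : ℝ} (hw : 0 ≤ w) :
    besselF α w ≤ 1 / Real.Gamma (α + 1) * Real.exp (2 * √w) := by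
  have hG : 0 < Real.Gamma (α + 1) := Real.Gamma_pos_of_pos (by linarith)
  have h1 := (hasSum_four_pow_mul hw).mul_left (1 / Real.Gamma (α + 1))
  have h2 : besselF α w ≤ 1 / Real.Gamma (α + 1) * Real.cosh (2 * √w) := by
    rw [← h1.tsum_eq]
    refine (summable_besselCoeff (by linarith) w).tsum_le_tsum (fun m => ?_) h1.summable
    rw [← mul_assoc]
    exact mul_le_mul_of_nonneg_right (besselCoeff_le hα m) (by positivity)
  refine h2.trans (mul_le_mul_of_nonneg_left ?_ (by positivity))
  rw [Real.cosh_eq]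
  have : Real.exp (-(2 * √w)) ≤ Real.exp (2 * √w) := by
    have := Real.sqrt_nonneg w
    gcongr
    linarith
  linarith

lemma exists_besselF_le (hα : -1 < α) :
    ∃ C > 0, ∀ w ≥ 0, besselF α w ≤ C * ((1 + w) * Real.exp (2 * √w)) := by
  have g1 : 0 < Real.Gamma (α + 1 + 1) := Real.Gamma_pos_of_pos (by linarith)
  have g2 : 0 < Real.Gamma (α + 2 + 1) := Real.Gamma_pos_of_pos (by linarith)
  have hα' : 0 < α + 1 := by linarith
  refine ⟨1 / Real.Gamma (α + 2 + 1) + (α + 1) * (1 / Real.Gamma (α + 1 + 1)), by positivity,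
    fun w hw => ?_⟩
  have h1 := besselF_le_exp_sqrt (α := α + 1) (by linarith) hw
  have h2 := besselF_le_exp_sqrt (α := α + 2) (by linarith) hw
  rw [besselF_eq hα]
  have h3 := mul_le_mul_of_nonneg_left h1 hα'.le
  have h4 := mul_le_mul_of_nonneg_left h2 hw
  have e := Real.exp_pos (2 * √w)
  have h5 : 0 ≤ 1 / Real.Gamma (α + 2 + 1) * Real.exp (2 * √w) := by positivity
  have h6 : 0 ≤ w * ((α + 1) * (1 / Real.Gamma (α + 1 + 1)) * Real.exp (2 * √w)) := by positivity
  linarith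

/-- Growth of order 1/2 loses to any exponential. With η small a fixed part of a Gaussian absorbs
F_α(B y²), which makes superpositions against any integrable φ converge. -/
lemma exists_besselF_le_exp (hα : -1 < α) {η : ℝ} (hη : 0 < η) :
    ∃ C > 0, ∀ w ≥ 0, besselF α w ≤ C * Real.exp (η * w) := by
  obtain ⟨C, hC, h⟩ := exists_besselF_le hα
  refine ⟨C * ((1 + 2 / η) * Real.exp (2 / η)), by positivity, fun w hw => (h w hw).trans ?_⟩
  have h1 : 1 + w ≤ (1 + 2 / η) * Real.exp (η / 2 * w) := by
    have := Real.add_one_le_exp (η / 2 * w)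
    have h2 : 1 + w ≤ (1 + 2 / η) * (η / 2 * w + 1) := by
      have : (1 + 2 / η) * (η / 2 * w + 1) = 1 + w + η / 2 * w + 2 / η := by field_simp; ring
      rw [this]
      have : 0 ≤ η / 2 * w := by positivity
      have : 0 ≤ 2 / η := by positivity
      linarith
    exact h2.trans (mul_le_mul_of_nonneg_left this (by positivity))
  have h2 : 2 * √w ≤ η / 2 * w + 2 / η := by
    have hs := Real.sq_sqrt hw
    have : η / 2 * w + 2 / η - 2 * √w = 1 / (2 * η) * (η * √w - 2) ^ 2 := by
      nth_rewrite 1 [← hs]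
      field_simp
      ring
    have h3 : 0 ≤ 1 / (2 * η) * (η * √w - 2) ^ 2 := by positivity
    linarith
  calc C * ((1 + w) * Real.exp (2 * √w))
      ≤ C * (((1 + 2 / η) * Real.exp (η / 2 * w)) * Real.exp (η / 2 * w + 2 / η)) := by gcongr
    _ = C * ((1 + 2 / η) * Real.exp (2 / η)) * Real.exp (η * w) := by
      rw [Real.exp_add, show η * w = η / 2 * w + η / 2 * w by ring, Real.exp_add]; ring

/-- Uniform bound for the integrands of `besselInt`. -/
lemma exists_pow_mul_exp_mul_besselF_le (hα : -1 < α) (j : ℕ) {A₀ : ℝ} (hA₀ : 0 < A₀) (B₀ : ℝ) :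
    ∃ C, ∀ A ≥ A₀, ∀ B ∈ Icc 0 B₀, ∀ y,
      |y ^ (2 * j) * Real.exp (-A * y ^ 2) * besselF α (B * y ^ 2)| ≤ C := by
  have hη : 0 < A₀ / 2 / (|B₀| + 1) := by positivity
  obtain ⟨C, hC, h⟩ := exists_besselF_le_exp hα hη
  refine ⟨j.factorial * (2 / A₀) ^ j * C, fun A hA B hB y => ?_⟩
  have hw : 0 ≤ B * y ^ 2 := mul_nonneg hB.1 (sq_nonneg y)
  rw [abs_of_nonneg (mul_nonneg (mul_nonneg (by rw [pow_mul]; positivity) (Real.exp_pos _).le)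
    (besselF_nonneg hα hw))]
  have h1 : y ^ (2 * j) ≤ j.factorial * (2 / A₀) ^ j * Real.exp (A₀ / 2 * y ^ 2) := by
    have := Real.pow_div_factorial_le_exp (A₀ / 2 * y ^ 2) (by positivity) j
    rw [div_le_iff₀ (by positivity), mul_pow, ← pow_mul] at this
    have h2 : (2 / A₀) ^ j * (A₀ / 2) ^ j = 1 := by
      rw [← mul_pow, show 2 / A₀ * (A₀ / 2) = 1 by field_simp, one_pow]
    have h3 := mul_le_mul_of_nonneg_left this (by positivity : 0 ≤ (2 / A₀) ^ j)
    rw [← mul_assoc, h2, one_mul] at h3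
    linarith
  have h2 : besselF α (B * y ^ 2) ≤ C * Real.exp (A₀ / 2 * y ^ 2) := by
    refine (h _ hw).trans ?_
    have : A₀ / 2 / (|B₀| + 1) * (B * y ^ 2) ≤ A₀ / 2 * y ^ 2 := by
      have hB' : B ≤ |B₀| + 1 := by linarith [hB.2, le_abs_self B₀]
      calc A₀ / 2 / (|B₀| + 1) * (B * y ^ 2)
          ≤ A₀ / 2 / (|B₀| + 1) * ((|B₀| + 1) * y ^ 2) := by gcongr
        _ = _ := by field_simp
    gcongr
  calc y ^ (2 * j) * Real.exp (-A * y ^ 2) * besselF α (B * y ^ 2)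
      ≤ (j.factorial * (2 / A₀) ^ j * Real.exp (A₀ / 2 * y ^ 2)) * Real.exp (-A₀ * y ^ 2)
        * (C * Real.exp (A₀ / 2 * y ^ 2)) := by
        have := besselF_nonneg hα hw
        gcongr
    _ = j.factorial * (2 / A₀) ^ j * C * Real.exp (A₀ / 2 * y ^ 2 + -A₀ * y ^ 2 + A₀ / 2 * y ^ 2) := by
        rw [Real.exp_add, Real.exp_add]; ring
    _ = _ := by
        rw [show A₀ / 2 * y ^ 2 + -A₀ * y ^ 2 + A₀ / 2 * y ^ 2 = 0 by ring, Real.exp_zero, mul_one]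

end

/-! ### Integrals of `besselF` against a measure -/

/-- `∫ y^(2j) exp(-A y²) F_α(B y²) φ(y) dμ(y)`. -/
def besselInt (μ : Measure ℝ) (φ : ℝ → ℝ) (j : ℕ) (α A B : ℝ) : ℝ :=
  ∫ y, y ^ (2 * j) * Real.exp (-A * y ^ 2) * besselF α (B * y ^ 2) * φ y ∂μ

section
variable {μ : Measure ℝ} {φ : ℝ → ℝ} {α : ℝ}

lemma aestronglyMeasurable_besselInt (hα : -1 < α) (hφ : Integrable φ μ) (j : ℕ) (A B : ℝ) :
    AEStronglyMeasurable (fun y => y ^ (2 * j) * Real.exp (-A * y ^ 2) * besselF α (B * y ^ 2) * φ y)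
      μ := by
  have := continuous_besselF hα
  exact (Continuous.aestronglyMeasurable (by fun_prop)).mul hφ.aestronglyMeasurable

lemma integrable_besselInt (hα : -1 < α) (hφ : Integrable φ μ) (j : ℕ) {A B : ℝ} (hA : 0 < A)
    (hB : 0 ≤ B) :
    Integrable (fun y => y ^ (2 * j) * Real.exp (-A * y ^ 2) * besselF α (B * y ^ 2) * φ y) μ := by
  obtain ⟨C, hC⟩ := exists_pow_mul_exp_mul_besselF_le hα j hA B
  refine (hφ.abs.const_mul C).mono' (aestronglyMeasurable_besselInt hα hφ j A B)
    (Eventually.of_forall fun y => ?_)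
  rw [norm_mul]
  exact mul_le_mul_of_nonneg_right (hC A le_rfl B ⟨hB, le_rfl⟩ y) (abs_nonneg _)

lemma besselInt_recursion (hα : -1 < α) (hφ : Integrable φ μ) (j : ℕ) {A B : ℝ} (hA : 0 < A)
    (hB : 0 ≤ B) : besselInt μ φ j α A B
      = B * besselInt μ φ (j + 1) (α + 2) A B + (α + 1) * besselInt μ φ j (α + 1) A B := by
  unfold besselInt
  rw [← integral_const_mul, ← integral_const_mul, ← integral_add
    ((integrable_besselInt (by linarith) hφ _ hA hB).const_mul _)
    ((integrable_besselInt (by linarith) hφ _ hA hB).const_mul _)]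
  refine integral_congr_ae (Eventually.of_forall fun y => ?_)
  show _ * _ = _
  rw [besselF_eq hα]
  ring

lemma continuousOn_besselInt (hα : -1 < α) (hφ : Integrable φ μ) (j : ℕ) :
    ContinuousOn (fun z : ℝ × ℝ => besselInt μ φ j α z.1 z.2) (Ioi 0 ×ˢ Ici 0) := by
  rintro ⟨A₁, B₁⟩ ⟨hA, hB⟩
  have hA' : 0 < A₁ := hA
  obtain ⟨C, hC⟩ := exists_pow_mul_exp_mul_besselF_le hα j (half_pos hA') (B₁ + 1)
  unfold besselInt
  refine continuousWithinAt_of_dominated (bound := fun y => C * |φ y|)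
    (Eventually.of_forall fun z => aestronglyMeasurable_besselInt hα hφ j z.1 z.2) ?_
    (hφ.abs.const_mul C) (Eventually.of_forall fun y => ?_)
  · have h1 : ∀ᶠ z : ℝ × ℝ in 𝓝[Ioi 0 ×ˢ Ici 0] (A₁, B₁), A₁ / 2 < z.1 :=
      (continuous_fst.continuousAt.eventually (lt_mem_nhds (by show A₁ / 2 < A₁; linarith))).filter_mono
        nhdsWithin_le_nhds
    have h2 : ∀ᶠ z : ℝ × ℝ in 𝓝[Ioi 0 ×ˢ Ici 0] (A₁, B₁), z.2 < B₁ + 1 :=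
      (continuous_snd.continuousAt.eventually (gt_mem_nhds (by show B₁ < B₁ + 1; linarith))).filter_mono
        nhdsWithin_le_nhds
    filter_upwards [h1, h2, self_mem_nhdsWithin] with z z1 z2 z3
    refine Eventually.of_forall fun y => ?_
    rw [norm_mul]
    exact mul_le_mul_of_nonneg_right (hC z.1 z1.le z.2 ⟨z3.2, z2.le⟩ y) (abs_nonneg _)
  · have := continuous_besselF hα
    exact Continuous.continuousWithinAt (by fun_prop)

/-- The derivative of `besselInt` along a curve of parameters. -/
lemma hasDerivAt_besselInt (hα : -1 < α) (hφ : Integrable φ μ) (j : ℕ) {A B A' B' : ℝ → ℝ}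
    (hA : ∀ τ > 0, HasDerivAt A (A' τ) τ) (hB : ∀ τ > 0, HasDerivAt B (B' τ) τ)
    (hA' : ContinuousOn A' (Ioi 0)) (hB' : ContinuousOn B' (Ioi 0)) (hA0 : ∀ τ > 0, 0 < A τ)
    (hB0 : ∀ τ > 0, 0 ≤ B τ) {t : ℝ} (ht : 0 < t) :
    HasDerivAt (fun τ => besselInt μ φ j α (A τ) (B τ))
      (-A' t * besselInt μ φ (j + 1) α (A t) (B t)
        + B' t * besselInt μ φ (j + 1) (α + 1) (A t) (B t)) t := by
  have hsub : Icc (t / 2) (2 * t) ⊆ Ioi 0 := fun y hy => (half_pos ht).trans_le hy.1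
  have hne : (Icc (t / 2) (2 * t)).Nonempty := ⟨t, by linarith, by linarith⟩
  have cA : ContinuousOn A (Icc (t / 2) (2 * t)) := fun τ hτ =>
    (hA τ (hsub hτ)).continuousAt.continuousWithinAt
  have cB : ContinuousOn B (Icc (t / 2) (2 * t)) := fun τ hτ =>
    (hB τ (hsub hτ)).continuousAt.continuousWithinAt
  -- The smallest `A` and the largest `B` on a compact interval of parameters give one majorant for
  -- all of them.
  obtain ⟨τ₁, hτ₁, hmin⟩ := isCompact_Icc.exists_isMinOn hne cA
  obtain ⟨τ₂, hτ₂, hmax⟩ := isCompact_Icc.exists_isMaxOn hne cB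
  obtain ⟨M₁, hM₁⟩ := isCompact_Icc.exists_bound_of_continuousOn (hA'.mono hsub)
  obtain ⟨M₂, hM₂⟩ := isCompact_Icc.exists_bound_of_continuousOn (hB'.mono hsub)
  obtain ⟨C₁, hC₁⟩ := exists_pow_mul_exp_mul_besselF_le hα (j + 1) (hA0 τ₁ (hsub hτ₁)) (B τ₂)
  obtain ⟨C₂, hC₂⟩ := exists_pow_mul_exp_mul_besselF_le (α := α + 1) (by linarith) (j + 1)
    (hA0 τ₁ (hsub hτ₁)) (B τ₂)
  have hi : ∀ α', -1 < α' → Integrable (fun y => y ^ (2 * (j + 1)) * Real.exp (-A t * y ^ 2) *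
      besselF α' (B t * y ^ 2) * φ y) μ := fun α' h =>
    integrable_besselInt h hφ (j + 1) (hA0 t ht) (hB0 t ht)
  have e : -A' t * besselInt μ φ (j + 1) α (A t) (B t)
        + B' t * besselInt μ φ (j + 1) (α + 1) (A t) (B t)
      = ∫ y, (-A' t * (y ^ (2 * (j + 1)) * Real.exp (-A t * y ^ 2) * besselF α (B t * y ^ 2))
        + B' t * (y ^ (2 * (j + 1)) * Real.exp (-A t * y ^ 2) * besselF (α + 1) (B t * y ^ 2)))
        * φ y ∂μ := by
    unfold besselInt
    rw [← integral_const_mul, ← integral_const_mul, ← integral_add ((hi α hα).const_mul _)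
      ((hi (α + 1) (by linarith)).const_mul _)]
    refine integral_congr_ae (Eventually.of_forall fun y => ?_)
    beta_reduce
    ring
  rw [e]
  unfold besselInt
  refine (hasDerivAt_integral_of_dominated_loc_of_deriv_le (μ := μ) (s := Ioo (t / 2) (2 * t))
    (F := fun τ y => y ^ (2 * j) * Real.exp (-A τ * y ^ 2) * besselF α (B τ * y ^ 2) * φ y)
    (F' := fun τ y =>
      (-A' τ * (y ^ (2 * (j + 1)) * Real.exp (-A τ * y ^ 2) * besselF α (B τ * y ^ 2))
        + B' τ * (y ^ (2 * (j + 1)) * Real.exp (-A τ * y ^ 2) * besselF (α + 1) (B τ * y ^ 2)))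
        * φ y)
    (bound := fun y => (M₁ * C₁ + M₂ * C₂) * |φ y|)
    (Ioo_mem_nhds (by linarith) (by linarith))
    (Eventually.of_forall fun τ => aestronglyMeasurable_besselInt hα hφ j _ _)
    (integrable_besselInt hα hφ j (hA0 t ht) (hB0 t ht)) ?_ ?_ (hφ.abs.const_mul _) ?_).2
  · have c1 := continuous_besselF hα
    have c2 := continuous_besselF (α := α + 1) (by linarith)
    exact (Continuous.aestronglyMeasurable (by fun_prop)).mul hφ.aestronglyMeasurable
  · refine Eventually.of_forall fun y τ hτ => ?_
    have hτ' := Ioo_subset_Icc_self hτ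
    have hm : A τ₁ ≤ A τ := hmin hτ'
    have hM : B τ ≤ B τ₂ := hmax hτ'
    have b1 := hC₁ (A τ) hm (B τ) ⟨hB0 τ (hsub hτ'), hM⟩ y
    have b2 := hC₂ (A τ) hm (B τ) ⟨hB0 τ (hsub hτ'), hM⟩ y
    rw [norm_mul]
    refine mul_le_mul_of_nonneg_right ((norm_add_le _ _).trans ?_) (abs_nonneg _)
    rw [norm_mul (-A' τ), norm_mul (B' τ), norm_neg]
    refine add_le_add (mul_le_mul (hM₁ τ hτ') b1 (abs_nonneg _)
      ((norm_nonneg _).trans (hM₁ τ hτ'))) (mul_le_mul (hM₂ τ hτ') b2 (abs_nonneg _)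
      ((norm_nonneg _).trans (hM₂ τ hτ')))
  · refine Eventually.of_forall fun y τ hτ => ?_
    have hτ0 := hsub (Ioo_subset_Icc_self hτ)
    have d1 := (((hA τ hτ0).neg.mul_const (y ^ 2)).exp).const_mul (y ^ (2 * j))
    have d2 := (hasDerivAt_besselF hα (B τ * y ^ 2)).comp τ ((hB τ hτ0).mul_const (y ^ 2))
    refine ((d1.fun_mul d2).mul_const (φ y)).congr_deriv ?_
    simp only [Function.comp_apply, Pi.neg_apply]
    rw [show 2 * (j + 1) = 2 * j + 2 by ring, pow_add]
    ring

end

/-! ### The closed form of the transition density -/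

/-- The coefficient `c(s) = a / (2 (1 - exp(-2as)))` of `-x²` in the exponent of the transition
density. -/
def targetRate (a s : ℝ) : ℝ := a / (2 * (1 - Real.exp (-(2 * a * s))))

/-- The coefficient `c(s) exp(-2as)` of `-y²` in the exponent of the transition density. -/
def sourceRate (a s : ℝ) : ℝ := targetRate a s - a / 2

/-- The order of the Bessel function. -/
def besselOrder (b : ℝ) : ℝ := -(1 / 2 + b / 2)

lemma neg_one_lt_besselOrder {b : ℝ} (hb : b < 1) : -1 < besselOrder b := by
  unfold besselOrder; linarith

section
variable {a b s : ℝ}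

lemma one_sub_exp_pos (ha : 0 < a) (hs : 0 < s) : 0 < 1 - Real.exp (-(2 * a * s)) := by
  have : Real.exp (-(2 * a * s)) < 1 := Real.exp_lt_one_iff.2 (by
    have : 0 < 2 * a * s := by positivity
    linarith)
  linarith

lemma targetRate_pos (ha : 0 < a) (hs : 0 < s) : 0 < targetRate a s := by
  have := one_sub_exp_pos ha hs
  unfold targetRate
  positivity

lemma sourceRate_eq (ha : 0 < a) (hs : 0 < s) :
    sourceRate a s = targetRate a s * Real.exp (-(2 * a * s)) := by
  have := (one_sub_exp_pos ha hs).ne'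
  unfold sourceRate targetRate
  generalize Real.exp (-(2 * a * s)) = E at *
  field_simp
  ring

lemma sourceRate_pos (ha : 0 < a) (hs : 0 < s) : 0 < sourceRate a s := by
  rw [sourceRate_eq ha hs]
  exact mul_pos (targetRate_pos ha hs) (Real.exp_pos _)

/-- Riccati equation: the rates differ by the constant a/2 and so have the same derivative -4cA.
This relation makes the Gaussian factors compatible with the Fokker-Planck equation. -/
lemma hasDerivAt_targetRate (ha : 0 < a) (hs : 0 < s) :
    HasDerivAt (targetRate a) (-4 * targetRate a s * sourceRate a s) s := by
  have h0 := (one_sub_exp_pos ha hs).ne'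
  have h1 : HasDerivAt (fun s => 2 * (1 - Real.exp (-(2 * a * s))))
      (2 * -(Real.exp (-(2 * a * s)) * -(2 * a * 1))) s :=
    ((((hasDerivAt_id s).const_mul (2 * a)).neg.exp).const_sub 1).const_mul 2
  have h2 := (h1.fun_inv (mul_ne_zero two_ne_zero h0)).const_mul a
  refine (h2.congr_deriv ?_).congr_of_eventuallyEq (Eventually.of_forall fun y => ?_)
  · rw [sourceRate_eq ha hs, targetRate]
    field_simp
    ring
  · rw [targetRate, div_eq_mul_inv]

lemma hasDerivAt_sourceRate (ha : 0 < a) (hs : 0 < s) :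
    HasDerivAt (sourceRate a) (-4 * targetRate a s * sourceRate a s) s :=
  (hasDerivAt_targetRate ha hs).sub_const _

lemma continuousOn_targetRate (ha : 0 < a) : ContinuousOn (targetRate a) (Ioi 0) := fun _ hs =>
  (hasDerivAt_targetRate ha hs).continuousAt.continuousWithinAt

lemma continuousOn_sourceRate (ha : 0 < a) : ContinuousOn (sourceRate a) (Ioi 0) := fun _ hs =>
  (hasDerivAt_sourceRate ha hs).continuousAt.continuousWithinAt

end

lemma besselI_eq {α z : ℝ} (hz : 0 < z) :
    besselI α z = (z / 2) ^ α * besselF α ((z / 2) ^ 2) := by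
  have hz2 : 0 < z / 2 := by positivity
  unfold besselI besselF besselCoeff
  rw [← tsum_mul_left]
  refine tsum_congr fun m => ?_
  rw [Real.rpow_add hz2, ← pow_mul, show (2 * (m : ℝ)) = ((2 * m : ℕ) : ℝ) by push_cast; ring,
    Real.rpow_natCast]
  ring

/-- With κ = a / (4 sinh(at)) the rates are κ e^(at) and κ e^(-at), so their product is κ². Half the
Bessel argument is κxy, and the exponent splits into a Gaussian in x and one in y. -/
lemma transitionDensity_eq {a b x t y : ℝ} (ha : 0 < a) (hx : 0 < x) (ht : 0 < t) (hy : 0 < y) :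
    transitionDensity a b x t y
      = 2 * targetRate a t ^ (1 + besselOrder b) * x ^ (-b) * Real.exp (-targetRate a t * x ^ 2)
        * (Real.exp (-sourceRate a t * y ^ 2)
          * besselF (besselOrder b) (targetRate a t * sourceRate a t * x ^ 2 * y ^ 2)) := by
  have hat : 0 < a * t := by positivity
  set σ := Real.sinh (a * t) with hσ
  have hσ0 : 0 < σ := Real.sinh_pos_iff.2 hat
  set κ := a / (4 * σ) with hκ
  have hκ0 : 0 < κ := by positivity
  have hE := one_sub_exp_pos ha ht
  have e1 : 1 - Real.exp (-(2 * a * t)) = 2 * Real.exp (-(a * t)) * σ := by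
    rw [hσ, Real.sinh_eq, show -(2 * a * t) = -(a * t) + -(a * t) by ring, Real.exp_add]
    have : Real.exp (-(a * t)) * Real.exp (a * t) = 1 := by rw [← Real.exp_add]; simp
    linear_combination -this
  have hc : targetRate a t = κ * Real.exp (a * t) := by
    rw [targetRate, e1, hκ, Real.exp_neg]
    field_simp
    norm_num
  have hA : sourceRate a t = κ * Real.exp (-(a * t)) := by
    rw [sourceRate_eq ha ht, hc, mul_assoc, ← Real.exp_add]
    ring_nf
  have hcA : targetRate a t * sourceRate a t = κ ^ 2 := by
    rw [hc, hA]
    have : Real.exp (a * t) * Real.exp (-(a * t)) = 1 := by rw [← Real.exp_add]; simp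
    linear_combination κ ^ 2 * this
  have hsq : √(4 * σ ^ 2) = 2 * σ := by
    rw [show 4 * σ ^ 2 = (2 * σ) ^ 2 by ring, Real.sqrt_sq (by positivity)]
  have hq : (4 * σ ^ 2) ^ (1 / 4 : ℝ) = (2 * σ) ^ (1 / 2 : ℝ) := by
    rw [show 4 * σ ^ 2 = (2 * σ) ^ (2 : ℝ) by rw [Real.rpow_two]; ring, ← Real.rpow_mul (by positivity)]
    norm_num
  have hexp : -(a / 4 * (Real.cosh (a * t) / σ) * x ^ 2) - a * x ^ 2 / 4
      + a * y ^ 2 / (2 * (1 - Real.exp (2 * a * t)))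
      = -targetRate a t * x ^ 2 + -sourceRate a t * y ^ 2 := by
    have h1 : a / 4 * (Real.cosh (a * t) / σ) + a / 4 = targetRate a t := by
      have : Real.cosh (a * t) + σ = Real.exp (a * t) := Real.cosh_add_sinh _
      rw [hc, hκ, ← this]
      field_simp
    have h2 : a / (2 * (1 - Real.exp (2 * a * t))) = -sourceRate a t := by
      rw [hA, hκ]
      have : 1 - Real.exp (2 * a * t) = -(2 * Real.exp (a * t) * σ) := by
        rw [hσ, Real.sinh_eq, show 2 * a * t = a * t + a * t by ring, Real.exp_add]
        have : Real.exp (a * t) * Real.exp (-(a * t)) = 1 := by rw [← Real.exp_add]; simp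
        linear_combination -this
      rw [this, Real.exp_neg]
      field_simp
      norm_num
    linear_combination -x ^ 2 * h1 + y ^ 2 * h2
  have hz : 0 < a * y * (x / (2 * σ)) := by positivity
  have hz2 : a * y * (x / (2 * σ)) / 2 = κ * (x * y) := by rw [hκ]; field_simp; norm_num
  have harg : targetRate a t * sourceRate a t * x ^ 2 * y ^ 2 = (κ * (x * y)) ^ 2 := by
    rw [hcA]; ring
  unfold transitionDensity
  have hord : -(1 / 2 + b / 2) = besselOrder b := rfl
  simp only [← hσ, hsq, hq, hexp, hord]
  rw [besselI_eq hz, hz2, harg, Real.exp_add]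
  have hpow : a * y ^ (1 / 2 : ℝ) * (x / y) ^ (-b / 2) * (x / (2 * σ)) ^ (1 / 2 : ℝ)
      * (κ * (x * y)) ^ besselOrder b * (Real.exp (2 * a * (1 - b) * t / 4) / (2 * σ) ^ (1 / 2 : ℝ))
      = 2 * targetRate a t ^ (1 + besselOrder b) * x ^ (-b) := by
    have h2σ : (2 * σ) ^ (1 / 2 : ℝ) * (2 * σ) ^ (1 / 2 : ℝ) = 2 * σ := by
      rw [← Real.rpow_add (by positivity)]; norm_num
    have ha2 : a = 2 * κ * (2 * σ) := by rw [hκ]; field_simp; norm_num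
    rw [hc, Real.mul_rpow hκ0.le (Real.exp_pos _).le, ← Real.exp_mul, Real.div_rpow hx.le hy.le,
      Real.div_rpow hx.le (by positivity), Real.mul_rpow hκ0.le (by positivity),
      Real.mul_rpow hx.le hy.le, Real.rpow_add hκ0, Real.rpow_one,
      show 2 * a * (1 - b) * t / 4 = a * t * (1 + besselOrder b) by unfold besselOrder; ring]
    have hxx : x ^ (-b) = x ^ (-b / 2) * x ^ (1 / 2 : ℝ) * x ^ besselOrder b := by
      rw [← Real.rpow_add hx, ← Real.rpow_add hx]
      congr 1
      unfold besselOrder; ring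
    have hyy : y ^ (1 / 2 : ℝ) * y ^ besselOrder b = y ^ (-b / 2) := by
      rw [← Real.rpow_add hy]
      congr 1
      unfold besselOrder; ring
    have hy0 : y ^ (-b / 2) ≠ 0 := (Real.rpow_pos_of_pos hy _).ne'
    rw [hxx]
    have hs0 : (2 * σ) ^ (1 / 2 : ℝ) ≠ 0 := (Real.rpow_pos_of_pos (by positivity) _).ne'
    rw [← hyy] at hy0 ⊢
    have hy1 := left_ne_zero_of_mul hy0
    have hy2 := right_ne_zero_of_mul hy0
    nth_rewrite 1 [ha2, ← h2σ]
    field_simp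
  rw [← hpow]
  ring

/-! ### Superpositions of transition densities -/

/-- `∫ p(x,s|y) φ(y) dμ(y)` in terms of `besselInt`. -/
def fpSolution (μ : Measure ℝ) (φ : ℝ → ℝ) (a b x s : ℝ) : ℝ :=
  2 * targetRate a s ^ (1 + besselOrder b) * x ^ (-b) * Real.exp (-targetRate a s * x ^ 2)
    * besselInt μ φ 0 (besselOrder b) (sourceRate a s) (targetRate a s * sourceRate a s * x ^ 2)

lemma transitionDensity_eq_fpSolution {a b x t y : ℝ} (ha : 0 < a) (hx : 0 < x) (ht : 0 < t)
    (hy : 0 < y) :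
    transitionDensity a b x t y = fpSolution (Measure.dirac y) (fun _ => 1) a b x t := by
  rw [transitionDensity_eq ha hx ht hy, fpSolution, besselInt, integral_dirac]
  simp

lemma greenSolution_eq_fpSolution {a b x t : ℝ} (φ : ℝ → ℝ) (ha : 0 < a) (hx : 0 < x)
    (ht : 0 < t) :
    greenSolution a b φ x t = fpSolution (volume.restrict (Ioi 0)) φ a b x t := by
  rw [greenSolution, fpSolution, besselInt, ← integral_const_mul]
  refine setIntegral_congr_fun measurableSet_Ioi fun y hy => ?_
  show _ * _ = _
  rw [transitionDensity_eq ha hx ht hy]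
  ring

/-- One computation serves p itself, with μ a Dirac mass, and u, with μ Lebesgue measure. Since a =
2(c - A) and the terms in b/x cancel, the flux of the product Q J is 2AxQ times (c J₁ - J₀), in
which J₁ has order α + 1. The recurrence then identifies the space derivative of the flux with the
time derivative of the solution. -/
theorem exists_isFluxSolution_fpSolution {a b : ℝ} (ha : 0 < a) (hb : b < 1) {μ : Measure ℝ}
    {φ : ℝ → ℝ} (hφ : Integrable φ μ) : ∃ w S, IsFluxSolution a b (fpSolution μ φ a b) w S := by
  set α := besselOrder b with hα
  have hα1 : -1 < α := neg_one_lt_besselOrder hb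
  have hbα : b = -1 - 2 * α := by rw [hα, besselOrder]; ring
  set c := targetRate a with hc
  set A := sourceRate a with hA
  have c0 : ∀ s > 0, 0 < c s := fun s hs => targetRate_pos ha hs
  have A0 : ∀ s > 0, 0 < A s := fun s hs => sourceRate_pos ha hs
  have dc : ∀ s > 0, HasDerivAt c (-4 * c s * A s) s := fun s hs => hasDerivAt_targetRate ha hs
  have dA : ∀ s > 0, HasDerivAt A (-4 * c s * A s) s := fun s hs => hasDerivAt_sourceRate ha hs
  have cc : ContinuousOn c (Ioi 0) := continuousOn_targetRate ha
  have cA : ContinuousOn A (Ioi 0) := continuousOn_sourceRate ha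
  have hcA : ∀ s, c s - A s = a / 2 := fun s => by rw [hA, sourceRate]; ring
  set Q : ℝ → ℝ → ℝ := fun x s => 2 * c s ^ (1 + α) * x ^ (-b) * Real.exp (-c s * x ^ 2) with hQ
  set J : ℕ → ℝ → ℝ → ℝ → ℝ := fun j α' x s => besselInt μ φ j α' (A s) (c s * A s * x ^ 2) with hJ
  have hu : fpSolution μ φ a b = fun x s => Q x s * J 0 α x s := rfl
  have B0 : ∀ x s, 0 < s → 0 ≤ c s * A s * x ^ 2 := fun x s hs =>
    mul_nonneg (mul_pos (c0 s hs) (A0 s hs)).le (sq_nonneg x)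
  have cQ : ContinuousOn (Function.uncurry Q) (Ioi 0 ×ˢ Ioi 0) := by
    have k1 : ContinuousOn (fun z : ℝ × ℝ => c z.2) (Ioi 0 ×ˢ Ioi 0) :=
      cc.comp continuousOn_snd fun z hz => hz.2
    have k2 : ContinuousOn (fun z : ℝ × ℝ => c z.2 ^ (1 + α)) (Ioi 0 ×ˢ Ioi 0) :=
      k1.rpow_const fun z hz => Or.inl (c0 z.2 hz.2).ne'
    have k3 : ContinuousOn (fun z : ℝ × ℝ => z.1 ^ (-b)) (Ioi 0 ×ˢ Ioi 0) :=
      continuousOn_fst.rpow_const fun z hz => Or.inl (ne_of_gt hz.1)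
    exact ((continuousOn_const.mul k2).mul k3).mul (k1.neg.mul (by fun_prop)).rexp
  have cJ : ∀ j α', -1 < α' → ContinuousOn (Function.uncurry (J j α')) (Ioi 0 ×ˢ Ioi 0) := by
    intro j α' h
    have k1 : ContinuousOn (fun z : ℝ × ℝ => c z.2) (Ioi 0 ×ˢ Ioi 0) :=
      cc.comp continuousOn_snd fun z hz => hz.2
    have k2 : ContinuousOn (fun z : ℝ × ℝ => A z.2) (Ioi 0 ×ˢ Ioi 0) :=
      cA.comp continuousOn_snd fun z hz => hz.2
    have k3 : ContinuousOn (fun z : ℝ × ℝ => c z.2 * A z.2 * z.1 ^ 2) (Ioi 0 ×ˢ Ioi 0) :=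
      (k1.mul k2).mul (by fun_prop)
    exact (continuousOn_besselInt h hφ j).comp (f := fun z : ℝ × ℝ =>
      (A z.2, c z.2 * A z.2 * z.1 ^ 2)) (k2.prodMk k3) fun z hz => ⟨A0 z.2 hz.2, B0 z.1 z.2 hz.2⟩
  have dJx : ∀ j α', -1 < α' → ∀ x > 0, ∀ s > 0, HasDerivAt (fun x => J j α' x s)
      (2 * c s * A s * x * J (j + 1) (α' + 1) x s) x := by
    intro j α' h x hx s hs
    have := hasDerivAt_besselInt h hφ j (A := fun _ => A s) (B := fun x => c s * A s * x ^ 2)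
      (A' := fun _ => 0) (B' := fun x => c s * A s * (2 * x)) (fun τ _ => hasDerivAt_const τ _)
      (fun τ _ => by simpa using (hasDerivAt_pow 2 τ).const_mul (c s * A s)) (by fun_prop)
      (by fun_prop) (fun _ _ => A0 s hs) (fun τ _ => B0 τ s hs) hx
    refine this.congr_deriv ?_
    simp only [hJ]
    ring
  have dJs : ∀ x > 0, ∀ s > 0, HasDerivAt (fun s => J 0 α x s)
      (4 * c s * A s * (J 1 α x s - (c s + A s) * x ^ 2 * J 1 (α + 1) x s)) s := by
    intro x hx s hs
    have := hasDerivAt_besselInt hα1 hφ 0 (A := A) (B := fun s => c s * A s * x ^ 2)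
      (A' := fun s => -4 * c s * A s)
      (B' := fun s => (-4 * c s * A s * A s + c s * (-4 * c s * A s)) * x ^ 2) dA
      (fun τ hτ => ((dc τ hτ).fun_mul (dA τ hτ)).mul_const (x ^ 2)) (by fun_prop) (by fun_prop)
      A0 (fun τ hτ => B0 x τ hτ) hs
    refine this.congr_deriv ?_
    simp only [hJ, zero_add]
    ring
  have dQx : ∀ x > 0, ∀ s, HasDerivAt (fun x => Q x s) (Q x s * (-b / x - 2 * c s * x)) x := by
    intro x hx s
    have h1 := Real.hasDerivAt_rpow_const (x := x) (p := -b) (Or.inl hx.ne')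
    have h2 := ((hasDerivAt_pow 2 x).const_mul (-c s)).exp
    refine (((h1.const_mul (2 * c s ^ (1 + α))).fun_mul h2)).congr_deriv ?_
    rw [Real.rpow_sub_one hx.ne']
    simp only [hQ]
    push_cast
    ring
  have dQs : ∀ x, ∀ s > 0, HasDerivAt (fun s => Q x s)
      (Q x s * (-4 * A s * (1 + α - c s * x ^ 2))) s := by
    intro x s hs
    have h1 := (dc s hs).rpow_const (p := 1 + α) (Or.inl (c0 s hs).ne')
    have h2 := ((dc s hs).fun_neg.mul_const (x ^ 2)).exp
    refine (((h1.const_mul 2).mul_const (x ^ (-b))).fun_mul h2).congr_deriv ?_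
    have := (c0 s hs).ne'
    rw [Real.rpow_sub_one this]
    simp only [hQ]
    field_simp
    ring
  refine ⟨fun x s => 2 * A s * x * Q x s * (c s * J 1 (α + 1) x s - J 0 α x s),
    fun x s => Q x s * (-4 * A s * (1 + α - c s * x ^ 2)) * J 0 α x s
      + Q x s * (4 * c s * A s * (J 1 α x s - (c s + A s) * x ^ 2 * J 1 (α + 1) x s)),
    ⟨?_, ?_, ?_, ?_, ?_⟩⟩
  · intro x hx s hs
    rw [hu]
    refine ((dQx x hx s).fun_mul (dJx 0 α hα1 x hx s hs)).congr_deriv ?_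
    simp only [zero_add, force]
    have : a = 2 * (c s - A s) := by rw [hcA]; ring
    rw [this]
    ring
  · intro x hx s hs
    -- Differentiation in x raises the order to α + 2 while the time derivative contains order α;
    -- the recurrence reconciles the two.
    have hrec : J 1 α x s = c s * A s * x ^ 2 * J 2 (α + 2) x s + (α + 1) * J 1 (α + 1) x s :=
      besselInt_recursion hα1 hφ 1 (A0 s hs) (B0 x s hs)
    have d2 := dJx 1 (α + 1) (by linarith) x hx s hs
    rw [show α + 1 + 1 = α + 2 by ring] at d2
    have d := (((hasDerivAt_id x).const_mul (2 * A s)).fun_mul (dQx x hx s)).fun_mul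
      ((d2.const_mul (c s)).fun_sub (dJx 0 α hα1 x hx s hs))
    refine d.congr_deriv ?_
    have hbx : -b / x * x = 1 + 2 * α := by
      rw [div_mul_cancel₀ _ hx.ne']
      linarith
    rw [hrec]
    simp only [id_eq, zero_add]
    linear_combination 2 * A s * Q x s * (c s * J 1 (α + 1) x s - J 0 α x s) * hbx
  · intro x hx s hs
    rw [hu]
    exact (dQs x s hs).fun_mul (dJs x hx s hs)
  · exact cQ.mul (cJ 0 α hα1)
  · have k1 : ContinuousOn (fun z : ℝ × ℝ => c z.2) (Ioi 0 ×ˢ Ioi 0) :=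
      cc.comp continuousOn_snd fun z hz => hz.2
    have k2 : ContinuousOn (fun z : ℝ × ℝ => A z.2) (Ioi 0 ×ˢ Ioi 0) :=
      cA.comp continuousOn_snd fun z hz => hz.2
    have k3 : ContinuousOn (fun z : ℝ × ℝ => z.1 ^ 2) (Ioi 0 ×ˢ Ioi 0) := by fun_prop
    exact ((cQ.mul ((continuousOn_const.mul k2).mul (continuousOn_const.sub (k1.mul k3)))).mul
      (cJ 0 α hα1)).add (cQ.mul (((continuousOn_const.mul k1).mul k2).mul ((cJ 1 α hα1).sub
      (((k1.add k2).mul k3).mul (cJ 1 (α + 1) (by linarith))))))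

/-! ### Weber's integral -/

section
variable {α : ℝ}

/-- A form of the Chu-Vandermonde identity. -/
lemma sum_descFactorial_mul_besselCoeff (hα : -1 < α) (i j : ℕ) :
    ∑ k ∈ Finset.range (i + 1), (i.descFactorial k : ℝ) * j.descFactorial k * besselCoeff α k
      = Real.Gamma (i + j + α + 1) / (Real.Gamma (i + α + 1) * Real.Gamma (j + α + 1)) := by
  induction j with
  | zero =>
    have hi := (Gamma_nat_add_pos hα i).ne'
    rw [Finset.sum_eq_single 0]
    · simp only [Nat.descFactorial_zero, Nat.cast_one, besselCoeff, Nat.factorial_zero,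
        Nat.cast_zero, zero_add, add_zero, one_mul]
      field_simp
    · intro k _ hk
      rw [Nat.descFactorial_eq_zero_iff_lt.2 (Nat.pos_of_ne_zero hk)]
      simp
    · simp
  | succ j ih =>
    set T : ℕ → ℕ → ℝ := fun j k =>
      (i.descFactorial k : ℝ) * j.descFactorial k * besselCoeff α k with hT
    have hj : (0 : ℝ) < j + α + 1 := by have : (0 : ℝ) ≤ j := j.cast_nonneg; linarith
    have hij : (0 : ℝ) < i + j + α + 1 := by have : (0 : ℝ) ≤ i := i.cast_nonneg; linarith
    have hcast : ∀ n k : ℕ, (n.descFactorial (k + 1) : ℝ) = (n - k) * n.descFactorial k := by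
      intro n k
      rw [Nat.descFactorial_succ]
      rcases le_or_gt k n with h | h
      · push_cast [Nat.cast_sub h]; rfl
      · rw [Nat.descFactorial_eq_zero_iff_lt.2 h]; simp
    -- Creative telescoping: with certificate k(k+α) T(j+1,k)/(j+1), the summand satisfies a
    -- first-order recurrence in j up to a difference in k.
    have htel : ∀ k : ℕ, (j + α + 1) * T (j + 1) k - (i + j + α + 1) * T j k
        = -((((k + 1 : ℕ) : ℝ) * (((k + 1 : ℕ) : ℝ) + α) * T (j + 1) (k + 1) / (j + 1))
          - (k * (k + α) * T (j + 1) k / (j + 1))) := by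
      intro k
      have h1 : ((j : ℝ) + 1) * T j k = (j + 1 - k) * T (j + 1) k := by
        have := hcast (j + 1) k
        rw [Nat.succ_descFactorial_succ] at this
        push_cast at this
        simp only [hT]
        linear_combination (i.descFactorial k : ℝ) * besselCoeff α k * this
      have h2 : ((k + 1 : ℕ) : ℝ) * (((k + 1 : ℕ) : ℝ) + α) * T (j + 1) (k + 1)
          = (i - k) * (j + 1 - k) * T (j + 1) k := by
        simp only [hT]
        rw [hcast i k, hcast (j + 1) k, ← besselCoeff_succ hα k]
        push_cast
        ring
      rw [h2]
      have hj1 : (j : ℝ) + 1 ≠ 0 := by positivity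
      field_simp
      linear_combination -(i + j + α + 1) * h1
    have hsum : ∑ k ∈ Finset.range (i + 1), ((j + α + 1) * T (j + 1) k - (i + j + α + 1) * T j k)
        = 0 := by
      -- The telescoped sum vanishes at k = 0 by the factor k, and at k = i + 1 because
      -- i.descFactorial (i + 1) = 0.
      simp only [htel]
      rw [Finset.sum_neg_distrib, Finset.sum_range_sub
        (fun k : ℕ => (k : ℝ) * (k + α) * T (j + 1) k / (j + 1))]
      simp [hT]
    rw [Finset.sum_sub_distrib, ← Finset.mul_sum, ← Finset.mul_sum, ih] at hsum
    have g1 : Real.Gamma (((j + 1 : ℕ) : ℝ) + α + 1) = (j + α + 1) * Real.Gamma (j + α + 1) := by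
      rw [← Real.Gamma_add_one hj.ne']; push_cast; ring_nf
    have g2 : Real.Gamma (i + ((j + 1 : ℕ) : ℝ) + α + 1)
        = (i + j + α + 1) * Real.Gamma (i + j + α + 1) := by
      rw [← Real.Gamma_add_one hij.ne']; push_cast; ring_nf
    rw [g1, g2]
    have hi := (Gamma_nat_add_pos hα i).ne'
    have hj' := (Gamma_nat_add_pos hα j).ne'
    have : ∑ k ∈ Finset.range (i + 1), T (j + 1) k = (i + j + α + 1) * (Real.Gamma (i + j + α + 1)
        / (Real.Gamma (i + α + 1) * Real.Gamma (j + α + 1))) / (j + α + 1) := by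
      rw [eq_div_iff hj.ne']
      linarith
    rw [this]
    field_simp

lemma hasSum_descFactorial_mul_pow (ξ : ℝ) (k : ℕ) :
    HasSum (fun i : ℕ => (i.descFactorial k : ℝ) * (ξ ^ i / i.factorial)) (ξ ^ k * Real.exp ξ) := by
  rw [← hasSum_nat_add_iff' k]
  have h0 : ∑ i ∈ Finset.range k, (i.descFactorial k : ℝ) * (ξ ^ i / i.factorial) = 0 :=
    Finset.sum_eq_zero fun i hi => by
      rw [Nat.descFactorial_eq_zero_iff_lt.2 (Finset.mem_range.1 hi)]; simp
  rw [h0, sub_zero, Real.exp_eq_exp_ℝ]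
  refine ((NormedSpace.expSeries_div_hasSum_exp (𝔸 := ℝ) ξ).mul_left (ξ ^ k)).of_eq (fun n => ?_) rfl
  have h := Nat.factorial_mul_descFactorial (Nat.le_add_left k n)
  rw [Nat.add_sub_cancel] at h
  have h' : ((n + k).factorial : ℝ) = n.factorial * (n + k).descFactorial k := by
    rw [← h]; push_cast; ring
  have h1 : (n.factorial : ℝ) ≠ 0 := by positivity
  have h2 : ((n + k).descFactorial k : ℝ) ≠ 0 := by
    intro h0
    rw [h0, mul_zero] at h'
    exact (by positivity : ((n + k).factorial : ℝ) ≠ 0) h'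
  rw [h', pow_add]
  field_simp

/-- Expand F_α(ξη) in powers (ξη)^k and each ξ^k e^ξ, η^k e^η in falling factorials. For fixed
powers (i,j) the sum over k is finite and is the Chu-Vandermonde sum. All terms are nonnegative, so
the order of summation is free. -/
lemma hasSum_besselCoeff_mul_besselCoeff (hα : -1 < α) {ξ η : ℝ} (hξ : 0 ≤ ξ) (hη : 0 ≤ η) :
    HasSum (fun p : ℕ × ℕ => besselCoeff α p.1 * besselCoeff α p.2
      * Real.Gamma (p.1 + p.2 + α + 1) * (ξ ^ p.1 * η ^ p.2))
      (Real.exp (ξ + η) * besselF α (ξ * η)) := by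
  set t : ℕ × (ℕ × ℕ) → ℝ := fun z => besselCoeff α z.1 *
    (((z.2.1.descFactorial z.1 : ℝ) * (ξ ^ z.2.1 / z.2.1.factorial))
      * ((z.2.2.descFactorial z.1 : ℝ) * (η ^ z.2.2 / z.2.2.factorial))) with ht
  have ht0 : 0 ≤ t := fun z => by
    have := (besselCoeff_pos hα z.1).le
    show 0 ≤ t z
    simp only [ht]
    positivity
  have hk : ∀ k, HasSum (fun p => t (k, p)) (besselCoeff α k *
      ((ξ ^ k * Real.exp ξ) * (η ^ k * Real.exp η))) := fun k => by
    have s1 := hasSum_descFactorial_mul_pow ξ k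
    have s2 := hasSum_descFactorial_mul_pow η k
    exact (s1.mul s2 (s1.summable.mul_of_nonneg s2.summable (fun i => by positivity)
      (fun i => by positivity))).mul_left _
  have hF : HasSum (fun k => besselCoeff α k * ((ξ ^ k * Real.exp ξ) * (η ^ k * Real.exp η)))
      (Real.exp (ξ + η) * besselF α (ξ * η)) := by
    refine ((summable_besselCoeff hα (ξ * η)).hasSum.mul_left (Real.exp (ξ + η))).of_eq
      (fun k => ?_) rfl
    rw [Real.exp_add, mul_pow]
    ring
  have hs : Summable t := (summable_prod_of_nonneg ht0).2
    ⟨fun k => (hk k).summable, hF.summable.congr fun k => ((hk k).tsum_eq).symm⟩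
  have htot : HasSum t (Real.exp (ξ + η) * besselF α (ξ * η)) := by
    have h1 := hs.hasSum
    rwa [(h1.prod_fiberwise hk).unique hF] at h1
  have hswap := (Equiv.prodComm (ℕ × ℕ) ℕ).hasSum_iff.2 htot
  refine hswap.prod_fiberwise fun p => ?_
  have hz : ∀ k ∉ Finset.range (p.1 + 1), (t ∘ Equiv.prodComm (ℕ × ℕ) ℕ) (p, k) = 0 := by
    intro k hk
    have : p.1 < k := by simpa [Nat.lt_succ_iff] using hk
    simp [ht, Nat.descFactorial_eq_zero_iff_lt.2 this]
  have hfin := hasSum_sum_of_ne_finset_zero (L := SummationFilter.unconditional ℕ) hz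
  refine hfin.of_eq (fun _ => rfl) ?_
  have e := sum_descFactorial_mul_besselCoeff hα p.1 p.2
  have h1 := (Gamma_nat_add_pos hα p.1).ne'
  have h2 := (Gamma_nat_add_pos hα p.2).ne'
  symm
  calc ∑ k ∈ Finset.range (p.1 + 1), (t ∘ Equiv.prodComm (ℕ × ℕ) ℕ) (p, k)
      = (ξ ^ p.1 / p.1.factorial * (η ^ p.2 / p.2.factorial)) *
        ∑ k ∈ Finset.range (p.1 + 1), (p.1.descFactorial k : ℝ) * p.2.descFactorial k
          * besselCoeff α k := by
        rw [Finset.mul_sum]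
        refine Finset.sum_congr rfl fun k _ => ?_
        simp only [ht, Function.comp_apply, Equiv.prodComm_apply, Prod.swap_prod_mk]
        ring
    _ = _ := by
        rw [e]
        unfold besselCoeff
        field_simp

lemma integral_rpow_mul_exp_neg_sq (hα : -1 < α) {P : ℝ} (hP : 0 < P) (n : ℕ) :
    IntegrableOn (fun y : ℝ => 2 * y ^ (1 + 2 * α) * Real.exp (-P * y ^ 2) * (y ^ 2) ^ n) (Ioi 0) ∧
    ∫ y in Ioi (0 : ℝ), 2 * y ^ (1 + 2 * α) * Real.exp (-P * y ^ 2) * (y ^ 2) ^ n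
      = P ^ (-1 - α) * (Real.Gamma (n + α + 1) * P⁻¹ ^ n) := by
  have hn : (0 : ℝ) ≤ n := n.cast_nonneg
  have e : EqOn (fun y : ℝ => 2 * (y ^ (1 + 2 * α + 2 * n) * Real.exp (-P * y ^ (2 : ℝ))))
      (fun y : ℝ => 2 * y ^ (1 + 2 * α) * Real.exp (-P * y ^ 2) * (y ^ 2) ^ n) (Ioi 0) := by
    intro y hy
    have : (y : ℝ) ^ (2 * (n : ℝ)) = (y ^ 2) ^ n := by
      rw [← pow_mul, ← Real.rpow_natCast]; push_cast; rfl
    show 2 * _ = _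
    rw [Real.rpow_two, Real.rpow_add hy, this]
    ring
  refine ⟨IntegrableOn.congr_fun ((integrableOn_rpow_mul_exp_neg_mul_rpow (by linarith) two_pos
    hP).const_mul 2) e measurableSet_Ioi, ?_⟩
  rw [← setIntegral_congr_fun measurableSet_Ioi e, integral_const_mul,
    integral_rpow_mul_exp_neg_mul_rpow two_pos (by linarith) hP,
    show -(1 + 2 * α + 2 * (n : ℝ) + 1) / 2 = (-1 - α) + -(n : ℝ) by ring,
    show (1 + 2 * α + 2 * (n : ℝ) + 1) / 2 = n + α + 1 by ring, Real.rpow_add hP,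
    Real.rpow_neg hP.le, Real.rpow_natCast, inv_pow]
  ring

/-- Weber's second exponential integral. -/
theorem integral_besselF_mul_besselF (hα : -1 < α) {P X Y : ℝ} (hP : 0 < P) (hX : 0 ≤ X)
    (hY : 0 ≤ Y) : ∫ y in Ioi (0 : ℝ), 2 * y ^ (1 + 2 * α) * Real.exp (-P * y ^ 2)
        * (besselF α (X * y ^ 2) * besselF α (Y * y ^ 2))
      = P ^ (-1 - α) * (Real.exp ((X + Y) / P) * besselF α (X * Y / P ^ 2)) := by
  set k : ℕ × ℕ → ℝ := fun p => besselCoeff α p.1 * besselCoeff α p.2 * (X ^ p.1 * Y ^ p.2) with hk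
  have hk0 : ∀ p, 0 ≤ k p := fun p => by
    have := (besselCoeff_pos hα p.1).le
    have := (besselCoeff_pos hα p.2).le
    simp only [hk]
    positivity
  set w : ℝ → ℝ := fun y => 2 * y ^ (1 + 2 * α) * Real.exp (-P * y ^ 2) with hw
  have hint : ∀ p : ℕ × ℕ, Integrable (fun y => w y * (y ^ 2) ^ (p.1 + p.2) * k p)
      (volume.restrict (Ioi 0)) := fun p =>
    (integral_rpow_mul_exp_neg_sq hα hP (p.1 + p.2)).1.mul_const (k p)
  have hval : ∀ p : ℕ × ℕ, ∫ y in Ioi (0 : ℝ), w y * (y ^ 2) ^ (p.1 + p.2) * k p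
      = P ^ (-1 - α) * (besselCoeff α p.1 * besselCoeff α p.2
      * Real.Gamma (p.1 + p.2 + α + 1) * ((X / P) ^ p.1 * (Y / P) ^ p.2)) := fun p => by
    rw [integral_mul_const, (integral_rpow_mul_exp_neg_sq hα hP (p.1 + p.2)).2]
    simp only [hk, div_eq_mul_inv, mul_pow, pow_add]
    push_cast
    ring
  have hsum := (hasSum_besselCoeff_mul_besselCoeff hα (div_nonneg hX hP.le)
    (div_nonneg hY hP.le)).mul_left (P ^ (-1 - α))
  have h := hasSum_integral_of_summable_integral_norm hint (by
    refine hsum.summable.congr fun p => ?_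
    rw [← hval p]
    refine setIntegral_congr_fun measurableSet_Ioi fun y hy => ?_
    have hy' : 0 < y := hy
    have := hk0 p
    rw [Real.norm_of_nonneg]
    simp only [hw]
    positivity)
  simp only [hval] at h
  have h2 := h.unique hsum
  rw [← add_div, div_mul_div_comm, ← sq] at h2
  rw [← h2]
  refine setIntegral_congr_fun measurableSet_Ioi fun y hy => ?_
  have s1 := (summable_besselCoeff hα (X * y ^ 2))
  have s2 := (summable_besselCoeff hα (Y * y ^ 2))
  have s3 := s1.mul_of_nonneg s2 (fun i => mul_nonneg (besselCoeff_pos hα i).le (by positivity))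
    (fun i => mul_nonneg (besselCoeff_pos hα i).le (by positivity))
  have h3 := (s1.hasSum.mul s2.hasSum s3).mul_left (w y)
  show w y * (besselF α (X * y ^ 2) * besselF α (Y * y ^ 2)) = _
  rw [besselF, besselF, ← h3.tsum_eq]
  refine tsum_congr fun p => ?_
  simp only [hk, mul_pow, pow_add]
  ring

end

/-! ### Moments of the transition density -/

lemma besselF_zero (α : ℝ) : besselF α 0 = besselCoeff α 0 := by
  rw [besselF, tsum_eq_single 0 fun m hm => by simp [hm]]
  simp

/-- The integrals `∫ 2 y^(1+2α+2j) exp(-P y²) F_α(Y y²) dy`. -/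
def besselMoment (P Y : ℝ) (j : ℕ) (α : ℝ) : ℝ :=
  ∫ y in Ioi (0 : ℝ), 2 * y ^ (1 + 2 * α) * (y ^ 2) ^ j * Real.exp (-P * y ^ 2) * besselF α (Y * y ^ 2)

section
variable {α P Y : ℝ}

/-- Weber's integral with X = 0, where the first Bessel factor is the constant `besselCoeff α 0`. -/
lemma besselMoment_zero (hα : -1 < α) (hP : 0 < P) (hY : 0 ≤ Y) :
    IntegrableOn (fun y => 2 * y ^ (1 + 2 * α) * (y ^ 2) ^ 0 * Real.exp (-P * y ^ 2)
      * besselF α (Y * y ^ 2)) (Ioi 0) ∧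
    besselMoment P Y 0 α = P ^ (-1 - α) * Real.exp (Y / P) := by
  have h0 := besselCoeff_pos hα 0
  have h := integral_besselF_mul_besselF hα hP le_rfl hY
  have e : ∀ y, 2 * y ^ (1 + 2 * α) * Real.exp (-P * y ^ 2)
        * (besselF α (0 * y ^ 2) * besselF α (Y * y ^ 2))
      = besselCoeff α 0 * (2 * y ^ (1 + 2 * α) * (y ^ 2) ^ 0 * Real.exp (-P * y ^ 2)
        * besselF α (Y * y ^ 2)) := fun y => by
    rw [zero_mul, besselF_zero, pow_zero]; ring
  simp only [e] at h
  rw [integral_const_mul, zero_add, zero_mul, zero_div, besselF_zero] at h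
  have hv : besselMoment P Y 0 α = P ^ (-1 - α) * Real.exp (Y / P) :=
    mul_left_cancel₀ h0.ne' (h.trans (by ring))
  refine ⟨?_, hv⟩
  -- A nonintegrable function has integral 0 by convention, so the positive value just found proves
  -- integrability.
  by_contra hn
  have : besselMoment P Y 0 α = 0 := integral_undef hn
  rw [hv] at this
  exact absurd this (by positivity)

/-- The recurrence trades a factor y² for a shift of the order by 1 or 2, so higher moments reduce
to zeroth moments of higher order. -/
lemma besselMoment_succ {j : ℕ} (hα : -1 < α)
    (h1 : IntegrableOn (fun y => 2 * y ^ (1 + 2 * (α + 1)) * (y ^ 2) ^ j * Real.exp (-P * y ^ 2)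
      * besselF (α + 1) (Y * y ^ 2)) (Ioi 0))
    (h2 : IntegrableOn (fun y => 2 * y ^ (1 + 2 * (α + 2)) * (y ^ 2) ^ j * Real.exp (-P * y ^ 2)
      * besselF (α + 2) (Y * y ^ 2)) (Ioi 0)) :
    IntegrableOn (fun y => 2 * y ^ (1 + 2 * α) * (y ^ 2) ^ (j + 1) * Real.exp (-P * y ^ 2)
      * besselF α (Y * y ^ 2)) (Ioi 0) ∧
    besselMoment P Y (j + 1) α
      = Y * besselMoment P Y j (α + 2) + (α + 1) * besselMoment P Y j (α + 1) := by
  have e : EqOn (fun y => Y * (2 * y ^ (1 + 2 * (α + 2)) * (y ^ 2) ^ j * Real.exp (-P * y ^ 2)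
        * besselF (α + 2) (Y * y ^ 2)) + (α + 1) * (2 * y ^ (1 + 2 * (α + 1)) * (y ^ 2) ^ j
          * Real.exp (-P * y ^ 2) * besselF (α + 1) (Y * y ^ 2)))
      (fun y => 2 * y ^ (1 + 2 * α) * (y ^ 2) ^ (j + 1) * Real.exp (-P * y ^ 2)
        * besselF α (Y * y ^ 2)) (Ioi 0) := by
    intro y hy
    have r1 : y ^ (1 + 2 * (α + 1)) = y ^ (1 + 2 * α) * y ^ 2 := by
      rw [show 1 + 2 * (α + 1) = 1 + 2 * α + 2 by ring, Real.rpow_add hy, Real.rpow_two]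
    have r2 : y ^ (1 + 2 * (α + 2)) = y ^ (1 + 2 * α) * y ^ 2 * y ^ 2 := by
      rw [show 1 + 2 * (α + 2) = 1 + 2 * α + 2 + 2 by ring, Real.rpow_add hy, Real.rpow_add hy,
        Real.rpow_two]
    beta_reduce
    rw [besselF_eq hα, r1, r2]
    ring
  refine ⟨IntegrableOn.congr_fun ((h2.const_mul Y).add (h1.const_mul (α + 1))) e measurableSet_Ioi,
    ?_⟩
  unfold besselMoment
  rw [← setIntegral_congr_fun measurableSet_Ioi e, integral_add (h2.const_mul Y)
    (h1.const_mul (α + 1)), integral_const_mul, integral_const_mul]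

end

section
variable {a b x y t : ℝ}

/-- The transition density as a function of the target, in terms of the integrands of
`besselMoment`. -/
lemma transitionDensity_eq_mul (ha : 0 < a) (hx : 0 < x) (ht : 0 < t) (hy : 0 < y) (j : ℕ) :
    (x ^ 2) ^ j * transitionDensity a b x t y
      = (targetRate a t ^ (1 + besselOrder b) * Real.exp (-sourceRate a t * y ^ 2))
        * (2 * x ^ (1 + 2 * besselOrder b) * (x ^ 2) ^ j * Real.exp (-targetRate a t * x ^ 2)
          * besselF (besselOrder b) ((targetRate a t * sourceRate a t * y ^ 2) * x ^ 2)) := by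
  rw [transitionDensity_eq ha hx ht hy, show -b = 1 + 2 * besselOrder b by unfold besselOrder; ring,
    show targetRate a t * sourceRate a t * x ^ 2 * y ^ 2
      = targetRate a t * sourceRate a t * y ^ 2 * x ^ 2 by ring]
  ring

lemma transitionDensity_nonneg (ha : 0 < a) (hb : b < 1) (hx : 0 < x) (ht : 0 < t) (hy : 0 < y) :
    0 ≤ transitionDensity a b x t y := by
  have h1 := targetRate_pos ha ht
  have h2 := sourceRate_pos ha ht
  have := besselF_nonneg (neg_one_lt_besselOrder hb)
    (w := targetRate a t * sourceRate a t * x ^ 2 * y ^ 2) (by positivity)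
  rw [transitionDensity_eq ha hx ht hy]
  positivity

lemma moments_transitionDensity (ha : 0 < a) (hb : b < 1) (ht : 0 < t) (hy : 0 < y) :
    (∀ j ≤ 2, IntegrableOn (fun x => (x ^ 2) ^ j * transitionDensity a b x t y) (Ioi 0)) ∧
    ∫ x in Ioi (0 : ℝ), (x ^ 2) ^ 0 * transitionDensity a b x t y = 1 ∧
    ∫ x in Ioi (0 : ℝ), (x ^ 2) ^ 1 * transitionDensity a b x t y
      = Real.exp (-(2 * a * t)) * y ^ 2 + (besselOrder b + 1) / targetRate a t ∧
    ∫ x in Ioi (0 : ℝ), (x ^ 2) ^ 2 * transitionDensity a b x t y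
      = (Real.exp (-(2 * a * t)) * y ^ 2) ^ 2
        + (2 * besselOrder b + 4) * (Real.exp (-(2 * a * t)) * y ^ 2) / targetRate a t
        + (besselOrder b + 1) * (besselOrder b + 2) / targetRate a t ^ 2 := by
  set α := besselOrder b with hα
  have hα1 : -1 < α := neg_one_lt_besselOrder hb
  set c := targetRate a t with hc
  set A := sourceRate a t with hA
  set E := Real.exp (-(2 * a * t)) with hE
  have c0 : 0 < c := targetRate_pos ha ht
  have A0 : 0 < A := sourceRate_pos ha ht
  have hAE : A = c * E := sourceRate_eq ha ht
  have hY : 0 ≤ c * A * y ^ 2 := by positivity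
  set K := c ^ (1 + α) * Real.exp (-A * y ^ 2) with hK
  have e : ∀ j : ℕ, EqOn (fun x => K * (2 * x ^ (1 + 2 * α) * (x ^ 2) ^ j * Real.exp (-c * x ^ 2)
      * besselF α ((c * A * y ^ 2) * x ^ 2))) (fun x => (x ^ 2) ^ j * transitionDensity a b x t y)
      (Ioi 0) := fun j x hx => (transitionDensity_eq_mul ha hx ht hy j).symm
  have m0 := fun (α' : ℝ) (h : -1 < α') => besselMoment_zero h c0 hY
  have m1 := fun (α' : ℝ) (h : -1 < α') => besselMoment_succ h (m0 (α' + 1) (by linarith)).1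
    (m0 (α' + 2) (by linarith)).1
  have m2 := besselMoment_succ hα1 (m1 (α + 1) (by linarith)).1 (m1 (α + 2) (by linarith)).1
  have hval : ∀ j, ∫ x in Ioi (0 : ℝ), (x ^ 2) ^ j * transitionDensity a b x t y
      = K * besselMoment c (c * A * y ^ 2) j α := fun j => by
    rw [← setIntegral_congr_fun measurableSet_Ioi (e j), integral_const_mul]; rfl
  -- With the normalisation K of the density, raising the order by n divides the zeroth moment by
  -- c^n; the exponentials cancel.
  have v : ∀ n : ℕ, K * besselMoment c (c * A * y ^ 2) 0 (α + n) = (c ^ n)⁻¹ := fun n => by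
    have hn : (0 : ℝ) ≤ n := n.cast_nonneg
    rw [(m0 (α + n) (by linarith)).2, hK, show c * A * y ^ 2 / c = A * y ^ 2 by field_simp]
    have h1 : c ^ (1 + α) * c ^ (-1 - (α + n)) = (c ^ n)⁻¹ := by
      rw [← Real.rpow_add c0, show 1 + α + (-1 - (α + n)) = -(n : ℝ) by ring, Real.rpow_neg c0.le,
        Real.rpow_natCast]
    have h2 : Real.exp (-A * y ^ 2) * Real.exp (A * y ^ 2) = 1 := by
      rw [← Real.exp_add]; simp
    calc _ = (c ^ (1 + α) * c ^ (-1 - (α + n))) * (Real.exp (-A * y ^ 2) * Real.exp (A * y ^ 2)) := by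
          ring
      _ = _ := by rw [h1, h2, mul_one]
  have v0 := v 0
  have v1 := v 1
  have v2 := v 2
  have v3 := v 3
  have v4 := v 4
  push_cast at v0 v1 v2 v3 v4
  rw [add_zero] at v0
  refine ⟨fun j hj => ?_, ?_, ?_, ?_⟩
  · refine IntegrableOn.congr_fun (Integrable.const_mul ?_ K) (e j) measurableSet_Ioi
    interval_cases j
    exacts [(m0 α hα1).1, (m1 α hα1).1, m2.1]
  · rw [hval, v0]; simp
  · rw [hval, (m1 α hα1).2]
    have : K * (c * A * y ^ 2 * besselMoment c (c * A * y ^ 2) 0 (α + 2) +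
        (α + 1) * besselMoment c (c * A * y ^ 2) 0 (α + 1))
        = c * A * y ^ 2 * (c ^ 2)⁻¹ + (α + 1) * (c ^ 1)⁻¹ := by
      rw [← v1, ← v2]; ring
    rw [this, hAE]
    field_simp
  · rw [hval, m2.2, (m1 (α + 2) (by linarith)).2, (m1 (α + 1) (by linarith)).2,
      show α + 2 + 2 = α + 4 by ring, show α + 2 + 1 = α + 3 by ring,
      show α + 1 + 2 = α + 3 by ring, show α + 1 + 1 = α + 2 by ring]
    have : K * (c * A * y ^ 2 * (c * A * y ^ 2 * besselMoment c (c * A * y ^ 2) 0 (α + 4) +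
        (α + 3) * besselMoment c (c * A * y ^ 2) 0 (α + 3)) + (α + 1) *
        (c * A * y ^ 2 * besselMoment c (c * A * y ^ 2) 0 (α + 3) +
        (α + 2) * besselMoment c (c * A * y ^ 2) 0 (α + 2)))
        = c * A * y ^ 2 * (c * A * y ^ 2 * (c ^ 4)⁻¹ + (α + 3) * (c ^ 3)⁻¹)
          + (α + 1) * (c * A * y ^ 2 * (c ^ 3)⁻¹ + (α + 2) * (c ^ 2)⁻¹) := by
      rw [← v2, ← v3, ← v4]; ring
    rw [this, hAE]
    field_simp
    ring

lemma integrableOn_transitionDensity (ha : 0 < a) (hb : b < 1) (ht : 0 < t) (hy : 0 < y) :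
    IntegrableOn (fun x => transitionDensity a b x t y) (Ioi 0) := by
  simpa using (moments_transitionDensity ha hb ht hy).1 0 (by norm_num)

lemma integral_transitionDensity (ha : 0 < a) (hb : b < 1) (ht : 0 < t) (hy : 0 < y) :
    ∫ x in Ioi (0 : ℝ), transitionDensity a b x t y = 1 := by
  simpa using (moments_transitionDensity ha hb ht hy).2.1

/-- The constant in the bound of the second moment of `x² - y²`. -/
def momentBound (a b y : ℝ) : ℝ :=
  2 * a * y ^ 4 + (2 * besselOrder b + 4) * (4 * y ^ 2)
    + (besselOrder b + 1) * (besselOrder b + 2) * (8 / a)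

/-- The first bound handles the terms linear in 1/c; the product of both bounds 1/c² linearly in t
for all times. -/
lemma inv_targetRate_le (ha : 0 < a) (ht : 0 < t) :
    (targetRate a t)⁻¹ ≤ 4 * t ∧ (targetRate a t)⁻¹ ≤ 2 / a := by
  have h1 := one_sub_exp_pos ha ht
  have h2 : 1 - Real.exp (-(2 * a * t)) ≤ 2 * a * t := by
    have := Real.add_one_le_exp (-(2 * a * t)); linarith
  have h3 : 1 - Real.exp (-(2 * a * t)) ≤ 1 := by
    have := Real.exp_pos (-(2 * a * t)); linarith
  have e : (targetRate a t)⁻¹ = 2 * (1 - Real.exp (-(2 * a * t))) / a := by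
    rw [targetRate, inv_div]
  rw [e]
  refine ⟨?_, ?_⟩
  · rw [div_le_iff₀ ha]; linarith
  · gcongr; linarith

/-- The moments of x² are explicit, so x² - y² serves as the measure of displacement. The linear
bound in t drives both the weak initial condition and the Hölder rate. -/
lemma second_moment_transitionDensity (ha : 0 < a) (hb : b < 1) (ht : 0 < t) (hy : 0 < y) :
    IntegrableOn (fun x => (x ^ 2 - y ^ 2) ^ 2 * transitionDensity a b x t y) (Ioi 0) ∧
    ∫ x in Ioi (0 : ℝ), (x ^ 2 - y ^ 2) ^ 2 * transitionDensity a b x t y ≤ momentBound a b y * t := by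
  obtain ⟨hi, e0, e1, e2⟩ := moments_transitionDensity (b := b) ha hb ht hy
  have i0 := hi 0 (by norm_num)
  have i1 := hi 1 (by norm_num)
  have i2 := hi 2 le_rfl
  have e : ∀ x, (x ^ 2 - y ^ 2) ^ 2 * transitionDensity a b x t y
      = (x ^ 2) ^ 2 * transitionDensity a b x t y
        + (-(2 * y ^ 2) * ((x ^ 2) ^ 1 * transitionDensity a b x t y)
        + y ^ 4 * ((x ^ 2) ^ 0 * transitionDensity a b x t y)) := fun x => by ring
  simp only [e]
  have i3 : IntegrableOn (fun x => -(2 * y ^ 2) * ((x ^ 2) ^ 1 * transitionDensity a b x t y)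
      + y ^ 4 * ((x ^ 2) ^ 0 * transitionDensity a b x t y)) (Ioi 0) :=
    (i1.const_mul (-(2 * y ^ 2))).add (i0.const_mul (y ^ 4))
  refine ⟨i2.add i3, ?_⟩
  rw [integral_add i2 i3, integral_add (i1.const_mul _) (i0.const_mul _), integral_const_mul,
    integral_const_mul, e0, e1, e2]
  obtain ⟨c1, c2⟩ := inv_targetRate_le ha ht
  have c0 : 0 < (targetRate a t)⁻¹ := inv_pos.2 (targetRate_pos ha ht)
  have hα := neg_one_lt_besselOrder hb
  set α := besselOrder b
  rw [div_eq_mul_inv, div_eq_mul_inv, div_eq_mul_inv, ← inv_pow]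
  set k := (targetRate a t)⁻¹
  set E := Real.exp (-(2 * a * t)) with hE
  have E0 : 0 < E := Real.exp_pos _
  have E1 : 0 < 1 - E := one_sub_exp_pos ha ht
  have E2 : 1 - E ≤ 2 * a * t := by
    have := Real.add_one_le_exp (-(2 * a * t)); linarith
  have b1 : (1 - E) ^ 2 * y ^ 4 ≤ 2 * a * t * y ^ 4 := by
    refine mul_le_mul_of_nonneg_right ?_ (by positivity)
    have h : (1 - E) * (1 - E) ≤ 1 * (2 * a * t) := mul_le_mul (by linarith) E2 E1.le one_pos.le
    linarith
  have b2 : (2 * α + 4) * (E * y ^ 2) * k ≤ (2 * α + 4) * y ^ 2 * (4 * t) := by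
    have h1 : 0 ≤ 2 * α + 4 := by linarith
    have h2 : E * y ^ 2 ≤ y ^ 2 := mul_le_of_le_one_left (sq_nonneg _) (by linarith)
    have h3 : (2 * α + 4) * (E * y ^ 2) ≤ (2 * α + 4) * y ^ 2 := mul_le_mul_of_nonneg_left h2 h1
    exact mul_le_mul h3 c1 c0.le (mul_nonneg h1 (sq_nonneg _))
  have b3 : (α + 1) * (α + 2) * k ^ 2 ≤ (α + 1) * (α + 2) * (8 / a * t) := by
    refine mul_le_mul_of_nonneg_left ?_ (mul_nonneg (by linarith) (by linarith))
    have : k * k ≤ 2 / a * (4 * t) := mul_le_mul c2 c1 c0.le (by positivity)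
    calc k ^ 2 ≤ 2 / a * (4 * t) := by rw [sq]; exact this
      _ = _ := by ring
  have b4 : 0 ≤ 2 * y ^ 2 * ((α + 1) * k) :=
    mul_nonneg (by positivity) (mul_nonneg (by linarith) c0.le)
  unfold momentBound
  linear_combination b1 + b2 + b3 + b4

/-- Detailed balance. -/
lemma transitionDensity_symm (ha : 0 < a) (hx : 0 < x) (ht : 0 < t) (hy : 0 < y) :
    transitionDensity a b x t y = (y ^ b * Real.exp (a / 2 * y ^ 2))
      / (x ^ b * Real.exp (a / 2 * x ^ 2)) * transitionDensity a b y t x := by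
  rw [transitionDensity_eq ha hx ht hy, transitionDensity_eq ha hy ht hx]
  have e1 : Real.exp (-targetRate a t * x ^ 2)
      = Real.exp (-sourceRate a t * x ^ 2) / Real.exp (a / 2 * x ^ 2) := by
    rw [← Real.exp_sub, sourceRate]; ring_nf
  have e2 : Real.exp (-targetRate a t * y ^ 2)
      = Real.exp (-sourceRate a t * y ^ 2) / Real.exp (a / 2 * y ^ 2) := by
    rw [← Real.exp_sub, sourceRate]; ring_nf
  have hx' := (Real.rpow_pos_of_pos hx b).ne'
  have hy' := (Real.rpow_pos_of_pos hy b).ne'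
  rw [e1, e2, Real.rpow_neg hx.le, Real.rpow_neg hy.le,
    show targetRate a t * sourceRate a t * y ^ 2 * x ^ 2
      = targetRate a t * sourceRate a t * x ^ 2 * y ^ 2 by ring]
  field_simp

/-- The Chapman-Kolmogorov equation. -/
theorem integral_transitionDensity_mul (ha : 0 < a) (hb : b < 1) {x₀ s : ℝ} (hx : 0 < x)
    (hs : 0 < s) (ht : 0 < t) (hx₀ : 0 < x₀) :
    ∫ y in Ioi (0 : ℝ), transitionDensity a b x t y * transitionDensity a b y s x₀
      = transitionDensity a b x (s + t) x₀ := by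
  have hst : 0 < s + t := by positivity
  have ct := targetRate_pos ha ht
  have cs := targetRate_pos ha hs
  have At := sourceRate_pos ha ht
  have As := sourceRate_pos ha hs
  have hP : 0 < sourceRate a t + targetRate a s := by positivity
  -- Composition law of the rates: c(s+t) and A(s+t) are the products of the two rates of each kind,
  -- divided by A(t) + c(s), the Gaussian rate in the intermediate variable.
  have hc : targetRate a (s + t) = targetRate a t * targetRate a s
      / (sourceRate a t + targetRate a s) := by
    rw [sourceRate_eq ha ht]
    have h1 := one_sub_exp_pos ha ht
    have h2 := one_sub_exp_pos ha hs
    have h3 := one_sub_exp_pos ha hst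
    have e : Real.exp (-(2 * a * (s + t))) = Real.exp (-(2 * a * s)) * Real.exp (-(2 * a * t)) := by
      rw [← Real.exp_add]; ring_nf
    have et := Real.exp_pos (-(2 * a * t))
    rw [targetRate, targetRate, targetRate]
    rw [e] at h3 ⊢
    set Es := Real.exp (-(2 * a * s))
    set Et := Real.exp (-(2 * a * t))
    have : a / (2 * (1 - Et)) * Et + a / (2 * (1 - Es))
        = a / 2 * (1 - Es * Et) / ((1 - Et) * (1 - Es)) := by
      field_simp
      ring
    rw [this]
    field_simp
  have hAA : sourceRate a (s + t) = sourceRate a s * sourceRate a t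
      / (sourceRate a t + targetRate a s) := by
    have h1 : sourceRate a (s + t) = targetRate a (s + t) - a / 2 := rfl
    have h2 : sourceRate a s = targetRate a s - a / 2 := rfl
    have h3 : targetRate a t = sourceRate a t + a / 2 := by rw [sourceRate]; ring
    rw [h1, hc, h2, h3]
    field_simp
    ring
  have hα := neg_one_lt_besselOrder hb
  have hW := integral_besselF_mul_besselF hα hP
    (X := targetRate a t * sourceRate a t * x ^ 2) (Y := targetRate a s * sourceRate a s * x₀ ^ 2)
    (by positivity) (by positivity)
  have e : EqOn (fun y => transitionDensity a b x t y * transitionDensity a b y s x₀)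
      (fun y => (2 * (targetRate a t * targetRate a s) ^ (1 + besselOrder b) * x ^ (-b)
        * (Real.exp (-targetRate a t * x ^ 2) * Real.exp (-sourceRate a s * x₀ ^ 2)))
        * (2 * y ^ (1 + 2 * besselOrder b)
        * Real.exp (-(sourceRate a t + targetRate a s) * y ^ 2)
        * (besselF (besselOrder b) (targetRate a t * sourceRate a t * x ^ 2 * y ^ 2)
          * besselF (besselOrder b) (targetRate a s * sourceRate a s * x₀ ^ 2 * y ^ 2)))) (Ioi 0) := by
    intro y hy
    beta_reduce
    rw [transitionDensity_eq ha hx ht hy, transitionDensity_eq ha hy hs hx₀,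
      show (1 + 2 * besselOrder b) = -b by unfold besselOrder; ring,
      show -(sourceRate a t + targetRate a s) * y ^ 2
        = -sourceRate a t * y ^ 2 + -targetRate a s * y ^ 2 by ring, Real.exp_add,
      Real.mul_rpow ct.le cs.le, show targetRate a s * sourceRate a s * y ^ 2 * x₀ ^ 2
        = targetRate a s * sourceRate a s * x₀ ^ 2 * y ^ 2 by ring]
    ring
  rw [setIntegral_congr_fun measurableSet_Ioi e, integral_const_mul, hW,
    transitionDensity_eq ha hx hst hx₀]
  have r1 : targetRate a (s + t) ^ (1 + besselOrder b) = (targetRate a t * targetRate a s)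
      ^ (1 + besselOrder b) * (sourceRate a t + targetRate a s) ^ (-1 - besselOrder b) := by
    rw [hc, Real.div_rpow (by positivity) hP.le, div_eq_mul_inv, ← Real.rpow_neg hP.le]
    ring_nf
  have r2 : Real.exp (-targetRate a (s + t) * x ^ 2) * Real.exp (-sourceRate a (s + t) * x₀ ^ 2)
      = Real.exp (-targetRate a t * x ^ 2) * Real.exp (-sourceRate a s * x₀ ^ 2)
        * Real.exp ((targetRate a t * sourceRate a t * x ^ 2
          + targetRate a s * sourceRate a s * x₀ ^ 2) / (sourceRate a t + targetRate a s)) := by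
    rw [hc, hAA, ← Real.exp_add, ← Real.exp_add, ← Real.exp_add]
    congr 1
    field_simp
    ring
  have r3 : targetRate a (s + t) * sourceRate a (s + t) * x ^ 2 * x₀ ^ 2
      = targetRate a t * sourceRate a t * x ^ 2 * (targetRate a s * sourceRate a s * x₀ ^ 2)
        / (sourceRate a t + targetRate a s) ^ 2 := by
    rw [hc, hAA]
    field_simp
  rw [r1, r3]
  linear_combination -(2 * (targetRate a t * targetRate a s) ^ (1 + besselOrder b)
    * (sourceRate a t + targetRate a s) ^ (-1 - besselOrder b) * x ^ (-b)
    * besselF (besselOrder b) (targetRate a t * sourceRate a t * x ^ 2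
      * (targetRate a s * sourceRate a s * x₀ ^ 2) / (sourceRate a t + targetRate a s) ^ 2)) * r2

end

/-! ### Pointwise bounds of the transition density -/

section
variable {a b : ℝ}

/-- With η = exp(-as) y one has A y² = c η², and the growth exp(2cxη) of the Bessel factor completes
the square to exp(-c(x-η)²). Half of this Gaussian is spent on the polynomial factor. -/
lemma exists_transitionDensity_le_gaussian (ha : 0 < a) (hb : b < 1) {p q : ℝ} (hp : 0 < p) :
    ∃ K > 0, ∀ x ∈ Icc p q, ∀ y > 0, ∀ s > 0, transitionDensity a b x s y
      ≤ K * (targetRate a s ^ (1 + besselOrder b) * (1 + targetRate a s) ^ 2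
        * Real.exp (-(targetRate a s * (x - Real.exp (-(a * s)) * y) ^ 2 / 2))) := by
  have h0 : Icc p q ⊆ Ioi 0 := fun y hy => hp.trans_le hy.1
  obtain ⟨M, hM⟩ := isCompact_Icc.exists_bound_of_continuousOn (f := fun x : ℝ => x ^ (-b))
    (s := Icc p q) (continuousOn_id.rpow_const fun x hx => Or.inl (ne_of_gt (h0 hx)))
  obtain ⟨C, hC, hF⟩ := exists_besselF_le (neg_one_lt_besselOrder hb)
  refine ⟨2 * (|M| + 1) * C * (1 + 2 * q ^ 4 + 2 * q ^ 2), by positivity, fun x hx y hy s hs => ?_⟩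
  have hx0 : 0 < x := h0 hx
  have c0 := targetRate_pos ha hs
  set c := targetRate a s with hc
  set η := Real.exp (-(a * s)) * y with hη
  have hη0 : 0 < η := by positivity
  have hAy : sourceRate a s * y ^ 2 = c * η ^ 2 := by
    rw [sourceRate_eq ha hs, ← hc, hη, mul_pow, ← Real.exp_nat_mul]
    push_cast
    ring_nf
  have hw : c * sourceRate a s * x ^ 2 * y ^ 2 = (c * x * η) ^ 2 := by
    linear_combination c * x ^ 2 * hAy
  have hsq : √((c * x * η) ^ 2) = c * x * η := Real.sqrt_sq (by positivity)
  have hb1 := hF ((c * x * η) ^ 2) (sq_nonneg _)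
  rw [hsq] at hb1
  have hM' : x ^ (-b) ≤ |M| + 1 := by
    have := hM x hx
    rw [Real.norm_eq_abs] at this
    linarith [le_abs_self (x ^ (-b)), le_abs_self M]
  set v := x - η with hv
  have hpoly : 1 + (c * x * η) ^ 2 ≤ (1 + 2 * q ^ 4 + 2 * q ^ 2) * (1 + c ^ 2 + c ^ 2 * v ^ 2) := by
    have h1 : x ^ 2 ≤ q ^ 2 := pow_le_pow_left₀ hx0.le hx.2 2
    have h2 : η ^ 2 ≤ 2 * q ^ 2 + 2 * v ^ 2 := by
      have : η = x - v := by rw [hv]; ring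
      rw [this]
      linarith [sq_nonneg (x + v)]
    have h3 : x ^ 2 * η ^ 2 ≤ q ^ 2 * (2 * q ^ 2 + 2 * v ^ 2) :=
      mul_le_mul h1 h2 (sq_nonneg _) (sq_nonneg _)
    have h4 := mul_le_mul_of_nonneg_left h3 (sq_nonneg c)
    have e1 : 0 ≤ c ^ 2 + c ^ 2 * v ^ 2 + 2 * q ^ 4 * (1 + c ^ 2 * v ^ 2) + 2 * q ^ 2 * (1 + c ^ 2) := by
      positivity
    linear_combination h4 + e1
  have hexp : (1 + c ^ 2 + c ^ 2 * v ^ 2) * Real.exp (-(c * v ^ 2))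
      ≤ (1 + c) ^ 2 * Real.exp (-(c * v ^ 2 / 2)) := by
    have e1 : Real.exp (-(c * v ^ 2)) = Real.exp (-(c * v ^ 2 / 2)) * Real.exp (-(c * v ^ 2 / 2)) := by
      rw [← Real.exp_add]; ring_nf
    have e2 : c * v ^ 2 / 2 * Real.exp (-(c * v ^ 2 / 2)) ≤ 1 := by
      have h1 := Real.add_one_le_exp (c * v ^ 2 / 2)
      rw [Real.exp_neg, ← div_eq_mul_inv, div_le_one (Real.exp_pos _)]
      linarith
    have e3 : Real.exp (-(c * v ^ 2 / 2)) ≤ 1 := Real.exp_le_one_iff.2 (by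
      have : 0 ≤ c * v ^ 2 / 2 := by positivity
      linarith)
    have e4 : (1 + c ^ 2 + c ^ 2 * v ^ 2) * Real.exp (-(c * v ^ 2 / 2)) ≤ (1 + c) ^ 2 := by
      have h5 := mul_le_mul_of_nonneg_left e3 (by positivity : 0 ≤ 1 + c ^ 2)
      have h6 := mul_le_mul_of_nonneg_left e2 (by positivity : 0 ≤ 2 * c)
      linear_combination h5 + h6
    rw [e1, ← mul_assoc]
    exact mul_le_mul_of_nonneg_right e4 (Real.exp_pos _).le
  rw [transitionDensity_eq ha hx0 hs hy, ← hc, hw]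
  have hcp : 0 ≤ c ^ (1 + besselOrder b) := by positivity
  calc 2 * c ^ (1 + besselOrder b) * x ^ (-b) * Real.exp (-c * x ^ 2)
        * (Real.exp (-sourceRate a s * y ^ 2) * besselF (besselOrder b) ((c * x * η) ^ 2))
      ≤ 2 * c ^ (1 + besselOrder b) * (|M| + 1) * Real.exp (-c * x ^ 2)
        * (Real.exp (-sourceRate a s * y ^ 2) * (C * ((1 + (c * x * η) ^ 2)
          * Real.exp (2 * (c * x * η))))) := by
        gcongr
        have := besselF_nonneg (neg_one_lt_besselOrder hb) (sq_nonneg (c * x * η))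
        positivity
    _ = 2 * (|M| + 1) * C * c ^ (1 + besselOrder b) * ((1 + (c * x * η) ^ 2)
          * (Real.exp (-c * x ^ 2) * Real.exp (-sourceRate a s * y ^ 2)
            * Real.exp (2 * (c * x * η)))) := by ring
    _ = 2 * (|M| + 1) * C * c ^ (1 + besselOrder b) * ((1 + (c * x * η) ^ 2)
          * Real.exp (-(c * v ^ 2))) := by
        rw [← Real.exp_add, ← Real.exp_add, neg_mul (sourceRate a s), hAy, hv]
        ring_nf
    _ ≤ 2 * (|M| + 1) * C * c ^ (1 + besselOrder b) *
          (((1 + 2 * q ^ 4 + 2 * q ^ 2) * (1 + c ^ 2 + c ^ 2 * v ^ 2)) * Real.exp (-(c * v ^ 2))) := by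
        gcongr
    _ = 2 * (|M| + 1) * C * c ^ (1 + besselOrder b) * (1 + 2 * q ^ 4 + 2 * q ^ 2) *
          ((1 + c ^ 2 + c ^ 2 * v ^ 2) * Real.exp (-(c * v ^ 2))) := by ring
    _ ≤ 2 * (|M| + 1) * C * c ^ (1 + besselOrder b) * (1 + 2 * q ^ 4 + 2 * q ^ 2) *
          ((1 + c) ^ 2 * Real.exp (-(c * v ^ 2 / 2))) := by
        gcongr
    _ = _ := by ring

lemma targetRate_le (ha : 0 < a) {s₁ s : ℝ} (hs₁ : 0 < s₁) (hs : s₁ ≤ s) :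
    targetRate a s ≤ targetRate a s₁ := by
  have h1 := one_sub_exp_pos ha hs₁
  have h2 : Real.exp (-(2 * a * s)) ≤ Real.exp (-(2 * a * s₁)) := by
    gcongr
  unfold targetRate
  gcongr

lemma exists_transitionDensity_le (ha : 0 < a) (hb : b < 1) {p q s₁ : ℝ} (hp : 0 < p)
    (hs₁ : 0 < s₁) : ∃ C > 0, ∀ x ∈ Icc p q, ∀ y > 0, ∀ s ≥ s₁, transitionDensity a b x s y ≤ C := by
  obtain ⟨K, hK, h⟩ := exists_transitionDensity_le_gaussian (b := b) ha hb (q := q) hp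
  have hα := neg_one_lt_besselOrder hb
  have c1 := targetRate_pos ha hs₁
  refine ⟨K * (targetRate a s₁ ^ (1 + besselOrder b) * (1 + targetRate a s₁) ^ 2), by positivity,
    fun x hx y hy s hs => (h x hx y hy s (hs₁.trans_le hs)).trans ?_⟩
  have c0 := targetRate_pos ha (hs₁.trans_le hs)
  have hc := targetRate_le ha hs₁ hs
  refine mul_le_mul_of_nonneg_left ?_ hK.le
  refine (mul_le_of_le_one_right (by positivity) (Real.exp_le_one_iff.2 ?_)).trans ?_
  · have : 0 ≤ targetRate a s * (x - Real.exp (-(a * s)) * y) ^ 2 / 2 := by positivity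
    linarith
  · have : targetRate a s ^ (1 + besselOrder b) ≤ targetRate a s₁ ^ (1 + besselOrder b) :=
      Real.rpow_le_rpow c0.le hc (by linarith)
    gcongr

lemma exists_rpow_mul_exp_le {r k : ℝ} (hr : 0 ≤ r) (hk : 0 < k) :
    ∃ C > 0, ∀ c > 0, c ^ r * (1 + c) ^ 2 * Real.exp (-(k * c)) ≤ C := by
  obtain ⟨N, hN⟩ := exists_nat_ge r
  refine ⟨Real.exp k * ((N + 2).factorial / k ^ (N + 2)), by positivity, fun c hc => ?_⟩
  have h1 : c ^ r ≤ (1 + c) ^ N := by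
    rw [← Real.rpow_natCast]
    exact (Real.rpow_le_rpow hc.le (by linarith) hr).trans
      (Real.rpow_le_rpow_of_exponent_le (by linarith) hN)
  have h2 := Real.pow_div_factorial_le_exp (k * (1 + c)) (by positivity) (N + 2)
  rw [div_le_iff₀ (by positivity), mul_pow] at h2
  have e1 : (1 + c) ^ (N + 2) ≤ Real.exp (k * (1 + c)) * (N + 2).factorial / k ^ (N + 2) := by
    rw [le_div_iff₀ (by positivity)]
    linarith
  calc c ^ r * (1 + c) ^ 2 * Real.exp (-(k * c))
      ≤ (1 + c) ^ N * (1 + c) ^ 2 * Real.exp (-(k * c)) := by gcongr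
    _ = (1 + c) ^ (N + 2) * Real.exp (-(k * c)) := by ring
    _ ≤ Real.exp (k * (1 + c)) * (N + 2).factorial / k ^ (N + 2) * Real.exp (-(k * c)) := by gcongr
    _ = Real.exp (k * (1 + c) + -(k * c)) * ((N + 2).factorial / k ^ (N + 2)) := by
      rw [Real.exp_add]; ring
    _ = _ := by ring_nf

/-- Away from the diagonal the transition density vanishes linearly at `0`. -/
lemma exists_transitionDensity_le_mul (ha : 0 < a) (hb : b < 1) {p q δ : ℝ} (hp : 0 < p)
    (hpq : p ≤ q) (hδ : 0 < δ) : ∃ C > 0, ∀ x ∈ Icc p q, ∀ y > 0, δ ≤ |x - y| → ∀ s > 0,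
      transitionDensity a b x s y ≤ C * s := by
  have hα := neg_one_lt_besselOrder hb
  have hq : 0 < q := hp.trans_le hpq
  -- Before this time the contraction from y to exp(-as) y is too small to bring a source at
  -- distance δ to within δ/2 of the target.
  set s₁ := Real.log (1 + δ / (2 * q + δ)) / a with hs₁
  have hs₁0 : 0 < s₁ := div_pos (Real.log_pos (by
    have : 0 < δ / (2 * q + δ) := by positivity
    linarith)) ha
  obtain ⟨K, hK, h⟩ := exists_transitionDensity_le_gaussian (b := b) ha hb (q := q) hp
  obtain ⟨M, hM, hMb⟩ := exists_transitionDensity_le (b := b) ha hb (q := q) hp hs₁0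
  -- The exponent is one more than needed: the spare power of c is divided out and 1/c ≤ 4s produces
  -- the linear rate.
  obtain ⟨C, hC, hCb⟩ := exists_rpow_mul_exp_le (r := 1 + besselOrder b + 1) (k := δ ^ 2 / 8)
    (by linarith) (by positivity)
  refine ⟨K * C * 4 + M / s₁, by positivity, fun x hx y hy hxy s hs => ?_⟩
  rcases le_or_gt s₁ s with hss | hss
  · have h1 := hMb x hx y hy s hss
    have h2 : M ≤ M / s₁ * s := by
      rw [div_mul_eq_mul_div, le_div_iff₀ hs₁0]
      gcongr
    have h3 : 0 ≤ K * C * 4 * s := by positivity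
    linarith
  · have c0 := targetRate_pos ha hs
    have hv : δ / 2 ≤ |x - Real.exp (-(a * s)) * y| := by
      by_contra! hv
      have he : Real.exp (a * s) ≤ 1 + δ / (2 * q + δ) := by
        rw [← Real.le_log_iff_exp_le (by positivity)]
        rw [hs₁, lt_div_iff₀ ha] at hss
        linarith
      set η := Real.exp (-(a * s)) * y with hη
      have hy' : y = η * Real.exp (a * s) := by
        rw [hη, mul_right_comm, ← Real.exp_add]; simp
      have hη0 : 0 < η := by positivity
      have he1 : 1 ≤ Real.exp (a * s) := Real.one_le_exp (by positivity)
      have h1 : η ≤ q + δ / 2 := by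
        have := (abs_lt.1 hv).1
        linarith [hx.2]
      have h2 : y - η ≤ δ / 2 := by
        calc y - η = η * (Real.exp (a * s) - 1) := by rw [hy']; ring
          _ ≤ (q + δ / 2) * (δ / (2 * q + δ)) :=
            mul_le_mul h1 (by linarith) (by linarith) (by positivity)
          _ = δ / 2 := by field_simp
      have h3 : 0 ≤ y - η := by
        rw [hy']
        nlinarith
      have : |x - y| < δ := by
        rw [abs_lt] at hv ⊢
        constructor <;> linarith [hv.1, hv.2]
      linarith
    have hv2 : δ ^ 2 / 4 ≤ (x - Real.exp (-(a * s)) * y) ^ 2 := by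
      rw [← sq_abs (x - Real.exp (-(a * s)) * y)]
      nlinarith
    have h1 := h x hx y hy s hs
    set c := targetRate a s with hc
    have h2 : Real.exp (-(c * (x - Real.exp (-(a * s)) * y) ^ 2 / 2))
        ≤ Real.exp (-(δ ^ 2 / 8 * c)) := by
      rw [Real.exp_le_exp]
      nlinarith
    have h3 := hCb c c0
    rw [Real.rpow_add_one c0.ne'] at h3
    have h4 : c ^ (1 + besselOrder b) * (1 + c) ^ 2
        * Real.exp (-(c * (x - Real.exp (-(a * s)) * y) ^ 2 / 2)) ≤ C * c⁻¹ := by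
      rw [← div_eq_mul_inv, le_div_iff₀ c0]
      calc c ^ (1 + besselOrder b) * (1 + c) ^ 2
            * Real.exp (-(c * (x - Real.exp (-(a * s)) * y) ^ 2 / 2)) * c
          ≤ c ^ (1 + besselOrder b) * (1 + c) ^ 2 * Real.exp (-(δ ^ 2 / 8 * c)) * c := by gcongr
        _ ≤ C := by linarith
    have h5 := (inv_targetRate_le ha hs).1
    have h6 : 0 ≤ M / s₁ * s := by positivity
    have h7 : C * c⁻¹ ≤ C * (4 * s) := mul_le_mul_of_nonneg_left h5 hC.le
    calc transitionDensity a b x s y ≤ K * (C * (4 * s)) :=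
          h1.trans (mul_le_mul_of_nonneg_left (h4.trans h7) hK.le)
      _ ≤ (K * C * 4 + M / s₁) * s := by linarith

end

/-! ### The initial condition of superpositions -/

section
variable {a b : ℝ}

/-- Locally, a locally Hölder continuous function times the speed density is Hölder continuous with
an exponent `2 ε ≤ 1`. -/
lemma IsLocallyHolder.exists_mul_weight {φ : ℝ → ℝ} (hφ : IsLocallyHolder φ) (a b : ℝ) {x₁ : ℝ}
    (hx₁ : 0 < x₁) : ∃ δ > 0, ∃ K ≥ (0 : ℝ), ∃ M ≥ (0 : ℝ), ∃ ε > (0 : ℝ), ε ≤ 1 / 2 ∧ 2 * δ < x₁ ∧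
      ContinuousOn φ (Metric.closedBall x₁ (2 * δ)) ∧
      (∀ y ∈ Metric.closedBall x₁ (2 * δ), |φ y| ≤ M) ∧
      ∀ x ∈ Metric.closedBall x₁ (2 * δ), ∀ y ∈ Metric.closedBall x₁ (2 * δ),
        |(y ^ b * Real.exp (a / 2 * y ^ 2)) / (x ^ b * Real.exp (a / 2 * x ^ 2)) * φ y - φ x|
          ≤ K * |y - x| ^ (2 * ε) := by
  obtain ⟨U, hU, C, r, hr, hH⟩ := hφ x₁ hx₁
  set n : ℝ → ℝ := fun y => y ^ b * Real.exp (a / 2 * y ^ 2) with hn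
  have hnd : ContDiffAt ℝ 1 n x₁ :=
    (Real.contDiffAt_rpow_const_of_ne hx₁.ne').mul (by fun_prop)
  obtain ⟨L, V, hV, hL⟩ := hnd.exists_lipschitzOnWith
  obtain ⟨ρ, hρ, hball⟩ := Metric.mem_nhds_iff.1 (inter_mem hU hV)
  -- The bound 1/4 makes any two points of the ball of radius 2δ at most 1 apart, so Hölder
  -- exponents may be lowered to min(r,1); the other two keep the ball in the neighbourhood and in
  -- (0,∞).
  set δ := min (ρ / 4) (min (x₁ / 4) (1 / 4)) with hδ
  have hδ0 : 0 < δ := by positivity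
  have hδ1 : δ ≤ ρ / 4 := min_le_left _ _
  have hδ2 : δ ≤ x₁ / 4 := (min_le_right _ _).trans (min_le_left _ _)
  have hδ3 : δ ≤ 1 / 4 := (min_le_right _ _).trans (min_le_right _ _)
  set B := Metric.closedBall x₁ (2 * δ) with hB
  have hBU : B ⊆ U ∩ V := (Metric.closedBall_subset_ball (by linarith)).trans hball
  have hB0 : ∀ y ∈ B, 0 < y := fun y hy => by
    have := (abs_le.1 (Real.dist_eq y x₁ ▸ Metric.mem_closedBall.1 hy)).1
    linarith
  have cφ : ContinuousOn φ B := (hH.continuousOn hr).mono (hBU.trans inter_subset_left)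
  have cn : ContinuousOn n B := hL.continuousOn.mono (hBU.trans inter_subset_right)
  have hcomp : IsCompact B := isCompact_closedBall _ _
  obtain ⟨M, hM⟩ := hcomp.exists_bound_of_continuousOn cφ
  have npos : ∀ y ∈ B, 0 < n y := fun y hy => by
    have := hB0 y hy
    simp only [hn]; positivity
  obtain ⟨N, hN⟩ := hcomp.exists_bound_of_continuousOn (f := fun y => (n y)⁻¹)
    (cn.inv₀ fun y hy => (npos y hy).ne')
  obtain ⟨N', hN'⟩ := hcomp.exists_bound_of_continuousOn cn
  have hx₁B : x₁ ∈ B := Metric.mem_closedBall_self (by positivity)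
  have hM0 : 0 ≤ M := (norm_nonneg _).trans (hM x₁ hx₁B)
  have hN0 : 0 ≤ N := (norm_nonneg _).trans (hN x₁ hx₁B)
  have hN'0 : 0 ≤ N' := (norm_nonneg _).trans (hN' x₁ hx₁B)
  set ε : ℝ := min (r : ℝ) 1 / 2 with hε
  have hr' : (0 : ℝ) < r := hr
  have hε0 : 0 < ε := by positivity
  refine ⟨δ, hδ0, N * (N' * C + M * L), by positivity, M, hM0, ε, hε0, ?_, by linarith, cφ, hM,
    fun x hx y hy => ?_⟩
  · have := min_le_right (r : ℝ) 1
    linarith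
  · have hd1 : |y - x| ≤ 1 := by
      have h1 := Metric.mem_closedBall.1 hx
      have h2 := Metric.mem_closedBall.1 hy
      have := dist_triangle_right y x x₁
      rw [← Real.dist_eq]
      linarith
    have h2ε : 2 * ε = min (r : ℝ) 1 := by rw [hε]; ring
    have p1 : |y - x| ^ (r : ℝ) ≤ |y - x| ^ (2 * ε) := by
      rcases (abs_nonneg (y - x)).eq_or_lt with h | h
      · rw [← h, Real.zero_rpow hr'.ne', Real.zero_rpow (by positivity)]
      · exact Real.rpow_le_rpow_of_exponent_ge h hd1 (h2ε ▸ min_le_left _ _)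
    have p2 : |y - x| ≤ |y - x| ^ (2 * ε) := by
      rcases (abs_nonneg (y - x)).eq_or_lt with h | h
      · rw [← h, Real.zero_rpow (by positivity)]
      · have := Real.rpow_le_rpow_of_exponent_ge h hd1 (h2ε ▸ min_le_right (r : ℝ) 1)
        rwa [Real.rpow_one] at this
    have q1 : |φ y - φ x| ≤ C * |y - x| ^ (2 * ε) := by
      have := hH.dist_le (hBU hy).1 (hBU hx).1
      rw [Real.dist_eq, Real.dist_eq] at this
      exact this.trans (mul_le_mul_of_nonneg_left p1 C.coe_nonneg)
    have q2 : |n y - n x| ≤ L * |y - x| ^ (2 * ε) := by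
      have := hL.dist_le_mul y (hBU hy).2 x (hBU hx).2
      rw [Real.dist_eq, Real.dist_eq] at this
      exact this.trans (mul_le_mul_of_nonneg_left p2 L.coe_nonneg)
    have e : n y / n x * φ y - φ x = (n x)⁻¹ * (n y * (φ y - φ x) + φ x * (n y - n x)) := by
      have := (npos x hx).ne'
      field_simp
      ring
    show |n y / n x * φ y - φ x| ≤ _
    rw [e, abs_mul]
    have r1 := hN x hx
    have r2 := hN' y hy
    have r3 := hM x hx
    rw [Real.norm_eq_abs] at r1 r2 r3
    have hd0 : 0 ≤ |y - x| ^ (2 * ε) := by positivity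
    calc |(n x)⁻¹| * |n y * (φ y - φ x) + φ x * (n y - n x)|
        ≤ N * (N' * (C * |y - x| ^ (2 * ε)) + M * (L * |y - x| ^ (2 * ε))) := by
          refine mul_le_mul r1 ((abs_add_le _ _).trans ?_) (abs_nonneg _) hN0
          rw [abs_mul (n y), abs_mul (φ x)]
          exact add_le_add (mul_le_mul r2 q1 (abs_nonneg _) hN'0)
            (mul_le_mul r3 q2 (abs_nonneg _) hM0)
      _ = _ := by ring

/-- With h = √s and r = 2ε this bounds a Hölder modulus by s^ε + s^(ε-1) d²; against a second moment
of order s both terms become s^ε. -/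
lemma rpow_le_add_of_pos {d h r : ℝ} (hd : 0 ≤ d) (hh : 0 < h) (hr : 0 < r) (hr2 : r ≤ 2) :
    d ^ r ≤ h ^ r + h ^ (r - 2) * d ^ 2 := by
  rcases le_or_gt d h with hdh | hdh
  · have : d ^ r ≤ h ^ r := Real.rpow_le_rpow hd hdh hr.le
    have h2 : 0 ≤ h ^ (r - 2) * d ^ 2 := by positivity
    linarith
  · have hd0 : 0 < d := hh.trans hdh
    have e : d ^ r = d ^ (r - 2) * d ^ 2 := by
      rw [← Real.rpow_two, ← Real.rpow_add hd0]; ring_nf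
    have : d ^ (r - 2) ≤ h ^ (r - 2) := Real.rpow_le_rpow_of_nonpos hh hdh.le (by linarith)
    have h2 : 0 ≤ h ^ r := by positivity
    rw [e]
    have := mul_le_mul_of_nonneg_right this (sq_nonneg d)
    linarith

lemma integrable_transitionDensity_mul (ha : 0 < a) (hb : b < 1) {φ : ℝ → ℝ}
    (hφ : IntegrableOn φ (Ioi 0)) {x t : ℝ} (hx : 0 < x) (ht : 0 < t) :
    IntegrableOn (fun y => transitionDensity a b x t y * φ y) (Ioi 0) := by
  have h1 := targetRate_pos ha ht
  have h2 := sourceRate_pos ha ht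
  refine IntegrableOn.congr_fun ((integrable_besselInt (neg_one_lt_besselOrder hb) hφ 0 h2
    (B := targetRate a t * sourceRate a t * x ^ 2) (by positivity)).const_mul
    (2 * targetRate a t ^ (1 + besselOrder b) * x ^ (-b) * Real.exp (-targetRate a t * x ^ 2)))
    (fun y hy => ?_) measurableSet_Ioi
  rw [transitionDensity_eq ha hx ht hy]
  ring

/-- The initial condition, with a rate that is locally uniform. -/
theorem exists_abs_greenSolution_sub_le (ha : 0 < a) (hb : b < 1) {φ : ℝ → ℝ}
    (hφ : IntegrableOn φ (Ioi 0)) (hH : IsLocallyHolder φ) {x₁ : ℝ} (hx₁ : 0 < x₁) :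
    ∃ δ > 0, δ < x₁ ∧ ContinuousOn φ (Icc (x₁ - δ) (x₁ + δ)) ∧ ∃ C ε : ℝ, 0 < ε ∧ ε ≤ 1 ∧
      ∀ x ∈ Icc (x₁ - δ) (x₁ + δ), ∀ s > 0, |greenSolution a b φ x s - φ x| ≤ C * (s ^ ε + s) := by
  obtain ⟨δ, hδ, K, hK, M, hM, ε, hε, hε2, hδx, cφ, hMb, hloc⟩ := hH.exists_mul_weight a b hx₁
  have hball : Metric.closedBall x₁ δ = Icc (x₁ - δ) (x₁ + δ) := Real.closedBall_eq_Icc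
  have hp : 0 < x₁ - δ := by linarith
  obtain ⟨C₁, hC₁, hoff⟩ := exists_transitionDensity_le_mul (b := b) ha hb hp
    (show x₁ - δ ≤ x₁ + δ by linarith) hδ
  have hsub : Icc (x₁ - δ) (x₁ + δ) ⊆ Metric.closedBall x₁ (2 * δ) := by
    rw [← hball]; exact Metric.closedBall_subset_closedBall (by linarith)
  obtain ⟨C₂, hC₂⟩ := isCompact_Icc.exists_bound_of_continuousOn
    (f := fun x => momentBound a b x / (x₁ - δ) ^ 2) (s := Icc (x₁ - δ) (x₁ + δ))
    (by unfold momentBound; fun_prop)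
  set I := ∫ y in Ioi (0 : ℝ), |φ y| with hI
  have hI0 : 0 ≤ I := integral_nonneg fun y => abs_nonneg _
  have hC₂0 : 0 ≤ C₂ := (norm_nonneg _).trans (hC₂ x₁ ⟨by linarith, by linarith⟩)
  refine ⟨δ, hδ, by linarith, cφ.mono hsub, K + K * C₂ + M / δ ^ 2 * C₂ + C₁ * I, ε, hε,
    by linarith, fun x hx s hs => ?_⟩
  have hx0 : 0 < x := hp.trans_le hx.1
  have hm := second_moment_transitionDensity (b := b) ha hb hs hx0
  have hmass := integral_transitionDensity (b := b) ha hb hs hx0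
  have hmi := integrableOn_transitionDensity (b := b) ha hb hs hx0
  have hd : ∀ y > 0, (y - x) ^ 2 ≤ (y ^ 2 - x ^ 2) ^ 2 / (x₁ - δ) ^ 2 := fun y hy => by
    rw [le_div_iff₀ (by positivity)]
    have h1 : (x₁ - δ) ^ 2 ≤ (y + x) ^ 2 := pow_le_pow_left₀ hp.le (by linarith [hx.1]) 2
    calc (y - x) ^ 2 * (x₁ - δ) ^ 2 ≤ (y - x) ^ 2 * (y + x) ^ 2 := by gcongr
      _ = _ := by ring
  set G : ℝ → ℝ := fun y => K * (s ^ ε * transitionDensity a b y s x)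
    + (K * s ^ (ε - 1) + M / δ ^ 2) * ((y ^ 2 - x ^ 2) ^ 2 * transitionDensity a b y s x
      / (x₁ - δ) ^ 2) + C₁ * s * |φ y| with hG
  have hpt : ∀ y ∈ Ioi (0 : ℝ), |transitionDensity a b x s y * φ y
      - φ x * transitionDensity a b y s x| ≤ G y := by
    intro y hy
    have hy0 : 0 < y := hy
    have pn := transitionDensity_nonneg (b := b) ha hb hy0 hs hx0
    have pn' := transitionDensity_nonneg (b := b) ha hb hx0 hs hy0
    have hD : (y - x) ^ 2 * transitionDensity a b y s x ≤ (y ^ 2 - x ^ 2) ^ 2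
        * transitionDensity a b y s x / (x₁ - δ) ^ 2 := by
      rw [mul_div_right_comm]
      exact mul_le_mul_of_nonneg_right (hd y hy) pn
    have g1 : 0 ≤ K * (s ^ ε * transitionDensity a b y s x) := by positivity
    have g2 : 0 ≤ (y - x) ^ 2 * transitionDensity a b y s x := by positivity
    have g3 : 0 ≤ C₁ * s * |φ y| := by positivity
    have g4 : 0 ≤ K * s ^ (ε - 1) := by positivity
    have g5 : 0 ≤ M / δ ^ 2 := by positivity
    -- Near the diagonal detailed balance replaces p(x,s|y) by p(y,s|x) times a ratio of weights, so
    -- y becomes the variable of a probability density and the Hölder bound applies. Far from it the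
    -- two terms are bounded separately: the one with φ(y) by the linear bound on p, the one with
    -- φ(x) by Chebyshev's inequality.
    rcases lt_or_ge |y - x| δ with hyx | hyx
    · have hyB : y ∈ Metric.closedBall x₁ (2 * δ) := by
        rw [Metric.mem_closedBall]
        have h1 : dist x x₁ ≤ δ := Metric.mem_closedBall.1 (hball ▸ hx)
        have h2 := dist_triangle y x x₁
        rw [Real.dist_eq y x] at h2
        linarith
      have hl := hloc x (hsub hx) y hyB
      have hr := rpow_le_add_of_pos (abs_nonneg (y - x)) (Real.sqrt_pos.2 hs)
        (show 0 < 2 * ε by positivity) (by linarith)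
      rw [sq_abs, Real.sqrt_eq_rpow, ← Real.rpow_mul hs.le, ← Real.rpow_mul hs.le,
        show 1 / 2 * (2 * ε) = ε by ring, show 1 / 2 * (2 * ε - 2) = ε - 1 by ring] at hr
      rw [transitionDensity_symm ha hx0 hs hy0, mul_right_comm, ← sub_mul, abs_mul, abs_of_nonneg pn]
      calc _ ≤ K * (s ^ ε + s ^ (ε - 1) * (y - x) ^ 2) * transitionDensity a b y s x :=
            mul_le_mul_of_nonneg_right (hl.trans (mul_le_mul_of_nonneg_left hr hK)) pn
        _ = K * (s ^ ε * transitionDensity a b y s x)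
            + K * s ^ (ε - 1) * ((y - x) ^ 2 * transitionDensity a b y s x) := by ring
        _ ≤ _ := by
          have := mul_le_mul_of_nonneg_left hD g4
          have := mul_nonneg g5 (g2.trans hD)
          simp only [hG]
          linarith
    · have ho := hoff x hx y hy0 (by rwa [abs_sub_comm]) s hs
      have h1 : 1 ≤ (y - x) ^ 2 / δ ^ 2 := by
        rw [one_le_div (by positivity), ← sq_abs (y - x)]
        exact pow_le_pow_left₀ hδ.le hyx 2
      have hMx := hMb x (hsub hx)
      have a1 : |φ x * transitionDensity a b y s x|
          ≤ M / δ ^ 2 * ((y - x) ^ 2 * transitionDensity a b y s x) := by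
        rw [abs_mul, abs_of_nonneg pn]
        have := mul_le_mul_of_nonneg_left h1 (mul_nonneg hM pn)
        calc |φ x| * transitionDensity a b y s x ≤ M * transitionDensity a b y s x := by gcongr
          _ ≤ M * transitionDensity a b y s x * ((y - x) ^ 2 / δ ^ 2) := by linarith
          _ = _ := by ring
      have a2 : |transitionDensity a b x s y * φ y| ≤ C₁ * s * |φ y| := by
        rw [abs_mul, abs_of_nonneg pn']
        gcongr
      have a3 := mul_le_mul_of_nonneg_left hD g5
      have a4 := mul_nonneg g4 (g2.trans hD)
      refine (abs_sub _ _).trans ?_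
      simp only [hG]
      linarith
  have i1 := integrable_transitionDensity_mul ha hb hφ hx0 hs
  have i2 : IntegrableOn (fun y => φ x * transitionDensity a b y s x) (Ioi 0) := hmi.const_mul _
  have j1 : IntegrableOn (fun y => K * (s ^ ε * transitionDensity a b y s x)) (Ioi 0) :=
    (hmi.const_mul _).const_mul _
  have j2 : IntegrableOn (fun y => (K * s ^ (ε - 1) + M / δ ^ 2) * ((y ^ 2 - x ^ 2) ^ 2
      * transitionDensity a b y s x / (x₁ - δ) ^ 2)) (Ioi 0) := (hm.1.div_const _).const_mul _
  have j3 : IntegrableOn (fun y => C₁ * s * |φ y|) (Ioi 0) := hφ.abs.const_mul _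
  have j12 : IntegrableOn (fun y => K * (s ^ ε * transitionDensity a b y s x)
      + (K * s ^ (ε - 1) + M / δ ^ 2) * ((y ^ 2 - x ^ 2) ^ 2
      * transitionDensity a b y s x / (x₁ - δ) ^ 2)) (Ioi 0) := j1.add j2
  have hGi : IntegrableOn G (Ioi 0) := j12.add j3
  have e1 : greenSolution a b φ x s - φ x = ∫ y in Ioi (0 : ℝ), (transitionDensity a b x s y * φ y
      - φ x * transitionDensity a b y s x) := by
    rw [integral_sub i1 i2, integral_const_mul, hmass, mul_one]; rfl
  have e2 : ∫ y in Ioi (0 : ℝ), G y = K * s ^ ε + (K * s ^ (ε - 1) + M / δ ^ 2)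
      * ((∫ y in Ioi (0 : ℝ), (y ^ 2 - x ^ 2) ^ 2 * transitionDensity a b y s x) / (x₁ - δ) ^ 2)
      + C₁ * s * I := by
    simp only [hG]
    rw [integral_add j12 j3, integral_add j1 j2, integral_const_mul, integral_const_mul,
      integral_const_mul, integral_const_mul, hmass, integral_div, mul_one]
  have e3 : (∫ y in Ioi (0 : ℝ), (y ^ 2 - x ^ 2) ^ 2 * transitionDensity a b y s x)
      / (x₁ - δ) ^ 2 ≤ C₂ * s := by
    have h1 := hC₂ x hx
    rw [Real.norm_eq_abs] at h1
    have h2 := (le_abs_self _).trans h1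
    calc _ ≤ momentBound a b x * s / (x₁ - δ) ^ 2 := by gcongr; exact hm.2
      _ = momentBound a b x / (x₁ - δ) ^ 2 * s := by ring
      _ ≤ _ := by gcongr
  have e4 : s ^ (ε - 1) * s = s ^ ε := by
    rw [← Real.rpow_add_one hs.ne']; ring_nf
  calc |greenSolution a b φ x s - φ x| ≤ ∫ y in Ioi (0 : ℝ), G y := by
        rw [e1, ← Real.norm_eq_abs]
        refine norm_integral_le_of_norm_le hGi ?_
        exact (ae_restrict_iff' measurableSet_Ioi).2 (Eventually.of_forall hpt)
    _ ≤ K * s ^ ε + (K * s ^ (ε - 1) + M / δ ^ 2) * (C₂ * s) + C₁ * s * I := by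
        rw [e2]
        gcongr
    _ = K * s ^ ε + K * C₂ * s ^ ε + M / δ ^ 2 * C₂ * s + C₁ * I * s := by
        linear_combination K * C₂ * e4
    _ ≤ _ := by
        have s0 : 0 < s ^ ε := by positivity
        have t1 : 0 ≤ M / δ ^ 2 * C₂ * s ^ ε := by positivity
        have t2 : 0 ≤ C₁ * I * s ^ ε := by positivity
        have t3 : 0 ≤ K * s := by positivity
        have t4 : 0 ≤ K * C₂ * s := by positivity
        linear_combination t1 + t2 + t3 + t4

end

/-! ### The transition density as a solution -/

lemma IsFluxSolution.congr {a b : ℝ} {u v w S : ℝ → ℝ → ℝ} (h : IsFluxSolution a b u w S)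
    (e : ∀ x > 0, ∀ s > 0, v x s = u x s) : IsFluxSolution a b v w S where
  hasDerivAt_left x hx s hs := by
    rw [e x hx s hs]
    refine (h.hasDerivAt_left x hx s hs).congr_of_eventuallyEq ?_
    filter_upwards [Ioi_mem_nhds hx] with y hy using e y hy s hs
  hasDerivAt_flux := h.hasDerivAt_flux
  hasDerivAt_right x hx s hs := by
    refine (h.hasDerivAt_right x hx s hs).congr_of_eventuallyEq ?_
    filter_upwards [Ioi_mem_nhds hs] with r hr using e x hx r hr
  continuousOn := h.continuousOn.congr fun z hz => e z.1 hz.1 z.2 hz.2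
  continuousOn_deriv := h.continuousOn_deriv

section
variable {a b : ℝ}

lemma exists_isFluxSolution_transitionDensity (ha : 0 < a) (hb : b < 1) {x₀ : ℝ} (hx₀ : 0 < x₀) :
    ∃ w S, IsFluxSolution a b (fun x s => transitionDensity a b x s x₀) w S := by
  obtain ⟨w, S, h⟩ := exists_isFluxSolution_fpSolution ha hb (μ := Measure.dirac x₀)
    (φ := fun _ => 1) (integrable_const 1)
  exact ⟨w, S, h.congr fun x hx s hs => transitionDensity_eq_fpSolution ha hx hs hx₀⟩

lemma exists_isFluxSolution_greenSolution (ha : 0 < a) (hb : b < 1) {φ : ℝ → ℝ}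
    (hφ : IntegrableOn φ (Ioi 0)) : ∃ w S, IsFluxSolution a b (greenSolution a b φ) w S := by
  obtain ⟨w, S, h⟩ := exists_isFluxSolution_fpSolution ha hb hφ
  exact ⟨w, S, h.congr fun x hx s hs => greenSolution_eq_fpSolution φ ha hx hs⟩

lemma continuousOn_transitionDensity_prod (ha : 0 < a) (hb : b < 1) {x₀ : ℝ} (hx₀ : 0 < x₀) :
    ContinuousOn (Function.uncurry fun x s => transitionDensity a b x s x₀) (Ioi 0 ×ˢ Ioi 0) := by
  obtain ⟨w, S, h⟩ := exists_isFluxSolution_transitionDensity ha hb hx₀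
  exact h.continuousOn

/-! ### Bounded functions integrated against the transition density -/

section
variable {χ : ℝ → ℝ} {M x₀ : ℝ}

lemma integrableOn_mul_transitionDensity (ha : 0 < a) (hb : b < 1) (hx₀ : 0 < x₀)
    (hχ : ContinuousOn χ (Ioi 0)) (hM : ∀ x > 0, |χ x| ≤ M) {s : ℝ} (hs : 0 < s) :
    IntegrableOn (fun x => χ x * transitionDensity a b x s x₀) (Ioi 0) ∧
      ∫ x in Ioi (0 : ℝ), |χ x * transitionDensity a b x s x₀| ≤ M := by
  have hi := integrableOn_transitionDensity (b := b) ha hb hs hx₀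
  have hle : ∀ x ∈ Ioi (0 : ℝ), |χ x * transitionDensity a b x s x₀|
      ≤ M * transitionDensity a b x s x₀ := fun x hx => by
    have := transitionDensity_nonneg ha hb hx hs hx₀
    rw [abs_mul, abs_of_nonneg this]
    exact mul_le_mul_of_nonneg_right (hM x hx) this
  have hj : IntegrableOn (fun x => χ x * transitionDensity a b x s x₀) (Ioi 0) :=
    (hi.const_mul M).mono' ((hχ.mul ((continuousOn_transitionDensity_prod ha hb hx₀).uncurry_left'
      hs)).aestronglyMeasurable measurableSet_Ioi)
      ((ae_restrict_iff' measurableSet_Ioi).2 (Eventually.of_forall hle))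
  refine ⟨hj, (setIntegral_mono_on hj.abs (hi.const_mul M) measurableSet_Ioi hle).trans ?_⟩
  rw [integral_const_mul, integral_transitionDensity ha hb hs hx₀, mul_one]

lemma abs_integral_mul_transitionDensity_le (ha : 0 < a) (hb : b < 1) (hx₀ : 0 < x₀)
    (hχ : ContinuousOn χ (Ioi 0)) (hM : ∀ x > 0, |χ x| ≤ M) {s : ℝ} (hs : 0 < s) :
    |∫ x in Ioi (0 : ℝ), χ x * transitionDensity a b x s x₀| ≤ M := by
  rw [← Real.norm_eq_abs]
  exact (norm_integral_le_integral_norm _).trans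
    (integrableOn_mul_transitionDensity ha hb hx₀ hχ hM hs).2

/-- Integrals over the target are of the form `besselInt` as well. As c > a/2, a Gaussian of rate
a/4 can be split off to make χ(x) x^(-b) integrable, using b < 1 at the origin; the remaining rate c
- a/4 is positive. -/
lemma continuousOn_integral_mul_transitionDensity (ha : 0 < a) (hb : b < 1) (hx₀ : 0 < x₀)
    (hχ : ContinuousOn χ (Ioi 0)) (hM : ∀ x > 0, |χ x| ≤ M) :
    ContinuousOn (fun s => ∫ x in Ioi (0 : ℝ), χ x * transitionDensity a b x s x₀) (Ioi 0) := by
  have hα := neg_one_lt_besselOrder hb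
  have hM0 : 0 ≤ M := (abs_nonneg _).trans (hM 1 one_pos)
  set φ : ℝ → ℝ := fun x => χ x * (x ^ (-b) * Real.exp (-(a / 4) * x ^ (2 : ℝ))) with hφd
  have i0 := integrableOn_rpow_mul_exp_neg_mul_rpow (s := -b) (p := 2) (b := a / 4) (by linarith)
    two_pos (by linarith)
  have hφ : IntegrableOn φ (Ioi 0) := by
    refine (i0.const_mul M).mono' (ContinuousOn.aestronglyMeasurable (hχ.mul (ContinuousOn.mul ?_ ?_))
      measurableSet_Ioi) ((ae_restrict_iff' measurableSet_Ioi).2 (Eventually.of_forall fun x hx => ?_))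
    · exact continuousOn_id.rpow_const fun x hx => Or.inl (ne_of_gt hx)
    · simp only [Real.rpow_two]
      fun_prop
    · have hx' : 0 < x := hx
      rw [norm_mul, Real.norm_eq_abs, Real.norm_of_nonneg (by positivity)]
      exact mul_le_mul_of_nonneg_right (hM x hx) (by positivity)
  have cc := continuousOn_targetRate ha
  have cA := continuousOn_sourceRate ha
  have hJ : ContinuousOn (fun s => besselInt (volume.restrict (Ioi 0)) φ 0 (besselOrder b)
      (targetRate a s - a / 4) (targetRate a s * sourceRate a s * x₀ ^ 2)) (Ioi 0) := by
    refine (continuousOn_besselInt hα hφ 0).comp (f := fun s => (targetRate a s - a / 4,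
      targetRate a s * sourceRate a s * x₀ ^ 2)) ((cc.sub continuousOn_const).prodMk
      ((cc.mul cA).mul continuousOn_const)) fun s hs => ⟨?_, ?_⟩
    · have := sourceRate_pos ha hs
      rw [sourceRate] at this
      show 0 < targetRate a s - a / 4
      linarith
    · have h1 := sourceRate_pos ha hs
      have h2 := targetRate_pos ha hs
      show 0 ≤ targetRate a s * sourceRate a s * x₀ ^ 2
      positivity
  have hpre : ContinuousOn (fun s => 2 * targetRate a s ^ (1 + besselOrder b)
      * Real.exp (-sourceRate a s * x₀ ^ 2)) (Ioi 0) :=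
    (continuousOn_const.mul (cc.rpow_const fun s hs => Or.inl (targetRate_pos ha hs).ne')).mul
      (cA.neg.mul continuousOn_const).rexp
  refine (hpre.mul hJ).congr fun s hs => ?_
  change _ = _ * besselInt _ _ _ _ _ _
  rw [besselInt, ← integral_const_mul]
  refine setIntegral_congr_fun measurableSet_Ioi fun x hx => ?_
  beta_reduce
  rw [transitionDensity_eq ha hx hs hx₀]
  have e : Real.exp (-targetRate a s * x ^ 2)
      = Real.exp (-(targetRate a s - a / 4) * x ^ 2) * Real.exp (-(a / 4) * x ^ (2 : ℝ)) := by
    rw [← Real.exp_add, Real.rpow_two]; ring_nf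
  rw [e, show targetRate a s * sourceRate a s * x ^ 2 * x₀ ^ 2
    = targetRate a s * sourceRate a s * x₀ ^ 2 * x ^ 2 by ring]
  simp only [hφd]
  ring

/-- Chebyshev's inequality with the moment of (x² - x₀²)². At distance at least δ from x₀ one has
|x² - x₀²| ≥ δx₀, which fixes the constant `K`. -/
lemma tendsto_integral_mul_transitionDensity (ha : 0 < a) (hb : b < 1) (hx₀ : 0 < x₀)
    (hχ : ContinuousOn χ (Ioi 0)) (hM : ∀ x > 0, |χ x| ≤ M) :
    Tendsto (fun s => ∫ x in Ioi (0 : ℝ), χ x * transitionDensity a b x s x₀) (𝓝[>] 0)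
      (𝓝 (χ x₀)) := by
  have hM0 : 0 ≤ M := (abs_nonneg _).trans (hM 1 one_pos)
  rw [Metric.tendsto_nhds]
  intro ε hε
  obtain ⟨δ, hδ, hδε⟩ := Metric.continuousAt_iff.1 (hχ.continuousAt (Ioi_mem_nhds hx₀)) (ε / 2)
    (half_pos hε)
  set K := 2 * M / (δ * x₀) ^ 2 with hK
  have hK0 : 0 ≤ K := by positivity
  have hpt : ∀ x ∈ Ioi (0 : ℝ), |χ x - χ x₀| ≤ ε / 2 + K * (x ^ 2 - x₀ ^ 2) ^ 2 := by
    intro x hx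
    have hx' : 0 < x := hx
    rcases lt_or_ge |x - x₀| δ with h | h
    · have h1 := (hδε (show dist x x₀ < δ by rwa [Real.dist_eq])).le
      rw [Real.dist_eq] at h1
      have : 0 ≤ K * (x ^ 2 - x₀ ^ 2) ^ 2 := by positivity
      linarith
    · have h1 : (δ * x₀) ^ 2 ≤ (x ^ 2 - x₀ ^ 2) ^ 2 := by
        have h2 : δ * x₀ ≤ |x - x₀| * (x + x₀) := mul_le_mul h (by linarith) hx₀.le (abs_nonneg _)
        calc (δ * x₀) ^ 2 ≤ (|x - x₀| * (x + x₀)) ^ 2 := pow_le_pow_left₀ (by positivity) h2 2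
          _ = _ := by rw [mul_pow, sq_abs]; ring
      have h2 : 2 * M ≤ K * (x ^ 2 - x₀ ^ 2) ^ 2 := by
        rw [hK, div_mul_eq_mul_div, le_div_iff₀ (by positivity)]
        gcongr
      have h3 := (abs_sub (χ x) (χ x₀)).trans (add_le_add (hM x hx) (hM x₀ hx₀))
      linarith
  have hlim : Tendsto (fun s : ℝ => ε / 2 + K * (momentBound a b x₀ * s)) (𝓝[>] 0)
      (𝓝 (ε / 2)) := by
    have : Continuous fun s : ℝ => ε / 2 + K * (momentBound a b x₀ * s) := by fun_prop
    have h := this.tendsto 0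
    rw [mul_zero, mul_zero, add_zero] at h
    exact h.mono_left nhdsWithin_le_nhds
  filter_upwards [self_mem_nhdsWithin, hlim.eventually_lt_const (half_lt_self hε)] with s hs hlt
  have hs' : 0 < s := hs
  have hi := integrableOn_transitionDensity (b := b) ha hb hs' hx₀
  have hm := second_moment_transitionDensity (b := b) ha hb hs' hx₀
  have hmass := integral_transitionDensity (b := b) ha hb hs' hx₀
  have e1 : (∫ x in Ioi (0 : ℝ), χ x * transitionDensity a b x s x₀) - χ x₀
      = ∫ x in Ioi (0 : ℝ), (χ x * transitionDensity a b x s x₀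
        - χ x₀ * transitionDensity a b x s x₀) := by
    rw [integral_sub (integrableOn_mul_transitionDensity ha hb hx₀ hχ hM hs').1 (hi.const_mul _),
      integral_const_mul, hmass, mul_one]
  have i1 : IntegrableOn (fun x => ε / 2 * transitionDensity a b x s x₀
      + K * ((x ^ 2 - x₀ ^ 2) ^ 2 * transitionDensity a b x s x₀)) (Ioi 0) :=
    (hi.const_mul _).add (hm.1.const_mul _)
  rw [dist_eq_norm, e1]
  refine (norm_integral_le_of_norm_le i1 ((ae_restrict_iff' measurableSet_Ioi).2
    (Eventually.of_forall fun x hx => ?_))).trans_lt ?_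
  · have := transitionDensity_nonneg (b := b) ha hb hx hs' hx₀
    rw [← sub_mul, norm_mul, Real.norm_eq_abs, Real.norm_of_nonneg this, ← mul_assoc, ← add_mul]
    exact mul_le_mul_of_nonneg_right (hpt x hx) this
  · rw [integral_add (hi.const_mul _) (hm.1.const_mul _), integral_const_mul, integral_const_mul,
      hmass, mul_one]
    exact (add_le_add_right (mul_le_mul_of_nonneg_left hm.2 hK0) _).trans_lt hlt

/-- Fubini reduces mass, initial values and weak equation for p_β to the Wright transform of a
single function of time. It needs no bound on p at the diagonal, since the space integral is taken
before the time integral. -/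
lemma integral_mul_fracDensity (ha : 0 < a) (hb : b < 1) (hx₀ : 0 < x₀) {β : ℝ} (hβ : 0 < β)
    (hβ1 : β < 1) (hχ : ContinuousOn χ (Ioi 0)) (hM : ∀ x > 0, |χ x| ≤ M) {t : ℝ} (ht : 0 < t) :
    IntegrableOn (fun x => χ x * fracDensity β a b x t x₀) (Ioi 0) ∧
      ∫ x in Ioi (0 : ℝ), χ x * fracDensity β a b x t x₀
        = wrightTransform β (fun s => ∫ x in Ioi (0 : ℝ), χ x * transitionDensity a b x s x₀) t := by
  have hν : 1 - β < 1 := by linarith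
  have hJc := continuousOn_wrightJ_left hβ hβ1 (1 - β) t
  have hJi := integrableOn_wrightJ_self hβ hβ1 hν ht
  have hint : Integrable (fun z : ℝ × ℝ => (χ z.1 * transitionDensity a b z.1 z.2 x₀)
      * wrightJ β (1 - β) z.2 t) ((volume.restrict (Ioi 0)).prod (volume.restrict (Ioi 0))) := by
    have c1 : ContinuousOn (fun z : ℝ × ℝ => χ z.1) (Ioi 0 ×ˢ Ioi 0) :=
      hχ.comp continuousOn_fst fun z hz => hz.1
    have c2 : ContinuousOn (fun z : ℝ × ℝ => wrightJ β (1 - β) z.2 t) (Ioi 0 ×ˢ Ioi 0) :=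
      hJc.comp continuousOn_snd fun z hz => hz.2
    have hmeas : AEStronglyMeasurable (fun z : ℝ × ℝ => (χ z.1 * transitionDensity a b z.1 z.2 x₀)
        * wrightJ β (1 - β) z.2 t) ((volume.restrict (Ioi 0)).prod (volume.restrict (Ioi 0))) := by
      rw [Measure.prod_restrict]
      exact ((c1.mul (continuousOn_transitionDensity_prod ha hb hx₀)).mul c2).aestronglyMeasurable
        (measurableSet_Ioi.prod measurableSet_Ioi)
    rw [integrable_prod_iff' hmeas]
    refine ⟨(ae_restrict_iff' measurableSet_Ioi).2 (Eventually.of_forall fun s hs =>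
      (integrableOn_mul_transitionDensity ha hb hx₀ hχ hM hs).1.mul_const (wrightJ β (1 - β) s t)),
      ?_⟩
    refine (hJi.abs.const_mul M).mono' hmeas.norm.prod_swap.integral_prod_right'
      ((ae_restrict_iff' measurableSet_Ioi).2 (Eventually.of_forall fun s hs => ?_))
    rw [Real.norm_of_nonneg (integral_nonneg fun _ => norm_nonneg _)]
    simp only [norm_mul _ (wrightJ β (1 - β) s t), Real.norm_eq_abs]
    rw [integral_mul_const]
    exact mul_le_mul_of_nonneg_right (integrableOn_mul_transitionDensity ha hb hx₀ hχ hM hs).2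
      (abs_nonneg _)
  have e : ∀ x, ∫ s in Ioi (0 : ℝ), (χ x * transitionDensity a b x s x₀) * wrightJ β (1 - β) s t
      = χ x * fracDensity β a b x t x₀ := fun x => by
    rw [fracDensity, wrightTransform_eq hβ hβ1 _ ht, ← integral_const_mul]
    simp only [mul_assoc]
  refine ⟨hint.integral_prod_left.congr (Eventually.of_forall e), ?_⟩
  rw [wrightTransform_eq hβ hβ1 _ ht]
  simp only [← e, ← integral_mul_const]
  exact integral_integral_swap hint

end

/-! ### Densities and their weak initial values -/

theorem isDensityFrom_transitionDensity (ha : 0 < a) (hb : b < 1) {x₀ : ℝ} (hx₀ : 0 < x₀) :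
    IsDensityFrom (fun x t => transitionDensity a b x t x₀) x₀ :=
  ⟨fun _ ht => ⟨fun _ hx => transitionDensity_nonneg ha hb hx ht hx₀,
    integrableOn_transitionDensity ha hb ht hx₀, integral_transitionDensity ha hb ht hx₀⟩,
    fun ψ => tendsto_integral_mul_transitionDensity ha hb hx₀ ψ.continuous.continuousOn
      fun x _ => ψ.norm_coe_le_norm x⟩

theorem isDensityFrom_fracDensity (ha : 0 < a) (hb : b < 1) {x₀ : ℝ} (hx₀ : 0 < x₀) {β : ℝ}
    (hβ : 0 < β) (hβ1 : β < 1) : IsDensityFrom (fun x t => fracDensity β a b x t x₀) x₀ := by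
  have h1 : ∀ x > (0 : ℝ), |(fun _ => 1 : ℝ → ℝ) x| ≤ 1 := fun x _ => by simp
  refine ⟨fun t ht => ⟨fun x hx => ?_, ?_, ?_⟩, fun ψ => ?_⟩
  · show 0 ≤ fracDensity β a b x t x₀
    rw [fracDensity, wrightTransform_eq hβ hβ1 _ ht]
    exact setIntegral_nonneg measurableSet_Ioi fun s hs =>
      mul_nonneg (transitionDensity_nonneg ha hb hx hs hx₀) (wrightJ_nonneg hβ hβ1 hs ht)
  · simpa using (integral_mul_fracDensity ha hb hx₀ hβ hβ1 continuousOn_const h1 ht).1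
  · have h := (integral_mul_fracDensity ha hb hx₀ hβ hβ1 continuousOn_const h1 ht).2
    simp only [one_mul] at h
    rw [h, wrightTransform_eq hβ hβ1 _ ht]
    refine Eq.trans (setIntegral_congr_fun measurableSet_Ioi fun s hs => ?_)
      (integral_wrightJ hβ hβ1 ht)
    rw [integral_transitionDensity ha hb hs hx₀, one_mul]
  · have hM : ∀ x > 0, |ψ x| ≤ ‖ψ‖ := fun x _ => ψ.norm_coe_le_norm x
    have hc : ContinuousOn ψ (Ioi 0) := ψ.continuous.continuousOn
    refine (tendsto_wrightTransform_of_bounded hβ hβ1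
      (continuousOn_integral_mul_transitionDensity ha hb hx₀ hc hM)
      (fun s hs => abs_integral_mul_transitionDensity_le ha hb hx₀ hc hM hs)
      (tendsto_integral_mul_transitionDensity ha hb hx₀ hc hM)).congr' ?_
    filter_upwards [self_mem_nhdsWithin] with t ht
    exact (integral_mul_fracDensity ha hb hx₀ hβ hβ1 hc hM ht).2.symm

/-! ### Integrability in time on the diagonal -/

/-- No small-time asymptotics are used. In the twofold space integral of the equation p(x₀,s|x₀)
equals H'(s) up to bounded terms, because p is bounded at the off-diagonal points x₀/2 and 2x₀.
Since H is bounded and p ≥ 0, the time integrals stay bounded. -/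
lemma integrableOn_transitionDensity_diag (ha : 0 < a) (hb : b < 1) {x₀ : ℝ} (hx₀ : 0 < x₀) :
    IntegrableOn (fun s => transitionDensity a b x₀ s x₀) (Ioc 0 1) := by
  obtain ⟨w, S, h⟩ := exists_isFluxSolution_transitionDensity ha hb hx₀
  set u : ℝ → ℝ → ℝ := fun x s => transitionDensity a b x s x₀ with hu
  set p := x₀ / 2 with hp
  set q := 2 * x₀ with hq
  have hp0 : 0 < p := by positivity
  have hpx : p < x₀ := by rw [hp]; linarith
  have hxq : x₀ < q := by rw [hq]; linarith
  have hpq : p < q := hpx.trans hxq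
  have hsub : Icc p q ⊆ Ioi 0 := fun y hy => hp0.trans_le hy.1
  obtain ⟨C, hC, hoff⟩ := exists_transitionDensity_le_mul (b := b) ha hb hp0 hpq.le hp0
  obtain ⟨B, hB⟩ := isCompact_Icc.exists_bound_of_continuousOn
    ((continuousOn_force a b).mono hsub)
  have hB0 : 0 ≤ B := (norm_nonneg _).trans (hB x₀ ⟨hpx.le, hxq.le⟩)
  have un : ∀ x > 0, ∀ s > 0, 0 ≤ u x s := fun x hx s hs => transitionDensity_nonneg ha hb hx hs hx₀
  have cu : ∀ s > 0, ContinuousOn (fun y => u y s) (Icc p q) := fun s hs =>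
    (h.continuousOn.uncurry_left' (s := s) hs).mono hsub
  have hint : ∀ (k : ℝ → ℝ) (D : ℝ), ContinuousOn k (Icc p q) → (∀ y ∈ Icc p q, |k y| ≤ D) →
      ∀ z ∈ Icc p q, ∀ s > 0, |∫ y in p..z, k y * u y s| ≤ D := by
    intro k D hk hD z hz s hs
    have hD0 : 0 ≤ D := (abs_nonneg _).trans (hD z hz)
    have hz' : Ioc p z ⊆ Icc p q := Ioc_subset_Icc_self.trans (Icc_subset_Icc_right hz.2)
    have i0 := (integrableOn_transitionDensity (b := b) ha hb hs hx₀).const_mul D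
    rw [intervalIntegral.integral_of_le hz.1]
    calc |∫ y in Ioc p z, k y * u y s| ≤ ∫ y in Ioc p z, D * u y s := by
          rw [← Real.norm_eq_abs]
          refine norm_integral_le_of_norm_le (IntegrableOn.mono_set i0 (hz'.trans hsub)) ?_
          refine (ae_restrict_iff' measurableSet_Ioc).2 (Eventually.of_forall fun y hy => ?_)
          have := un y (hsub (hz' hy)) s hs
          rw [norm_mul, Real.norm_of_nonneg this]
          exact mul_le_mul_of_nonneg_right (hD y (hz' hy)) this
      _ ≤ ∫ y in Ioi (0 : ℝ), D * u y s := by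
          refine setIntegral_mono_set i0 ((ae_restrict_iff' measurableSet_Ioi).2
            (Eventually.of_forall fun y hy => mul_nonneg hD0 (un y hy s hs)))
            (hz'.trans hsub).eventuallyLE
      _ = D := by
          rw [integral_const_mul, integral_transitionDensity ha hb hs hx₀, mul_one]
  set θ := (x₀ - p) / (q - p) with hθ
  have hθ0 : 0 ≤ θ := div_nonneg (by linarith) (by linarith)
  have hθ1 : θ ≤ 1 := (div_le_one (by linarith)).2 (by linarith)
  set H : ℝ → ℝ := fun s => (∫ y in p..x₀, (x₀ - y) * u y s) - θ * ∫ y in p..q, (q - y) * u y s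
    with hH
  set D : ℝ → ℝ := fun s => (u x₀ s - u p s + ∫ y in p..x₀, force a b y * u y s)
    - θ * (u q s - u p s + ∫ y in p..q, force a b y * u y s) with hD
  have hHd : ∀ s > 0, HasDerivAt H (D s) s := fun s hs =>
    h.hasDerivAt_integral_sub hp0 hpq hpx.le hs
  have hmul : ∀ X Y : ℝ, |Y| ≤ X → |θ * Y| ≤ X := fun X Y hXY => by
    rw [abs_mul, abs_of_nonneg hθ0]
    exact (mul_le_of_le_one_left (abs_nonneg _) hθ1).trans hXY
  have hHb : ∀ s > 0, |H s| ≤ 2 * (q - p) := by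
    intro s hs
    have b1 := hint (fun y => x₀ - y) (q - p) (by fun_prop) (fun y hy => abs_le.2
      ⟨by linarith [hy.2], by linarith [hy.1]⟩) x₀ ⟨hpx.le, hxq.le⟩ s hs
    have b2 := hmul _ _ (hint (fun y => q - y) (q - p) (by fun_prop) (fun y hy => abs_le.2
      ⟨by linarith [hy.2], by linarith [hy.1]⟩) q ⟨hpq.le, le_rfl⟩ s hs)
    refine (abs_sub _ _).trans ?_
    linarith
  set K := 2 * C + 2 * B with hK
  -- `u x₀` enters `D` with coefficient 1. The terms at p and q are at most C for s ≤ 1, and the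
  -- force terms at most B because the density has mass 1.
  have hle : ∀ s ∈ Ioc (0 : ℝ) 1, u x₀ s ≤ D s + K := by
    intro s hs
    have f1 := abs_le.1 (hint (force a b) B ((continuousOn_force a b).mono hsub) hB x₀
      ⟨hpx.le, hxq.le⟩ s hs.1)
    have f2 := abs_le.1 (hmul _ _ (hint (force a b) B ((continuousOn_force a b).mono hsub) hB q
      ⟨hpq.le, le_rfl⟩ s hs.1))
    have o1 : u p s ≤ C := (hoff p ⟨le_rfl, hpq.le⟩ x₀ hx₀ (by
      rw [abs_sub_comm, abs_of_pos (by linarith), hp]; linarith) s hs.1).trans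
      (mul_le_of_le_one_right hC.le hs.2)
    have o2 : u q s ≤ C := (hoff q ⟨hpq.le, le_rfl⟩ x₀ hx₀ (by
      rw [abs_of_pos (by linarith), hp, hq]; linarith) s hs.1).trans
      (mul_le_of_le_one_right hC.le hs.2)
    have n1 := un p hp0 s hs.1
    have n2 := un q (hp0.trans hpq) s hs.1
    have m1 : θ * u q s ≤ u q s := mul_le_of_le_one_left n2 hθ1
    have m2 : 0 ≤ θ * u p s := mul_nonneg hθ0 n1
    simp only [hD, hK]
    linarith [f1.1, f2.2]
  have cux : ContinuousOn (u x₀) (Ioi 0) := h.continuousOn.uncurry_right' hx₀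
  have cD : ContinuousOn D (Ioi 0) := by
    have cI : ∀ z ∈ Icc p q, ContinuousOn (fun s => ∫ y in p..z, force a b y * u y s) (Ioi 0) := by
      intro z hz s hs
      have h0 : uIcc p z ⊆ Icc p q := by
        rw [uIcc_of_le hz.1]; exact Icc_subset_Icc_right hz.2
      exact (hasDerivAt_intervalIntegral_of_continuousOn (v := u) (S := S)
        ((continuousOn_force a b).mono (h0.trans hsub))
        (h.continuousOn.mono (prod_mono (h0.trans hsub) Subset.rfl))
        (h.continuousOn_deriv.mono (prod_mono (h0.trans hsub) Subset.rfl))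
        (fun y hy r hr => h.hasDerivAt_right y (hsub (h0 hy)) r hr)
        hs).continuousAt.continuousWithinAt
    have cup : ContinuousOn (u p) (Ioi 0) := h.continuousOn.uncurry_right' hp0
    have cuq : ContinuousOn (u q) (Ioi 0) := h.continuousOn.uncurry_right' (hp0.trans hpq)
    exact ((cux.sub cup).add (cI x₀ ⟨hpx.le, hxq.le⟩)).sub
      (continuousOn_const.mul ((cuq.sub cup).add (cI q ⟨hpq.le, le_rfl⟩)))
  have hloc : ∀ r > (0 : ℝ), Icc r 1 ⊆ Ioi 0 := fun r hr y hy => hr.trans_le hy.1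
  have hr0 : ∀ i : ℕ, (0 : ℝ) < 1 / (i + 1) := fun i => by positivity
  -- Exhaustion of (0,1] by (1/(i+1), 1], with a bound independent of i from |H| ≤ 2(q-p) at both
  -- ends.
  refine integrableOn_Ioc_of_intervalIntegral_norm_bounded_left (l := atTop)
    (a := fun i : ℕ => 1 / ((i : ℝ) + 1)) (I := 4 * (q - p) + K) (fun i =>
      ((cux.mono (hloc _ (hr0 i))).integrableOn_Icc).mono_set Ioc_subset_Icc_self)
    tendsto_one_div_add_atTop_nhds_zero_nat (Eventually.of_forall fun i => ?_)
  set r : ℝ := 1 / ((i : ℝ) + 1) with hr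
  have hr1 : r ≤ 1 := by
    rw [hr, div_le_one (by positivity)]
    linarith [(Nat.cast_nonneg i : (0 : ℝ) ≤ i)]
  have iD : IntervalIntegrable D volume r 1 := ContinuousOn.intervalIntegrable (by
    rw [uIcc_of_le hr1]; exact cD.mono (hloc r (hr0 i)))
  have ftc := intervalIntegral.integral_eq_sub_of_hasDerivAt (a := r) (b := 1)
    (f := fun s => H s + K * s) (f' := fun s => D s + K) (fun s hs => by
      rw [uIcc_of_le hr1] at hs
      exact ((hHd s ((hr0 i).trans_le hs.1)).fun_add ((hasDerivAt_id s).const_mul K)).congr_deriv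
        (by ring)) (iD.add intervalIntegrable_const)
  have iDK : IntegrableOn (fun s => D s + K) (Ioc r 1) :=
    (iD.add intervalIntegrable_const).1
  have hK0 : 0 ≤ K := by positivity
  calc ∫ s in Ioc r 1, ‖transitionDensity a b x₀ s x₀‖ ≤ ∫ s in Ioc r 1, (D s + K) := by
        refine setIntegral_mono_on ?_ iDK measurableSet_Ioc fun s hs => ?_
        · exact (((cux.mono (hloc r (hr0 i))).integrableOn_Icc).mono_set Ioc_subset_Icc_self).norm
        · have hs0 : 0 < s := (hr0 i).trans hs.1
          rw [Real.norm_of_nonneg (un x₀ hx₀ s hs0)]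
          exact hle s ⟨hs0, hs.2⟩
    _ = H 1 + K * 1 - (H r + K * r) := by
        rw [← intervalIntegral.integral_of_le hr1, ftc]
    _ ≤ _ := by
        have h1 := (abs_le.1 (hHb 1 one_pos)).2
        have h2 := (abs_le.1 (hHb r (hr0 i))).1
        have h3 : 0 ≤ K * r := mul_nonneg hK0 (hr0 i).le
        linarith

end

/-! ### Weak solutions -/

lemma exists_Ioo_of_isCompact {T : Set ℝ} (hT : IsCompact T) (h0 : T ⊆ Ioi 0) :
    ∃ p q : ℝ, 0 < p ∧ p < q ∧ T ⊆ Ioo p q := by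
  -- Adding the point 1 covers the case of an empty set.
  have hc : IsCompact (insert 1 T) := hT.insert 1
  have hpos : insert 1 T ⊆ Ioi (0 : ℝ) := insert_subset (mem_Ioi.2 one_pos) h0
  obtain ⟨m, hm, hm'⟩ := hc.exists_isLeast ⟨1, mem_insert 1 T⟩
  obtain ⟨n, hn, hn'⟩ := hc.exists_isGreatest ⟨1, mem_insert 1 T⟩
  have m0 : 0 < m := hpos hm
  have hmn : m ≤ n := hm' hn
  refine ⟨m / 2, n + 1, by positivity, by linarith, fun y hy => ⟨?_, ?_⟩⟩
  · have := hm' (mem_insert_of_mem 1 hy)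
    linarith
  · have := hn' (mem_insert_of_mem 1 hy)
    linarith

lemma setIntegral_Ioi_eq_intervalIntegral {p q : ℝ} (hp : 0 < p) (hpq : p ≤ q) {k : ℝ → ℝ}
    (hk : ∀ x ∉ Ioo p q, k x = 0) : ∫ x in Ioi (0 : ℝ), k x = ∫ x in p..q, k x := by
  rw [intervalIntegral.integral_of_le hpq]
  exact setIntegral_eq_of_subset_of_forall_sdiff_eq_zero measurableSet_Ioi
    (fun x hx => hp.trans hx.1) fun x hx => hk x fun h => hx.2 (Ioo_subset_Ioc_self h)

section
variable {a b : ℝ} {ψ : ℝ → ℝ}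

/-- A test function on `(0,∞)` and the adjoint Fokker-Planck operator applied to it. -/
lemma exists_testFunction (a b : ℝ) (hψ : ContDiff ℝ 2 ψ) (hc : HasCompactSupport ψ)
    (h0 : tsupport ψ ⊆ Ioi 0) : ∃ p q : ℝ, 0 < p ∧ p < q ∧ (∀ x ∉ Ioo p q, ψ x = 0) ∧
      (∀ x ∉ Ioo p q, deriv ψ x = 0) ∧ (∀ x ∉ Ioo p q, deriv (deriv ψ) x = 0) ∧
      (∀ x, HasDerivAt ψ (deriv ψ x) x) ∧ (∀ x, HasDerivAt (deriv ψ) (deriv (deriv ψ) x) x) ∧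
      Continuous (deriv (deriv ψ)) ∧ ContinuousOn
        (fun x => deriv (deriv ψ) x - force a b x * deriv ψ x) (Ioi 0) ∧
      ∃ M, (∀ x, |ψ x| ≤ M) ∧ ∀ x, |deriv (deriv ψ) x - force a b x * deriv ψ x| ≤ M := by
  obtain ⟨p, q, hp, hpq, hsub⟩ := exists_Ioo_of_isCompact hc h0
  have z0 : ∀ x ∉ Ioo p q, ψ x = 0 := fun x hx => image_eq_zero_of_notMem_tsupport fun h => hx (hsub h)
  have s1 : tsupport (deriv ψ) ⊆ tsupport ψ := closure_minimal support_deriv_subset isClosed_closure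
  have s2 : tsupport (deriv (deriv ψ)) ⊆ tsupport (deriv ψ) :=
    closure_minimal support_deriv_subset isClosed_closure
  have z1 : ∀ x ∉ Ioo p q, deriv ψ x = 0 := fun x hx =>
    image_eq_zero_of_notMem_tsupport fun h => hx (hsub (s1 h))
  have z2 : ∀ x ∉ Ioo p q, deriv (deriv ψ) x = 0 := fun x hx =>
    image_eq_zero_of_notMem_tsupport fun h => hx (hsub (s1 (s2 h)))
  have hψ1 : ContDiff ℝ 1 (deriv ψ) := by
    have : ContDiff ℝ (1 + 1) ψ := by simpa [one_add_one_eq_two] using hψ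
    exact (contDiff_succ_iff_deriv.1 this).2.2
  have c2 : Continuous (deriv (deriv ψ)) := hψ1.continuous_deriv le_rfl
  have cL : ContinuousOn (fun x => deriv (deriv ψ) x - force a b x * deriv ψ x) (Ioi 0) :=
    c2.continuousOn.sub ((continuousOn_force a b).mul hψ1.continuous.continuousOn)
  obtain ⟨M₁, hM₁⟩ := isCompact_Icc.exists_bound_of_continuousOn (s := Icc p q)
    hψ.continuous.continuousOn
  obtain ⟨M₂, hM₂⟩ := isCompact_Icc.exists_bound_of_continuousOn (s := Icc p q)
    (cL.mono fun x hx => hp.trans_le hx.1)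
  have hpm : p ∈ Icc p q := ⟨le_rfl, hpq.le⟩
  have n1 := (norm_nonneg _).trans (hM₁ p hpm)
  have n2 := (norm_nonneg _).trans (hM₂ p hpm)
  refine ⟨p, q, hp, hpq, z0, z1, z2, fun x => (hψ.differentiable two_ne_zero x).hasDerivAt,
    fun x => (hψ1.differentiable one_ne_zero x).hasDerivAt, c2, cL, M₁ + M₂, fun x => ?_, fun x => ?_⟩
  · by_cases hx : x ∈ Ioo p q
    · have := hM₁ x (Ioo_subset_Icc_self hx)
      rw [Real.norm_eq_abs] at this
      linarith
    · rw [z0 x hx, abs_zero]; linarith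
  · by_cases hx : x ∈ Ioo p q
    · have := hM₂ x (Ioo_subset_Icc_self hx)
      rw [Real.norm_eq_abs] at this
      linarith
    · rw [z1 x hx, z2 x hx, mul_zero, sub_zero, abs_zero]; linarith

/-- Two integrations by parts move the operator onto ψ; the boundary terms vanish since ψ and ψ' are
zero at p and q. -/
lemma IsFluxSolution.hasDerivAt_integral_mul {u w S : ℝ → ℝ → ℝ} (h : IsFluxSolution a b u w S)
    (hψ : ContDiff ℝ 2 ψ) (hc : HasCompactSupport ψ) (h0 : tsupport ψ ⊆ Ioi 0) {s : ℝ} (hs : 0 < s) :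
    HasDerivAt (fun s => ∫ x in Ioi (0 : ℝ), ψ x * u x s)
      (∫ x in Ioi (0 : ℝ), (deriv (deriv ψ) x - force a b x * deriv ψ x) * u x s) s := by
  obtain ⟨p, q, hp, hpq, z0, z1, z2, d0, d1, c2, -, -⟩ := exists_testFunction a b hψ hc h0
  have hu : uIcc p q ⊆ Ioi 0 := by
    rw [uIcc_of_le hpq.le]; exact fun x hx => hp.trans_le hx.1
  have c0 : Continuous ψ := hψ.continuous
  have c1 : Continuous (deriv ψ) := continuous_iff_continuousAt.2 fun x => (d1 x).continuousAt
  have e : ∀ s, ∫ x in Ioi (0 : ℝ), ψ x * u x s = ∫ x in p..q, ψ x * u x s := fun s =>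
    setIntegral_Ioi_eq_intervalIntegral hp hpq.le fun x hx => by rw [z0 x hx, zero_mul]
  simp only [e]
  rw [setIntegral_Ioi_eq_intervalIntegral hp hpq.le fun x hx => by rw [z1 x hx, z2 x hx]; ring]
  have hp' : p ∉ Ioo p q := fun h => lt_irrefl _ h.1
  have hq' : q ∉ Ioo p q := fun h => lt_irrefl _ h.2
  have cu : ContinuousOn (fun x => u x s) (uIcc p q) :=
    (h.continuousOn.uncurry_left' (s := s) hs).mono hu
  have cS : ContinuousOn (fun x => S x s) (uIcc p q) :=
    (h.continuousOn_deriv.uncurry_left' (s := s) hs).mono hu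
  have cw : ContinuousOn (fun x => w x s) (uIcc p q) := fun x hx =>
    (h.hasDerivAt_flux x (hu hx) s hs).continuousAt.continuousWithinAt
  have cf : ContinuousOn (fun x => force a b x * u x s) (uIcc p q) :=
    ((continuousOn_force a b).mono hu).mul cu
  have p1 := intervalIntegral.integral_mul_deriv_eq_deriv_mul (a := p) (b := q) (u := ψ)
    (u' := deriv ψ) (v := fun x => w x s) (v' := fun x => S x s) (fun x _ => d0 x)
    (fun x hx => h.hasDerivAt_flux x (hu hx) s hs) c1.continuousOn.intervalIntegrable
    cS.intervalIntegrable
  have p2 := intervalIntegral.integral_mul_deriv_eq_deriv_mul (a := p) (b := q) (u := deriv ψ)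
    (u' := deriv (deriv ψ)) (v := fun x => u x s) (v' := fun x => w x s - force a b x * u x s)
    (fun x _ => d1 x) (fun x hx => h.hasDerivAt_left x (hu hx) s hs)
    c2.continuousOn.intervalIntegrable (cw.sub cf).intervalIntegrable
  rw [z0 p hp', z0 q hq'] at p1
  rw [z1 p hp', z1 q hq'] at p2
  have i1 : IntervalIntegrable (fun x => deriv ψ x * w x s) volume p q :=
    (c1.continuousOn.mul cw).intervalIntegrable
  have i2 : IntervalIntegrable (fun x => deriv ψ x * (force a b x * u x s)) volume p q :=
    (c1.continuousOn.mul cf).intervalIntegrable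
  have i3 : IntervalIntegrable (fun x => deriv (deriv ψ) x * u x s) volume p q :=
    (c2.continuousOn.mul cu).intervalIntegrable
  have e1 : ∫ x in p..q, deriv ψ x * (w x s - force a b x * u x s)
      = (∫ x in p..q, deriv ψ x * w x s) - ∫ x in p..q, deriv ψ x * (force a b x * u x s) := by
    rw [← intervalIntegral.integral_sub i1 i2]
    simp only [mul_sub]
  have e2 : ∫ x in p..q, (deriv (deriv ψ) x - force a b x * deriv ψ x) * u x s
      = (∫ x in p..q, deriv (deriv ψ) x * u x s)
        - ∫ x in p..q, deriv ψ x * (force a b x * u x s) := by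
    rw [← intervalIntegral.integral_sub i3 i2]
    refine intervalIntegral.integral_congr fun x _ => ?_
    ring
  have key : ∫ x in p..q, ψ x * S x s
      = ∫ x in p..q, (deriv (deriv ψ) x - force a b x * deriv ψ x) * u x s := by
    rw [e1] at p2
    rw [e2, p1]
    linarith
  rw [← key]
  exact hasDerivAt_intervalIntegral_of_continuousOn c0.continuousOn
    (h.continuousOn.mono (prod_mono hu Subset.rfl))
    (h.continuousOn_deriv.mono (prod_mono hu Subset.rfl))
    (fun y hy r hr => h.hasDerivAt_right y (hu hy) r hr) hs

lemma abs_sub_le_mul_of_hasDerivAt {H D : ℝ → ℝ} {H₀ K : ℝ} (hH : ∀ s > 0, HasDerivAt H (D s) s)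
    (hD : ∀ s > 0, |D s| ≤ K) (h0 : Tendsto H (𝓝[>] 0) (𝓝 H₀)) {s : ℝ} (hs : 0 < s) :
    |H s - H₀| ≤ K * s := by
  have hK : 0 ≤ K := (abs_nonneg _).trans (hD s hs)
  refine le_of_tendsto ((h0.const_sub (H s)).abs) ?_
  filter_upwards [Ioo_mem_nhdsGT hs] with r hr
  have := (convex_Ioi (0 : ℝ)).norm_image_sub_le_of_norm_hasDerivWithin_le
    (fun x hx => (hH x hx).hasDerivWithinAt) (fun x hx => hD x hx) hr.1 hs
  rw [Real.norm_eq_abs, Real.norm_eq_abs, abs_of_pos (show 0 < s - r by linarith [hr.2])] at this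
  refine this.trans (mul_le_mul_of_nonneg_left ?_ hK)
  linarith [hr.1]

/-- The function H = ∫ ψ p has the bounded derivative D = ∫ (ψ'' - fψ') p, hence |H - ψ(x₀)| ≤ Ms,
which is the rate needed for the Caputo derivative of its transform. Integration by parts in s turns
that derivative into the transform of D, and Fubini identifies both transforms with integrals
against p_β. Testing smooths out the singularity at x₀. -/
theorem solvesFokkerPlanckWeaklyAt_fracDensity (ha : 0 < a) (hb : b < 1) {x₀ : ℝ} (hx₀ : 0 < x₀)
    {β : ℝ} (hβ : 0 < β) (hβ1 : β < 1) {t : ℝ} (ht : 0 < t) :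
    SolvesFokkerPlanckWeaklyAt β (force a b) (fun y τ => fracDensity β a b y τ x₀) t := by
  intro ψ hψ hc h0
  obtain ⟨w, S, hsol⟩ := exists_isFluxSolution_transitionDensity ha hb hx₀
  obtain ⟨p, q, hp, hpq, -, -, -, -, -, -, cL, M, hM, hML⟩ := exists_testFunction a b hψ hc h0
  have cψ : ContinuousOn ψ (Ioi 0) := hψ.continuous.continuousOn
  set H : ℝ → ℝ := fun s => ∫ x in Ioi (0 : ℝ), ψ x * transitionDensity a b x s x₀ with hH
  set D : ℝ → ℝ := fun s => ∫ x in Ioi (0 : ℝ), (deriv (deriv ψ) x - force a b x * deriv ψ x)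
    * transitionDensity a b x s x₀ with hD
  have hHd : ∀ s > 0, HasDerivAt H (D s) s := fun s hs => hsol.hasDerivAt_integral_mul hψ hc h0 hs
  have hDb : ∀ s > 0, |D s| ≤ M := fun s hs =>
    abs_integral_mul_transitionDensity_le ha hb hx₀ cL (fun x _ => hML x) hs
  have hHc : ContinuousOn H (Ioi 0) :=
    continuousOn_integral_mul_transitionDensity ha hb hx₀ cψ fun x _ => hM x
  have hDc : ContinuousOn D (Ioi 0) :=
    continuousOn_integral_mul_transitionDensity ha hb hx₀ cL fun x _ => hML x
  have hM0 : 0 ≤ M := (abs_nonneg _).trans (hM 0)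
  have hHb : ∀ s > 0, |H s - ψ x₀| ≤ M * (s ^ (1 : ℝ) + s) := fun s hs => by
    have h1 := abs_sub_le_mul_of_hasDerivAt hHd hDb
      (tendsto_integral_mul_transitionDensity ha hb hx₀ cψ fun x _ => hM x) hs
    have h2 : 0 ≤ M * s := by positivity
    rw [Real.rpow_one]
    linarith
  have hcap := hasCaputoDerivAt_wrightTransform hβ hβ1 hHc one_pos le_rfl hHb ht
  have hDi : IntegrableOn (fun s => D s * wrightJ β (1 - β) s t) (Ioi 0) := by
    refine ((integrableOn_wrightJ_self hβ hβ1 (show 1 - β < 1 by linarith) ht).abs.const_mul M).mono'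
      ((hDc.mul (continuousOn_wrightJ_left hβ hβ1 _ _)).aestronglyMeasurable measurableSet_Ioi)
      ((ae_restrict_iff' measurableSet_Ioi).2 (Eventually.of_forall fun s hs => ?_))
    rw [norm_mul]
    exact mul_le_mul_of_nonneg_right (hDb s hs) (abs_nonneg _)
  rw [← integral_deriv_mul_wrightJ hβ hβ1 ht one_pos hHd hHb hDi, ← wrightTransform_eq hβ hβ1 D ht]
    at hcap
  beta_reduce
  rw [(integral_mul_fracDensity ha hb hx₀ hβ hβ1 cL (fun x _ => hML x) ht).2]
  exact hcap.congr_of_eqOn ht fun τ hτ =>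
    (integral_mul_fracDensity ha hb hx₀ hβ hβ1 cψ (fun x _ => hM x) hτ).2

/-! ### The fractional density off the diagonal, and its integrability -/

/-- Away from x₀ the density has initial value 0, with a linear rate uniform on a neighbourhood. The
general transfer theorem therefore applies to it with u₀ = 0. -/
lemma exists_abs_transitionDensity_le (ha : 0 < a) (hb : b < 1) {x x₀ : ℝ} (hx : 0 < x)
    (hx₀ : 0 < x₀) (hne : x ≠ x₀) : ∃ p q C : ℝ, 0 < p ∧ x ∈ Ioo p q ∧
      ∀ y ∈ Icc p q, ∀ s > 0, |transitionDensity a b y s x₀ - 0| ≤ C * (s ^ (1 : ℝ) + s) := by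
  set δ := min x |x - x₀| / 2 with hδ
  have hd : 0 < |x - x₀| := abs_pos.2 (sub_ne_zero.2 hne)
  have hδ0 : 0 < δ := by positivity
  have h1 : 2 * δ ≤ x := by rw [hδ]; linarith [min_le_left x |x - x₀|]
  have h2 : 2 * δ ≤ |x - x₀| := by rw [hδ]; linarith [min_le_right x |x - x₀|]
  obtain ⟨C, hC, h⟩ := exists_transitionDensity_le_mul (b := b) ha hb (p := x - δ) (q := x + δ)
    (by linarith) (by linarith) hδ0
  refine ⟨x - δ, x + δ, C, by linarith, ⟨by linarith, by linarith⟩, fun y hy s hs => ?_⟩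
  have hyx : |x - y| ≤ δ := abs_le.2 ⟨by linarith [hy.2], by linarith [hy.1]⟩
  have hy0 : 0 < y := by linarith [hy.1]
  have h3 := abs_sub_le x y x₀
  have h4 := h y hy x₀ hx₀ (by linarith) s hs
  rw [sub_zero, abs_of_nonneg (transitionDensity_nonneg ha hb hy0 hs hx₀), Real.rpow_one]
  have : 0 ≤ C * s := by positivity
  linarith

theorem solvesFokkerPlanckAt_fracDensity (ha : 0 < a) (hb : b < 1) {x x₀ : ℝ} (hx : 0 < x)
    (hx₀ : 0 < x₀) (hne : x ≠ x₀) {β : ℝ} (hβ : 0 < β) (hβ1 : β < 1) {t : ℝ} (ht : 0 < t) :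
    SolvesFokkerPlanckAt β (force a b) (fun y τ => fracDensity β a b y τ x₀) x t := by
  obtain ⟨w, S, hsol⟩ := exists_isFluxSolution_transitionDensity ha hb hx₀
  obtain ⟨p, q, C, hp, hxpq, hC⟩ := exists_abs_transitionDensity_le (b := b) ha hb hx hx₀ hne
  exact hsol.solvesFokkerPlanckAt_wrightTransform hβ hβ1 (u₀ := fun _ => 0) hp (hxpq.1.trans hxpq.2)
    continuousOn_const one_pos le_rfl hC hxpq ht

/-- Off the diagonal p = O(s). On it the range is split at s = 1: below, the kernel is bounded and p
is integrable; above, p is bounded and the kernel is integrable. -/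
theorem integrableOn_transitionDensity_mul_wrightG (ha : 0 < a) (hb : b < 1) {x x₀ : ℝ} (hx : 0 < x)
    (hx₀ : 0 < x₀) {β : ℝ} (hβ : 0 < β) (hβ1 : β < 1) {t : ℝ} (ht : 0 < t) :
    IntegrableOn (fun s => transitionDensity a b x s x₀ * wrightG β s t) (Ioi 0) := by
  have hν : 1 - β < 1 := by linarith
  have hc : ContinuousOn (fun s => transitionDensity a b x s x₀) (Ioi 0) :=
    (continuousOn_transitionDensity_prod ha hb hx₀).uncurry_right' hx
  rcases eq_or_ne x x₀ with rfl | hne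
  · have hcJ := continuousOn_wrightJ_left hβ hβ1 (1 - β) t
    have hm : AEStronglyMeasurable (fun s => transitionDensity a b x s x * wrightJ β (1 - β) s t)
        (volume.restrict (Ioi 0)) := (hc.mul hcJ).aestronglyMeasurable measurableSet_Ioi
    obtain ⟨D, hD, hDb⟩ := exists_abs_wrightJ_le_rpow_mul_exp hβ hβ1 hν
    obtain ⟨C, hC, hCb⟩ := exists_transitionDensity_le (b := b) ha hb (q := x) hx one_pos
    have hJb : ∀ s > 0, |wrightJ β (1 - β) s t| ≤ D * t ^ (1 - β - 1) := fun s hs =>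
      (hDb s hs t ht).trans (mul_le_of_le_one_right (by positivity) (Real.exp_le_one_iff.2 (by
        have h1 := cos_half_pos hβ hβ1
        have h2 : 0 ≤ s / t ^ β := by positivity
        nlinarith)))
    have i1 : IntegrableOn (fun s => transitionDensity a b x s x * wrightJ β (1 - β) s t)
        (Ioc 0 1) := by
      refine (Integrable.mul_const (integrableOn_transitionDensity_diag (b := b) ha hb hx)
        (D * t ^ (1 - β - 1))).mono' (hm.mono_set Ioc_subset_Ioi_self)
        ((ae_restrict_iff' measurableSet_Ioc).2 (Eventually.of_forall fun s hs => ?_))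
      have hn := transitionDensity_nonneg (b := b) ha hb hx hs.1 hx
      rw [norm_mul, Real.norm_of_nonneg hn]
      exact mul_le_mul_of_nonneg_left (hJb s hs.1) hn
    have i2 : IntegrableOn (fun s => transitionDensity a b x s x * wrightJ β (1 - β) s t)
        (Ioi 1) := by
      have h1 : Ioi (1 : ℝ) ⊆ Ioi 0 := Ioi_subset_Ioi zero_le_one
      refine (Integrable.const_mul (IntegrableOn.mono_set (integrableOn_wrightJ_self hβ hβ1 hν ht)
        h1).abs C).mono' (hm.mono_set h1)
        ((ae_restrict_iff' measurableSet_Ioi).2 (Eventually.of_forall fun s hs => ?_))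
      have hn := transitionDensity_nonneg (b := b) ha hb hx (h1 hs) hx
      rw [norm_mul, Real.norm_of_nonneg hn]
      exact mul_le_mul_of_nonneg_right (hCb x ⟨le_rfl, le_rfl⟩ x hx s (le_of_lt hs)) (abs_nonneg _)
    have i := i1.union i2
    rw [Ioc_union_Ioi_eq_Ioi zero_le_one] at i
    refine IntegrableOn.congr_fun i (fun s hs => by
      rw [wrightG_eq_wrightJ hβ hβ1 hs ht]) measurableSet_Ioi
  · obtain ⟨p, q, C, hp, hxpq, hC⟩ := exists_abs_transitionDensity_le (b := b) ha hb hx hx₀ hne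
    exact (wrightTransform_eq_add hβ hβ1 hc one_pos (hC x (Ioo_subset_Icc_self hxpq)) ht).1

/-! ### The fractional Cauchy problem -/

theorem fracSolution_spec (ha : 0 < a) (hb : b < 1) {β : ℝ} (hβ : 0 < β) (hβ1 : β ≤ 1) {φ : ℝ → ℝ}
    (hφ : IntegrableOn φ (Ioi 0)) (hH : IsLocallyHolder φ) {x : ℝ} (hx : 0 < x) :
    (β < 1 → ∀ t > 0, IntegrableOn (fun s => greenSolution a b φ x s * wrightG β s t) (Ioi 0)) ∧
      (∀ t > 0, SolvesFokkerPlanckAt β (force a b) (fracSolution β a b φ) x t) ∧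
      Tendsto (fun t => fracSolution β a b φ x t) (𝓝[>] 0) (𝓝 (φ x)) := by
  obtain ⟨w, S, hsol⟩ := exists_isFluxSolution_greenSolution ha hb hφ
  obtain ⟨δ, hδ, hδx, cφ, C, ε, hε, hε1, hC⟩ := exists_abs_greenSolution_sub_le ha hb hφ hH hx
  have hxm : x ∈ Ioo (x - δ) (x + δ) := ⟨by linarith, by linarith⟩
  have hc : ContinuousOn (greenSolution a b φ x) (Ioi 0) := hsol.continuousOn.uncurry_right' hx
  have hCx := hC x (Ioo_subset_Icc_self hxm)
  rcases hβ1.lt_or_eq with hlt | rfl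
  · exact ⟨fun _ t ht => (wrightTransform_eq_add hβ hlt hc hε hCx ht).1,
      fun t ht => hsol.solvesFokkerPlanckAt_wrightTransform hβ hlt (by linarith) (by linarith) cφ
        hε hε1 hC hxm ht, tendsto_wrightTransform_zero hβ hlt hc hε hCx⟩
  · have e : fracSolution 1 a b φ = greenSolution a b φ := by
      funext y t
      simp [fracSolution, wrightTransform]
    rw [e]
    refine ⟨fun h => absurd h (lt_irrefl _), fun t ht => hsol.solvesFokkerPlanckAt hx ht, ?_⟩
    have hb : Tendsto (fun s : ℝ => C * (s ^ ε + s)) (𝓝[>] 0) (𝓝 0) := by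
      have h1 := Real.continuousAt_rpow_const 0 ε (Or.inr hε.le)
      have : ContinuousAt (fun s : ℝ => C * (s ^ ε + s)) 0 := by fun_prop
      have := this.tendsto.mono_left (nhdsWithin_le_nhds (s := Ioi 0))
      simpa [Real.zero_rpow hε.ne'] using this
    refine tendsto_iff_norm_sub_tendsto_zero.2 (squeeze_zero' (Eventually.of_forall fun _ =>
      norm_nonneg _) ?_ hb)
    filter_upwards [self_mem_nhdsWithin] with s hs using hCx s hs

end

end

theorem corollary4p2 (a b : ℝ) (ha : 0 < a) (hb : b < 1) :
    (∀ x₀ > 0,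
      IsDensityFrom (fun x t => transitionDensity a b x t x₀) x₀ ∧
      (∀ x > 0, ∀ t > 0,
        SolvesFokkerPlanckAt 1 (force a b) (fun y τ => transitionDensity a b y τ x₀) x t) ∧
      (∀ x > 0, ∀ s > 0, ∀ t > 0,
        ∫ y in Ioi (0 : ℝ), transitionDensity a b x t y * transitionDensity a b y s x₀
          = transitionDensity a b x (s + t) x₀)) ∧
    (∀ β : ℝ, 0 < β → β < 1 → ∀ x₀ > 0,
      (∀ x > 0, ∀ t > 0,
        IntegrableOn (fun s => transitionDensity a b x s x₀ * wrightG β s t) (Ioi 0)) ∧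
      IsDensityFrom (fun x t => fracDensity β a b x t x₀) x₀ ∧
      (∀ x > 0, x ≠ x₀ → ∀ t > 0,
        SolvesFokkerPlanckAt β (force a b) (fun y τ => fracDensity β a b y τ x₀) x t) ∧
      (∀ t > 0,
        SolvesFokkerPlanckWeaklyAt β (force a b) (fun y τ => fracDensity β a b y τ x₀) t)) ∧
    (∀ β : ℝ, 0 < β → β ≤ 1 → ∀ φ : ℝ → ℝ, IntegrableOn φ (Ioi 0) → IsLocallyHolder φ →
      ∀ x > 0,
        (∀ t > 0, IntegrableOn (fun y => transitionDensity a b x t y * φ y) (Ioi 0)) ∧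
        (β < 1 → ∀ t > 0,
          IntegrableOn (fun s => greenSolution a b φ x s * wrightG β s t) (Ioi 0)) ∧
        (∀ t > 0, SolvesFokkerPlanckAt β (force a b) (fracSolution β a b φ) x t) ∧
        Tendsto (fun t => fracSolution β a b φ x t) (𝓝[>] 0) (𝓝 (φ x))) := by
  refine ⟨fun x₀ hx₀ => ⟨isDensityFrom_transitionDensity ha hb hx₀, fun x hx t ht => ?_,
      fun x hx s hs t ht => integral_transitionDensity_mul ha hb hx hs ht hx₀⟩,
    fun β hβ hβ1 x₀ hx₀ => ⟨fun x hx t ht =>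
      integrableOn_transitionDensity_mul_wrightG ha hb hx hx₀ hβ hβ1 ht,
      isDensityFrom_fracDensity ha hb hx₀ hβ hβ1,
      fun x hx hne t ht => solvesFokkerPlanckAt_fracDensity ha hb hx hx₀ hne hβ hβ1 ht,
      fun t ht => solvesFokkerPlanckWeaklyAt_fracDensity ha hb hx₀ hβ hβ1 ht⟩,
    fun β hβ hβ1 φ hφ hH x hx => ⟨fun t ht => integrable_transitionDensity_mul ha hb hφ hx ht,
      fracSolution_spec ha hb hβ hβ1 hφ hH hx⟩⟩
  obtain ⟨w, S, h⟩ := exists_isFluxSolution_transitionDensity ha hb hx₀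
  exact h.solvesFokkerPlanckAt hx ht
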